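/- **Setting.** Let $\mathcal O=\mathbb C\{z\}$ and let $K=\mathbb C(\{z\})$ be its fraction field. For $w=e^{\mathrm i\theta}\in S^1$ write $c<_\theta c'$ if $\mathrm{Re}(e^{-\mathrm i\theta}(c-c'))<0$, and $c\leqslant_\theta c'$ if $c<_\theta c'$ or $c=c'$; relations between exponents in formulas for sheaves are read stalkwise, at $e^{\mathrm i\theta}$ with $\leqslant_\theta$, $<_\theta$. Let $\widetilde{\mathscr O}$ be the sheaf on $S^1$ (the boundary of the real oriented blow-up of $\mathbb C$ at $0$) of germs of holomorphic functions on $\mathbb C^*$, $\mathscr A\subset\widetilde{\mathscr O}$ the subsheaf of functions having an asymptotic expansion of Gevrey order one, i.e. an expansion $\sum a_nz^n$ with $|a_n|<B^{n+1}n!$ for some $B$, such that on every closed subsector there is $B'$ with $|f(z)-\sum_{n<N}a_nz^n|<B'^{N+1}N!\,|z|^N$ for all $N\ge1$; $\mathscr A^{\leqslant0}$ the subsheaf of functions of moderate growth, and $\mathscr A^{\leqslant c}=e^{c/z}\mathscr A^{\leqslant 0}$. Let $L$ be a free abelian group of finite rank, $\|\cdot\|$ a norm on $L\otimes_{\mathbb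 Z}\mathbb R$, and $\mu\colon L\to\mathbb C$ a homomorphism such that for some $R>0$ one has $R\|\gamma\|\le|\mu(\gamma)|$ for all $\gamma\in L$. Let $C\subset\mathbb C$ be a finite set whose elements are pairwise incongruent modulo $\mu(L)$. Let $\mathscr A_\mu^{\leqslant 0}$ be the sheaf generated by the series $\sum_{\mu(\gamma)\leqslant_I0}a_\gamma e^{\mu(\gamma)/z}$ on open arcs $I$ with $\sum|a_\gamma|\varrho^{\|\gamma\|}<\infty$ for some $\varrho>0$; put $\mathscr A_\mu=\sum_{\gamma\in L}e^{\mu(\gamma)/z}\mathscr A_\mu^{\leqslant 0}$, filtered by $\mathscr A_\mu^{\leqslant c}=\mathscr A_\mu\cap\mathscr A^{\leqslant c}$ $(c\in\mathbb C)$. **De Rham objects.** An object $(E,\Xi)=((E,\mathcal I,\Xi),(E^0,\nabla^0))$ of $\mathsf{dR}_{C,\mu}$ consists of: a connection $(E^0,\nabla^0)$ over $K$ isomorphic to $\bigoplus_{c\in C}\bigl(K^{r_c},\,d-(c-zA_c)\,dz/z^2\bigr)$ with $r_c\ge 0$ and constant matrices $A_c$; a finite dimensional $K$-vector space $E$; a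 cyclic covering $\mathcal I=(I_k)_{k\in\mathbb Z/m\mathbb Z}$, $m\geq 1$, of $S^1$ by open arcs ($I_k\cap I_\ell\ne\emptyset$ if and only if $\ell\in\{k-1,k,k+1\}$, and the intersections have at most two components); and isomorphisms of $\mathscr A|_{I_k}$-modules $\Xi_k\colon E\otimes_{\mathcal O}\mathscr A|_{I_k}\to E^0\otimes_{\mathcal O}\mathscr A|_{I_k}$ such that, for all $k$, $\Xi_k\circ\Xi_{k+1}^{-1}$ is a section over $I_k\cap I_{k+1}$ of $\mathrm{id}+\sum_{c+c'<0}\mathscr A_\mu^{\leqslant c}\,\mathscr H^0\mathrm{DR}_{\leqslant c'}(\mathrm{End}(E^0))$, where $\mathscr H^0\mathrm{DR}_{\leqslant c'}(M)$ denotes the sheaf of flat sections of $M\otimes\mathscr A^{\leqslant c'}$. All $\Xi_k$ have the same asymptotic expansion $\widehat\Xi\colon E\otimes_{\mathcal O}\mathbb C[[z]]_1\to E^0\otimes_{\mathcal O}\mathbb C[[z]]_1$, where $\mathbb C[[z]]_1$ is the ring of power series $\sum a_nz^n$ with $|a_n|<B^{n+1}n!$ for some $B$. The object $(E,\Xi)$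 is *summable along* $d\in\mathbb R$ if $\widehat\Xi$ is: for $K$-bases of $E$ and $E^0$, every matrix entry of $\widehat\Xi$ has the form $z^{-n}F$ where $F\in\mathbb C[[z]]_1$ is the asymptotic expansion (of Gevrey order one) of a holomorphic function on a sector $\{0<|z|<\rho,\ |\arg z-d|<\Theta/2\}$ with $\rho>0$ and $\Theta>\pi$. **The de Rham functor.** $\mathrm{DR}^\mu(E,\Xi)$ is the filtered $\mathscr A_\mu$-submodule of $E\otimes\widetilde{\mathscr O}$ given on $I_k$ by $\mathscr A_\mu\,\mathscr H^0\widetilde{\mathrm{DR}}(E\otimes\mathscr A|_{I_k},\nabla^k)$, where $\nabla^k=\Xi_k^{-1}\nabla^0\Xi_k$ and $\mathscr H^0\widetilde{\mathrm{DR}}$ is the sheaf of flat sections with coefficients in $\widetilde{\mathscr O}$, with filtration $\mathrm{DR}^\mu_{\leqslant c}=\sum_{c'+c''\leqslant c}\mathscr A_\mu^{\leqslant c'}\,\mathscr H^0\mathrm{DR}_{\leqslant c''}(E\otimes\mathscr A|_{I_k},\nabla^k)$. For a filtered $\mathscr A_\mu$-module $\mathscr L$ put $\mathscr L_{<c}=\sum_{c'<c}\mathscr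 L_{\leqslant c'}$ and $\mathrm{gr}\,\mathscr L=\bigoplus_{c\in\mathbb C}\mathscr L_{\leqslant c}/\mathscr L_{<c}$, a $\mathbb C[L]$-module via multiplication by $e^{\mu(\gamma)/z}$; give $\mathscr A_\mu\otimes_{\mathbb C[L]}\mathrm{gr}\,\mathscr L$ the tensor filtration. Then $\mathscr L$ is *summable along* $d$ if for some $\varepsilon>0$ there is an isomorphism of filtered $\mathscr A_\mu$-modules $\eta\colon(\mathscr A_\mu\otimes_{\mathbb C[L]}\mathrm{gr}\,\mathscr L)|_{I}\to\mathscr L|_{I}$ with $\mathrm{gr}(\eta)=\mathrm{id}$ on the arc $I=\{e^{\mathrm i\theta}: |\theta-d|<(\pi+\varepsilon)/2\}$. **Corollary.** For every object $(E,\Xi)$ of $\mathsf{dR}_{C,\mu}$ and every $d\in\mathbb R$, $(E,\Xi)$ is summable along $d$ if and only if $\mathrm{DR}^\mu(E,\Xi)$ is summable along $d$. -/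

import Mathlib

open Filter Topology TensorProduct

noncomputable section

namespace PeriodRH

/-! ### Germs, differentiation of germs, and the field of meromorphic germs at the origin -/

/-- A filter on `ℂ` such that every property that holds eventually holds eventually on a
neighbourhood. -/
class OpenFilter (l : Filter ℂ) : Prop where
  ev_nhds : ∀ {p : ℂ → Prop}, (∀ᶠ z in l, p z) → ∀ᶠ z in l, ∀ᶠ y in 𝓝 z, p y

instance openFilter_punctured : OpenFilter (𝓝[≠] (0 : ℂ)) where
  ev_nhds {p} h := by
    have h1 := eventually_eventually_nhdsWithin.2 h
    filter_upwards [h1, self_mem_nhdsWithin] with z hz hz0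
    have : 𝓝[≠] (0 : ℂ) ≤ 𝓝[≠] 0 := le_rfl
    rwa [(isOpen_compl_singleton (x := (0 : ℂ))).nhdsWithin_eq hz0] at hz

/-- Differentiation of germs. -/
def derivGerm (l : Filter ℂ) [OpenFilter l] : Germ l ℂ → Germ l ℂ :=
  Germ.map' deriv (by
    intro f g hfg
    filter_upwards [OpenFilter.ev_nhds hfg] with z hz
    exact EventuallyEq.deriv_eq hz)

theorem derivGerm_coe (l : Filter ℂ) [OpenFilter l] (f : ℂ → ℂ) :
    derivGerm l (f : Germ l ℂ) = ((deriv f : ℂ → ℂ) : Germ l ℂ) := rfl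

/-- The ring of germs along `l` of holomorphic functions. -/
def holSubring (l : Filter ℂ) : Subring (Germ l ℂ) where
  carrier := {g | ∃ f : ℂ → ℂ, (∀ᶠ z in l, DifferentiableAt ℂ f z) ∧ (f : Germ l ℂ) = g}
  mul_mem' := by
    rintro _ _ ⟨f, hf, rfl⟩ ⟨g, hg, rfl⟩
    exact ⟨f * g, by filter_upwards [hf, hg] with z h1 h2 using h1.mul h2, rfl⟩
  one_mem' := ⟨1, Eventually.of_forall fun z => differentiableAt_const 1, rfl⟩
  add_mem' := by
    rintro _ _ ⟨f, hf, rfl⟩ ⟨g, hg, rfl⟩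
    exact ⟨f + g, by filter_upwards [hf, hg] with z h1 h2 using h1.add h2, rfl⟩
  zero_mem' := ⟨0, Eventually.of_forall fun z => differentiableAt_const 0, rfl⟩
  neg_mem' := by
    rintro _ ⟨f, hf, rfl⟩
    exact ⟨-f, by filter_upwards [hf] with z h1 using h1.neg, rfl⟩

/-- The ring of germs along `l` of holomorphic functions, as a type. -/
def Hol (l : Filter ℂ) : Type := holSubring l

namespace Hol

variable {l : Filter ℂ}

instance : CommRing (Hol l) := inferInstanceAs (CommRing (holSubring l))

/-- The underlying germ. -/
def germ : Hol l →+* Germ l ℂ := (holSubring l).subtype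

theorem germ_injective : Function.Injective (germ : Hol l → Germ l ℂ) := Subtype.val_injective

theorem exists_rep (g : Hol l) :
    ∃ f : ℂ → ℂ, (∀ᶠ z in l, DifferentiableAt ℂ f z) ∧ g.germ = (f : Germ l ℂ) := by
  obtain ⟨f, hf, h⟩ := g.2
  exact ⟨f, hf, h.symm⟩

/-- The germ of a holomorphic function. -/
def mk (f : ℂ → ℂ) (hf : ∀ᶠ z in l, DifferentiableAt ℂ f z) : Hol l := ⟨(f : Germ l ℂ), f, hf, rfl⟩

theorem germ_mk (f : ℂ → ℂ) (hf : ∀ᶠ z in l, DifferentiableAt ℂ f z) :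
    (mk f hf).germ = (f : Germ l ℂ) := rfl

/-- Constant germs. -/
def const : ℂ →+* Hol l where
  toFun c := mk (fun _ => c) (Eventually.of_forall fun _ => differentiableAt_const c)
  map_one' := rfl
  map_mul' _ _ := rfl
  map_zero' := rfl
  map_add' _ _ := rfl

instance : Algebra ℂ (Hol l) := const.toAlgebra

theorem smul_def (c : ℂ) (g : Hol l) : c • g = const c * g := rfl

/-- The derivation `d/dz` on germs of holomorphic functions. -/
def D [OpenFilter l] : Hol l →+ Hol l where
  toFun g := ⟨derivGerm l g.1, by
    obtain ⟨f, hf, h⟩ := g.2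
    refine ⟨deriv f, ?_, by rw [← h]; rfl⟩
    filter_upwards [OpenFilter.ev_nhds hf] with z hz
    have hd : DifferentiableOn ℂ f {y | DifferentiableAt ℂ f y} :=
      fun y hy => DifferentiableAt.differentiableWithinAt hy
    exact (hd.analyticAt hz).deriv.differentiableAt⟩
  map_zero' := by
    apply Subtype.ext
    change derivGerm l ((fun _ => (0 : ℂ) : ℂ → ℂ) : Germ l ℂ) = ((fun _ => 0 : ℂ → ℂ) : Germ l ℂ)
    rw [derivGerm_coe]
    simp
  map_add' g h := by
    apply Subtype.ext
    obtain ⟨f, hf, hfg⟩ := g.2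
    obtain ⟨k, hk, hkh⟩ := h.2
    change derivGerm l (g.1 + h.1) = derivGerm l g.1 + derivGerm l h.1
    rw [← hfg, ← hkh]
    refine Germ.coe_eq.2 ?_
    filter_upwards [hf, hk] with z h1 h2
    exact deriv_add h1 h2

theorem germ_D [OpenFilter l] (g : Hol l) : (D g).germ = derivGerm l g.germ := rfl

theorem D_mul [OpenFilter l] (g h : Hol l) : D (g * h) = D g * h + g * D h := by
  apply Subtype.ext
  obtain ⟨f, hf, hfg⟩ := g.2
  obtain ⟨k, hk, hkh⟩ := h.2
  change derivGerm l (g.1 * h.1) = derivGerm l g.1 * h.1 + g.1 * derivGerm l h.1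
  rw [← hfg, ← hkh]
  refine Germ.coe_eq.2 ?_
  filter_upwards [hf, hk] with z h1 h2
  exact deriv_mul h1 h2

end Hol

/-- Germs at the origin of meromorphic functions. -/
def meroSubring : Subring (Germ (𝓝[≠] (0 : ℂ)) ℂ) where
  carrier := {g | ∃ f : ℂ → ℂ, MeromorphicAt f 0 ∧ (f : Germ (𝓝[≠] (0 : ℂ)) ℂ) = g}
  mul_mem' := by
    rintro _ _ ⟨f, hf, rfl⟩ ⟨g, hg, rfl⟩
    exact ⟨f * g, hf.mul hg, rfl⟩
  one_mem' := ⟨1, MeromorphicAt.const 1 0, rfl⟩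
  add_mem' := by
    rintro _ _ ⟨f, hf, rfl⟩ ⟨g, hg, rfl⟩
    exact ⟨f + g, hf.add hg, rfl⟩
  zero_mem' := ⟨0, MeromorphicAt.const 0 0, rfl⟩
  neg_mem' := by
    rintro _ ⟨f, hf, rfl⟩
    exact ⟨-f, hf.neg, rfl⟩

/-- The field `ℂ({z})` of germs at the origin of meromorphic functions, i.e. the fraction field of
the ring `ℂ{z}` of convergent power series. -/
def Mero : Type := meroSubring

namespace Mero

instance : CommRing Mero := inferInstanceAs (CommRing meroSubring)

/-- The inverse of a meromorphic germ. -/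
def inv (g : Mero) : Mero := ⟨g.1⁻¹, by
  obtain ⟨f, hf, h⟩ := g.2
  exact ⟨f⁻¹, hf.inv, by rw [← h]; rfl⟩⟩

instance : Field Mero where
  inv := inv
  exists_pair_ne := ⟨0, 1, fun h => by
    have h1 : (0 : Germ (𝓝[≠] (0 : ℂ)) ℂ) = 1 := congrArg Subtype.val h
    exact zero_ne_one h1⟩
  mul_inv_cancel g hg := by
    obtain ⟨f, hf, h⟩ := g.2
    apply Subtype.ext
    change g.1 * g.1⁻¹ = 1
    rw [← h]
    rcases hf.eventually_eq_zero_or_eventually_ne_zero with h0 | h0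
    · exact (hg (Subtype.ext (by
        change g.1 = 0
        rw [← h]
        exact Germ.coe_eq.2 h0))).elim
    · refine Germ.coe_eq.2 ?_
      filter_upwards [h0] with z hz
      exact mul_inv_cancel₀ hz
  inv_zero := by
    apply Subtype.ext
    change (0 : Germ (𝓝[≠] (0 : ℂ)) ℂ)⁻¹ = 0
    refine Germ.coe_eq.2 (Eventually.of_forall fun z => ?_)
    exact inv_zero
  nnqsmul := _
  qsmul := _

/-- The class of a function that is meromorphic at the origin. -/
def mk (f : ℂ → ℂ) (hf : MeromorphicAt f 0) : Mero := ⟨(f : Germ (𝓝[≠] (0 : ℂ)) ℂ), f, hf, rfl⟩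

/-- Constants. -/
def const (c : ℂ) : Mero := mk (fun _ => c) (MeromorphicAt.const c 0)

/-- The coordinate `z`. -/
def X : Mero := mk id (MeromorphicAt.id 0)

/-- The derivation `d/dz` of `ℂ({z})`. -/
def D (g : Mero) : Mero := ⟨derivGerm _ g.1, by
  obtain ⟨f, hf, h⟩ := g.2
  exact ⟨deriv f, hf.deriv, by rw [← h]; rfl⟩⟩

/-- Restriction of meromorphic germs at the origin to a finer filter. -/
def toHol {l : Filter ℂ} (hl : l ≤ 𝓝[≠] (0 : ℂ)) : Mero →+* Hol l where
  toFun g := ⟨g.1.compTendsto id hl, by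
    obtain ⟨f, hf, h⟩ := g.2
    refine ⟨f, ?_, by rw [← h]; rfl⟩
    filter_upwards [hl hf.eventually_analyticAt] with z hz using hz.differentiableAt⟩
  map_one' := rfl
  map_zero' := rfl
  map_mul' g h := by
    apply Subtype.ext
    obtain ⟨f, hf, hfg⟩ := g.2
    obtain ⟨k, hk, hkh⟩ := h.2
    change (g.1 * h.1).compTendsto id hl = g.1.compTendsto id hl * h.1.compTendsto id hl
    rw [← hfg, ← hkh]
    rfl
  map_add' g h := by
    apply Subtype.ext
    obtain ⟨f, hf, hfg⟩ := g.2
    obtain ⟨k, hk, hkh⟩ := h.2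
    change (g.1 + h.1).compTendsto id hl = g.1.compTendsto id hl + h.1.compTendsto id hl
    rw [← hfg, ← hkh]
    rfl

theorem exists_rep (g : Mero) {l : Filter ℂ} (hl : l ≤ 𝓝[≠] (0 : ℂ)) :
    ∃ f : ℂ → ℂ, MeromorphicAt f 0 ∧ (toHol hl g).germ = (f : Germ l ℂ) ∧ g.1 = f := by
  obtain ⟨f, hf, h⟩ := g.2
  exact ⟨f, hf, by change g.1.compTendsto id hl = _; rw [← h]; rfl, h.symm⟩

theorem toHol_D {l : Filter ℂ} [OpenFilter l] (hl : l ≤ 𝓝[≠] (0 : ℂ)) (g : Mero) :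
    toHol hl (D g) = Hol.D (toHol hl g) := by
  apply Subtype.ext
  obtain ⟨f, hf, h⟩ := g.2
  change (derivGerm _ g.1).compTendsto id hl = derivGerm l (g.1.compTendsto id hl)
  rw [← h]
  rfl

end Mero

/-! ### The circle of directions and the sheaf `Õ` -/

/-- The filter of neighbourhoods in `ℂ ∖ {0}` of the boundary point `w` of the real oriented blow-up
of `ℂ` at the origin: it is pulled back along `z ↦ (z, z / |z|)`. -/
def dirNhds (w : Circle) : Filter ℂ :=
  comap (fun z : ℂ => (z, z / (‖z‖ : ℂ))) (𝓝 ((0 : ℂ), (w : ℂ)))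

theorem eventually_ne_dirNhds (w : Circle) : ∀ᶠ z in dirNhds w, z ≠ 0 := by
  have h : ∀ᶠ p : ℂ × ℂ in 𝓝 ((0 : ℂ), (w : ℂ)), p.2 ≠ 0 := by
    have h1 : ContinuousAt (fun p : ℂ × ℂ => p.2) ((0 : ℂ), (w : ℂ)) := continuousAt_snd
    exact h1.eventually_ne (Circle.coe_ne_zero w)
  filter_upwards [h.comap _] with z hz hz0
  exact hz (by simp [hz0])

theorem dirNhds_le (w : Circle) : dirNhds w ≤ 𝓝[≠] (0 : ℂ) := by
  refine le_inf ?_ (le_principal_iff.2 (eventually_ne_dirNhds w))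
  have h : Tendsto (fun z : ℂ => ((z, z / (‖z‖ : ℂ)) : ℂ × ℂ).1) (dirNhds w) (𝓝 0) :=
    (continuous_fst.tendsto ((0 : ℂ), (w : ℂ))).comp tendsto_comap
  exact h

instance (w : Circle) : OpenFilter (dirNhds w) where
  ev_nhds {p} h := by
    obtain ⟨V, hV, hp⟩ := eventually_comap.1 h |>.exists_mem
    obtain ⟨U, hUV, hU, hwU⟩ := mem_nhds_iff.1 hV
    have h1 : ∀ᶠ z in dirNhds w, ((z, z / (‖z‖ : ℂ)) : ℂ × ℂ) ∈ U :=
      tendsto_comap (hU.mem_nhds hwU)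
    filter_upwards [h1, eventually_ne_dirNhds w] with z hz hz0
    have hc : ContinuousAt (fun z : ℂ => ((z, z / (‖z‖ : ℂ)) : ℂ × ℂ)) z := by
      refine continuousAt_id.prodMk (continuousAt_id.div ?_ ?_)
      · exact Complex.continuous_ofReal.continuousAt.comp continuous_norm.continuousAt
      · simpa using hz0
    filter_upwards [hc (hU.mem_nhds hz)] with y hy
    exact hp _ (hUV hy) y rfl

theorem eventually_dirNhds {w : Circle} {p : ℂ → Prop} (h : ∀ᶠ z in dirNhds w, p z) :
    ∀ᶠ v in 𝓝 w, ∀ᶠ z in dirNhds v, p z := by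
  obtain ⟨V, hV, hp⟩ := eventually_comap.1 h |>.exists_mem
  obtain ⟨U, hUV, hU, hwU⟩ := mem_nhds_iff.1 hV
  have hc : Continuous (fun v : Circle => (((0 : ℂ), (v : ℂ)) : ℂ × ℂ)) := by fun_prop
  filter_upwards [hc.continuousAt (hU.mem_nhds hwU)] with v hv
  have h1 : ∀ᶠ z in dirNhds v, ((z, z / (‖z‖ : ℂ)) : ℂ × ℂ) ∈ U :=
    tendsto_comap (hU.mem_nhds hv)
  filter_upwards [h1] with z hz
  exact hp _ (hUV hz) z rfl

/-- The stalk at `w` of the sheaf `Õ = ι⁻¹ j_* 𝒪` on the circle of directions. -/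
abbrev O (w : Circle) : Type := Hol (dirNhds w)

instance (w : Circle) : Algebra Mero (O w) := (Mero.toHol (dirNhds_le w)).toAlgebra

instance (w : Circle) : SMulCommClass Mero ℂ (O w) where
  smul_comm k c g := by
    change Mero.toHol (dirNhds_le w) k * (Hol.const c * g) =
      Hol.const c * (Mero.toHol (dirNhds_le w) k * g)
    ring

/-- A family of germs is a section of `Õ` near `w`: nearby it consists of the germs of one function. -/
def IsSec (s : ∀ v, O v) (w : Circle) : Prop :=
  ∃ f : ℂ → ℂ, ∀ᶠ v in 𝓝 w, (s v).germ = (f : Germ (dirNhds v) ℂ)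

/-- The germ of `z ↦ exp (c / z)`. -/
def expO (c : ℂ) (w : Circle) : O w := Hol.mk (fun z => Complex.exp (c / z)) (by
  filter_upwards [eventually_ne_dirNhds w] with z hz
  exact ((differentiableAt_const c).div differentiableAt_id hz).cexp)

theorem expO_add (c c' : ℂ) (w : Circle) : expO (c + c') w = expO c w * expO c' w := by
  apply Hol.germ_injective
  rw [map_mul]
  refine Germ.coe_eq.2 (Eventually.of_forall fun z => ?_)
  simp [add_div, Complex.exp_add]

theorem expO_zero (w : Circle) : expO 0 w = 1 := by
  apply Hol.germ_injective
  rw [map_one]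
  refine Germ.coe_eq.2 (Eventually.of_forall fun z => ?_)
  simp

/-- `c <_θ c'` for `w = exp (i θ)`, that is `Re (exp (-i θ) (c - c')) < 0`. -/
def ltAt (w : Circle) (c c' : ℂ) : Prop := (((w⁻¹ : Circle) : ℂ) * (c - c')).re < 0

/-- `c ≤_θ c'` for `w = exp (i θ)`, that is `c <_θ c'` or `c = c'`. -/
def leAt (w : Circle) (c c' : ℂ) : Prop := ltAt w c c' ∨ c = c'

/-- Germs of moderate growth: the stalk of `𝒜^{≤ 0}`. -/
def Amod0 (w : Circle) : Set (O w) :=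
  {g | ∃ f : ℂ → ℂ, g.germ = (f : Germ (dirNhds w) ℂ) ∧
    ∃ B > 0, ∃ N : ℕ, ∀ᶠ z in dirNhds w, ‖f z‖ ≤ B * (‖z‖⁻¹) ^ N}

/-- The stalk of `𝒜^{≤ c} = exp (c / z) 𝒜^{≤ 0}`. -/
def Amod (c : ℂ) (w : Circle) : Set (O w) := {g | ∃ h ∈ Amod0 w, g = expO c w * h}


/-! ### Period data and the filtered sheaf of rings `𝒜_μ` -/

/-- The standing data on a lattice `L`: a homomorphism `μ : L → ℂ` and a norm on `L ⊗ ℝ` for which the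
support property holds. -/
structure PeriodDatum (L : Type*) [AddCommGroup L] [Module.Free ℤ L] [Module.Finite ℤ L] where
  /-- the period homomorphism -/
  μ : L →+ ℂ
  /-- the norm on `L ⊗ ℝ` -/
  norm : Seminorm ℝ (ℝ ⊗[ℤ] L)
  norm_definite : ∀ x, norm x = 0 → x = 0
  support : ∃ R > 0, ∀ γ : L, R * norm (1 ⊗ₜ[ℤ] γ) ≤ ‖μ γ‖

variable {L : Type*} [AddCommGroup L] [Module.Free ℤ L] [Module.Finite ℤ L]

/-- The norm of a lattice vector. -/
def PeriodDatum.len (P : PeriodDatum L) (γ : L) : ℝ := P.norm (1 ⊗ₜ[ℤ] γ)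

theorem PeriodDatum.len_nonneg (P : PeriodDatum L) (γ : L) : 0 ≤ P.len γ := apply_nonneg _ _

theorem PeriodDatum.exists_bound (P : PeriodDatum L) : ∃ M > 0, ∀ γ, ‖P.μ γ‖ ≤ M * P.len γ := by
  let _ : Norm (ℝ ⊗[ℤ] L) := ⟨fun x => P.norm x⟩
  have core : NormedSpace.Core ℝ (ℝ ⊗[ℤ] L) :=
    { norm_nonneg := fun x => apply_nonneg P.norm x
      norm_smul := fun c x => map_smul_eq_mul P.norm c x
      norm_triangle := fun x y => map_add_le_add P.norm x y
      norm_eq_zero_iff := fun x => ⟨P.norm_definite x, fun h => by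
        change P.norm x = 0
        rw [h, map_zero]⟩ }
  let _ : NormedAddCommGroup (ℝ ⊗[ℤ] L) := NormedAddCommGroup.ofCore core
  let _ : NormedSpace ℝ (ℝ ⊗[ℤ] L) := NormedSpace.ofCore core
  let φ : (ℝ ⊗[ℤ] L) →ₗ[ℝ] ℂ := LinearMap.liftBaseChange ℝ P.μ.toIntLinearMap
  let ψ : (ℝ ⊗[ℤ] L) →L[ℝ] ℂ := LinearMap.toContinuousLinearMap φ
  refine ⟨‖ψ‖ + 1, by positivity, fun γ => ?_⟩
  have h := ψ.le_opNorm (1 ⊗ₜ[ℤ] γ)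
  have h1 : ψ (1 ⊗ₜ[ℤ] γ) = P.μ γ := by
    change φ (1 ⊗ₜ[ℤ] γ) = P.μ γ
    simp [φ]
  rw [h1] at h
  refine h.trans ?_
  have h2 : ‖(1 ⊗ₜ[ℤ] γ : ℝ ⊗[ℤ] L)‖ = P.len γ := rfl
  rw [h2]
  nlinarith [P.len_nonneg γ]

/-- The stalk at `w` of `𝒜_μ^{≤ 0}`: germs of series `∑ a_γ exp (μ(γ) / z)` over those `γ` with
`μ(γ) ≤ 0` in all directions near `w`, such that `∑ |a_γ| ϱ^‖γ‖` is finite for some `ϱ > 0`. -/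
def AmuNonpos (P : PeriodDatum L) (w : Circle) : Set (O w) :=
  {g | ∃ a : L → ℂ, (∀ᶠ v in 𝓝 w, ∀ γ, a γ ≠ 0 → leAt v (P.μ γ) 0) ∧
    (∃ ϱ : ℝ, 0 < ϱ ∧ Summable fun γ => ‖a γ‖ * ϱ ^ P.len γ) ∧
    ∃ f : ℂ → ℂ, g.germ = (f : Germ (dirNhds w) ℂ) ∧
      ∀ᶠ z in dirNhds w, HasSum (fun γ => a γ * Complex.exp (P.μ γ / z)) (f z)}

theorem one_mem_AmuNonpos (P : PeriodDatum L) (w : Circle) : (1 : O w) ∈ AmuNonpos P w := by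
  classical
  refine ⟨Pi.single 0 1, Eventually.of_forall fun v γ hγ => ?_, ⟨1, one_pos, ?_⟩, 1, rfl,
    Eventually.of_forall fun z => ?_⟩
  · by_cases h : γ = 0
    · right; simp [h]
    · simp [h] at hγ
  · refine summable_of_ne_finset_zero (s := {0}) fun γ hγ => ?_
    have : γ ≠ 0 := by simpa using hγ
    simp [this]
  · have : (1 : ℂ → ℂ) z = (Pi.single 0 1 : L → ℂ) 0 * Complex.exp (P.μ 0 / z) := by simp
    rw [this]
    refine hasSum_single 0 fun γ hγ => ?_
    simp [hγ]

/-- Near a given direction, the exponents that are nonpositive in all nearby directions lie in a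
strict cone. -/
theorem exists_cone (w : Circle) {U : Set Circle} (hU : U ∈ 𝓝 w) :
    ∃ s > 0, ∀ c : ℂ, (∀ v ∈ U, leAt v c 0) → ‖c‖ * s ≤ -(((w⁻¹ : Circle) : ℂ) * c).re := by
  have hc : ContinuousAt (fun t : ℝ => w * Circle.exp t) 0 := by fun_prop
  have h0 : w * Circle.exp 0 = w := by simp
  have hev : ∀ᶠ t in 𝓝 (0 : ℝ), w * Circle.exp t ∈ U := hc (by simpa only [h0] using hU)
  obtain ⟨ε, hε, hball⟩ := Metric.eventually_nhds_iff.1 hev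
  set t : ℝ := min (ε / 2) 1 with ht
  have ht0 : 0 < t := by positivity
  have ht1 : t ≤ 1 := min_le_right _ _
  have htε : t < ε := lt_of_le_of_lt (min_le_left _ _) (by linarith)
  have hs : 0 < Real.sin t := Real.sin_pos_of_pos_of_lt_pi ht0 (by linarith [Real.pi_gt_three])
  have hco : 0 < Real.cos t := Real.cos_pos_of_mem_Ioo ⟨by linarith [Real.pi_gt_three],
    by linarith [Real.pi_gt_three]⟩
  refine ⟨Real.sin t, hs, fun c hc => ?_⟩
  have key : ∀ v ∈ U, (((v⁻¹ : Circle) : ℂ) * c).re ≤ 0 := by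
    intro v hv
    rcases hc v hv with h | h
    · have h' : (((v⁻¹ : Circle) : ℂ) * (c - 0)).re < 0 := h
      rw [sub_zero] at h'
      exact h'.le
    · simp [h]
  set u : ℂ := ((w⁻¹ : Circle) : ℂ) * c with hu
  have hnorm : ‖c‖ = ‖u‖ := by rw [hu, norm_mul, Circle.norm_coe, one_mul]
  have hp := key _ (hball (y := t) (by simp [abs_of_pos ht0, htε]))
  have hm := key _ (hball (y := -t) (by simp [abs_of_pos ht0, htε]))
  have e1 : ∀ r : ℝ, (((w * Circle.exp r)⁻¹ : Circle) : ℂ) * c = Complex.exp (-(r * Complex.I)) * u := by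
    intro r
    rw [mul_inv, Circle.coe_mul, ← Circle.exp_neg, Circle.coe_exp, hu]
    push_cast
    ring_nf
  have e2 : ∀ r : ℝ, (Complex.exp (-(r * Complex.I)) * u).re
      = Real.cos r * u.re + Real.sin r * u.im := by
    intro r
    have : -((r : ℂ) * Complex.I) = ((-r : ℝ) : ℂ) * Complex.I := by push_cast; ring
    rw [this, Complex.mul_re, Complex.exp_ofReal_mul_I_re, Complex.exp_ofReal_mul_I_im]
    simp
  rw [e1, e2] at hp hm
  rw [Real.cos_neg, Real.sin_neg] at hm
  have hx : u.re ≤ 0 := by nlinarith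
  rw [hnorm]
  have h1 : (Real.sin t * u.im) ^ 2 ≤ (-(Real.cos t * u.re)) ^ 2 := by
    apply sq_le_sq'
    · nlinarith
    · nlinarith
  have h2 : (‖u‖ * Real.sin t) ^ 2 ≤ (-u.re) ^ 2 := by
    have h3 : ‖u‖ ^ 2 = u.re ^ 2 + u.im ^ 2 := by
      rw [← Complex.normSq_eq_norm_sq, Complex.normSq_apply]; ring
    rw [mul_pow, h3]
    have h4 := Real.sin_sq_add_cos_sq t
    nlinarith
  exact abs_le_of_sq_le_sq' h2 (by linarith) |>.2

theorem mul_mem_AmuNonpos (P : PeriodDatum L) (w : Circle) {g h : O w} (hg : g ∈ AmuNonpos P w)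
    (hh : h ∈ AmuNonpos P w) : g * h ∈ AmuNonpos P w := by
  obtain ⟨a, ha, ⟨r, hr, hra⟩, f, hf, hfa⟩ := hg
  obtain ⟨b, hb, ⟨r', hr', hrb⟩, k, hk, hkb⟩ := hh
  obtain ⟨M, hM, hMb⟩ := P.exists_bound
  obtain ⟨R, hR, hRb⟩ := P.support
  obtain ⟨s, hs, hcone⟩ := exists_cone w (ha.and hb)
  set q : ℝ := min (min r r') 1 with hq
  have hq0 : 0 < q := by positivity
  have hq1 : q ≤ 1 := min_le_right _ _
  have hqr : q ≤ r := (min_le_left _ _).trans (min_le_left _ _)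
  have hqr' : q ≤ r' := (min_le_left _ _).trans (min_le_right _ _)
  have hqa : Summable fun γ => ‖a γ‖ * q ^ P.len γ :=
    hra.of_nonneg_of_le (fun γ => by positivity) fun γ => by
      gcongr
      exact P.len_nonneg γ
  have hqb : Summable fun γ => ‖b γ‖ * q ^ P.len γ :=
    hrb.of_nonneg_of_le (fun γ => by positivity) fun γ => by
      gcongr
      exact P.len_nonneg γ
  set κ : ℝ := R * s / M with hκ
  have hκ0 : 0 < κ := by positivity
  have hlen : ∀ γ γ', a γ ≠ 0 → b γ' ≠ 0 → P.len γ + P.len γ' ≤ κ⁻¹ * P.len (γ + γ') := by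
    intro γ γ' h1 h2
    have c1 := hcone (P.μ γ) (fun v hv => hv.1 γ h1)
    have c2 := hcone (P.μ γ') (fun v hv => hv.2 γ' h2)
    have r1 : R * P.len γ ≤ ‖P.μ γ‖ := hRb γ
    have r2 : R * P.len γ' ≤ ‖P.μ γ'‖ := hRb γ'
    have m := hMb (γ + γ')
    have n : -(((w⁻¹ : Circle) : ℂ) * P.μ (γ + γ')).re ≤ ‖P.μ (γ + γ')‖ := by
      have := Complex.abs_re_le_norm (((w⁻¹ : Circle) : ℂ) * P.μ (γ + γ'))
      rw [norm_mul, Circle.norm_coe, one_mul] at this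
      exact (neg_le_abs _).trans this
    rw [map_add, mul_add, Complex.add_re] at n
    rw [map_add] at m
    have : κ * (P.len γ + P.len γ') ≤ P.len (γ + γ') := by
      rw [hκ, div_mul_eq_mul_div, div_le_iff₀ hM]
      nlinarith
    rw [inv_mul_eq_div, le_div_iff₀ hκ0]
    linarith
  let e : L × L ≃ L × L :=
    { toFun := fun x => (x.2, x.1 - x.2)
      invFun := fun x => (x.1 + x.2, x.1)
      left_inv := fun x => by ext <;> simp
      right_inv := fun x => by ext <;> simp }
  refine ⟨fun δ => ∑' γ, a γ * b (δ - γ), ?_, ⟨q ^ κ⁻¹, by positivity, ?_⟩, f * k, ?_, ?_⟩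
  · filter_upwards [ha, hb] with v h1 h2 δ hδ
    have : ∃ γ, a γ * b (δ - γ) ≠ 0 := by
      by_contra hcon
      push Not at hcon
      exact hδ (by simp [hcon])
    obtain ⟨γ, hγ⟩ := this
    have i1 := h1 γ (left_ne_zero_of_mul hγ)
    have i2 := h2 (δ - γ) (right_ne_zero_of_mul hγ)
    have e1 : P.μ δ = P.μ γ + P.μ (δ - γ) := by rw [← map_add]; congr 1; abel
    rw [e1]
    unfold leAt ltAt at *
    simp only [sub_zero] at *
    rw [mul_add, Complex.add_re]
    rcases i1 with i1 | i1 <;> rcases i2 with i2 | i2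
    · left; linarith
    · left; rw [i2]; simpa using i1
    · left; rw [i1]; simpa using i2
    · right; rw [i1, i2]; simp
  · have hprod := hqa.mul_of_nonneg hqb (fun γ => by positivity) (fun γ => by positivity)
    have hprod' := e.summable_iff.2 hprod
    have hbd : Summable fun x : L × L =>
        ‖a x.2 * b (x.1 - x.2)‖ * (q ^ κ⁻¹) ^ P.len x.1 := by
      refine hprod'.of_nonneg_of_le (fun x => by positivity) fun x => ?_
      by_cases hz : a x.2 * b (x.1 - x.2) = 0
      · rw [hz, norm_zero, zero_mul]
        change 0 ≤ ‖a x.2‖ * q ^ P.len x.2 * (‖b (x.1 - x.2)‖ * q ^ P.len (x.1 - x.2))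
        positivity
      · have h1 := hlen x.2 (x.1 - x.2) (left_ne_zero_of_mul hz) (right_ne_zero_of_mul hz)
        rw [add_sub_cancel] at h1
        change _ ≤ ‖a x.2‖ * q ^ P.len x.2 * (‖b (x.1 - x.2)‖ * q ^ P.len (x.1 - x.2))
        have h2 : (q ^ κ⁻¹) ^ P.len x.1 ≤ q ^ P.len x.2 * q ^ P.len (x.1 - x.2) := by
          rw [← Real.rpow_mul hq0.le, ← Real.rpow_add hq0]
          exact Real.rpow_le_rpow_of_exponent_ge hq0 hq1 h1
        rw [norm_mul]
        calc _ ≤ ‖a x.2‖ * ‖b (x.1 - x.2)‖ * (q ^ P.len x.2 * q ^ P.len (x.1 - x.2)) := by gcongr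
          _ = _ := by ring
    refine hbd.prod.of_nonneg_of_le (fun δ => by positivity) fun δ => ?_
    simp only [tsum_mul_right]
    gcongr
    by_cases hsum : Summable fun γ => ‖a γ * b (δ - γ)‖
    · exact norm_tsum_le_tsum_norm hsum
    · have := hbd.prod_factor δ
      simp only at this
      have hne : (q ^ κ⁻¹) ^ P.len δ ≠ 0 := by positivity
      exact (hsum ((summable_mul_right_iff hne).1 this)).elim
  · rw [map_mul, hf, hk]; rfl
  · filter_upwards [hfa, hkb] with z h1 h2
    have hs := summable_mul_of_summable_norm h1.summable.norm h2.summable.norm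
    have h3 := e.hasSum_iff.2 (h1.mul h2 hs)
    have hterm : ((fun x : L × L => a x.1 * Complex.exp (P.μ x.1 / z) *
        (b x.2 * Complex.exp (P.μ x.2 / z))) ∘ e) =
        fun x : L × L => a x.2 * b (x.1 - x.2) * Complex.exp (P.μ x.1 / z) := by
      funext x
      change a x.2 * Complex.exp (P.μ x.2 / z) *
        (b (x.1 - x.2) * Complex.exp (P.μ (x.1 - x.2) / z)) = _
      have : P.μ x.1 / z = P.μ x.2 / z + P.μ (x.1 - x.2) / z := by
        rw [map_sub]; ring
      rw [this, Complex.exp_add]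
      ring
    rw [hterm] at h3
    refine h3.prod_fiberwise fun δ => ?_
    have h4 := (h3.summable.prod_factor δ).hasSum
    simpa only [tsum_mul_right] using h4

/-- The stalk at `w` of `𝒜_μ = ∑_γ exp (μ(γ) / z) 𝒜_μ^{≤ 0}`. -/
def Amu (P : PeriodDatum L) (w : Circle) : Subalgebra ℂ (O w) :=
  (Submodule.span ℂ {g : O w | ∃ γ : L, ∃ h ∈ AmuNonpos P w, g = expO (P.μ γ) w * h}).toSubalgebra
    (Submodule.subset_span ⟨0, 1, one_mem_AmuNonpos P w, by rw [map_zero, expO_zero, one_mul]⟩)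
    (by
      intro x y hx hy
      have hxy := Submodule.mul_mem_mul hx hy
      rw [Submodule.span_mul_span] at hxy
      refine Submodule.span_mono ?_ hxy
      rintro _ ⟨_, ⟨γ, h, hh, rfl⟩, _, ⟨γ', h', hh', rfl⟩, rfl⟩
      refine ⟨γ + γ', h * h', mul_mem_AmuNonpos P w hh hh', ?_⟩
      simp only [map_add, expO_add]
      ring)

/-- The unit `u^γ = exp (μ(γ) / z)` of `𝒜_μ`. -/
def uExp (P : PeriodDatum L) (γ : L) (w : Circle) : Amu P w :=
  ⟨expO (P.μ γ) w, Submodule.subset_span ⟨γ, 1, one_mem_AmuNonpos P w, by rw [mul_one]⟩⟩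

/-- The filtration `𝒜_μ^{≤ c} = 𝒜_μ ∩ 𝒜^{≤ c}`. -/
def AmuLe (P : PeriodDatum L) (c : ℂ) (w : Circle) : Set (Amu P w) := {a | (a : O w) ∈ Amod c w}

/-- A family of germs is a section of `𝒜_μ` near `w`. -/
def IsSecAmu (P : PeriodDatum L) (a : ∀ v, Amu P v) (w : Circle) : Prop :=
  IsSec (fun v => (a v : O v)) w

/-! ### Functions with an asymptotic expansion of Gevrey order one -/

/-- The sector `S(d, Θ, ρ)`. -/
def sector (d Θ ρ : ℝ) : Set ℂ :=
  {z | ∃ r θ : ℝ, 0 < r ∧ r < ρ ∧ |d - θ| < Θ / 2 ∧ z = r * Complex.exp (θ * Complex.I)}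

/-- The closed sector with vertex removed `{r exp (i θ) | 0 < r ≤ ρ, |θ - d| ≤ Θ}`. -/
def closedSector (d Θ ρ : ℝ) : Set ℂ :=
  {z | ∃ r θ : ℝ, 0 < r ∧ r ≤ ρ ∧ |θ - d| ≤ Θ ∧ z = r * Complex.exp (θ * Complex.I)}

/-- Formal power series of Gevrey order one: `ℂ⟦z⟧₁`. -/
def IsGevrey (F : PowerSeries ℂ) : Prop :=
  ∃ B > 0, ∀ n : ℕ, ‖PowerSeries.coeff n F‖ < B ^ (n + 1) * (n.factorial : ℝ)

/-- `f` is holomorphic on the sector `S` and has `F ∈ ℂ⟦z⟧₁` as asymptotic expansion of Gevrey order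
one; so `f ∈ A(S)` and `asy f = F`. -/
def HasAsy (f : ℂ → ℂ) (F : PowerSeries ℂ) (S : Set ℂ) : Prop :=
  IsGevrey F ∧ DifferentiableOn ℂ f S ∧
    ∀ d' Θ' ρ' : ℝ, 0 < Θ' → 0 < ρ' → closedSector d' Θ' ρ' ⊆ S →
      ∃ B > 0, ∀ N : ℕ, 0 < N → ∀ z ∈ closedSector d' Θ' ρ',
        (‖z‖⁻¹) ^ N * ‖f z - ∑ n ∈ Finset.range N, PowerSeries.coeff n F * z ^ n‖
          < B ^ (N + 1) * (N.factorial : ℝ)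

/-- `F` is `1`-summable along `d`: it is the asymptotic expansion of a function on a sector with
bisecting direction `d` and opening larger than `π`. -/
def IsSummable (F : PowerSeries ℂ) (d : ℝ) : Prop :=
  ∃ Θ ρ : ℝ, Real.pi < Θ ∧ 0 < ρ ∧ ∃ f : ℂ → ℂ, HasAsy f F (sector d Θ ρ)

/-- A germ at `w` has the asymptotic expansion `F` (of Gevrey order one) on a sector around `w`. -/
def HasAsyAt (w : Circle) (g : O w) (F : PowerSeries ℂ) : Prop :=
  ∃ d Θ ρ : ℝ, 0 < Θ ∧ 0 < ρ ∧ w = Circle.exp d ∧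
    ∃ f : ℂ → ℂ, HasAsy f F (sector d Θ ρ) ∧ g.germ = (f : Germ (dirNhds w) ℂ)

/-- The stalk at `w` of the sheaf `𝒜` of functions with asymptotic expansions of Gevrey order one. -/
def AGev (w : Circle) : Set (O w) := {g | ∃ F, HasAsyAt w g F}

/-! ### Filtered `𝒜_μ`-modules, their graded modules, and graded splittings -/

/-- A filtered module over the sheaf of filtered rings `𝒜_μ` on the circle of directions. The sheaf is
given by its stalks and its local sections: `IsSection s w` says that the family `s` of germs is a
section near `w`, and the sections over an open set `U` are the families with this property at all
points of `U`. -/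
structure FilteredModule (P : PeriodDatum L) where
  /-- the stalks -/
  stalk : Circle → Type*
  [addCommGroup : ∀ w, AddCommGroup (stalk w)]
  [module : ∀ w, Module (Amu P w) (stalk w)]
  [moduleC : ∀ w, Module ℂ (stalk w)]
  [tower : ∀ w, IsScalarTower ℂ (Amu P w) (stalk w)]
  /-- being a section near a point -/
  IsSection : (∀ v, stalk v) → Circle → Prop
  section_nearby : ∀ {s w}, IsSection s w → ∀ᶠ v in 𝓝 w, IsSection s v
  section_congr : ∀ {s t w}, (∀ᶠ v in 𝓝 w, s v = t v) → IsSection s w → IsSection t w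
  section_exists : ∀ w (x : stalk w), ∃ s, IsSection s w ∧ s w = x
  section_unique : ∀ {s t w}, IsSection s w → IsSection t w → s w = t w → ∀ᶠ v in 𝓝 w, s v = t v
  section_add : ∀ {s t w}, IsSection s w → IsSection t w → IsSection (fun v => s v + t v) w
  section_smul : ∀ {a : ∀ v, Amu P v} {s w}, IsSecAmu P a w → IsSection s w →
    IsSection (fun v => a v • s v) w
  /-- the stalks of the filtration -/
  le : ℂ → ∀ w, Submodule ℂ (stalk w)
  le_smul : ∀ {c w} {a : Amu P w} {x : stalk w}, a ∈ AmuLe P 0 w → x ∈ le c w → a • x ∈ le c w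
  le_nearby : ∀ {c s w}, IsSection s w → s w ∈ le c w → ∀ᶠ v in 𝓝 w, s v ∈ le c v
  le_mono : ∀ {c c' w}, leAt w c c' → le c w ≤ le c' w
  le_shift : ∀ (γ : L) (c : ℂ) (w : Circle) (x : stalk w),
    uExp P γ w • x ∈ le (c + P.μ γ) w ↔ x ∈ le c w

namespace FilteredModule

attribute [instance] addCommGroup module moduleC tower

variable {P : PeriodDatum L} (M : FilteredModule P)

/-- The stalk at `w` of the subsheaf `ℒ_{< c}` of `ℒ_{≤ c}`. -/
def lt (c : ℂ) (w : Circle) : Submodule ℂ (M.stalk w) := ⨆ c' : {c' : ℂ // ltAt w c' c}, M.le c' w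

/-- The stalk at `w` of `gr_c ℒ = ℒ_{≤ c} / ℒ_{< c}`. -/
abbrev grPiece (w : Circle) (c : ℂ) : Type _ := M.le c w ⧸ (M.lt c w).submoduleOf (M.le c w)

/-- The stalk at `w` of `gr ℒ = ⨁_c gr_c ℒ`. -/
def Gr (w : Circle) : Type _ := DirectSum ℂ (M.grPiece w)

instance (w : Circle) : AddCommGroup (M.Gr w) :=
  inferInstanceAs (AddCommGroup (DirectSum ℂ (M.grPiece w)))

instance (w : Circle) : Module ℂ (M.Gr w) := inferInstanceAs (Module ℂ (DirectSum ℂ (M.grPiece w)))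

open Classical in
/-- The map `ℒ_{≤ c} → gr_c ℒ → gr ℒ` on stalks. -/
def toGr (c : ℂ) (w : Circle) : M.le c w →ₗ[ℂ] M.Gr w :=
  (DirectSum.lof ℂ ℂ (M.grPiece w) c).comp ((M.lt c w).submoduleOf (M.le c w)).mkQ

theorem toGr_congr {c c' : ℂ} {w : Circle} (h : c = c') {x : M.le c w} {x' : M.le c' w}
    (hx : (x : M.stalk w) = x') : M.toGr c w x = M.toGr c' w x' := by
  subst h
  rw [Subtype.ext hx]

open Classical in
theorem gr_hom_ext {w : Circle} {N : Type*} [AddCommGroup N] [Module ℂ N] {f g : M.Gr w →ₗ[ℂ] N}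
    (h : ∀ c x, f (M.toGr c w x) = g (M.toGr c w x)) : f = g := by
  refine DirectSum.linearMap_ext ℂ fun c => ?_
  ext x
  exact h c x

/-- Multiplication by `u^γ` from `ℒ_{≤ c}` to `ℒ_{≤ c + μ(γ)}`. -/
def shiftLe (γ : L) (c : ℂ) (w : Circle) : M.le c w →ₗ[ℂ] M.le (c + P.μ γ) w where
  toFun x := ⟨uExp P γ w • (x : M.stalk w), (M.le_shift γ c w x).2 x.2⟩
  map_add' x y := Subtype.ext (smul_add _ _ _)
  map_smul' a x := Subtype.ext (by
    change uExp P γ w • (a • (x : M.stalk w)) = a • (uExp P γ w • (x : M.stalk w))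
    rw [← algebraMap_smul (Amu P w) a (x : M.stalk w),
      ← algebraMap_smul (Amu P w) a (uExp P γ w • (x : M.stalk w)), smul_smul, smul_smul, mul_comm])

theorem shift_lt (γ : L) (c : ℂ) (w : Circle) (x : M.stalk w) (hx : x ∈ M.lt c w) :
    uExp P γ w • x ∈ M.lt (c + P.μ γ) w := by
  refine Submodule.iSup_induction _ (motive := fun x => uExp P γ w • x ∈ M.lt (c + P.μ γ) w) hx
    (fun c' y hy => ?_) (by simp) fun y z hy hz => by
      rw [smul_add]; exact Submodule.add_mem _ hy hz
  refine Submodule.mem_iSup_of_mem (⟨c'.1 + P.μ γ, ?_⟩ : {c' : ℂ // ltAt w c' (c + P.μ γ)})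
    ((M.le_shift γ c'.1 w y).2 hy)
  have := c'.2
  unfold ltAt at *
  rwa [add_sub_add_right_eq_sub]

theorem shift_submoduleOf (γ : L) (c : ℂ) (w : Circle) :
    (M.lt c w).submoduleOf (M.le c w) ≤
      ((M.lt (c + P.μ γ) w).submoduleOf (M.le (c + P.μ γ) w)).comap (M.shiftLe γ c w) :=
  fun x hx => M.shift_lt γ c w x hx

open Classical in
/-- The action of `u^γ` on `gr ℒ`, which maps `gr_c ℒ` to `gr_{c + μ(γ)} ℒ`. -/
def grShift (γ : L) (w : Circle) : M.Gr w →ₗ[ℂ] M.Gr w :=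
  DirectSum.toModule ℂ ℂ (M.Gr w) fun c =>
    (DirectSum.lof ℂ ℂ (M.grPiece w) (c + P.μ γ)).comp
      (Submodule.mapQ _ _ (M.shiftLe γ c w) (M.shift_submoduleOf γ c w))

open Classical in
theorem grShift_toGr (γ : L) (c : ℂ) (w : Circle) (x : M.le c w) :
    M.grShift γ w (M.toGr c w x) = M.toGr (c + P.μ γ) w (M.shiftLe γ c w x) := by
  exact DirectSum.toModule_lof (R := ℂ) (M := M.grPiece w) c
    (((M.lt c w).submoduleOf (M.le c w)).mkQ x)

/-- The action of `L` on `gr ℒ`. -/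
def grAction (w : Circle) : Multiplicative L →* Module.End ℂ (M.Gr w) where
  toFun γ := M.grShift γ.toAdd w
  map_one' := M.gr_hom_ext fun c x => by
    rw [grShift_toGr]
    refine M.toGr_congr (by simp) ?_
    change uExp P 0 w • (x : M.stalk w) = x
    have : uExp P 0 w = 1 := Subtype.ext (by
      change expO (P.μ 0) w = 1
      rw [map_zero, expO_zero])
    rw [this, one_smul]
  map_mul' γ γ' := M.gr_hom_ext fun c x => by
    rw [Module.End.mul_apply, grShift_toGr, grShift_toGr, grShift_toGr]
    refine M.toGr_congr (by rw [toAdd_mul, map_add]; ring) ?_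
    change uExp P (γ.toAdd + γ'.toAdd) w • (x : M.stalk w) =
      uExp P γ.toAdd w • uExp P γ'.toAdd w • (x : M.stalk w)
    rw [smul_smul]
    congr 1
    apply Subtype.ext
    change expO (P.μ (γ.toAdd + γ'.toAdd)) w = expO (P.μ γ.toAdd) w * expO (P.μ γ'.toAdd) w
    rw [map_add, expO_add]

/-- The `ℂ[L]`-module structure of `gr ℒ`. -/
instance (w : Circle) : Module (AddMonoidAlgebra ℂ L) (M.Gr w) :=
  Module.compHom (M.Gr w) (AddMonoidAlgebra.lift ℂ _ L (M.grAction w)).toRingHom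

end FilteredModule

/-- `γ ↦ u^γ` as a homomorphism to the multiplicative monoid of `𝒜_μ`. -/
def uHom (P : PeriodDatum L) (w : Circle) : Multiplicative L →* Amu P w where
  toFun γ := uExp P γ.toAdd w
  map_one' := Subtype.ext (by
    change expO (P.μ 0) w = 1
    rw [map_zero, expO_zero])
  map_mul' γ γ' := Subtype.ext (by
    change expO (P.μ (γ.toAdd + γ'.toAdd)) w = expO (P.μ γ.toAdd) w * expO (P.μ γ'.toAdd) w
    rw [map_add, expO_add])

/-- `𝒜_μ` as an algebra over `ℂ[L]`. -/
instance (P : PeriodDatum L) (w : Circle) : Algebra (AddMonoidAlgebra ℂ L) (Amu P w) :=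
  (AddMonoidAlgebra.lift ℂ _ L (uHom P w)).toRingHom.toAlgebra

namespace FilteredModule

variable {P : PeriodDatum L} (M : FilteredModule P)

/-- The stalk at `w` of `𝒜_μ ⊗_{ℂ[L]} gr ℒ`. -/
abbrev Graded (w : Circle) : Type _ := Amu P w ⊗[AddMonoidAlgebra ℂ L] M.Gr w

/-- The filtration of `𝒜_μ ⊗ gr ℒ`: its step `≤ c` is the sum of the images of
`𝒜_μ^{≤ c'} ⊗ gr_{c''} ℒ` over `c' + c'' ≤ c`. -/
def gradedLe (c : ℂ) (w : Circle) : AddSubgroup (M.Graded w) :=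
  AddSubgroup.closure {t | ∃ c' c'' : ℂ, leAt w (c' + c'') c ∧ ∃ a ∈ AmuLe P c' w,
    ∃ x : M.le c'' w, t = a ⊗ₜ M.toGr c'' w x}

/-- There is an isomorphism `η : (𝒜_μ ⊗ gr ℒ)|_I → ℒ|_I` of filtered `𝒜_μ`-modules with
`gr η = id`. It is given by its maps on stalks; these form a morphism of sheaves if `η (1 ⊗ [v])` is a
section of `ℒ` for every local section `v` of every `ℒ_{≤ c}`, as the sections `1 ⊗ [v]` generate
`𝒜_μ ⊗ gr ℒ` over `𝒜_μ`. -/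
def SplitsOn (I : Set Circle) : Prop :=
  ∃ η : ∀ w, w ∈ I → (M.Graded w ≃ₗ[Amu P w] M.stalk w),
    (∀ w ∈ I, ∀ (c : ℂ) (v : ∀ w, M.stalk w), M.IsSection v w → v w ∈ M.le c w →
      ∃ s : ∀ w, M.stalk w, M.IsSection s w ∧
        ∀ᶠ w' in 𝓝 w, ∀ (hw' : w' ∈ I) (hv : v w' ∈ M.le c w'),
          η w' hw' (1 ⊗ₜ M.toGr c w' ⟨v w', hv⟩) = s w') ∧
    (∀ w (hw : w ∈ I) (c : ℂ) (t : M.Graded w), η w hw t ∈ M.le c w ↔ t ∈ M.gradedLe c w) ∧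
    (∀ w (hw : w ∈ I) (c : ℂ) (x : M.le c w),
      η w hw (1 ⊗ₜ M.toGr c w x) - (x : M.stalk w) ∈ M.lt c w)

end FilteredModule

/-- The arc `I_d(ε)` of length `π + ε` centred at `exp (i d)`. -/
def arcAround (d ε : ℝ) : Set Circle := {w | ∃ θ : ℝ, |θ - d| < (Real.pi + ε) / 2 ∧ w = Circle.exp θ}

/-- Summability along `d` of a filtered `𝒜_μ`-module. -/
def FilteredModule.SummableAlong {P : PeriodDatum L} (M : FilteredModule P) (d : ℝ) : Prop :=
  ∃ ε > 0, M.SplitsOn (arcAround d ε)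

/-! ### Sections of `Õ`, `𝒜_μ` and `E ⊗ Õ` -/

section Sections

variable {w : Circle}

theorem IsSec.nearby {s : ∀ v, O v} (hs : IsSec s w) : ∀ᶠ v in 𝓝 w, IsSec s v := by
  obtain ⟨f, hf⟩ := hs
  filter_upwards [eventually_eventually_nhds.2 hf] with v hv using ⟨f, hv⟩

theorem IsSec.congr {s t : ∀ v, O v} (h : ∀ᶠ v in 𝓝 w, s v = t v) (hs : IsSec s w) : IsSec t w := by
  obtain ⟨f, hf⟩ := hs
  exact ⟨f, by filter_upwards [hf, h] with v h1 h2 using by rw [← h2, h1]⟩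

theorem IsSec.add {s t : ∀ v, O v} (hs : IsSec s w) (ht : IsSec t w) :
    IsSec (fun v => s v + t v) w := by
  obtain ⟨f, hf⟩ := hs
  obtain ⟨g, hg⟩ := ht
  exact ⟨f + g, by filter_upwards [hf, hg] with v h1 h2 using by rw [map_add, h1, h2]; rfl⟩

theorem IsSec.mul {s t : ∀ v, O v} (hs : IsSec s w) (ht : IsSec t w) :
    IsSec (fun v => s v * t v) w := by
  obtain ⟨f, hf⟩ := hs
  obtain ⟨g, hg⟩ := ht
  exact ⟨f * g, by filter_upwards [hf, hg] with v h1 h2 using by rw [map_mul, h1, h2]; rfl⟩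

theorem IsSec.D {s : ∀ v, O v} (hs : IsSec s w) : IsSec (fun v => Hol.D (s v)) w := by
  obtain ⟨f, hf⟩ := hs
  exact ⟨deriv f, by filter_upwards [hf] with v h1 using by rw [Hol.germ_D, h1, derivGerm_coe]⟩

theorem isSec_const (c : ℂ) : IsSec (fun _ => Hol.const c) w :=
  ⟨fun _ => c, Eventually.of_forall fun _ => rfl⟩

theorem isSec_zero : IsSec (fun _ => 0) w := ⟨0, Eventually.of_forall fun _ => rfl⟩

theorem isSec_expO (c : ℂ) : IsSec (fun v => expO c v) w :=
  ⟨fun z => Complex.exp (c / z), Eventually.of_forall fun _ => rfl⟩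

theorem isSec_mero (k : Mero) : IsSec (fun v => algebraMap Mero (O v) k) w := by
  obtain ⟨f, -, h⟩ := k.2
  refine ⟨f, Eventually.of_forall fun v => ?_⟩
  change Germ.compTendsto k.1 id (lc := dirNhds v) (dirNhds_le v) = _
  rw [← h]
  rfl

theorem IsSec.sum {ι : Type*} (S : Finset ι) {s : ι → ∀ v, O v} (hs : ∀ i, IsSec (s i) w) :
    IsSec (fun v => ∑ i ∈ S, s i v) w := by
  classical
  induction S using Finset.induction_on with
  | empty => simpa using isSec_zero
  | insert i S hi ih => simpa [Finset.sum_insert hi] using (hs i).add ih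

theorem IsSec.unique {s t : ∀ v, O v} (hs : IsSec s w) (ht : IsSec t w) (h : s w = t w) :
    ∀ᶠ v in 𝓝 w, s v = t v := by
  obtain ⟨f, hf⟩ := hs
  obtain ⟨g, hg⟩ := ht
  have hfg : (f : Germ (dirNhds w) ℂ) = g := by rw [← hf.self_of_nhds, h, hg.self_of_nhds]
  filter_upwards [hf, hg, eventually_dirNhds (Germ.coe_eq.1 hfg)] with v h1 h2 h3
  apply Hol.germ_injective
  rw [h1, h2]
  exact Germ.coe_eq.2 h3

open Classical in
theorem exists_isSec (g : O w) : ∃ s : ∀ v, O v, IsSec s w ∧ s w = g := by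
  obtain ⟨f, hf, hg⟩ := g.exists_rep
  have key : ∀ v, ∃ x : O v, (∀ᶠ z in dirNhds v, DifferentiableAt ℂ f z) →
      x.germ = (f : Germ (dirNhds v) ℂ) := by
    intro v
    by_cases h : ∀ᶠ z in dirNhds v, DifferentiableAt ℂ f z
    · exact ⟨Hol.mk f h, fun _ => rfl⟩
    · exact ⟨0, fun h' => (h h').elim⟩
  choose s hs using key
  refine ⟨s, ⟨f, ?_⟩, Hol.germ_injective (by rw [hs w hf, hg])⟩
  filter_upwards [eventually_dirNhds hf] with v hv using hs v hv

theorem IsSec.mem_Amod {c : ℂ} {s : ∀ v, O v} (hs : IsSec s w) (h : s w ∈ Amod c w) :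
    ∀ᶠ v in 𝓝 w, s v ∈ Amod c v := by
  obtain ⟨g, ⟨f, hf, B, hB, N, hN⟩, hg⟩ := h
  obtain ⟨t, ht, htw⟩ := exists_isSec g
  have h1 := hs.unique ((isSec_expO c).mul ht) (by rw [hg, htw])
  obtain ⟨k, hk⟩ := ht
  have hkf : (k : Germ (dirNhds w) ℂ) = f := by rw [← hk.self_of_nhds, htw, hf]
  filter_upwards [h1, hk, eventually_dirNhds (Germ.coe_eq.1 hkf), eventually_dirNhds hN]
    with v h2 h3 h4 h5
  refine ⟨t v, ⟨k, h3, B, hB, N, ?_⟩, h2⟩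
  filter_upwards [h4, h5] with z h6 h7
  rwa [h6]

theorem leAt.nearby {a b : ℂ} (h : leAt w a b) : ∀ᶠ v in 𝓝 w, leAt v a b := by
  rcases h with h | h
  · have hc : Continuous fun v : Circle => (((v⁻¹ : Circle) : ℂ) * (a - b)).re := by fun_prop
    filter_upwards [hc.continuousAt.eventually_lt continuousAt_const h] with v hv using Or.inl hv
  · exact Eventually.of_forall fun _ => Or.inr h

theorem leAt.trans {a b c : ℂ} (h : leAt w a b) (h' : leAt w b c) : leAt w a c := by
  rcases h with h | rfl
  · rcases h' with h' | rfl
    · left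
      unfold ltAt at *
      have : a - c = (a - b) + (b - c) := by ring
      rw [this, mul_add, Complex.add_re]
      linarith
    · exact Or.inl h
  · exact h'

theorem leAt.add_right {a b : ℂ} (h : leAt w a b) (c : ℂ) : leAt w (a + c) (b + c) := by
  rcases h with h | rfl
  · left
    unfold ltAt at *
    rwa [add_sub_add_right_eq_sub]
  · exact Or.inr rfl

theorem Amod_mul {c c' : ℂ} {g h : O w} (hg : g ∈ Amod c w) (hh : h ∈ Amod c' w) :
    g * h ∈ Amod (c + c') w := by
  obtain ⟨g, ⟨f, hf, B, hB, N, hN⟩, rfl⟩ := hg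
  obtain ⟨h, ⟨k, hk, B', hB', N', hN'⟩, rfl⟩ := hh
  refine ⟨g * h, ⟨f * k, by rw [map_mul, hf, hk]; rfl, B * B', by positivity, N + N', ?_⟩, ?_⟩
  · filter_upwards [hN, hN'] with z h1 h2
    rw [Pi.mul_apply, norm_mul, pow_add]
    calc ‖f z‖ * ‖k z‖ ≤ (B * ‖z‖⁻¹ ^ N) * (B' * ‖z‖⁻¹ ^ N') := by gcongr
      _ = _ := by ring
  · rw [expO_add]; ring

theorem expO_mem_Amod (c : ℂ) : expO c w ∈ Amod c w :=
  ⟨1, ⟨1, rfl, 1, one_pos, 0, Eventually.of_forall fun z => by simp⟩, by rw [mul_one]⟩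

variable {P : PeriodDatum L}

theorem exists_isSecAmu (a : Amu P w) : ∃ s : ∀ v, Amu P v, IsSecAmu P s w ∧ s w = a := by
  classical
  have key : ∀ g ∈ Submodule.span ℂ {g : O w | ∃ γ : L, ∃ h ∈ AmuNonpos P w,
      g = expO (P.μ γ) w * h}, ∃ s : ∀ v, O v, IsSec s w ∧ s w = g ∧ ∀ᶠ v in 𝓝 w, s v ∈ Amu P v := by
    intro g hg
    induction hg using Submodule.span_induction with
    | mem g hg =>
      obtain ⟨γ, h, ⟨b, hb, hϱ, f, hf, hfb⟩, rfl⟩ := hg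
      obtain ⟨t, ht, htw⟩ := exists_isSec h
      refine ⟨fun v => expO (P.μ γ) v * t v, (isSec_expO _).mul ht, by simp only [htw], ?_⟩
      obtain ⟨k, hk⟩ := ht
      have hkf : (k : Germ (dirNhds w) ℂ) = f := by rw [← hk.self_of_nhds, htw, hf]
      filter_upwards [hk, eventually_dirNhds (Germ.coe_eq.1 hkf), eventually_dirNhds hfb,
        eventually_eventually_nhds.2 hb] with v h1 h2 h3 h4
      refine Submodule.subset_span ⟨γ, t v, ⟨b, h4, hϱ, k, h1, ?_⟩, rfl⟩
      filter_upwards [h2, h3] with z h5 h6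
      rwa [h5]
    | zero => exact ⟨fun v => 0, isSec_zero, rfl, Eventually.of_forall fun v => zero_mem _⟩
    | add x y _ _ hx hy =>
      obtain ⟨s, hs, rfl, hs'⟩ := hx
      obtain ⟨t, ht, rfl, ht'⟩ := hy
      exact ⟨_, hs.add ht, rfl, by filter_upwards [hs', ht'] with v h1 h2 using add_mem h1 h2⟩
    | smul c x _ hx =>
      obtain ⟨s, hs, rfl, hs'⟩ := hx
      exact ⟨fun v => Hol.const c * s v, (isSec_const c).mul hs, rfl,
        by filter_upwards [hs'] with v h1 using (Amu P v).smul_mem h1 c⟩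
  obtain ⟨s, hs, hsw, hmem⟩ := key a.1 a.2
  refine ⟨fun v => if h : s v ∈ Amu P v then ⟨s v, h⟩ else 0, ?_, ?_⟩
  · refine IsSec.congr ?_ hs
    filter_upwards [hmem] with v hv
    simp [hv]
  · have := hmem.self_of_nhds
    simp only [this, dif_pos]
    exact Subtype.ext hsw

end Sections

section TensorSections

variable {w : Circle} {E F : Type*} [AddCommGroup E] [Module Mero E] [AddCommGroup F] [Module Mero F]

/-- A family of elements of the stalks of `E ⊗ Õ` is a section near `w`. -/
def IsSecT (t : ∀ v, O v ⊗[Mero] E) (w : Circle) : Prop :=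
  ∃ (n : ℕ) (s : Fin n → ∀ v, O v) (e : Fin n → E), (∀ i, IsSec (s i) w) ∧
    ∀ᶠ v in 𝓝 w, t v = ∑ i, s i v ⊗ₜ e i

theorem IsSecT.nearby {t : ∀ v, O v ⊗[Mero] E} (ht : IsSecT t w) : ∀ᶠ v in 𝓝 w, IsSecT t v := by
  obtain ⟨n, s, e, hs, h⟩ := ht
  filter_upwards [eventually_eventually_nhds.2 h, eventually_all.2 fun i => (hs i).nearby] with v h1 h2
  exact ⟨n, s, e, h2, h1⟩

theorem IsSecT.congr {t t' : ∀ v, O v ⊗[Mero] E} (h : ∀ᶠ v in 𝓝 w, t v = t' v) (ht : IsSecT t w) :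
    IsSecT t' w := by
  obtain ⟨n, s, e, hs, h'⟩ := ht
  exact ⟨n, s, e, hs, by filter_upwards [h, h'] with v h1 h2 using by rw [← h1, h2]⟩

theorem isSecT_zero : IsSecT (fun v => (0 : O v ⊗[Mero] E)) w :=
  ⟨0, fun i => i.elim0, fun i => i.elim0, fun i => i.elim0, Eventually.of_forall fun v => by simp⟩

theorem isSecT_tmul {s : ∀ v, O v} (hs : IsSec s w) (e : E) : IsSecT (fun v => s v ⊗ₜ[Mero] e) w :=
  ⟨1, fun _ => s, fun _ => e, fun _ => hs, Eventually.of_forall fun v => by simp⟩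

theorem IsSecT.add {t t' : ∀ v, O v ⊗[Mero] E} (ht : IsSecT t w) (ht' : IsSecT t' w) :
    IsSecT (fun v => t v + t' v) w := by
  obtain ⟨n, s, e, hs, h⟩ := ht
  obtain ⟨n', s', e', hs', h'⟩ := ht'
  refine ⟨n + n', Fin.addCases s s', Fin.addCases e e', ?_, ?_⟩
  · intro i
    refine Fin.addCases (fun j => ?_) (fun j => ?_) i
    · simpa using hs j
    · simpa using hs' j
  · filter_upwards [h, h'] with v h1 h2
    simp [Fin.sum_univ_add, h1, h2]

theorem IsSecT.sum {ι : Type*} (S : Finset ι) {t : ι → ∀ v, O v ⊗[Mero] E}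
    (ht : ∀ i, IsSecT (t i) w) : IsSecT (fun v => ∑ i ∈ S, t i v) w := by
  classical
  induction S using Finset.induction_on with
  | empty => simpa using isSecT_zero
  | insert i S hi ih => simpa [Finset.sum_insert hi] using (ht i).add ih

theorem IsSecT.smul {s : ∀ v, O v} {t : ∀ v, O v ⊗[Mero] E} (hs : IsSec s w) (ht : IsSecT t w) :
    IsSecT (fun v => s v • t v) w := by
  obtain ⟨n, s', e, hs', h⟩ := ht
  refine ⟨n, fun i v => s v * s' i v, e, fun i => hs.mul (hs' i), ?_⟩
  filter_upwards [h] with v h1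
  rw [h1, Finset.smul_sum]
  rfl

theorem exists_isSecT (x : O w ⊗[Mero] E) : ∃ t : ∀ v, O v ⊗[Mero] E, IsSecT t w ∧ t w = x := by
  induction x using TensorProduct.induction_on with
  | zero => exact ⟨_, isSecT_zero, rfl⟩
  | tmul g e =>
    obtain ⟨s, hs, rfl⟩ := exists_isSec g
    exact ⟨_, isSecT_tmul hs e, rfl⟩
  | add x y hx hy =>
    obtain ⟨s, hs, rfl⟩ := hx
    obtain ⟨t, ht, rfl⟩ := hy
    exact ⟨_, hs.add ht, rfl⟩

theorem neg_const_smul (x : O w ⊗[Mero] E) : (Hol.const (-1) : O w) • x = -x := by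
  have h : (Hol.const (-1) : O w) = -1 := by rw [map_neg, map_one]
  rw [h]
  exact neg_one_smul (O w) x

theorem IsSecT.eventually_zero [FiniteDimensional Mero E] {t : ∀ v, O v ⊗[Mero] E} (ht : IsSecT t w)
    (h : t w = 0) : ∀ᶠ v in 𝓝 w, t v = 0 := by
  obtain ⟨n, s, e, hs, hev⟩ := ht
  let b := Module.finBasis Mero E
  have hcoef : ∀ v j, (∑ i, s i v * algebraMap Mero (O v) (b.repr (e i) j)) =
      (b.baseChange (O v)).repr (∑ i, s i v ⊗ₜ e i) j := by
    intro v j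
    rw [map_sum, Finsupp.finsetSum_apply]
    refine Finset.sum_congr rfl fun i _ => ?_
    rw [Module.Basis.baseChange_repr_tmul, Algebra.smul_def, mul_comm]
  have hz : ∀ j, ∀ᶠ v in 𝓝 w, (∑ i, s i v * algebraMap Mero (O v) (b.repr (e i) j)) = 0 := by
    intro j
    refine IsSec.unique (IsSec.sum _ fun i => (hs i).mul (isSec_mero _)) isSec_zero ?_
    rw [hcoef, ← hev.self_of_nhds, h]
    simp
  filter_upwards [hev, eventually_all.2 hz] with v h1 h2
  rw [h1]
  apply (b.baseChange (O v)).repr.injective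
  ext j
  rw [← hcoef, h2]
  simp

theorem IsSecT.unique [FiniteDimensional Mero E] {t t' : ∀ v, O v ⊗[Mero] E} (ht : IsSecT t w)
    (ht' : IsSecT t' w) (h : t w = t' w) : ∀ᶠ v in 𝓝 w, t v = t' v := by
  have h1 := (ht.add (IsSecT.smul (isSec_const (-1)) ht')).eventually_zero (by
    rw [h, neg_const_smul, add_neg_cancel])
  filter_upwards [h1] with v hv
  rw [neg_const_smul, add_neg_eq_zero] at hv
  exact hv

end TensorSections

/-! ### Connections -/

/-- A connection on a vector space over `ℂ({z})`, written as the covariant derivative along `d/dz`. -/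
structure Connection (E : Type*) [AddCommGroup E] [Module Mero E] where
  /-- the covariant derivative along `d/dz` -/
  nabla : E →+ E
  leibniz : ∀ (k : Mero) (e : E), nabla (k • e) = Mero.D k • e + k • nabla e

namespace Connection

variable {E : Type*} [AddCommGroup E] [Module Mero E] (N : Connection E)

/-- The connection is elementary exponential with exponential factors in `C`: it is isomorphic to the
direct sum over `c ∈ C` of `d - (c - z A_c) dz / z²` on `ℂ({z})^{r_c}`, with constant matrices `A_c`. -/
def IsElementaryExponential (C : Finset ℂ) : Prop :=
  ∃ (r : C → ℕ) (A : ∀ c, Matrix (Fin (r c)) (Fin (r c)) ℂ)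
    (φ : E ≃ₗ[Mero] (∀ c, Fin (r c) → Mero)), ∀ (e : E) (c : C) (i : Fin (r c)),
      φ (N.nabla e) c i = Mero.D (φ e c i) -
        (Mero.const c * φ e c i - Mero.X * ∑ j, Mero.const (A c i j) * φ e c j) / Mero.X ^ 2

/-- The connection `∇ ⊗ id + id ⊗ d` on the stalk at `w` of `E ⊗ Õ`. -/
def ext (w : Circle) : O w ⊗[Mero] E →+ O w ⊗[Mero] E :=
  TensorProduct.liftAddHom
    { toFun := fun f =>
        { toFun := fun e => Hol.D f ⊗ₜ e + f ⊗ₜ N.nabla e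
          map_zero' := by simp
          map_add' := fun e e' => by
            simp only [TensorProduct.tmul_add, map_add]
            abel }
      map_zero' := by ext e; simp
      map_add' := fun f g => by
        ext e
        simp only [AddMonoidHom.coe_mk, ZeroHom.coe_mk, AddMonoidHom.add_apply, map_add,
          TensorProduct.add_tmul]
        abel }
    (fun k f e => by
      simp only [AddMonoidHom.coe_mk, ZeroHom.coe_mk]
      have h : Hol.D (k • f) = Mero.D k • f + k • Hol.D f := by
        rw [Algebra.smul_def, Algebra.smul_def, Algebra.smul_def, Hol.D_mul]
        change Hol.D (Mero.toHol (dirNhds_le w) k) * f + _ = Mero.toHol (dirNhds_le w) (Mero.D k) * f + _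
        rw [Mero.toHol_D]
      rw [h, N.leibniz, TensorProduct.add_tmul, TensorProduct.tmul_add, TensorProduct.smul_tmul,
        TensorProduct.smul_tmul, TensorProduct.smul_tmul]
      abel)

theorem ext_tmul (w : Circle) (f : O w) (e : E) :
    N.ext w (f ⊗ₜ e) = Hol.D f ⊗ₜ e + f ⊗ₜ N.nabla e := rfl

theorem isSecT_ext {w : Circle} {t : ∀ v, O v ⊗[Mero] E} (ht : IsSecT t w) :
    IsSecT (fun v => N.ext v (t v)) w := by
  obtain ⟨n, s, e, hs, h⟩ := ht
  have h1 : IsSecT (fun v => ∑ i, (Hol.D (s i v) ⊗ₜ[Mero] e i + s i v ⊗ₜ[Mero] N.nabla (e i))) w :=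
    IsSecT.sum _ fun i => (isSecT_tmul (hs i).D _).add (isSecT_tmul (hs i) _)
  refine h1.congr ?_
  filter_upwards [h] with v hv
  rw [hv, map_sum]
  rfl

end Connection

/-- The additive span in the stalk at `w` of `E ⊗ Õ` of the `f ⊗ e` with `f ∈ S`. For `S` the stalk of
`𝒜` or of `𝒜^{≤ c}` this is the stalk of `E ⊗ 𝒜` or of `E ⊗ 𝒜^{≤ c}`, the tensor products being over
`ℂ{z}`. -/
def tensorSpan {w : Circle} (E : Type*) [AddCommGroup E] [Module Mero E] (S : Set (O w)) :
    AddSubgroup (O w ⊗[Mero] E) :=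
  AddSubgroup.closure {t | ∃ f ∈ S, ∃ e : E, t = f ⊗ₜ e}

theorem IsSecT.mem_tensorSpan {E : Type*} [AddCommGroup E] [Module Mero E] [FiniteDimensional Mero E]
    {w : Circle} {c : ℂ} {t : ∀ v, O v ⊗[Mero] E} (ht : IsSecT t w)
    (h : t w ∈ tensorSpan E (Amod c w)) : ∀ᶠ v in 𝓝 w, t v ∈ tensorSpan E (Amod c v) := by
  have key : ∀ x ∈ tensorSpan E (Amod c w), ∃ s : ∀ v, O v ⊗[Mero] E, IsSecT s w ∧ s w = x ∧
      ∀ᶠ v in 𝓝 w, s v ∈ tensorSpan E (Amod c v) := by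
    intro x hx
    induction hx using AddSubgroup.closure_induction with
    | mem x hx =>
      obtain ⟨f, hf, e, rfl⟩ := hx
      obtain ⟨s, hs, rfl⟩ := exists_isSec f
      refine ⟨_, isSecT_tmul hs e, rfl, ?_⟩
      filter_upwards [hs.mem_Amod hf] with v hv
      exact AddSubgroup.subset_closure ⟨_, hv, e, rfl⟩
    | zero => exact ⟨_, isSecT_zero, rfl, Eventually.of_forall fun v => zero_mem _⟩
    | add x y _ _ hx hy =>
      obtain ⟨s, hs, rfl, hs'⟩ := hx
      obtain ⟨s', ht, rfl, ht'⟩ := hy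
      exact ⟨_, hs.add ht, rfl, by filter_upwards [hs', ht'] with v h1 h2 using add_mem h1 h2⟩
    | neg x _ hx =>
      obtain ⟨s, hs, rfl, hs'⟩ := hx
      refine ⟨_, IsSecT.smul (isSec_const (-1)) hs, neg_const_smul _, ?_⟩
      filter_upwards [hs'] with v h1
      rw [neg_const_smul]
      exact neg_mem h1
  obtain ⟨s, hs, hsw, hmem⟩ := key _ h
  filter_upwards [hs.unique ht hsw, hmem] with v h1 h2
  rwa [← h1]

theorem smul_mem_tensorSpan {E : Type*} [AddCommGroup E] [Module Mero E] {w : Circle} {c c' : ℂ}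
    {g : O w} (hg : g ∈ Amod c w) {x : O w ⊗[Mero] E} (hx : x ∈ tensorSpan E (Amod c' w)) :
    g • x ∈ tensorSpan E (Amod (c + c') w) := by
  induction hx using AddSubgroup.closure_induction with
  | mem x hx =>
    obtain ⟨f, hf, e, rfl⟩ := hx
    exact AddSubgroup.subset_closure ⟨g * f, Amod_mul hg hf, e, rfl⟩
  | zero => simp
  | add x y _ _ hx hy => rw [smul_add]; exact add_mem hx hy
  | neg x _ hx => rw [smul_neg]; exact neg_mem hx

/-! ### The category `dR_{C,μ}` and the de Rham functor -/

/-- A cyclic covering of the circle by open arcs, indexed by `ℤ / K`. -/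
structure CyclicCovering where
  /-- the number of arcs -/
  K : ℕ
  K_pos : 0 < K
  /-- the arcs -/
  arc : ZMod K → Set Circle
  isArc : ∀ k, ∃ α β : ℝ, α < β ∧ arc k = Circle.exp '' Set.Ioo α β
  covers : ∀ w, ∃ k, w ∈ arc k
  meets_iff : ∀ k l, (arc k ∩ arc l).Nonempty ↔ l = k - 1 ∨ l = k ∨ l = k + 1
  components : ∀ k l, ENat.card (ConnectedComponents ↥(arc k ∩ arc l)) ≤ 2

theorem CyclicCovering.isOpen_arc (I : CyclicCovering) (k : ZMod I.K) : IsOpen (I.arc k) := by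
  obtain ⟨α, β, -, h⟩ := I.isArc k
  rw [h]
  exact isLocalHomeomorph_circleExp.isOpenMap _ isOpen_Ioo

section EndNeg

variable {E : Type*} [AddCommGroup E] [Module Mero E]

/-- The stalk at `w` of `End(E) ⊗ 𝒜^{≤ c}`, as endomorphisms of `E ⊗ Õ`. -/
def endSpan (E : Type*) [AddCommGroup E] [Module Mero E] (c : ℂ) (w : Circle) :
    AddSubgroup (Module.End (O w) (O w ⊗[Mero] E)) :=
  AddSubgroup.closure {φ | ∃ f ∈ Amod c w, ∃ u : E →ₗ[Mero] E, φ = f • u.baseChange (O w)}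

/-- The stalk at `w` of `ℰnd_μ^{<0}(E) = ∑_{c + c' < 0} 𝒜_μ^{≤ c} ℋ⁰DR_{≤ c'}(End(E))`. -/
def endNeg (P : PeriodDatum L) (N : Connection E) (w : Circle) :
    AddSubgroup (Module.End (O w) (O w ⊗[Mero] E)) :=
  AddSubgroup.closure {φ | ∃ c c' : ℂ, ltAt w (c + c') 0 ∧ ∃ a ∈ AmuLe P c w, ∃ ψ ∈ endSpan E c' w,
    (∀ x, N.ext w (ψ x) = ψ (N.ext w x)) ∧ φ = (a : O w) • ψ}

end EndNeg

/-- Objects of the category `dR_{C,μ}`. -/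
structure DRObject (P : PeriodDatum L) (C : Finset ℂ) where
  /-- the elementary exponential connection `(E⁰, ∇⁰)` -/
  E0 : Type*
  [addCommGroup0 : AddCommGroup E0]
  [module0 : Module Mero E0]
  [finiteDimensional0 : FiniteDimensional Mero E0]
  conn : Connection E0
  elementary : conn.IsElementaryExponential C
  /-- the vector space `E` -/
  E : Type*
  [addCommGroup : AddCommGroup E]
  [module : Module Mero E]
  [finiteDimensional : FiniteDimensional Mero E]
  /-- the cyclic covering -/
  cov : CyclicCovering
  /-- the maps on stalks of the isomorphisms `Ξ_k : E ⊗ 𝒜 → E⁰ ⊗ 𝒜` on the arcs, extended to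
  `E ⊗ Õ → E⁰ ⊗ Õ` -/
  Xi : ∀ (k : ZMod cov.K) (w : Circle), w ∈ cov.arc k →
    ((O w ⊗[Mero] E) ≃ₗ[O w] (O w ⊗[Mero] E0))
  Xi_mem : ∀ k w hw x, Xi k w hw x ∈ tensorSpan E0 (AGev w) ↔ x ∈ tensorSpan E (AGev w)
  Xi_section : ∀ k, ∀ w ∈ cov.arc k, ∀ e : E, ∃ t : ∀ v, O v ⊗[Mero] E0, IsSecT t w ∧
    ∀ᶠ v in 𝓝 w, ∀ hv : v ∈ cov.arc k, Xi k v hv (1 ⊗ₜ e) = t v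
  Xi_aut : ∀ k w (hw : w ∈ cov.arc k) (hw' : w ∈ cov.arc (k + 1)),
    ((Xi (k + 1) w hw').symm.trans (Xi k w hw)).toLinearMap - LinearMap.id ∈ endNeg P conn w

namespace DRObject

attribute [instance] addCommGroup0 module0 finiteDimensional0 addCommGroup module finiteDimensional

variable {P : PeriodDatum L} {C : Finset ℂ} (X : DRObject P C)

/-- The stalk at `w` of `ℋ⁰ D̃R(E ⊗ 𝒜_{|I_k}, ∇^k)` with `∇^k = Ξ_k⁻¹ ∇⁰ Ξ_k`. -/
def IsFlat (k : ZMod X.cov.K) (w : Circle) (hw : w ∈ X.cov.arc k) (h : O w ⊗[Mero] X.E) : Prop :=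
  (X.Xi k w hw).symm (X.conn.ext w (X.Xi k w hw h)) = 0

/-- The stalk at `w` of `DR^μ(E, Ξ) ⊆ E ⊗ Õ`: it is `𝒜_μ ℋ⁰ D̃R(E ⊗ 𝒜_{|I_k}, ∇^k)` for `w ∈ I_k`.
(The summands for the different such `k` coincide.) -/
def drStalk (w : Circle) : Submodule (Amu P w) (O w ⊗[Mero] X.E) :=
  Submodule.span (Amu P w) {h | ∃ k, ∃ hw : w ∈ X.cov.arc k, X.IsFlat k w hw h}

/-- The stalk at `w` of the filtration
`DR^μ_{≤ c}(E, Ξ) = ∑_{c' + c'' ≤ c} 𝒜_μ^{≤ c'} ℋ⁰DR_{≤ c''}(E ⊗ 𝒜_{|I_k}, ∇^k)`. -/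
def drLe (c : ℂ) (w : Circle) : Submodule ℂ (O w ⊗[Mero] X.E) :=
  Submodule.span ℂ {t | ∃ c' c'' : ℂ, leAt w (c' + c'') c ∧ ∃ a ∈ AmuLe P c' w,
    ∃ h ∈ tensorSpan X.E (Amod c'' w), (∃ k, ∃ hw : w ∈ X.cov.arc k, X.IsFlat k w hw h) ∧ t = a • h}

theorem isSecT_Xi {k : ZMod X.cov.K} {w : Circle} (hw : w ∈ X.cov.arc k) {t : ∀ v, O v ⊗[Mero] X.E}
    (ht : IsSecT t w) : ∃ s : ∀ v, O v ⊗[Mero] X.E0, IsSecT s w ∧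
      ∀ᶠ v in 𝓝 w, ∀ hv : v ∈ X.cov.arc k, X.Xi k v hv (t v) = s v := by
  obtain ⟨n, f, e, hf, hev⟩ := ht
  choose s hs hs' using fun i => X.Xi_section k w hw (e i)
  refine ⟨fun v => ∑ i, f i v • s i v, IsSecT.sum _ fun i => IsSecT.smul (hf i) (hs i), ?_⟩
  filter_upwards [hev, eventually_all.2 hs'] with v h1 h2 hv
  rw [h1, map_sum]
  refine Finset.sum_congr rfl fun i _ => ?_
  have : f i v ⊗ₜ[Mero] e i = f i v • ((1 : O v) ⊗ₜ[Mero] e i) := by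
    rw [TensorProduct.smul_tmul', smul_eq_mul, mul_one]
  rw [this, map_smul, h2 i hv]

theorem flat_nearby {w : Circle} {t : ∀ v, O v ⊗[Mero] X.E} (ht : IsSecT t w)
    (h : ∃ k, ∃ hw : w ∈ X.cov.arc k, X.IsFlat k w hw (t w)) :
    ∀ᶠ v in 𝓝 w, ∃ k, ∃ hw : v ∈ X.cov.arc k, X.IsFlat k v hw (t v) := by
  obtain ⟨k, hw, hflat⟩ := h
  obtain ⟨s, hs, hs'⟩ := X.isSecT_Xi hw ht
  have h0 : X.conn.ext w (s w) = 0 := by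
    rw [← hs'.self_of_nhds hw]
    exact (LinearEquiv.map_eq_zero_iff _).1 hflat
  filter_upwards [(X.conn.isSecT_ext hs).eventually_zero h0, hs',
    (X.cov.isOpen_arc k).mem_nhds hw] with v h1 h2 h3
  refine ⟨k, h3, ?_⟩
  unfold IsFlat
  rw [h2 h3, h1, map_zero]

theorem drStalk_extend {w : Circle} {x : O w ⊗[Mero] X.E} (hx : x ∈ X.drStalk w) :
    ∃ t : ∀ v, O v ⊗[Mero] X.E, IsSecT t w ∧ t w = x ∧ ∀ᶠ v in 𝓝 w, t v ∈ X.drStalk v := by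
  induction hx using Submodule.span_induction with
  | mem x hx =>
    obtain ⟨t, ht, rfl⟩ := exists_isSecT x
    refine ⟨t, ht, rfl, ?_⟩
    filter_upwards [X.flat_nearby ht hx] with v hv using Submodule.subset_span hv
  | zero => exact ⟨_, isSecT_zero, rfl, Eventually.of_forall fun v => zero_mem _⟩
  | add x y _ _ hx hy =>
    obtain ⟨s, hs, rfl, hs'⟩ := hx
    obtain ⟨t, ht, rfl, ht'⟩ := hy
    exact ⟨_, hs.add ht, rfl, by filter_upwards [hs', ht'] with v h1 h2 using add_mem h1 h2⟩
  | smul a x _ hx =>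
    obtain ⟨s, hs, rfl, hs'⟩ := hx
    obtain ⟨b, hb, rfl⟩ := exists_isSecAmu a
    exact ⟨fun v => (b v : O v) • s v, IsSecT.smul hb hs, rfl,
      by filter_upwards [hs'] with v h1 using (X.drStalk v).smul_mem (b v) h1⟩

theorem drLe_extend {c : ℂ} {w : Circle} {x : O w ⊗[Mero] X.E} (hx : x ∈ X.drLe c w) :
    ∃ t : ∀ v, O v ⊗[Mero] X.E, IsSecT t w ∧ t w = x ∧ ∀ᶠ v in 𝓝 w, t v ∈ X.drLe c v := by
  induction hx using Submodule.span_induction with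
  | mem x hx =>
    obtain ⟨c', c'', hc, a, ha, h, hh, hflat, rfl⟩ := hx
    obtain ⟨t, ht, rfl⟩ := exists_isSecT h
    obtain ⟨b, hb, rfl⟩ := exists_isSecAmu a
    refine ⟨fun v => (b v : O v) • t v, IsSecT.smul hb ht, rfl, ?_⟩
    filter_upwards [X.flat_nearby ht hflat, ht.mem_tensorSpan hh, hc.nearby, IsSec.mem_Amod hb ha]
      with v h1 h2 h3 h4
    exact Submodule.subset_span ⟨c', c'', h3, b v, h4, t v, h2, h1, rfl⟩
  | zero => exact ⟨_, isSecT_zero, rfl, Eventually.of_forall fun v => zero_mem _⟩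
  | add x y _ _ hx hy =>
    obtain ⟨s, hs, rfl, hs'⟩ := hx
    obtain ⟨t, ht, rfl, ht'⟩ := hy
    exact ⟨_, hs.add ht, rfl, by filter_upwards [hs', ht'] with v h1 h2 using add_mem h1 h2⟩
  | smul a x _ hx =>
    obtain ⟨s, hs, rfl, hs'⟩ := hx
    refine ⟨fun v => (Hol.const a : O v) • s v, IsSecT.smul (isSec_const a) hs, ?_, ?_⟩
    · exact algebraMap_smul (O w) a (s w)
    · filter_upwards [hs'] with v h1
      have := (X.drLe c v).smul_mem a h1
      rwa [← algebraMap_smul (O v) a (s v)] at this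

theorem drLe_smul {c b : ℂ} {w : Circle} {a : Amu P w} (ha : a ∈ AmuLe P b w)
    {x : O w ⊗[Mero] X.E} (hx : x ∈ X.drLe c w) : a • x ∈ X.drLe (c + b) w := by
  induction hx using Submodule.span_induction with
  | mem x hx =>
    obtain ⟨c', c'', hc, a', ha', h, hh, hflat, rfl⟩ := hx
    refine Submodule.subset_span ⟨b + c', c'', ?_, a * a', Amod_mul ha ha', h, hh, hflat, ?_⟩
    · have := hc.add_right b
      rwa [show c' + c'' + b = b + c' + c'' by ring] at this
    · rw [smul_smul]
  | zero => simp
  | add x y _ _ hx hy => rw [smul_add]; exact add_mem hx hy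
  | smul r x _ hx =>
    have := (X.drLe (c + b) w).smul_mem r hx
    rwa [smul_comm] at this

/-- The filtered `𝒜_μ`-module `DR^μ(E, Ξ)`. -/
def DR : FilteredModule P where
  stalk w := X.drStalk w
  IsSection s w := IsSecT (fun v => (s v : O v ⊗[Mero] X.E)) w
  section_nearby h := h.nearby
  section_congr h hs := hs.congr (by filter_upwards [h] with v hv using by rw [hv])
  section_exists w x := by
    classical
    obtain ⟨t, ht, htw, hmem⟩ := X.drStalk_extend x.2
    refine ⟨fun v => if h : t v ∈ X.drStalk v then ⟨t v, h⟩ else 0, ?_, ?_⟩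
    · refine IsSecT.congr ?_ ht
      filter_upwards [hmem] with v hv
      simp [hv]
    · have := hmem.self_of_nhds
      simp only [this, dif_pos]
      exact Subtype.ext htw
  section_unique hs ht h := by
    filter_upwards [hs.unique ht (congrArg Subtype.val h)] with v hv using Subtype.ext hv
  section_add hs ht := hs.add ht
  section_smul ha hs := IsSecT.smul ha hs
  le c w := (X.drLe c w).comap ((X.drStalk w).subtype.restrictScalars ℂ)
  le_smul {c w a x} ha hx := by
    have := X.drLe_smul ha hx
    rw [add_zero] at this
    exact this
  le_nearby {c s w} hs h := by
    obtain ⟨t, ht, htw, hmem⟩ := X.drLe_extend h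
    filter_upwards [ht.unique hs htw, hmem] with v h1 h2
    change (s v : O v ⊗[Mero] X.E) ∈ X.drLe c v
    rw [← h1]
    exact h2
  le_mono {c c' w} h := by
    refine Submodule.comap_mono (Submodule.span_mono ?_)
    rintro _ ⟨b, b', hb, r⟩
    exact ⟨b, b', hb.trans h, r⟩
  le_shift γ c w x := by
    constructor
    · intro h
      have h1 := X.drLe_smul (a := uExp P (-γ) w) (expO_mem_Amod (P.μ (-γ))) h
      rw [map_neg, add_neg_cancel_right] at h1
      have h2 : uExp P (-γ) w • (uExp P γ w • (x : O w ⊗[Mero] X.E)) = x := by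
        rw [smul_smul]
        have : uExp P (-γ) w * uExp P γ w = 1 := Subtype.ext (by
          change expO (P.μ (-γ)) w * expO (P.μ γ) w = 1
          rw [← expO_add, map_neg, neg_add_cancel, expO_zero])
        rw [this, one_smul]
      change (x : O w ⊗[Mero] X.E) ∈ X.drLe c w
      rw [← h2]
      exact h1
    · intro h
      exact X.drLe_smul (expO_mem_Amod (P.μ γ)) h

/-- The matrix coefficient `⟨φ, Ξ_k(e)⟩` in the stalk of `Õ` at `w`. -/
def coeff (k : ZMod X.cov.K) (w : Circle) (hw : w ∈ X.cov.arc k) (e : X.E)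
    (φ : X.E0 →ₗ[Mero] Mero) : O w :=
  TensorProduct.AlgebraTensorModule.rid Mero (O w) (O w)
    (φ.baseChange (O w) (X.Xi k w hw (1 ⊗ₜ e)))

/-- The underlying formal isomorphism `Ξ̂` is summable along `d`: for all `e ∈ E` and all linear forms
`φ` on `E⁰`, the formal Laurent series `⟨φ, Ξ̂(e)⟩ = z^{-n} F`, which is the common asymptotic expansion
of the `⟨φ, Ξ_k(e)⟩`, has a `1`-summable numerator `F`. -/
def SummableAlong (d : ℝ) : Prop :=
  ∀ (e : X.E) (φ : X.E0 →ₗ[Mero] Mero), ∃ (n : ℕ) (F : PowerSeries ℂ),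
    (∀ k w hw, HasAsyAt w (algebraMap Mero (O w) Mero.X ^ n * X.coeff k w hw e φ) F) ∧
      IsSummable F d

end DRObject

end PeriodRH

end

noncomputable section

namespace PeriodRH

/-! ### Polar coordinates near a direction -/

/-- The point with polar coordinates `(r, θ)`. -/
def polar (p : ℝ × ℝ) : ℂ := (p.1 : ℂ) * Complex.exp (p.2 * Complex.I)

theorem continuous_polar : Continuous polar := by unfold polar; fun_prop

theorem norm_polar (p : ℝ × ℝ) : ‖polar p‖ = |p.1| := by
  rw [polar, norm_mul, Complex.norm_exp_ofReal_mul_I, mul_one, Complex.norm_real, Real.norm_eq_abs]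

theorem polar_eq (r θ : ℝ) : polar (r, θ) = r * (Circle.exp θ : ℂ) := by
  rw [polar, Circle.coe_exp]

theorem mem_sector_iff {d Θ ρ : ℝ} {z : ℂ} :
    z ∈ sector d Θ ρ ↔ ∃ r θ : ℝ, 0 < r ∧ r < ρ ∧ |θ - d| < Θ / 2 ∧ z = polar (r, θ) := by
  unfold sector polar
  simp only [Set.mem_ofPred_eq, abs_sub_comm d]

theorem sector_mem_dirNhds (d : ℝ) {Θ ρ : ℝ} (hΘ : 0 < Θ) (hρ : 0 < ρ) :
    sector d Θ ρ ∈ dirNhds (Circle.exp d) := by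
  have hS : Circle.exp '' Metric.ball d (Θ / 2) ∈ 𝓝 (Circle.exp d) :=
    (isLocalHomeomorph_circleExp.isOpenMap _ Metric.isOpen_ball).mem_nhds
      ⟨d, Metric.mem_ball_self (by positivity), rfl⟩
  have hind : @IsInducing Circle ℂ _ _ (fun z => (z : ℂ)) := ⟨rfl⟩
  rw [hind.nhds_eq_comap] at hS
  obtain ⟨V, hV, hVS⟩ := hS
  have hW : Metric.ball (0 : ℂ) ρ ×ˢ V ∈ 𝓝 ((0 : ℂ), (Circle.exp d : ℂ)) :=
    prod_mem_nhds (Metric.ball_mem_nhds _ hρ) hV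
  have h1 : ∀ᶠ z in dirNhds (Circle.exp d), (z, z / (‖z‖ : ℂ)) ∈ Metric.ball (0 : ℂ) ρ ×ˢ V :=
    tendsto_comap hW
  filter_upwards [h1, eventually_ne_dirNhds _] with z ⟨hz1, hz2⟩ hz0
  have hn : ‖z‖ ≠ 0 := norm_ne_zero_iff.2 hz0
  have hn' : (‖z‖ : ℂ) ≠ 0 := by exact_mod_cast hn
  have hc : z / (‖z‖ : ℂ) ∈ Submonoid.unitSphere ℂ := 
    mem_sphere_zero_iff_norm.2 (by simp [hn])
  obtain ⟨θ, hθ, hθz⟩ := hVS (show (⟨_, hc⟩ : Circle) ∈ _ from hz2)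
  rw [mem_sector_iff]
  refine ⟨‖z‖, θ, norm_pos_iff.2 hz0, by simpa using hz1, by simpa [Real.dist_eq] using hθ, ?_⟩
  rw [polar_eq, hθz]
  change z = ‖z‖ * (z / ‖z‖)
  field_simp

theorem dirNhds_eq_map (d : ℝ) : dirNhds (Circle.exp d) = map polar (𝓝[>] 0 ×ˢ 𝓝 d) := by
  apply le_antisymm
  · intro s hs
    rw [mem_map] at hs
    obtain ⟨A, hA, B, hB, hAB⟩ := mem_prod_iff.1 hs
    obtain ⟨ρ, hρ, hρA⟩ := mem_nhdsGT_iff_exists_Ioo_subset.1 hA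
    obtain ⟨δ, hδ, hδB⟩ := Metric.mem_nhds_iff.1 hB
    filter_upwards [sector_mem_dirNhds d (Θ := 2 * δ) (by positivity) hρ] with z hz
    obtain ⟨r, θ, h1, h2, h3, rfl⟩ := mem_sector_iff.1 hz
    exact hAB (Set.mk_mem_prod (hρA ⟨h1, h2⟩) (hδB (by
      rw [Metric.mem_ball, Real.dist_eq]; linarith)))
  · rw [dirNhds, ← tendsto_iff_comap, tendsto_map'_iff]
    have hc : Continuous (fun p : ℝ × ℝ => (polar p, (Circle.exp p.2 : ℂ))) :=
      continuous_polar.prodMk (by fun_prop)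
    have h1 : Tendsto (fun p : ℝ × ℝ => (polar p, (Circle.exp p.2 : ℂ))) (𝓝[>] 0 ×ˢ 𝓝 d)
        (𝓝 (0, (Circle.exp d : ℂ))) := by
      have := hc.tendsto ((0 : ℝ), d)
      simp only [polar, Complex.ofReal_zero, zero_mul] at this
      rw [nhds_prod_eq] at this
      exact this.mono_left (prod_mono nhdsWithin_le_nhds le_rfl)
    refine h1.congr' ?_
    have : ∀ᶠ p : ℝ × ℝ in 𝓝[>] 0 ×ˢ 𝓝 d, 0 < p.1 :=
      tendsto_fst.eventually (self_mem_nhdsWithin)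
    filter_upwards [this] with p hp
    have hp' : (p.1 : ℂ) ≠ 0 := by exact_mod_cast hp.ne'
    simp only [Function.comp_apply, norm_polar, abs_of_pos hp, Prod.mk.injEq, true_and]
    rw [← Prod.mk.eta (p := p), polar_eq]
    field_simp

theorem eventually_dirNhds_iff {d : ℝ} {p : ℂ → Prop} :
    (∀ᶠ z in dirNhds (Circle.exp d), p z) ↔ ∀ᶠ x : ℝ × ℝ in 𝓝[>] 0 ×ˢ 𝓝 d, p (polar x) := by
  rw [dirNhds_eq_map, eventually_map]

theorem eventually_dirNhds_iff_sector {d : ℝ} {p : ℂ → Prop} :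
    (∀ᶠ z in dirNhds (Circle.exp d), p z) ↔ ∃ δ > 0, ∀ z ∈ sector d δ δ, p z := by
  constructor
  · intro h
    rw [eventually_dirNhds_iff] at h
    obtain ⟨A, hA, B, hB, hAB⟩ := mem_prod_iff.1 h
    obtain ⟨ρ, hρ, hρA⟩ := mem_nhdsGT_iff_exists_Ioo_subset.1 hA
    obtain ⟨δ, hδ, hδB⟩ := Metric.mem_nhds_iff.1 hB
    have hρ' : 0 < ρ := hρ
    refine ⟨min ρ δ, by positivity, fun z hz => ?_⟩
    obtain ⟨r, θ, h1, h2, h3, rfl⟩ := mem_sector_iff.1 hz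
    refine hAB (Set.mk_mem_prod (hρA ⟨h1, h2.trans_le (min_le_left _ _)⟩) (hδB ?_))
    rw [Metric.mem_ball, Real.dist_eq]
    have := min_le_right ρ δ
    linarith
  · rintro ⟨δ, hδ, h⟩
    filter_upwards [sector_mem_dirNhds d hδ hδ] with z hz using h z hz

theorem exists_circle_exp (w : Circle) : ∃ d : ℝ, w = Circle.exp d :=
  ⟨Complex.arg w, by rw [Circle.exp_arg]⟩

instance (w : Circle) : (dirNhds w).NeBot := by
  obtain ⟨d, rfl⟩ := exists_circle_exp w
  rw [dirNhds_eq_map]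
  infer_instance

theorem isOpen_sector (d Θ ρ : ℝ) : IsOpen (sector d Θ ρ) := by
  have : sector d Θ ρ = Complex.exp '' {u : ℂ | u.re < Real.log ρ ∧ 0 < ρ ∧ |u.im - d| < Θ / 2} := by
    ext z
    rw [mem_sector_iff]
    constructor
    · rintro ⟨r, θ, h1, h2, h3, rfl⟩
      refine ⟨Real.log r + θ * Complex.I, ⟨by simpa using Real.log_lt_log h1 h2, h1.trans h2,
        by simpa using h3⟩, ?_⟩
      rw [Complex.exp_add, ← Complex.ofReal_exp, Real.exp_log h1, polar]
    · rintro ⟨u, ⟨h1, h2, h3⟩, rfl⟩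
      refine ⟨Real.exp u.re, u.im, Real.exp_pos _, (Real.lt_log_iff_exp_lt h2).1 h1, h3, ?_⟩
      rw [polar, Complex.ofReal_exp, ← Complex.exp_add, Complex.re_add_im]
  rw [this]
  have hE : IsOpenMap Complex.exp := by
    refine isOpenMap_iff_nhds_le.2 fun x => ?_
    have := (Complex.hasStrictDerivAt_exp x).map_nhds_eq (Complex.exp_ne_zero x)
    exact this.ge
  refine hE _ ?_
  refine (isOpen_lt Complex.continuous_re continuous_const).inter (isOpen_const.inter ?_)
  exact isOpen_lt ((Complex.continuous_im.sub continuous_const).abs) continuous_const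

/-- The sector in logarithmic coordinates. -/
theorem exp_mem_sector {d Θ ρ : ℝ} (hρ : 0 < ρ) {u : ℂ} (h : u.re < Real.log ρ)
    (h' : |u.im - d| < Θ / 2) : Complex.exp u ∈ sector d Θ ρ := by
  rw [mem_sector_iff]
  refine ⟨Real.exp u.re, u.im, Real.exp_pos _, (Real.lt_log_iff_exp_lt hρ).1 h, h', ?_⟩
  rw [polar, Complex.ofReal_exp, ← Complex.exp_add, Complex.re_add_im]

/-- A holomorphic germ with zero derivative is constant. -/
theorem Hol.const_of_D_eq_zero {w : Circle} {g : O w} (h : Hol.D g = 0) :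
    ∃ c : ℂ, g = Hol.const c := by
  obtain ⟨d, rfl⟩ := exists_circle_exp w
  obtain ⟨f, hf, hg⟩ := g.exists_rep
  have h0 : ∀ᶠ z in dirNhds (Circle.exp d), deriv f z = 0 := by
    have h1 := congrArg Hol.germ h
    rw [Hol.germ_D, hg, derivGerm_coe, map_zero] at h1
    exact Germ.coe_eq.1 h1
  obtain ⟨δ, hδ, hs⟩ := eventually_dirNhds_iff_sector.1 (hf.and h0)
  set S : Set ℂ := {u : ℂ | u.re < Real.log δ ∧ |u.im - d| < δ / 2} with hS
  have hconv : Convex ℝ S := by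
    have e : S = Complex.reLm ⁻¹' Set.Iio (Real.log δ) ∩ Complex.imLm ⁻¹' Metric.ball d (δ / 2) := by
      ext u; simp [hS, Real.dist_eq]
    rw [e]
    exact ((convex_Iio _).linear_preimage _).inter ((convex_ball _ _).linear_preimage _)
  have hd : ∀ u ∈ S, HasDerivAt (fun u => f (Complex.exp u)) 0 u := by
    intro u hu
    obtain ⟨h1, h2⟩ := hs _ (exp_mem_sector hδ hu.1 hu.2)
    have := h1.hasDerivAt.comp u (Complex.hasDerivAt_exp u)
    rwa [h2, zero_mul] at this
  set u0 : ℂ := (Real.log δ - 1 : ℝ) + d * Complex.I with hu0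
  have hu0S : u0 ∈ S := ⟨by simp [hu0], by simp [hu0, hδ]⟩
  refine ⟨f (Complex.exp u0), Hol.germ_injective ?_⟩
  rw [hg]
  refine Germ.coe_eq.2 ?_
  filter_upwards [sector_mem_dirNhds d hδ hδ] with z hz
  obtain ⟨r, θ, h1, h2, h3, rfl⟩ := mem_sector_iff.1 hz
  have hzS : (Real.log r + θ * Complex.I : ℂ) ∈ S :=
    ⟨by simpa using Real.log_lt_log h1 h2, by simpa using h3⟩
  have e : polar (r, θ) = Complex.exp (Real.log r + θ * Complex.I) := by
    rw [Complex.exp_add, ← Complex.ofReal_exp, Real.exp_log h1, polar]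
  rw [e]
  have := hconv.norm_image_sub_le_of_norm_hasDerivWithin_le (f := fun u => f (Complex.exp u))
    (f' := fun _ => 0) (C := 0) (fun x hx => (hd x hx).hasDerivWithinAt) (by simp) hu0S hzS
  rw [zero_mul, norm_le_zero_iff, sub_eq_zero] at this
  exact this

/-- Uniformity in the direction on compact sets of directions. -/
theorem eventually_polar_of_isCompact {K : Set ℝ} (hK : IsCompact K) {p : ℂ → Prop}
    (h : ∀ θ ∈ K, ∀ᶠ z in dirNhds (Circle.exp θ), p z) :
    ∃ ρ > 0, ∀ r θ : ℝ, 0 < r → r < ρ → θ ∈ K → p (polar (r, θ)) := by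
  have h1 : {x : ℝ × ℝ | p (polar x)} ∈ 𝓝[>] (0 : ℝ) ×ˢ 𝓝ˢ K := by
    refine hK.mem_prod_nhdsSet_of_forall fun θ hθ => ?_
    exact eventually_dirNhds_iff.1 (h θ hθ)
  obtain ⟨A, hA, B, hB, hAB⟩ := mem_prod_iff.1 h1
  obtain ⟨ρ, hρ, hρA⟩ := mem_nhdsGT_iff_exists_Ioo_subset.1 hA
  exact ⟨ρ, hρ, fun r θ h1 h2 h3 => hAB (Set.mk_mem_prod (hρA ⟨h1, h2⟩) (subset_of_mem_nhdsSet hB h3))⟩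

/-- The germ of a function, if it is holomorphic. -/
def toO (f : ℂ → ℂ) (w : Circle) : O w :=
  open Classical in if h : ∀ᶠ z in dirNhds w, DifferentiableAt ℂ f z then Hol.mk f h else 0

theorem germ_toO {f : ℂ → ℂ} {w : Circle} (h : ∀ᶠ z in dirNhds w, DifferentiableAt ℂ f z) :
    (toO f w).germ = (f : Germ (dirNhds w) ℂ) := by
  rw [toO, dif_pos h]; rfl

theorem isSec_toO {f : ℂ → ℂ} {w : Circle} (h : ∀ᶠ z in dirNhds w, DifferentiableAt ℂ f z) :
    IsSec (toO f) w :=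
  ⟨f, by filter_upwards [eventually_dirNhds h] with v hv using germ_toO hv⟩

theorem germ_eventually_diff {w : Circle} {g : O w} {f : ℂ → ℂ}
    (h : g.germ = (f : Germ (dirNhds w) ℂ)) : ∀ᶠ z in dirNhds w, DifferentiableAt ℂ f z := by
  obtain ⟨k, hk, hg⟩ := g.exists_rep
  rw [h] at hg
  have := OpenFilter.ev_nhds (Germ.coe_eq.1 hg)
  filter_upwards [this, hk] with z h1 h2
  exact (EventuallyEq.differentiableAt_iff h1).2 h2

theorem eq_toO {w : Circle} {g : O w} {f : ℂ → ℂ} (h : g.germ = (f : Germ (dirNhds w) ℂ)) :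
    g = toO f w :=
  Hol.germ_injective (by rw [h, germ_toO (germ_eventually_diff h)])

/-- The argument with values in `(m - π, m + π]`. -/
def argAt (m : ℝ) (z : ℂ) : ℝ := m + Complex.arg (z * Complex.exp (-(m * Complex.I)))

theorem argAt_polar {m r θ : ℝ} (hr : 0 < r) (h : |θ - m| < Real.pi) :
    argAt m (polar (r, θ)) = θ := by
  obtain ⟨h1, h2⟩ := abs_lt.1 h
  have e : polar (r, θ) * Complex.exp (-(m * Complex.I)) =
      r * (Complex.cos ((θ - m : ℝ) : ℂ) + Complex.sin ((θ - m : ℝ) : ℂ) * Complex.I) := by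
    rw [polar, ← Complex.exp_mul_I, mul_assoc, ← Complex.exp_add]
    push_cast
    ring_nf
  rw [argAt, e, Complex.arg_mul_cos_add_sin_mul_I hr ⟨h1, h2.le⟩]
  ring

/-- Sections over a compact arc of directions are given by a single function. -/
theorem exists_function_of_isSec {a b : ℝ} (hab : b - a < 2 * Real.pi) {s : ∀ v, O v}
    (hs : ∀ θ ∈ Set.Icc a b, IsSec s (Circle.exp θ)) :
    ∃ f : ℂ → ℂ, ∀ θ ∈ Set.Icc a b,
      (s (Circle.exp θ)).germ = (f : Germ (dirNhds (Circle.exp θ)) ℂ) := by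
  classical
  have h1 : ∀ θ : ℝ, ∃ (f : ℂ → ℂ) (r : ℝ), 0 < r ∧ (θ ∈ Set.Icc a b → ∀ θ', |θ' - θ| < 2 * r →
      (s (Circle.exp θ')).germ = (f : Germ (dirNhds (Circle.exp θ')) ℂ)) := by
    intro θ
    by_cases hθ : θ ∈ Set.Icc a b
    · obtain ⟨f, hf⟩ := hs θ hθ
      obtain ⟨r, hr, h⟩ := Metric.eventually_nhds_iff.1 (Circle.exp.continuous.tendsto θ |>.eventually hf)
      refine ⟨f, r / 2, by positivity, fun _ θ' h' => h ?_⟩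
      rw [Real.dist_eq]
      linarith
    · exact ⟨0, 1, one_pos, fun h => (hθ h).elim⟩
  choose f r hr hfr using h1
  obtain ⟨t, ht, hcov⟩ := isCompact_Icc.elim_nhds_subcover (s := Set.Icc a b)
    (fun θ => Metric.ball θ (r θ)) fun θ _ => Metric.ball_mem_nhds _ (hr θ)
  have hidx : ∀ θ : ℝ, ∃ j, (∃ i ∈ t, |θ - i| < r i) → j ∈ t ∧ |θ - j| < r j := by
    intro θ
    by_cases h : ∃ i ∈ t, |θ - i| < r i
    · exact ⟨h.choose, fun _ => h.choose_spec⟩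
    · exact ⟨0, fun h' => (h h').elim⟩
  choose idx hidx using hidx
  refine ⟨fun z => f (idx (argAt ((a + b) / 2) z)) z, fun θ₀ hθ₀ => ?_⟩
  obtain ⟨i₀, hi₀, hθi₀⟩ : ∃ i ∈ t, |θ₀ - i| < r i := by
    have := hcov hθ₀
    simp only [Set.mem_iUnion, Metric.mem_ball, Real.dist_eq, exists_prop] at this
    exact this
  rw [hfr i₀ (ht i₀ hi₀) θ₀ (by have := hr i₀; linarith)]
  refine Germ.coe_eq.2 (eventually_dirNhds_iff.2 ?_)
  have e0 : ∀ᶠ x : ℝ × ℝ in 𝓝[>] 0 ×ˢ 𝓝 θ₀, 0 < x.1 :=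
    tendsto_fst.eventually (self_mem_nhdsWithin)
  have e1 : ∀ᶠ x : ℝ × ℝ in 𝓝[>] 0 ×ˢ 𝓝 θ₀, |x.2 - (a + b) / 2| < Real.pi := by
    refine tendsto_snd.eventually (p := fun θ : ℝ => |θ - (a + b) / 2| < Real.pi) ?_
    refine ContinuousAt.eventually_lt (by fun_prop) continuousAt_const ?_
    rw [abs_lt]
    constructor <;> linarith [hθ₀.1, hθ₀.2]
  have e2 : ∀ᶠ x : ℝ × ℝ in 𝓝[>] 0 ×ˢ 𝓝 θ₀, |x.2 - i₀| < r i₀ :=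
    tendsto_snd.eventually (p := fun θ : ℝ => |θ - i₀| < r i₀)
      (ContinuousAt.eventually_lt (by fun_prop) continuousAt_const hθi₀)
  have e3 : ∀ j ∈ t, ∀ᶠ x : ℝ × ℝ in 𝓝[>] 0 ×ˢ 𝓝 θ₀, |x.2 - j| < r j →
      f i₀ (polar x) = f j (polar x) := by
    intro j hj
    by_cases hd : |θ₀ - j| < 2 * r j
    · have h2 := hfr j (ht j hj) θ₀ hd
      rw [hfr i₀ (ht i₀ hi₀) θ₀ (by have := hr i₀; linarith)] at h2
      filter_upwards [eventually_dirNhds_iff.1 (Germ.coe_eq.1 h2)] with x hx _ using hx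
    · have h2 : ∀ᶠ x : ℝ × ℝ in 𝓝[>] 0 ×ˢ 𝓝 θ₀, r j < |x.2 - j| :=
        tendsto_snd.eventually (p := fun θ : ℝ => r j < |θ - j|)
          (ContinuousAt.eventually_lt continuousAt_const (by fun_prop)
          (by have := hr j; linarith))
      filter_upwards [h2] with x hx h3
      linarith
  filter_upwards [e0, e1, e2, (Filter.eventually_all_finset t).2 e3] with x h0 h1 h2 h3
  rw [← Prod.mk.eta (p := x), argAt_polar h0 h1]
  obtain ⟨h4, h5⟩ := hidx x.2 ⟨i₀, hi₀, h2⟩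
  exact h3 _ h4 h5

end PeriodRH

namespace PeriodRH

/-! ### Gevrey asymptotics near a direction -/

/-- The partial sums of a formal power series. -/
def psum (F : PowerSeries ℂ) (N : ℕ) (z : ℂ) : ℂ :=
  ∑ n ∈ Finset.range N, PowerSeries.coeff n F * z ^ n

/-- `f` has the asymptotic expansion `F` of Gevrey order one near the direction `w`. -/
def AsyFn (w : Circle) (f : ℂ → ℂ) (F : PowerSeries ℂ) : Prop :=
  ∃ B > 0, ∀ᶠ z in dirNhds w, ∀ N : ℕ,
    ‖f z - psum F N z‖ ≤ B ^ (N + 1) * (N.factorial : ℝ) * ‖z‖ ^ N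

theorem eventually_norm_lt (w : Circle) {r : ℝ} (hr : 0 < r) : ∀ᶠ z in dirNhds w, ‖z‖ < r := by
  have h1 : Tendsto (fun z : ℂ => ‖z‖) (𝓝[≠] 0) (𝓝 0) :=
    tendsto_norm_zero.mono_left nhdsWithin_le_nhds
  exact dirNhds_le w (h1.eventually (gt_mem_nhds hr))

theorem tendsto_norm_dirNhds (w : Circle) : Tendsto (fun z : ℂ => ‖z‖) (dirNhds w) (𝓝[>] 0) := by
  refine tendsto_nhdsWithin_iff.2 ⟨?_, ?_⟩
  · exact (tendsto_norm_zero.mono_left nhdsWithin_le_nhds).mono_left (dirNhds_le w)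
  · filter_upwards [eventually_ne_dirNhds w] with z hz using norm_pos_iff.2 hz

variable {w : Circle} {f g : ℂ → ℂ} {F G : PowerSeries ℂ}

theorem AsyFn.coeff_le {B : ℝ} (h : ∀ᶠ z in dirNhds w, ∀ N : ℕ,
    ‖f z - psum F N z‖ ≤ B ^ (N + 1) * (N.factorial : ℝ) * ‖z‖ ^ N) (n : ℕ) :
    ‖PowerSeries.coeff n F‖ ≤ B ^ (n + 1) * n.factorial := by
  have h1 : ∀ᶠ z in dirNhds w, ‖PowerSeries.coeff n F‖ ≤
      B ^ (n + 1) * n.factorial + B ^ (n + 2) * (n + 1).factorial * ‖z‖ := by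
    filter_upwards [h, eventually_ne_dirNhds w] with z hz hz0
    have h2 := norm_sub_le (f z - psum F n z) (f z - psum F (n + 1) z)
    have h3 : f z - psum F n z - (f z - psum F (n + 1) z) = PowerSeries.coeff n F * z ^ n := by
      rw [psum, psum, Finset.sum_range_succ]; ring
    rw [h3, norm_mul, norm_pow] at h2
    have hzp : 0 < ‖z‖ ^ n := by positivity
    refine le_of_mul_le_mul_right (a := ‖z‖ ^ n) ?_ hzp
    have h4 := hz n
    have h5 := hz (n + 1)
    calc _ ≤ _ := h2
      _ ≤ _ := add_le_add h4 h5
      _ = _ := by ring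
  have h2 : Tendsto (fun z : ℂ => B ^ (n + 1) * n.factorial + B ^ (n + 2) * (n + 1).factorial * ‖z‖)
      (dirNhds w) (𝓝 (B ^ (n + 1) * n.factorial + B ^ (n + 2) * (n + 1).factorial * 0)) :=
    (((tendsto_norm_dirNhds w).mono_right nhdsWithin_le_nhds).const_mul _).const_add _
  rw [mul_zero, add_zero] at h2
  exact ge_of_tendsto h2 h1

theorem AsyFn.isGevrey (h : AsyFn w f F) : IsGevrey F := by
  obtain ⟨B, hB, h⟩ := h
  refine ⟨B + 1, by positivity, fun n => (AsyFn.coeff_le h n).trans_lt ?_⟩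
  gcongr
  linarith

theorem AsyFn.congr (h : AsyFn w f F) (hfg : ∀ᶠ z in dirNhds w, f z = g z) : AsyFn w g F := by
  obtain ⟨B, hB, h⟩ := h
  refine ⟨B, hB, ?_⟩
  filter_upwards [h, hfg] with z h1 h2
  rwa [← h2]

theorem AsyFn.nearby (h : AsyFn w f F) : ∀ᶠ v in 𝓝 w, AsyFn v f F := by
  obtain ⟨B, hB, h⟩ := h
  filter_upwards [eventually_dirNhds h] with v hv using ⟨B, hB, hv⟩

theorem AsyFn.add (hf : AsyFn w f F) (hg : AsyFn w g G) : AsyFn w (fun z => f z + g z) (F + G) := by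
  obtain ⟨B, hB, hf⟩ := hf
  obtain ⟨B', hB', hg⟩ := hg
  refine ⟨B + B', by positivity, ?_⟩
  filter_upwards [hf, hg] with z h1 h2 N
  have e : f z + g z - psum (F + G) N z = (f z - psum F N z) + (g z - psum G N z) := by
    simp only [psum, map_add, add_mul, Finset.sum_add_distrib]; ring
  rw [e]
  refine (norm_add_le _ _).trans ((add_le_add (h1 N) (h2 N)).trans ?_)
  rw [← add_mul, ← add_mul]
  gcongr
  exact pow_add_pow_le hB.le hB'.le (by omega)

theorem psum_mul_identity (F G : PowerSeries ℂ) (N : ℕ) (z : ℂ) :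
    psum (F * G) N z = ∑ k ∈ Finset.range N, PowerSeries.coeff k F * z ^ k * psum G (N - k) z := by
  have h := Finset.sum_range_diag_flip N (fun k m => (PowerSeries.coeff k F * z ^ k) *
    (PowerSeries.coeff m G * z ^ m))
  simp only [psum, Finset.mul_sum]
  rw [← h]
  refine Finset.sum_congr rfl fun n _ => ?_
  rw [PowerSeries.coeff_mul, Finset.Nat.sum_antidiagonal_eq_sum_range_succ
    (fun i j => PowerSeries.coeff i F * PowerSeries.coeff j G), Finset.sum_mul]
  refine Finset.sum_congr rfl fun k hk => ?_
  have : k + (n - k) = n := by have := Finset.mem_range.1 hk; omega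
  calc _ = PowerSeries.coeff k F * PowerSeries.coeff (n - k) G * z ^ (k + (n - k)) := by rw [this]
    _ = _ := by rw [pow_add]; ring

theorem AsyFn.mul (hf : AsyFn w f F) (hg : AsyFn w g G) : AsyFn w (fun z => f z * g z) (F * G) := by
  obtain ⟨B₁, hB₁, hf⟩ := hf
  obtain ⟨B₂, hB₂, hg⟩ := hg
  have hF := AsyFn.coeff_le hf
  set B := max (max B₁ B₂) 1 with hBdef
  have hB1 : 1 ≤ B := le_max_right _ _
  have hB0 : 0 < B := by linarith
  have hBB₁ : B₁ ≤ B := (le_max_left _ _).trans (le_max_left _ _)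
  have hBB₂ : B₂ ≤ B := (le_max_right _ _).trans (le_max_left _ _)
  refine ⟨2 * B ^ 2, by positivity, ?_⟩
  filter_upwards [hf, hg] with z h1 h2 N
  have e : f z * g z - psum (F * G) N z = ∑ k ∈ Finset.range N, PowerSeries.coeff k F * z ^ k *
      (g z - psum G (N - k) z) + (f z - psum F N z) * g z := by
    rw [psum_mul_identity]
    simp only [mul_sub, Finset.sum_sub_distrib]
    rw [← Finset.sum_mul]
    change _ = psum F N z * g z - _ + _
    ring
  have hgz : ‖g z‖ ≤ B := by
    have := h2 0
    simp only [psum, Finset.range_zero, Finset.sum_empty, sub_zero, zero_add, pow_one,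
      Nat.factorial_zero, Nat.cast_one, mul_one, pow_zero] at this
    linarith
  have hk : ∀ k ∈ Finset.range N, ‖PowerSeries.coeff k F * z ^ k * (g z - psum G (N - k) z)‖ ≤
      B ^ (N + 2) * N.factorial * ‖z‖ ^ N := by
    intro k hk
    have hkN : k + (N - k) = N := by have := Finset.mem_range.1 hk; omega
    rw [norm_mul, norm_mul, norm_pow]
    have hfac : ((k.factorial * (N - k).factorial : ℕ) : ℝ) ≤ N.factorial := by
      have := Nat.le_of_dvd (Nat.factorial_pos _) (Nat.factorial_mul_factorial_dvd_factorial_add k (N - k))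
      rw [hkN] at this
      exact_mod_cast this
    calc _ ≤ (B ^ (k + 1) * k.factorial) * ‖z‖ ^ k * (B ^ (N - k + 1) * (N - k).factorial * ‖z‖ ^ (N - k)) := by
          gcongr
          · exact (hF k).trans (by gcongr)
          · exact (h2 (N - k)).trans (by gcongr)
      _ = B ^ (k + (N - k) + 2) * ((k.factorial * (N - k).factorial : ℕ) : ℝ) * ‖z‖ ^ (k + (N - k)) := by
          push_cast; ring
      _ ≤ _ := by rw [hkN]; gcongr
  have hlast : ‖(f z - psum F N z) * g z‖ ≤ B ^ (N + 2) * N.factorial * ‖z‖ ^ N := by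
    rw [norm_mul]
    calc _ ≤ (B ^ (N + 1) * N.factorial * ‖z‖ ^ N) * B := by
          gcongr
          exact (h1 N).trans (by gcongr)
      _ = _ := by ring
  rw [e]
  have hsum := norm_sum_le_of_le _ hk
  rw [Finset.sum_const, Finset.card_range, nsmul_eq_mul] at hsum
  refine (norm_add_le _ _).trans ((add_le_add hsum hlast).trans ?_)
  have h2N : (N : ℝ) + 1 ≤ 2 ^ (N + 1) := by
    have : N + 1 < 2 ^ (N + 1) := Nat.lt_two_pow_self
    exact_mod_cast this.le
  have hpow : B ^ (N + 2) ≤ (B ^ 2) ^ (N + 1) := by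
    rw [← pow_mul]
    exact pow_le_pow_right₀ hB1 (by omega)
  calc _ = ((N : ℝ) + 1) * B ^ (N + 2) * (N.factorial * ‖z‖ ^ N) := by ring
    _ ≤ 2 ^ (N + 1) * (B ^ 2) ^ (N + 1) * (N.factorial * ‖z‖ ^ N) := by gcongr
    _ = _ := by rw [mul_pow]; ring

theorem AsyFn.bounded (hf : AsyFn w f F) : ∃ B > 0, ∀ᶠ z in dirNhds w, ‖f z‖ ≤ B := by
  obtain ⟨B, hB, hf⟩ := hf
  refine ⟨B, hB, ?_⟩
  filter_upwards [hf] with z h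
  simpa [psum] using h 0

theorem AsyFn.of_analyticAt (hf : AnalyticAt ℂ f 0) : ∃ F, ∀ w, AsyFn w f F := by
  obtain ⟨p, r, hp⟩ := hf
  obtain ⟨r', hr'0, hr'⟩ := ENNReal.lt_iff_exists_nnreal_btwn.1 hp.r_pos
  have hr'1 : (0 : ℝ) < r' := by exact_mod_cast hr'0
  obtain ⟨a, ha, C, hC, h⟩ := hp.uniform_geometric_approx' hr'
  refine ⟨PowerSeries.mk fun n => p.coeff n, fun w => ⟨C + 1 / r' + 1, by positivity, ?_⟩⟩
  filter_upwards [eventually_norm_lt w hr'1] with z hz N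
  have h1 := h z (by simpa using hz) N
  rw [zero_add] at h1
  have e : p.partialSum N z = psum (PowerSeries.mk fun n => p.coeff n) N z := by
    simp only [FormalMultilinearSeries.partialSum, psum, PowerSeries.coeff_mk]
    refine Finset.sum_congr rfl fun n _ => ?_
    rw [FormalMultilinearSeries.apply_eq_pow_smul_coeff, smul_eq_mul, mul_comm]
  rw [← e]
  refine h1.trans ?_
  have hfac : (1 : ℝ) ≤ N.factorial := by exact_mod_cast Nat.factorial_pos N
  calc C * (a * (‖z‖ / r')) ^ N ≤ C * (1 * (‖z‖ / r')) ^ N := by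
        have := ha.1
        gcongr
        exact ha.2.le
    _ = C * (1 / r') ^ N * 1 * ‖z‖ ^ N := by rw [one_mul, div_eq_mul_one_div, mul_pow]; ring
    _ ≤ (C + 1 / r' + 1) * (C + 1 / r' + 1) ^ N * N.factorial * ‖z‖ ^ N := by
        have : (0 : ℝ) ≤ 1 / r' := by positivity
        gcongr <;> linarith
    _ = _ := by ring

theorem AsyFn.X_pow_mul (m : ℕ) (hf : AsyFn w f F) :
    AsyFn w (fun z => z ^ m * f z) (PowerSeries.X ^ m * F) := by
  refine AsyFn.mul (f := fun z => z ^ m) ⟨1, one_pos, ?_⟩ hf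
  filter_upwards [eventually_norm_lt w one_pos] with z hz N
  have e : psum (PowerSeries.X ^ m) N z = if m < N then z ^ m else 0 := by
    simp [psum, PowerSeries.coeff_X_pow, ite_mul]
  rw [e]
  split_ifs with h
  · rw [sub_self, norm_zero]; positivity
  · rw [sub_zero, norm_pow, one_pow, one_mul]
    have hfac : (1 : ℝ) ≤ N.factorial := by exact_mod_cast Nat.factorial_pos N
    calc ‖z‖ ^ m ≤ ‖z‖ ^ N := pow_le_pow_of_le_one (norm_nonneg _) hz.le (not_lt.1 h)
      _ ≤ _ := le_mul_of_one_le_left (by positivity) hfac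

theorem AsyFn.of_X_pow_mul {m : ℕ}
    (hf : AsyFn w (fun z => z ^ m * f z) (PowerSeries.X ^ m * F)) : AsyFn w f F := by
  obtain ⟨B, hB, hf⟩ := hf
  refine ⟨(2 * B + 1) ^ (m + 1) * m.factorial, by positivity, ?_⟩
  filter_upwards [hf, eventually_ne_dirNhds w] with z h hz0 N
  have h1 := h (m + N)
  have e : psum (PowerSeries.X ^ m * F) (m + N) z = z ^ m * psum F N z := by
    rw [psum, psum, Finset.sum_range_add, Finset.mul_sum]
    have e1 : ∀ n ∈ Finset.range m, (PowerSeries.coeff n (PowerSeries.X ^ m * F)) * z ^ n = 0 := by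
      intro n hn
      rw [PowerSeries.coeff_X_pow_mul', if_neg (by have := Finset.mem_range.1 hn; omega), zero_mul]
    rw [Finset.sum_eq_zero e1, zero_add]
    refine Finset.sum_congr rfl fun n _ => ?_
    rw [add_comm m n, PowerSeries.coeff_X_pow_mul]
    ring
  rw [e, ← mul_sub, norm_mul, norm_pow] at h1
  have hzp : 0 < ‖z‖ ^ m := by positivity
  refine le_of_mul_le_mul_left (a := ‖z‖ ^ m) (h1.trans ?_) hzp
  have hfac : ((m + N).factorial : ℝ) ≤ 2 ^ (m + N) * (m.factorial * N.factorial) := by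
    have h2 := Nat.add_choose_mul_factorial_mul_factorial m N
    have h3 := Nat.choose_le_two_pow (m + N) N
    have : (m + N).factorial ≤ 2 ^ (m + N) * (m.factorial * N.factorial) := by
      rw [← h2, mul_assoc]; gcongr
    exact_mod_cast this
  have hm1 : (1 : ℝ) ≤ m.factorial := by exact_mod_cast Nat.factorial_pos m
  calc _ ≤ B ^ (m + N + 1) * (2 ^ (m + N) * (m.factorial * N.factorial)) * (‖z‖ ^ m * ‖z‖ ^ N) := by
        rw [← pow_add ‖z‖]
        gcongr
    _ ≤ B ^ (m + N + 1) * (2 ^ (m + N + 1) * (m.factorial * N.factorial)) * (‖z‖ ^ m * ‖z‖ ^ N) := by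
        gcongr _ * (?_ * _) * _
        exact pow_le_pow_right₀ one_le_two (by omega)
    _ = (2 * B) ^ (m + N + 1) * m.factorial ^ 1 * N.factorial * (‖z‖ ^ m * ‖z‖ ^ N) := by
        rw [mul_pow]; ring
    _ ≤ (2 * B + 1) ^ ((m + 1) * (N + 1)) * m.factorial ^ (N + 1) * N.factorial * (‖z‖ ^ m * ‖z‖ ^ N) := by
        gcongr ?_ * ?_ * _ * _
        · calc (2 * B) ^ (m + N + 1) ≤ (2 * B + 1) ^ (m + N + 1) := by gcongr; linarith
            _ ≤ _ := pow_le_pow_right₀ (by linarith) (by nlinarith)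
        · exact pow_le_pow_right₀ hm1 (by omega)
    _ = _ := by rw [mul_pow, ← pow_mul]; ring

/-! ### Exponentially small germs -/

/-- Exponential decay near the direction `w`. -/
def SmallFn (w : Circle) (f : ℂ → ℂ) : Prop :=
  ∃ C > 0, ∃ κ > 0, ∀ᶠ z in dirNhds w, ‖f z‖ ≤ C * Real.exp (-κ / ‖z‖)

theorem SmallFn.asyFn (h : SmallFn w f) : AsyFn w f 0 := by
  obtain ⟨C, hC, κ, hκ, h⟩ := h
  refine ⟨C + 1 / κ, by positivity, ?_⟩
  filter_upwards [h, eventually_ne_dirNhds w] with z hz hz0 N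
  have e : psum 0 N z = 0 := by simp [psum]
  rw [e, sub_zero]
  have hz' : 0 < ‖z‖ := norm_pos_iff.2 hz0
  refine hz.trans ?_
  have h1 := Real.pow_div_factorial_le_exp (x := κ / ‖z‖) (by positivity) N
  have hf : (0 : ℝ) < N.factorial := by exact_mod_cast Nat.factorial_pos N
  have h2 : Real.exp (-κ / ‖z‖) ≤ N.factorial * (‖z‖ * (1 / κ)) ^ N := by
    rw [neg_div, Real.exp_neg, inv_le_comm₀ (Real.exp_pos _) (by positivity)]
    refine le_trans (le_of_eq ?_) h1
    rw [mul_inv, ← inv_pow, mul_inv, one_div, inv_inv]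
    field_simp
  calc _ ≤ C * (N.factorial * (‖z‖ * (1 / κ)) ^ N) := by gcongr
    _ = C * (1 / κ) ^ N * N.factorial * ‖z‖ ^ N := by rw [mul_pow]; ring
    _ ≤ (C + 1 / κ) * (C + 1 / κ) ^ N * N.factorial * ‖z‖ ^ N := by
        have : (0 : ℝ) ≤ 1 / κ := by positivity
        gcongr <;> linarith
    _ = _ := by ring

theorem AsyFn.small (h : AsyFn w f 0) : SmallFn w f := by
  obtain ⟨B, hB, h⟩ := h
  refine ⟨B * Real.exp 1, by positivity, 1 / (Real.exp 1 * B), by positivity, ?_⟩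
  filter_upwards [h, eventually_ne_dirNhds w] with z hz hz0
  have hz' : 0 < ‖z‖ := norm_pos_iff.2 hz0
  set x : ℝ := 1 / (Real.exp 1 * B) / ‖z‖ with hx
  have hx0 : 0 < x := by positivity
  set N := ⌊x⌋₊ with hN
  have hNx : (N : ℝ) ≤ x := Nat.floor_le hx0.le
  have hxN : x < N + 1 := Nat.lt_floor_add_one x
  have h1 := hz N
  have e : psum 0 N z = 0 := by simp [psum]
  rw [e, sub_zero] at h1
  have hfac : (N.factorial : ℝ) ≤ (N : ℝ) ^ N := by exact_mod_cast Nat.factorial_le_pow N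
  have h2 : B * (N : ℝ) * ‖z‖ ≤ Real.exp (-1) := by
    calc B * (N : ℝ) * ‖z‖ ≤ B * x * ‖z‖ := by gcongr
      _ = _ := by rw [hx, Real.exp_neg]; field_simp
  have h3 : Real.exp (-(N : ℝ)) ≤ Real.exp 1 * Real.exp (-x) := by
    rw [← Real.exp_add]; exact Real.exp_le_exp.2 (by linarith)
  calc ‖f z‖ ≤ B ^ (N + 1) * (N : ℝ) ^ N * ‖z‖ ^ N := h1.trans (by gcongr)
    _ = B * (B * N * ‖z‖) ^ N := by rw [mul_pow, mul_pow]; ring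
    _ ≤ B * (Real.exp (-1)) ^ N := by gcongr
    _ = B * Real.exp (-(N : ℝ)) := by rw [← Real.exp_nat_mul]; simp
    _ ≤ B * (Real.exp 1 * Real.exp (-x)) := by gcongr
    _ = _ := by rw [hx]; ring_nf

theorem AsyFn.neg (hf : AsyFn w f F) : AsyFn w (fun z => -f z) (-F) := by
  obtain ⟨B, hB, hf⟩ := hf
  refine ⟨B, hB, ?_⟩
  filter_upwards [hf] with z h N
  have e : -f z - psum (-F) N z = -(f z - psum F N z) := by
    simp only [psum, map_neg, neg_mul, Finset.sum_neg_distrib]; ring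
  rw [e, norm_neg]
  exact h N

theorem AsyFn.eq_zero (h : AsyFn w (fun _ => 0) F) : F = 0 := by
  obtain ⟨B, hB, h⟩ := h
  ext n
  rw [map_zero]
  induction n using Nat.strong_induction_on with
  | _ n ih =>
    have h1 : ∀ᶠ z in dirNhds w, ‖PowerSeries.coeff n F‖ ≤ B ^ (n + 2) * (n + 1).factorial * ‖z‖ := by
      filter_upwards [h, eventually_ne_dirNhds w] with z hz hz0
      have h2 := hz (n + 1)
      have e : psum F (n + 1) z = PowerSeries.coeff n F * z ^ n := by
        rw [psum, Finset.sum_range_succ, Finset.sum_eq_zero, zero_add]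
        intro m hm
        rw [ih m (Finset.mem_range.1 hm), zero_mul]
      rw [e, zero_sub, norm_neg, norm_mul, norm_pow] at h2
      have hzp : 0 < ‖z‖ ^ n := by positivity
      refine le_of_mul_le_mul_right (a := ‖z‖ ^ n) (h2.trans (le_of_eq ?_)) hzp
      ring
    have h2 : Tendsto (fun z : ℂ => B ^ (n + 2) * (n + 1).factorial * ‖z‖) (dirNhds w)
        (𝓝 (B ^ (n + 2) * (n + 1).factorial * 0)) :=
      ((tendsto_norm_dirNhds w).mono_right nhdsWithin_le_nhds).const_mul _
    rw [mul_zero] at h2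
    exact norm_le_zero_iff.1 (ge_of_tendsto h2 h1)

theorem AsyFn.unique (h : AsyFn w f F) (h' : AsyFn w f G) : F = G := by
  have := (h.add h'.neg).congr (g := fun _ => 0) (Eventually.of_forall fun z => by ring)
  exact sub_eq_zero.1 ((sub_eq_add_neg F G).trans this.eq_zero)

end PeriodRH

namespace PeriodRH

/-! ### Comparison of the notions of asymptotic expansion -/

theorem AsyFn.of_bound {w : Circle} {f : ℂ → ℂ} {F : PowerSeries ℂ} {B : ℝ} (hB : 0 < B)
    (h : ∀ᶠ z in dirNhds w, ∀ N : ℕ, 0 < N →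
      (‖z‖⁻¹) ^ N * ‖f z - psum F N z‖ < B ^ (N + 1) * (N.factorial : ℝ)) : AsyFn w f F := by
  refine ⟨B + B ^ 2 + ‖PowerSeries.coeff 0 F‖, by positivity, ?_⟩
  filter_upwards [h, eventually_ne_dirNhds w, eventually_norm_lt w one_pos] with z hz hz0 hz1 N
  have hz' : 0 < ‖z‖ := norm_pos_iff.2 hz0
  have key : ∀ N, 0 < N → ‖f z - psum F N z‖ ≤ B ^ (N + 1) * N.factorial * ‖z‖ ^ N := by
    intro N hN
    have h1 := (hz N hN).le
    rw [inv_pow, inv_mul_le_iff₀ (by positivity)] at h1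
    linarith
  have hB' : B ≤ B + B ^ 2 + ‖PowerSeries.coeff 0 F‖ := by
    have := norm_nonneg (PowerSeries.coeff 0 F)
    nlinarith
  rcases Nat.eq_zero_or_pos N with rfl | hN
  · have h1 := key 1 one_pos
    simp only [psum, Finset.range_one, Finset.sum_singleton, pow_zero, mul_one, Nat.factorial_one,
      Nat.cast_one, pow_one] at h1
    simp only [psum, Finset.range_zero, Finset.sum_empty, sub_zero, zero_add, pow_one,
      Nat.factorial_zero, Nat.cast_one, mul_one, pow_zero]
    have h2 : ‖f z‖ ≤ ‖f z - PowerSeries.coeff 0 F‖ + ‖PowerSeries.coeff 0 F‖ := by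
      simpa using norm_add_le (f z - PowerSeries.coeff 0 F) (PowerSeries.coeff 0 F)
    have h3 : B ^ (1 + 1) * ‖z‖ ≤ B ^ 2 := mul_le_of_le_one_right (by positivity) hz1.le
    linarith
  · exact (key N hN).trans (by gcongr)

theorem HasAsy.asyFn {f : ℂ → ℂ} {F : PowerSeries ℂ} {S : Set ℂ} (h : HasAsy f F S) {θ η ρ : ℝ}
    (hη : 0 < η) (hρ : 0 < ρ) (hS : sector θ η ρ ⊆ S) : AsyFn (Circle.exp θ) f F := by
  have hsub : closedSector θ (η / 4) (ρ / 2) ⊆ S := by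
    refine Set.Subset.trans ?_ hS
    rintro z ⟨r, θ', h1, h2, h3, rfl⟩
    rw [abs_sub_comm] at h3
    exact ⟨r, θ', h1, by linarith, by linarith, rfl⟩
  obtain ⟨B, hB, hb⟩ := h.2.2 θ (η / 4) (ρ / 2) (by positivity) (by positivity) hsub
  refine AsyFn.of_bound hB ?_
  filter_upwards [sector_mem_dirNhds θ (Θ := η / 2) (ρ := ρ / 2) (by positivity) (by positivity)]
    with z hz N hN
  refine hb N hN z ?_
  obtain ⟨r, θ', h1, h2, h3, rfl⟩ := hz
  rw [abs_sub_comm] at h3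
  exact ⟨r, θ', h1, h2.le, by linarith, rfl⟩

theorem norm_sub_psum_lt {f : ℂ → ℂ} {F : PowerSeries ℂ} {B : ℝ} (hB : 0 < B) {z : ℂ}
    (hz0 : z ≠ 0) (h : ∀ N : ℕ, ‖f z - psum F N z‖ ≤ B ^ (N + 1) * (N.factorial : ℝ) * ‖z‖ ^ N)
    (N : ℕ) : (‖z‖⁻¹) ^ N * ‖f z - psum F N z‖ < (B + 1) ^ (N + 1) * (N.factorial : ℝ) := by
  have hz' : 0 < ‖z‖ := norm_pos_iff.2 hz0
  rw [inv_pow, inv_mul_lt_iff₀ (by positivity)]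
  refine (h N).trans_lt ?_
  have hf : (0 : ℝ) < N.factorial := by exact_mod_cast Nat.factorial_pos N
  have : B ^ (N + 1) < (B + 1) ^ (N + 1) := by gcongr; linarith
  rw [mul_comm (‖z‖ ^ N)]
  gcongr

theorem hasAsyAt_iff {w : Circle} {g : O w} {f : ℂ → ℂ} {F : PowerSeries ℂ}
    (hg : g.germ = (f : Germ (dirNhds w) ℂ)) : HasAsyAt w g F ↔ AsyFn w f F := by
  constructor
  · rintro ⟨d, Θ, ρ, hΘ, hρ, rfl, f', h, hf'⟩
    exact (h.asyFn hΘ hρ subset_rfl).congr (Germ.coe_eq.1 (hf'.symm.trans hg))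
  · intro h
    have hG := h.isGevrey
    obtain ⟨B, hB, h⟩ := h
    obtain ⟨d, rfl⟩ := exists_circle_exp w
    obtain ⟨δ, hδ, hs⟩ := eventually_dirNhds_iff_sector.1
      (h.and ((germ_eventually_diff hg).and (eventually_ne_dirNhds _)))
    refine ⟨d, δ, δ, hδ, hδ, rfl, f, ⟨hG, fun z hz => (hs z hz).2.1.differentiableWithinAt, ?_⟩, hg⟩
    intro d' Θ' ρ' _ _ hsub
    refine ⟨B + 1, by positivity, fun N _ z hz => ?_⟩
    exact norm_sub_psum_lt hB (hs z (hsub hz)).2.2 (hs z (hsub hz)).1 N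

theorem IsSummable.exists_asyFn {F : PowerSeries ℂ} {d : ℝ} (h : IsSummable F d) :
    ∃ (A : ℝ) (f : ℂ → ℂ), Real.pi / 2 < A ∧ ∀ θ, |θ - d| < A → AsyFn (Circle.exp θ) f F ∧
      ∀ᶠ z in dirNhds (Circle.exp θ), DifferentiableAt ℂ f z := by
  obtain ⟨Θ, ρ, hΘ, hρ, f, hf⟩ := h
  refine ⟨Θ / 2, f, by linarith, fun θ hθ => ?_⟩
  set η := Θ / 2 - |θ - d| with hη
  have hη0 : 0 < η := by linarith
  have hsub : sector θ (2 * η) ρ ⊆ sector d Θ ρ := by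
    rintro z ⟨r, θ', h1, h2, h3, rfl⟩
    refine ⟨r, θ', h1, h2, ?_, rfl⟩
    have := abs_sub_le d θ θ'
    rw [abs_sub_comm d θ] at this
    linarith
  refine ⟨hf.asyFn (by positivity) hρ hsub, ?_⟩
  filter_upwards [sector_mem_dirNhds θ (Θ := 2 * η) (by positivity) hρ] with z hz
  exact hf.2.1.differentiableAt ((isOpen_sector d Θ ρ).mem_nhds (hsub hz))

theorem isSummable_of_asyFn {F : PowerSeries ℂ} {d A : ℝ} {f : ℂ → ℂ} (hA : Real.pi / 2 < A)
    (hd : ∀ θ ∈ Set.Icc (d - A) (d + A), ∀ᶠ z in dirNhds (Circle.exp θ), DifferentiableAt ℂ f z)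
    (h : ∀ θ ∈ Set.Icc (d - A) (d + A), AsyFn (Circle.exp θ) f F) : IsSummable F d := by
  have hG : IsGevrey F := (h d ⟨by linarith [Real.pi_pos], by linarith [Real.pi_pos]⟩).isGevrey
  have h1 : ∃ B > 0, ∃ ρ > 0, ∀ r θ : ℝ, 0 < r → r < ρ → θ ∈ Set.Icc (d - A) (d + A) →
      ∀ N : ℕ, ‖f (polar (r, θ)) - psum F N (polar (r, θ))‖ ≤
        B ^ (N + 1) * (N.factorial : ℝ) * ‖polar (r, θ)‖ ^ N := by
    refine isCompact_Icc.induction_on (p := fun S : Set ℝ => ∃ B > 0, ∃ ρ > 0, ∀ r θ : ℝ, 0 < r →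
      r < ρ → θ ∈ S → ∀ N : ℕ, ‖f (polar (r, θ)) - psum F N (polar (r, θ))‖ ≤
        B ^ (N + 1) * (N.factorial : ℝ) * ‖polar (r, θ)‖ ^ N) ?_ ?_ ?_ ?_
    · exact ⟨1, one_pos, 1, one_pos, fun _ _ _ _ h => h.elim⟩
    · rintro s t hst ⟨B, hB, ρ, hρ, H⟩
      exact ⟨B, hB, ρ, hρ, fun r θ h1 h2 h3 => H r θ h1 h2 (hst h3)⟩
    · rintro s t ⟨B, hB, ρ, hρ, H⟩ ⟨B', hB', ρ', hρ', H'⟩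
      refine ⟨max B B', by positivity, min ρ ρ', by positivity, fun r θ h1 h2 h3 N => ?_⟩
      rcases h3 with h3 | h3
      · refine (H r θ h1 (h2.trans_le (min_le_left _ _)) h3 N).trans ?_
        gcongr
        exact le_max_left _ _
      · refine (H' r θ h1 (h2.trans_le (min_le_right _ _)) h3 N).trans ?_
        gcongr
        exact le_max_right _ _
    · intro θ hθ
      obtain ⟨B, hB, H⟩ := h θ hθ
      obtain ⟨δ, hδ, hs⟩ := eventually_dirNhds_iff_sector.1 H
      refine ⟨Metric.ball θ (δ / 2), mem_nhdsWithin_of_mem_nhds (Metric.ball_mem_nhds _ (by positivity)),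
        B, hB, δ, hδ, fun r θ' h1 h2 h3 N => hs _ ?_ N⟩
      rw [mem_sector_iff]
      exact ⟨r, θ', h1, h2, by simpa [Real.dist_eq] using h3, rfl⟩
  obtain ⟨B, hB, ρ, hρ, H⟩ := h1
  obtain ⟨ρ', hρ', H'⟩ := eventually_polar_of_isCompact isCompact_Icc hd
  have hz : ∀ z ∈ sector d (2 * A) (min ρ ρ'), ∃ r θ : ℝ, 0 < r ∧ r < ρ ∧ r < ρ' ∧
      θ ∈ Set.Icc (d - A) (d + A) ∧ z = polar (r, θ) := by
    intro z hz
    obtain ⟨r, θ, h1, h2, h3, rfl⟩ := mem_sector_iff.1 hz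
    obtain ⟨h4, h5⟩ := abs_lt.1 h3
    exact ⟨r, θ, h1, h2.trans_le (min_le_left _ _), h2.trans_le (min_le_right _ _),
      ⟨by linarith, by linarith⟩, rfl⟩
  refine ⟨2 * A, min ρ ρ', by linarith, by positivity, f, hG, ?_, ?_⟩
  · intro z hz'
    obtain ⟨r, θ, h1, h2, h3, h4, rfl⟩ := hz z hz'
    exact (H' r θ h1 h3 h4).differentiableWithinAt
  · intro d' Θ' ρ'' _ _ hsub
    refine ⟨B + 1, by positivity, fun N _ z hz' => ?_⟩
    obtain ⟨r, θ, h1, h2, h3, h4, rfl⟩ := hz z (hsub hz')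
    refine norm_sub_psum_lt hB ?_ (H r θ h1 h2 h4) N
    rw [← norm_pos_iff, norm_polar]
    exact abs_pos.2 h1.ne'

/-! ### Growth of exponentials -/

/-- The real part of `c` in the direction `w`. -/
def lev (w : Circle) (c : ℂ) : ℝ := (((w⁻¹ : Circle) : ℂ) * c).re

theorem ltAt_iff {w : Circle} {c c' : ℂ} : ltAt w c c' ↔ lev w c < lev w c' := by
  unfold ltAt lev
  rw [mul_sub, Complex.sub_re, sub_neg]

theorem ltAt_zero_iff {w : Circle} {c : ℂ} : ltAt w c 0 ↔ lev w c < 0 := by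
  rw [ltAt_iff, lev, lev, mul_zero, Complex.zero_re]

theorem lev_add (w : Circle) (c c' : ℂ) : lev w (c + c') = lev w c + lev w c' := by
  simp only [lev, mul_add, Complex.add_re]

theorem lev_sub (w : Circle) (c c' : ℂ) : lev w (c - c') = lev w c - lev w c' := by
  simp only [lev, mul_sub, Complex.sub_re]

theorem lev_neg (w : Circle) (c : ℂ) : lev w (-c) = -lev w c := by
  simp only [lev, mul_neg, Complex.neg_re]

theorem abs_lev_le (w : Circle) (c : ℂ) : |lev w c| ≤ ‖c‖ := by
  refine (Complex.abs_re_le_norm _).trans ?_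
  rw [norm_mul, Circle.norm_coe, one_mul]

theorem continuous_lev (c : ℂ) : Continuous fun w => lev w c := by unfold lev; fun_prop

theorem leAt.lev_le {w : Circle} {c c' : ℂ} (h : leAt w c c') : lev w c ≤ lev w c' := by
  rcases h with h | rfl
  · exact (ltAt_iff.1 h).le
  · exact le_rfl

theorem div_polar_re (c : ℂ) {r θ : ℝ} : (c / polar (r, θ)).re = lev (Circle.exp θ) c / r := by
  have : c / polar (r, θ) = (((Circle.exp θ)⁻¹ : Circle) : ℂ) * c / r := by
    rw [polar_eq, Circle.coe_inv]
    field_simp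
  rw [this, Complex.div_ofReal_re, lev]

theorem norm_exp_div_polar (c : ℂ) {r θ : ℝ} :
    ‖Complex.exp (c / polar (r, θ))‖ = Real.exp (lev (Circle.exp θ) c / r) := by
  rw [Complex.norm_exp, div_polar_re]

theorem eventually_norm_exp_le {w : Circle} {c : ℂ} {y : ℝ} (h : lev w c < y) :
    ∀ᶠ z in dirNhds w, ‖Complex.exp (c / z)‖ ≤ Real.exp (y / ‖z‖) := by
  obtain ⟨d, rfl⟩ := exists_circle_exp w
  rw [eventually_dirNhds_iff]
  have h1 : ∀ᶠ θ in 𝓝 d, lev (Circle.exp θ) c < y :=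
    (((continuous_lev c).comp Circle.exp.continuous).tendsto d).eventually (gt_mem_nhds h)
  have h2 : ∀ᶠ x : ℝ × ℝ in 𝓝[>] 0 ×ˢ 𝓝 d, 0 < x.1 := tendsto_fst.eventually (self_mem_nhdsWithin)
  filter_upwards [tendsto_snd.eventually h1, h2] with x hx hx0
  rw [← Prod.mk.eta (p := x), norm_exp_div_polar, norm_polar, abs_of_pos hx0]
  gcongr

theorem leAt_zero_of_eventually {w : Circle} {c : ℂ} (h : ∀ᶠ v in 𝓝 w, lev v c ≤ 0) :
    leAt w c 0 := by
  by_cases hlt : lev w c < 0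
  · exact Or.inl (ltAt_zero_iff.2 hlt)
  right
  have h0 : lev w c = 0 := le_antisymm h.self_of_nhds (not_lt.1 hlt)
  obtain ⟨d, rfl⟩ := exists_circle_exp w
  have hev : ∀ᶠ t in 𝓝 (0 : ℝ), lev (Circle.exp (d + t)) c ≤ 0 := by
    have : Tendsto (fun t : ℝ => Circle.exp (d + t)) (𝓝 0) (𝓝 (Circle.exp d)) := by
      have hc : Continuous fun t : ℝ => Circle.exp (d + t) := by fun_prop
      simpa using hc.tendsto 0
    exact this.eventually h
  obtain ⟨ε, hε, hball⟩ := Metric.eventually_nhds_iff.1 hev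
  set t : ℝ := min (ε / 2) 1 with ht
  have ht0 : 0 < t := by positivity
  have ht1 : t ≤ 1 := min_le_right _ _
  have htε : t < ε := lt_of_le_of_lt (min_le_left _ _) (by linarith)
  have hs : 0 < Real.sin t := Real.sin_pos_of_pos_of_lt_pi ht0 (by linarith [Real.pi_gt_three])
  set u : ℂ := (((Circle.exp d)⁻¹ : Circle) : ℂ) * c with hu
  have hure : u.re = 0 := h0
  have e1 : ∀ r : ℝ, lev (Circle.exp (d + r)) c = Real.sin r * u.im := by
    intro r
    have e2 : (((Circle.exp (d + r))⁻¹ : Circle) : ℂ) * c = Complex.exp (((-r : ℝ) : ℂ) * Complex.I) * u := by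
      rw [Circle.exp_add, mul_inv, Circle.coe_mul, hu, ← Circle.exp_neg r, Circle.coe_exp]
      push_cast
      ring
    rw [lev, e2, Complex.mul_re, Complex.exp_ofReal_mul_I_re, Complex.exp_ofReal_mul_I_im, hure]
    simp
  have hp := hball (y := t) (by simp [abs_of_pos ht0, htε])
  have hm := hball (y := -t) (by simp [abs_of_pos ht0, htε])
  rw [e1] at hp hm
  rw [Real.sin_neg] at hm
  have him : u.im = 0 := by nlinarith
  have hu0 : u = 0 := Complex.ext hure him
  rcases mul_eq_zero.1 (hu.symm.trans hu0) with h | h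
  · exact absurd h (Circle.coe_ne_zero _)
  · exact h

theorem tendsto_pow_mul_exp_neg {κ : ℝ} (hκ : 0 < κ) (N : ℕ) (w : Circle) :
    Tendsto (fun z : ℂ => (‖z‖⁻¹) ^ N * Real.exp (-κ / ‖z‖)) (dirNhds w) (𝓝 0) := by
  have h1 : Tendsto (fun z : ℂ => ‖z‖⁻¹) (dirNhds w) atTop :=
    tendsto_inv_nhdsGT_zero.comp (tendsto_norm_dirNhds w)
  have h2 := (Real.tendsto_pow_mul_exp_neg_atTop_nhds_zero N).comp (h1.const_mul_atTop hκ)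
  have h3 := h2.const_mul ((κ ^ N)⁻¹)
  rw [mul_zero] at h3
  refine h3.congr fun z => ?_
  simp only [Function.comp_apply, mul_pow]
  rw [mul_assoc, ← mul_assoc, inv_mul_cancel₀ (by positivity), one_mul, neg_div, div_eq_mul_inv]

theorem SmallFn.congr {w : Circle} {f g : ℂ → ℂ} (h : SmallFn w f)
    (hfg : ∀ᶠ z in dirNhds w, f z = g z) : SmallFn w g := by
  obtain ⟨C, hC, κ, hκ, h⟩ := h
  refine ⟨C, hC, κ, hκ, ?_⟩
  filter_upwards [h, hfg] with z h1 h2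
  rwa [← h2]

theorem smallFn_of_bound {w : Circle} {f : ℂ → ℂ} {κ B : ℝ} (hκ : 0 < κ) (hB : 0 < B) (N : ℕ)
    (h : ∀ᶠ z in dirNhds w, ‖f z‖ ≤ B * (‖z‖⁻¹) ^ N * Real.exp (-κ / ‖z‖)) : SmallFn w f := by
  refine ⟨B, hB, κ / 2, by positivity, ?_⟩
  have h1 := (tendsto_pow_mul_exp_neg (half_pos hκ) N w).eventually (gt_mem_nhds one_pos)
  filter_upwards [h, h1] with z h2 h3
  refine h2.trans ?_
  have : Real.exp (-κ / ‖z‖) = Real.exp (-(κ / 2) / ‖z‖) * Real.exp (-(κ / 2) / ‖z‖) := by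
    rw [← Real.exp_add]; congr 1; ring
  rw [this]
  calc _ = B * Real.exp (-(κ / 2) / ‖z‖) * ((‖z‖⁻¹) ^ N * Real.exp (-(κ / 2) / ‖z‖)) := by ring
    _ ≤ B * Real.exp (-(κ / 2) / ‖z‖) * 1 := by gcongr
    _ = _ := mul_one _

/-- Exponentially small germs. -/
def Small (w : Circle) : Set (O w) :=
  {g | ∃ f : ℂ → ℂ, g.germ = (f : Germ (dirNhds w) ℂ) ∧ SmallFn w f}

theorem mem_Small_iff {w : Circle} {g : O w} {f : ℂ → ℂ} (h : g.germ = (f : Germ (dirNhds w) ℂ)) :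
    g ∈ Small w ↔ SmallFn w f :=
  ⟨fun ⟨_, hf', hs⟩ => hs.congr (Germ.coe_eq.1 (hf'.symm.trans h)), fun hs => ⟨f, h, hs⟩⟩

theorem mem_Amod0_iff {w : Circle} {g : O w} {f : ℂ → ℂ} (h : g.germ = (f : Germ (dirNhds w) ℂ)) :
    g ∈ Amod0 w ↔ ∃ B > 0, ∃ N : ℕ, ∀ᶠ z in dirNhds w, ‖f z‖ ≤ B * (‖z‖⁻¹) ^ N := by
  constructor
  · rintro ⟨f', hf', B, hB, N, hN⟩
    refine ⟨B, hB, N, ?_⟩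
    filter_upwards [hN, Germ.coe_eq.1 (hf'.symm.trans h)] with z h1 h2
    rwa [← h2]
  · rintro ⟨B, hB, N, hN⟩
    exact ⟨f, h, B, hB, N, hN⟩

theorem mem_Amod_iff {w : Circle} {c : ℂ} {g : O w} : g ∈ Amod c w ↔ expO (-c) w * g ∈ Amod0 w := by
  constructor
  · rintro ⟨h, hh, rfl⟩
    rwa [← mul_assoc, ← expO_add, neg_add_cancel, expO_zero, one_mul]
  · intro h
    exact ⟨_, h, by rw [← mul_assoc, ← expO_add, add_neg_cancel, expO_zero, one_mul]⟩

theorem Amod_zero (w : Circle) : Amod 0 w = Amod0 w := by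
  ext g
  rw [mem_Amod_iff, neg_zero, expO_zero, one_mul]

theorem Amod0_add {w : Circle} {g h : O w} (hg : g ∈ Amod0 w) (hh : h ∈ Amod0 w) :
    g + h ∈ Amod0 w := by
  obtain ⟨f, hf, B, hB, N, hN⟩ := hg
  obtain ⟨k, hk, B', hB', N', hN'⟩ := hh
  refine ⟨f + k, by rw [map_add, hf, hk]; rfl, B + B', by positivity, N + N', ?_⟩
  filter_upwards [hN, hN', eventually_norm_lt w one_pos, eventually_ne_dirNhds w] with z h1 h2 h3 h4
  have h5 : 1 ≤ ‖z‖⁻¹ := (one_le_inv₀ (norm_pos_iff.2 h4)).2 h3.le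
  refine (norm_add_le _ _).trans ((add_le_add h1 h2).trans ?_)
  rw [add_mul]
  gcongr
  · omega
  · omega

theorem Amod_add {w : Circle} {c : ℂ} {g h : O w} (hg : g ∈ Amod c w) (hh : h ∈ Amod c w) :
    g + h ∈ Amod c w := by
  rw [mem_Amod_iff] at *
  rw [mul_add]
  exact Amod0_add hg hh

theorem const_mem_Amod0 (w : Circle) (b : ℂ) : (Hol.const b : O w) ∈ Amod0 w :=
  ⟨fun _ => b, rfl, ‖b‖ + 1, by positivity, 0, Eventually.of_forall fun z => by simp⟩

theorem Amod0_mul {w : Circle} {g h : O w} (hg : g ∈ Amod0 w) (hh : h ∈ Amod0 w) :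
    g * h ∈ Amod0 w := by
  rw [← Amod_zero] at *
  simpa using Amod_mul hg hh

/-- Germs of moderate growth as a subring. -/
def modR (w : Circle) : Subring (O w) where
  carrier := Amod0 w
  mul_mem' := Amod0_mul
  add_mem' := Amod0_add
  one_mem' := by have := const_mem_Amod0 w 1; rwa [map_one] at this
  zero_mem' := by have := const_mem_Amod0 w 0; rwa [map_zero] at this
  neg_mem' {x} hx := by
    have := Amod0_mul (const_mem_Amod0 w (-1)) hx
    rwa [map_neg, map_one, neg_one_mul] at this

theorem Amod_mono {w : Circle} {c c' : ℂ} (h : leAt w c c') : Amod c w ⊆ Amod c' w := by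
  rcases h with h | rfl
  · rintro _ ⟨g, hg, rfl⟩
    rw [mem_Amod_iff, ← mul_assoc, ← expO_add]
    refine Amod0_mul ⟨_, rfl, 1, one_pos, 0, ?_⟩ hg
    have h1 : lev w (-c' + c) < 0 := by
      rw [lev_add, lev_neg]; linarith [ltAt_iff.1 h]
    filter_upwards [eventually_norm_exp_le h1] with z hz
    simpa using hz
  · exact subset_rfl

theorem Amod_subset_Small {w : Circle} {c : ℂ} (h : ltAt w c 0) : Amod c w ⊆ Small w := by
  rintro _ ⟨g, ⟨f, hf, B, hB, N, hN⟩, rfl⟩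
  have h1 : lev w c < lev w c / 2 := by linarith [ltAt_zero_iff.1 h]
  refine ⟨fun z => Complex.exp (c / z) * f z, by rw [map_mul, hf]; rfl, ?_⟩
  refine smallFn_of_bound (κ := -(lev w c / 2)) (by linarith [ltAt_zero_iff.1 h]) hB N ?_
  filter_upwards [hN, eventually_norm_exp_le h1] with z h2 h3
  rw [norm_mul, mul_comm, neg_neg]
  gcongr

theorem Small_subset_Amod0 {w : Circle} : Small w ⊆ Amod0 w := by
  rintro g ⟨f, hf, C, hC, κ, hκ, h⟩
  refine ⟨f, hf, C, hC, 0, ?_⟩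
  filter_upwards [h] with z hz
  refine hz.trans ?_
  rw [pow_zero]
  gcongr
  rw [Real.exp_le_one_iff, neg_div, neg_nonpos]
  positivity

theorem mul_mem_Small {w : Circle} {g h : O w} (hg : g ∈ Amod0 w) (hh : h ∈ Small w) :
    g * h ∈ Small w := by
  obtain ⟨f, hf, B, hB, N, hN⟩ := hg
  obtain ⟨k, hk, C, hC, κ, hκ, h⟩ := hh
  refine ⟨fun z => f z * k z, by rw [map_mul, hf, hk]; rfl, ?_⟩
  refine smallFn_of_bound hκ (mul_pos hB hC) N ?_
  filter_upwards [hN, h] with z h1 h2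
  rw [norm_mul]
  calc _ ≤ (B * ‖z‖⁻¹ ^ N) * (C * Real.exp (-κ / ‖z‖)) := by gcongr
    _ = _ := by ring

theorem Small_add {w : Circle} {g h : O w} (hg : g ∈ Small w) (hh : h ∈ Small w) :
    g + h ∈ Small w := by
  obtain ⟨f, hf, C, hC, κ, hκ, h1⟩ := hg
  obtain ⟨k, hk, C', hC', κ', hκ', h2⟩ := hh
  refine ⟨fun z => f z + k z, by rw [map_add, hf, hk]; rfl, C + C', by positivity, min κ κ',
    by positivity, ?_⟩
  filter_upwards [h1, h2] with z h1 h2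
  refine (norm_add_le _ _).trans ((add_le_add h1 h2).trans ?_)
  rw [add_mul]
  gcongr
  · exact min_le_left _ _
  · exact min_le_right _ _

theorem zero_mem_Small {w : Circle} : (0 : O w) ∈ Small w :=
  ⟨fun _ => 0, rfl, 1, one_pos, 1, one_pos, Eventually.of_forall fun z => by simp; positivity⟩

theorem sum_mem_Small {w : Circle} {ι : Type*} (S : Finset ι) {g : ι → O w}
    (hg : ∀ i ∈ S, g i ∈ Small w) : ∑ i ∈ S, g i ∈ Small w := by
  classical
  induction S using Finset.induction_on with
  | empty => simpa using zero_mem_Small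
  | insert i S hi ih =>
    rw [Finset.sum_insert hi]
    exact Small_add (hg i (Finset.mem_insert_self _ _))
      (ih fun j hj => hg j (Finset.mem_insert_of_mem hj))

theorem zero_le_of_const_mem_Amod {w : Circle} {b e : ℂ} (hb : b ≠ 0)
    (h : (Hol.const b : O w) ∈ Amod e w) : leAt w 0 e := by
  have key : ∀ v : Circle, (Hol.const b : O v) ∈ Amod e v → lev v (-e) ≤ 0 := by
    intro v hv
    by_contra hcon
    push Not at hcon
    rw [lev_neg] at hcon
    obtain ⟨f, hf, C, hC, κ, hκ, h1⟩ := Amod_subset_Small (ltAt_zero_iff.2 (by linarith)) hv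
    have h2 := (tendsto_pow_mul_exp_neg hκ 0 v).const_mul C
    rw [mul_zero] at h2
    have h3 : ∀ᶠ z in dirNhds v, ‖b‖ ≤ C * ((‖z‖⁻¹) ^ 0 * Real.exp (-κ / ‖z‖)) := by
      have hf' : ((fun _ => b : ℂ → ℂ) : Germ (dirNhds v) ℂ) = f := hf
      filter_upwards [h1, Germ.coe_eq.1 hf'] with z hz hz'
      rwa [pow_zero, one_mul, hz']
    have h4 := ge_of_tendsto h2 h3
    exact hb (norm_le_zero_iff.1 h4)
  have h1 : ∀ᶠ v in 𝓝 w, lev v (-e) ≤ 0 := by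
    filter_upwards [(isSec_const b).mem_Amod h] with v hv using key v hv
  have h2 := (leAt_zero_of_eventually h1).add_right e
  simpa using h2

end PeriodRH

namespace PeriodRH

open MeasureTheory in
/-- The Laplace transform of a generalized Dirichlet series detects its leading coefficients. -/
theorem tendsto_laplace_coeff {T : Type*} [Countable T] (a p : T → ℂ) (t₀ : ℝ) (τ₀ : T)
    (hsum : Summable fun τ => ‖a τ‖ * Real.exp (-(p τ).re * t₀))
    (hre : ∀ τ, a τ ≠ 0 → (p τ₀).re ≤ (p τ).re) (hne : ∀ τ, a τ ≠ 0 → τ ≠ τ₀ → p τ ≠ p τ₀) :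
    Tendsto (fun σ : ℝ => σ * ∫ t in Set.Ioi t₀, Complex.exp ((p τ₀ - σ) * t) *
      ∑' τ, a τ * Complex.exp (-p τ * t)) (𝓝[>] 0) (𝓝 (a τ₀)) := by
  classical
  set I : ℝ → T → ℂ := fun σ τ =>
    a τ * (-Complex.exp ((p τ₀ - σ - p τ) * t₀) / (p τ₀ - σ - p τ)) with hI
  have hneg : ∀ σ : ℝ, 0 < σ → ∀ τ, a τ ≠ 0 → (p τ₀ - σ - p τ).re < 0 := by
    intro σ hσ τ hτ
    have := hre τ hτ
    simp only [Complex.sub_re, Complex.ofReal_re]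
    linarith
  have hnorm_exp : ∀ (σ : ℝ) τ (t : ℝ), ‖Complex.exp ((p τ₀ - σ - p τ) * t)‖ =
      Real.exp ((p τ₀ - σ - p τ).re * t) := by
    intro σ τ t
    rw [Complex.norm_exp, Complex.re_mul_ofReal]
  have key : ∀ σ : ℝ, 0 < σ → HasSum (I σ) (∫ t in Set.Ioi t₀, Complex.exp ((p τ₀ - σ) * t) *
      ∑' τ, a τ * Complex.exp (-p τ * t)) := by
    intro σ hσ
    have hint : ∀ τ, Integrable (fun t : ℝ => a τ * Complex.exp ((p τ₀ - σ - p τ) * t))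
        (volume.restrict (Set.Ioi t₀)) := by
      intro τ
      by_cases hτ : a τ = 0
      · simp [hτ]
      · exact (integrableOn_exp_mul_complex_Ioi (hneg σ hσ τ hτ) t₀).const_mul _
    have hnorm : ∀ τ, ∫ t in Set.Ioi t₀, ‖a τ * Complex.exp ((p τ₀ - σ - p τ) * t)‖ ≤
        ‖a τ‖ * Real.exp (-(p τ).re * t₀) * (Real.exp (((p τ₀).re - σ) * t₀) / σ) := by
      intro τ
      by_cases hτ : a τ = 0
      · simp [hτ]
      · have hn := hneg σ hσ τ hτ
        simp only [norm_mul, hnorm_exp]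
        rw [integral_const_mul, integral_exp_mul_Ioi hn, mul_assoc]
        gcongr
        have e : Real.exp ((p τ₀ - σ - p τ).re * t₀) =
            Real.exp (-(p τ).re * t₀) * Real.exp (((p τ₀).re - σ) * t₀) := by
          rw [← Real.exp_add]; congr 1; simp; ring
        rw [neg_div, ← div_neg, e, mul_div_assoc]
        gcongr
        have := hre τ hτ
        simp only [Complex.sub_re, Complex.ofReal_re]
        linarith
    have h1 := hasSum_integral_of_summable_integral_norm hint
      ((hsum.mul_right _).of_nonneg_of_le (fun τ => by positivity) hnorm)
    have e1 : (fun τ => ∫ t in Set.Ioi t₀, a τ * Complex.exp ((p τ₀ - σ - p τ) * t)) = I σ := by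
      funext τ
      rw [integral_const_mul, hI]
      by_cases hτ : a τ = 0
      · simp [hτ]
      · rw [integral_exp_mul_complex_Ioi (hneg σ hσ τ hτ)]
    rw [e1] at h1
    have e2 : ∀ t : ℝ, Complex.exp ((p τ₀ - σ) * t) * ∑' τ, a τ * Complex.exp (-p τ * t) =
        ∑' τ, a τ * Complex.exp ((p τ₀ - σ - p τ) * t) := by
      intro t
      rw [← tsum_mul_left]
      refine tsum_congr fun τ => ?_
      rw [sub_mul _ (p τ), sub_eq_add_neg _ (p τ * t), Complex.exp_add, neg_mul]
      ring
    simpa only [e2] using h1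
  have hbound : ∀ᶠ σ : ℝ in 𝓝[>] 0, ∀ τ, ‖(σ : ℂ) * I σ τ‖ ≤
      ‖a τ‖ * Real.exp (-(p τ).re * t₀) * Real.exp ((p τ₀).re * t₀ + |t₀|) := by
    have h1 : ∀ᶠ σ : ℝ in 𝓝[>] 0, σ < 1 := mem_nhdsWithin_of_mem_nhds (gt_mem_nhds one_pos)
    filter_upwards [self_mem_nhdsWithin, h1] with σ hσ hσ1 τ
    have hσ0 : 0 < σ := hσ
    by_cases hτ : a τ = 0
    · simp [hI, hτ]
    have hn := hneg σ hσ0 τ hτ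
    have h2 : σ ≤ ‖p τ₀ - σ - p τ‖ := by
      have h3 := Complex.abs_re_le_norm (p τ₀ - σ - p τ)
      rw [abs_of_neg hn] at h3
      have := hre τ hτ
      simp only [Complex.sub_re, Complex.ofReal_re] at h3
      linarith
    simp only [hI]
    rw [norm_mul, norm_mul, norm_div, norm_neg, hnorm_exp, Complex.norm_real, Real.norm_eq_abs,
      abs_of_pos hσ0]
    have e : Real.exp ((p τ₀ - σ - p τ).re * t₀) ≤
        Real.exp (-(p τ).re * t₀) * Real.exp ((p τ₀).re * t₀ + |t₀|) := by
      rw [← Real.exp_add, Real.exp_le_exp]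
      simp only [Complex.sub_re, Complex.ofReal_re]
      have : -(σ * t₀) ≤ |t₀| := by
        have := neg_abs_le (σ * t₀)
        rw [abs_mul, abs_of_pos hσ0] at this
        nlinarith [abs_nonneg t₀, neg_le_abs (σ * t₀), abs_mul σ t₀, abs_of_pos hσ0]
      linarith
    calc σ * (‖a τ‖ * (Real.exp ((p τ₀ - σ - p τ).re * t₀) / ‖p τ₀ - σ - p τ‖))
        = ‖a τ‖ * Real.exp ((p τ₀ - σ - p τ).re * t₀) * (σ / ‖p τ₀ - σ - p τ‖) := by ring
      _ ≤ ‖a τ‖ * (Real.exp (-(p τ).re * t₀) * Real.exp ((p τ₀).re * t₀ + |t₀|)) * 1 := by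
          gcongr
          exact div_le_one_of_le₀ h2 (norm_nonneg _)
      _ = _ := by ring
  have hlim : ∀ τ, Tendsto (fun σ : ℝ => (σ : ℂ) * I σ τ) (𝓝[>] 0)
      (𝓝 (if τ = τ₀ then a τ else 0)) := by
    intro τ
    have hσ0 : Tendsto (fun σ : ℝ => (σ : ℂ)) (𝓝[>] 0) (𝓝 0) :=
      (Complex.continuous_ofReal.tendsto' 0 0 rfl).mono_left nhdsWithin_le_nhds
    split_ifs with h
    · subst h
      have h1 : Tendsto (fun σ : ℝ => a τ * Complex.exp (-σ * t₀)) (𝓝[>] 0) (𝓝 (a τ)) := by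
        have hc : Continuous fun σ : ℝ => a τ * Complex.exp (-σ * t₀) := by fun_prop
        have := (hc.tendsto 0).mono_left (nhdsWithin_le_nhds (s := Set.Ioi 0))
        simpa using this
      refine h1.congr' ?_
      filter_upwards [self_mem_nhdsWithin] with σ hσ
      have : (σ : ℂ) ≠ 0 := by exact_mod_cast (ne_of_gt hσ)
      simp only [hI]
      rw [show p τ - σ - p τ = -(σ : ℂ) by ring]
      field_simp
    · by_cases hτ : a τ = 0
      · simp [hI, hτ]
      · have hd : p τ₀ - (0 : ℂ) - p τ ≠ 0 := by
          rw [sub_zero]; exact sub_ne_zero.2 (hne τ hτ h).symm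
        have h2 : Tendsto (fun σ : ℝ => p τ₀ - (σ : ℂ) - p τ) (𝓝[>] 0) (𝓝 (p τ₀ - 0 - p τ)) :=
          (tendsto_const_nhds.sub hσ0).sub tendsto_const_nhds
        have h3 := hσ0.mul (tendsto_const_nhds (x := a τ) |>.mul
          (((h2.mul_const (t₀ : ℂ)).cexp.neg).div h2 hd))
        rw [zero_mul] at h3
        exact h3
  have hfin := tendsto_tsum_of_dominated_convergence (hsum.mul_right _) hlim hbound
  rw [tsum_ite_eq] at hfin
  refine hfin.congr' ?_
  filter_upwards [self_mem_nhdsWithin] with σ hσ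
  rw [tsum_mul_left, (key σ hσ).tsum_eq]

open MeasureTheory in
/-- If the Dirichlet series decays faster than its leading exponential, the coefficient vanishes. -/
theorem laplace_coeff_eq_zero {T : Type*} [Countable T] (a p : T → ℂ) (t₀ : ℝ) (τ₀ : T)
    (hsum : Summable fun τ => ‖a τ‖ * Real.exp (-(p τ).re * t₀))
    (hre : ∀ τ, a τ ≠ 0 → (p τ₀).re ≤ (p τ).re) (hne : ∀ τ, a τ ≠ 0 → τ ≠ τ₀ → p τ ≠ p τ₀)
    {C κ : ℝ} (hκ : 0 < κ) (hb : ∀ t, t₀ < t → ‖∑' τ, a τ * Complex.exp (-p τ * t)‖ ≤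
      C * Real.exp (-((p τ₀).re + κ) * t)) : a τ₀ = 0 := by
  have h1 := tendsto_laplace_coeff a p t₀ τ₀ hsum hre hne
  refine tendsto_nhds_unique h1 ?_
  rw [tendsto_zero_iff_norm_tendsto_zero]
  have hC : ∀ σ : ℝ, 0 < σ → ‖∫ t in Set.Ioi t₀, Complex.exp ((p τ₀ - σ) * t) *
      ∑' τ, a τ * Complex.exp (-p τ * t)‖ ≤ ∫ t in Set.Ioi t₀, C * Real.exp (-κ * t) * Real.exp (σ * |t₀|) := by
    intro σ hσ
    refine norm_integral_le_of_norm_le (((integrableOn_exp_mul_Ioi (neg_lt_zero.2 hκ) t₀).const_mul _).mul_const _) ?_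
    filter_upwards [ae_restrict_mem measurableSet_Ioi] with t ht
    rw [norm_mul, Complex.norm_exp, Complex.re_mul_ofReal]
    refine (mul_le_mul_of_nonneg_left (hb t ht) (Real.exp_pos _).le).trans ?_
    have hCn : 0 ≤ C := by
      have := (norm_nonneg _).trans (hb t ht)
      exact nonneg_of_mul_nonneg_left this (Real.exp_pos _)
    rw [mul_left_comm, mul_assoc, ← Real.exp_add, ← Real.exp_add]
    have hre' : (p τ₀ - σ).re = (p τ₀).re - σ := by simp
    rw [hre']
    refine mul_le_mul_of_nonneg_left (Real.exp_le_exp.2 ?_) hCn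
    have h2 : -|t₀| ≤ t := (neg_abs_le t₀).trans (le_of_lt ht)
    nlinarith
  have h3 : Tendsto (fun σ : ℝ => σ * ∫ t in Set.Ioi t₀, C * Real.exp (-κ * t) * Real.exp (σ * |t₀|))
      (𝓝[>] 0) (𝓝 0) := by
    have h4 : Tendsto (fun σ : ℝ => σ * ((∫ t in Set.Ioi t₀, C * Real.exp (-κ * t)) * Real.exp (σ * |t₀|)))
        (𝓝[>] 0) (𝓝 0) := by
      have hc : Continuous fun σ : ℝ =>
        σ * ((∫ t in Set.Ioi t₀, C * Real.exp (-κ * t)) * Real.exp (σ * |t₀|)) := by fun_prop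
      have := (hc.tendsto 0).mono_left (nhdsWithin_le_nhds (s := Set.Ioi 0))
      simpa using this
    refine h4.congr fun σ => ?_
    rw [integral_mul_const]
  refine squeeze_zero' (Eventually.of_forall fun _ => norm_nonneg _) ?_ h3
  filter_upwards [self_mem_nhdsWithin] with σ hσ
  have hσ0 : 0 < σ := hσ
  rw [norm_mul, Complex.norm_real, Real.norm_eq_abs, abs_of_pos hσ0]
  exact mul_le_mul_of_nonneg_left (hC σ hσ0) hσ0.le

/-! ### Discreteness of the periods -/

variable {L : Type*} [AddCommGroup L] [Module.Free ℤ L] [Module.Finite ℤ L]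

instance countable_lattice : Countable L :=
  (Module.finBasis ℤ L).equivFun.toEquiv.injective.countable

theorem PeriodDatum.finite_len_le (P : PeriodDatum L) (r : ℝ) : {γ : L | P.len γ ≤ r}.Finite := by
  let _ : Norm (ℝ ⊗[ℤ] L) := ⟨fun x => P.norm x⟩
  have core : NormedSpace.Core ℝ (ℝ ⊗[ℤ] L) :=
    { norm_nonneg := fun x => apply_nonneg P.norm x
      norm_smul := fun c x => map_smul_eq_mul P.norm c x
      norm_triangle := fun x y => map_add_le_add P.norm x y
      norm_eq_zero_iff := fun x => ⟨P.norm_definite x, fun h => by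
        change P.norm x = 0
        rw [h, map_zero]⟩ }
  let _ : NormedAddCommGroup (ℝ ⊗[ℤ] L) := NormedAddCommGroup.ofCore core
  let _ : NormedSpace ℝ (ℝ ⊗[ℤ] L) := NormedSpace.ofCore core
  let b := Module.finBasis ℤ L
  have hcoord : ∀ i, ∃ M : ℝ, ∀ γ : L, |((b.repr γ i : ℤ) : ℝ)| ≤ M * P.len γ := by
    intro i
    let φ : (ℝ ⊗[ℤ] L) →ₗ[ℝ] ℝ :=
      LinearMap.liftBaseChange ℝ ((Int.castAddHom ℝ).toIntLinearMap ∘ₗ b.coord i)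
    let ψ : (ℝ ⊗[ℤ] L) →L[ℝ] ℝ := LinearMap.toContinuousLinearMap φ
    refine ⟨‖ψ‖, fun γ => ?_⟩
    have h := ψ.le_opNorm (1 ⊗ₜ[ℤ] γ)
    have h1 : ψ (1 ⊗ₜ[ℤ] γ) = ((b.repr γ i : ℤ) : ℝ) := by
      change φ (1 ⊗ₜ[ℤ] γ) = _
      simp [φ]
    rw [h1] at h
    exact h
  choose M hM using hcoord
  have hfin : (Set.pi Set.univ fun i => {n : ℤ | |(n : ℝ)| ≤ |M i| * |r|}).Finite := by
    refine Set.Finite.pi fun i => ?_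
    refine (Set.finite_Icc (-⌈|M i| * |r|⌉) ⌈|M i| * |r|⌉).subset fun n hn => ?_
    have hn' : |(n : ℝ)| ≤ |M i| * |r| := hn
    obtain ⟨h1, h2⟩ := abs_le.1 hn'
    have h3 := Int.le_ceil (|M i| * |r|)
    constructor
    · have : ((-⌈|M i| * |r|⌉ : ℤ) : ℝ) ≤ n := by push_cast; linarith
      exact_mod_cast this
    · have : (n : ℝ) ≤ ((⌈|M i| * |r|⌉ : ℤ) : ℝ) := by linarith
      exact_mod_cast this
  refine Set.Finite.of_finite_image (f := fun γ => fun i => b.repr γ i) (hfin.subset ?_) ?_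
  · rintro _ ⟨γ, hγ, rfl⟩
    intro i _
    have hγ' : P.len γ ≤ r := hγ
    refine (hM i γ).trans ?_
    calc M i * P.len γ ≤ |M i| * P.len γ := by
          gcongr
          · exact P.len_nonneg γ
          · exact le_abs_self _
      _ ≤ |M i| * |r| := by gcongr; exact hγ'.trans (le_abs_self _)
  · intro γ _ γ' _ h
    exact b.repr.injective (Finsupp.ext fun i => congrFun h i)

theorem PeriodDatum.finite_norm_le (P : PeriodDatum L) (r : ℝ) : {γ : L | ‖P.μ γ‖ ≤ r}.Finite := by
  obtain ⟨R, hR, h⟩ := P.support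
  refine (P.finite_len_le (r / R)).subset fun γ hγ => ?_
  rw [Set.mem_ofPred, le_div_iff₀ hR, mul_comm]
  exact (h γ).trans hγ

theorem PeriodDatum.μ_injective (P : PeriodDatum L) : Function.Injective P.μ := by
  rw [injective_iff_map_eq_zero]
  intro γ hγ
  obtain ⟨R, hR, h⟩ := P.support
  by_contra hne
  have h1 : P.len γ = 0 := by
    have := h γ
    rw [hγ, norm_zero] at this
    have h2 := P.len_nonneg γ
    change R * P.len γ ≤ 0 at this
    nlinarith
  have hmul : ∀ n : ℕ, P.len (n • γ) = 0 := by
    intro n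
    have h2 := h (n • γ)
    rw [map_nsmul, hγ, smul_zero, norm_zero] at h2
    have h3 := P.len_nonneg (n • γ)
    change R * P.len (n • γ) ≤ 0 at h2
    nlinarith
  refine Set.infinite_of_injective_forall_mem (f := fun n : ℕ => n • γ) ?_ (fun n => ?_)
    (P.finite_len_le 0)
  · intro m n hmn
    have hmn' : (m : ℤ) • γ = (n : ℤ) • γ := by simpa using hmn
    have := smul_left_injective ℤ hne hmn'
    exact_mod_cast this
  · exact (hmul n).le

end PeriodRH

namespace PeriodRH

variable {L : Type*} [AddCommGroup L] [Module.Free ℤ L] [Module.Finite ℤ L] (P : PeriodDatum L)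

/-! ### Coefficients of germs of `𝒜_μ` -/

/-- Coefficients of a series `∑ a_γ exp (μ(γ) / z)` that converges near the direction `w`. -/
def CoeffAt (w : Circle) (a : L → ℂ) : Prop :=
  (∃ s > 0, ∃ Y : ℝ, ∀ γ, a γ ≠ 0 → s * ‖P.μ γ‖ ≤ Y - lev w (P.μ γ)) ∧
    ∃ ϱ : ℝ, 0 < ϱ ∧ Summable fun γ => ‖a γ‖ * ϱ ^ P.len γ

/-- The sum of the series with coefficients `a`. -/
def serFn (a : L → ℂ) (z : ℂ) : ℂ := ∑' γ, a γ * Complex.exp (P.μ γ / z)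

/-- The germ of the series with coefficients `a`. -/
def serO (a : L → ℂ) (w : Circle) : O w := toO (serFn P a) w

variable {P}

theorem PeriodDatum.len_add_le (γ γ' : L) : P.len (γ + γ') ≤ P.len γ + P.len γ' := by
  unfold PeriodDatum.len
  rw [TensorProduct.tmul_add]
  exact map_add_le_add _ _ _

theorem PeriodDatum.len_neg (γ : L) : P.len (-γ) = P.len γ := by
  unfold PeriodDatum.len
  rw [TensorProduct.tmul_neg, map_neg_eq_map]

theorem lev_sub_lev_le (v w : Circle) (c : ℂ) :
    |lev v c - lev w c| ≤ ‖((v⁻¹ : Circle) : ℂ) - ((w⁻¹ : Circle) : ℂ)‖ * ‖c‖ := by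
  have : lev v c - lev w c = ((((v⁻¹ : Circle) : ℂ) - ((w⁻¹ : Circle) : ℂ)) * c).re := by
    rw [lev, lev, sub_mul, Complex.sub_re]
  rw [this, ← norm_mul]
  exact Complex.abs_re_le_norm _

theorem eventually_inv_sub_lt (w : Circle) {s : ℝ} (hs : 0 < s) :
    ∀ᶠ v in 𝓝 w, ‖((v⁻¹ : Circle) : ℂ) - ((w⁻¹ : Circle) : ℂ)‖ < s := by
  have hc : Continuous fun v : Circle => ‖((v⁻¹ : Circle) : ℂ) - ((w⁻¹ : Circle) : ℂ)‖ := by fun_prop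
  have := hc.tendsto w
  simp only [sub_self, norm_zero] at this
  exact this.eventually (gt_mem_nhds hs)

theorem cone_nearby {w : Circle} {S : Set L} {s y : ℝ} (hs : 0 < s)
    (hc : ∀ γ ∈ S, s * ‖P.μ γ‖ ≤ y - lev w (P.μ γ)) :
    ∀ᶠ v in 𝓝 w, ∀ γ ∈ S, s / 2 * ‖P.μ γ‖ ≤ y - lev v (P.μ γ) := by
  filter_upwards [eventually_inv_sub_lt w (half_pos hs)] with v hv γ hγ
  have h1 := hc γ hγ
  have h2 := (abs_le.1 (lev_sub_lev_le v w (P.μ γ))).2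
  have h3 := mul_le_mul_of_nonneg_right hv.le (norm_nonneg (P.μ γ))
  linarith

theorem exp_bound {w : Circle} {S : Set L} {s y ϱ : ℝ} (hs : 0 < s) (hϱ : 0 < ϱ)
    (hc : ∀ γ ∈ S, s * ‖P.μ γ‖ ≤ y - lev w (P.μ γ)) :
    ∀ᶠ z in dirNhds w, ∀ γ ∈ S,
      ‖Complex.exp (P.μ γ / z)‖ ≤ Real.exp (y / ‖z‖) * ϱ ^ P.len γ := by
  obtain ⟨R, hR, hRb⟩ := P.support
  obtain ⟨d, rfl⟩ := exists_circle_exp w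
  rw [eventually_dirNhds_iff]
  have h1 : ∀ᶠ θ in 𝓝 d, ∀ γ ∈ S, s / 2 * ‖P.μ γ‖ ≤ y - lev (Circle.exp θ) (P.μ γ) :=
    (Circle.exp.continuous.tendsto d).eventually (cone_nearby hs hc)
  set r₀ : ℝ := s / 2 * R / (|Real.log ϱ| + 1) with hr₀
  have hr₀0 : 0 < r₀ := by positivity
  have h2 : ∀ᶠ r : ℝ in 𝓝[>] 0, 0 < r ∧ r < r₀ := Ioo_mem_nhdsGT hr₀0
  filter_upwards [tendsto_snd.eventually h1, tendsto_fst.eventually h2] with x hx ⟨hx0, hxr⟩ γ hγ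
  rw [← Prod.mk.eta (p := x), norm_exp_div_polar, norm_polar, abs_of_pos hx0,
    Real.rpow_def_of_pos hϱ, ← Real.exp_add, Real.exp_le_exp, ← sub_le_iff_le_add', ← sub_div,
    div_le_iff₀ hx0]
  have h3 := hx γ hγ
  have h4 : R * P.len γ ≤ ‖P.μ γ‖ := hRb γ
  have h5 : x.1 * (|Real.log ϱ| + 1) ≤ s / 2 * R := by
    rw [hr₀, lt_div_iff₀ (by positivity)] at hxr
    exact hxr.le
  have h6 := P.len_nonneg γ
  have h7 : -(Real.log ϱ * P.len γ * x.1) ≤ s / 2 * R * P.len γ := by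
    have h8 := neg_abs_le (Real.log ϱ)
    have h9 : 0 ≤ x.1 * P.len γ := by positivity
    nlinarith
  have h10 : s / 2 * R * P.len γ ≤ s / 2 * ‖P.μ γ‖ := by
    rw [mul_assoc]; gcongr
  linarith

namespace CoeffAt

variable {w : Circle} {a b : L → ℂ}

theorem exists_le_one (h : CoeffAt P w a) :
    ∃ ϱ : ℝ, 0 < ϱ ∧ ϱ ≤ 1 ∧ Summable fun γ => ‖a γ‖ * ϱ ^ P.len γ := by
  obtain ⟨ϱ, hϱ, hs⟩ := h.2
  refine ⟨min ϱ 1, by positivity, min_le_right _ _, hs.of_nonneg_of_le (fun γ => by positivity) fun γ => ?_⟩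
  gcongr
  · exact P.len_nonneg γ
  · exact min_le_left _ _

theorem exists_bound (h : CoeffAt P w a) : ∃ (ϱ : ℝ) (Y : ℝ), 0 < ϱ ∧
    Summable (fun γ => ‖a γ‖ * ϱ ^ P.len γ) ∧ ∀ᶠ z in dirNhds w, ∀ γ,
      ‖a γ * Complex.exp (P.μ γ / z)‖ ≤ Real.exp (Y / ‖z‖) * (‖a γ‖ * ϱ ^ P.len γ) := by
  obtain ⟨⟨s, hs, Y, hc⟩, ϱ, hϱ, hsum⟩ := h
  refine ⟨ϱ, Y, hϱ, hsum, ?_⟩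
  filter_upwards [exp_bound (P := P) (S := {γ | a γ ≠ 0}) hs hϱ fun γ hγ => hc γ hγ] with z hz γ
  by_cases ha : a γ = 0
  · simp [ha]
  · rw [norm_mul, mul_left_comm]
    exact mul_le_mul_of_nonneg_left (hz γ ha) (norm_nonneg _)

theorem summable (h : CoeffAt P w a) :
    ∀ᶠ z in dirNhds w, Summable fun γ => a γ * Complex.exp (P.μ γ / z) := by
  obtain ⟨ϱ, Y, hϱ, hsum, hb⟩ := h.exists_bound
  filter_upwards [hb] with z hz
  exact Summable.of_norm_bounded (hsum.mul_left _) hz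

theorem hasSum (h : CoeffAt P w a) :
    ∀ᶠ z in dirNhds w, HasSum (fun γ => a γ * Complex.exp (P.μ γ / z)) (serFn P a z) := by
  filter_upwards [h.summable] with z hz using hz.hasSum

theorem differentiableAt (h : CoeffAt P w a) : ∀ᶠ z in dirNhds w, DifferentiableAt ℂ (serFn P a) z := by
  obtain ⟨ϱ, Y, hϱ, hsum, hb⟩ := h.exists_bound
  obtain ⟨d, rfl⟩ := exists_circle_exp w
  obtain ⟨δ, hδ, hs⟩ := eventually_dirNhds_iff_sector.1 (hb.and (eventually_ne_dirNhds _))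
  filter_upwards [sector_mem_dirNhds d hδ hδ] with z₀ hz₀
  have hz₀0 : 0 < ‖z₀‖ := norm_pos_iff.2 (hs z₀ hz₀).2
  set U : Set ℂ := sector d δ δ ∩ {z | ‖z₀‖ / 2 < ‖z‖} with hU
  have hUo : IsOpen U := (isOpen_sector _ _ _).inter (isOpen_lt continuous_const continuous_norm)
  have hz₀U : z₀ ∈ U := ⟨hz₀, by change ‖z₀‖ / 2 < ‖z₀‖; linarith⟩
  have hd : DifferentiableOn ℂ (fun z => ∑' γ, a γ * Complex.exp (P.μ γ / z)) U := by
    refine Complex.differentiableOn_tsum_of_summable_norm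
      (hsum.mul_left (Real.exp (|Y| / (‖z₀‖ / 2)))) (fun γ z hz => ?_) hUo fun γ z hz => ?_
    · have hz0 := (hs z hz.1).2
      exact (((differentiableAt_const _).div differentiableAt_id hz0).cexp.const_mul _).differentiableWithinAt
    · refine ((hs z hz.1).1 γ).trans ?_
      have h1 : ‖z₀‖ / 2 < ‖z‖ := hz.2
      have h2 : Y / ‖z‖ ≤ |Y| / (‖z₀‖ / 2) := by
        calc Y / ‖z‖ ≤ |Y| / ‖z‖ := by gcongr; exact le_abs_self _
          _ ≤ _ := by gcongr
      exact mul_le_mul_of_nonneg_right (Real.exp_le_exp.2 h2) (by positivity)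
  exact hd.differentiableAt (hUo.mem_nhds hz₀U)

theorem nearby (h : CoeffAt P w a) : ∀ᶠ v in 𝓝 w, CoeffAt P v a := by
  obtain ⟨⟨s, hs, Y, hc⟩, hsum⟩ := h
  filter_upwards [cone_nearby (P := P) (S := {γ | a γ ≠ 0}) hs fun γ hγ => hc γ hγ] with v hv
  exact ⟨⟨s / 2, by positivity, Y, fun γ hγ => hv γ hγ⟩, hsum⟩

theorem germ (h : CoeffAt P w a) : (serO P a w).germ = (serFn P a : Germ (dirNhds w) ℂ) :=
  germ_toO h.differentiableAt

theorem isSec (h : CoeffAt P w a) : IsSec (serO P a) w := isSec_toO h.differentiableAt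

theorem of_support (h : CoeffAt P w a) (hb : ∀ γ, ‖b γ‖ ≤ ‖a γ‖) : CoeffAt P w b := by
  obtain ⟨⟨s, hs, Y, hc⟩, ϱ, hϱ, hsum⟩ := h
  refine ⟨⟨s, hs, Y, fun γ hγ => hc γ fun h0 => hγ ?_⟩, ϱ, hϱ,
    hsum.of_nonneg_of_le (fun γ => by positivity) fun γ => by gcongr; exact hb γ⟩
  have := hb γ
  rw [h0, norm_zero] at this
  exact norm_le_zero_iff.1 this

theorem smul (h : CoeffAt P w a) (c : ℂ) : CoeffAt P w (fun γ => c * a γ) := by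
  obtain ⟨⟨s, hs, Y, hc⟩, ϱ, hϱ, hsum⟩ := h
  refine ⟨⟨s, hs, Y, fun γ hγ => hc γ (right_ne_zero_of_mul hγ)⟩, ϱ, hϱ, ?_⟩
  simp only [norm_mul, mul_assoc]
  exact hsum.mul_left _

theorem add (ha : CoeffAt P w a) (hb : CoeffAt P w b) : CoeffAt P w (fun γ => a γ + b γ) := by
  obtain ⟨⟨s, hs, Y, hc⟩, -⟩ := id ha
  obtain ⟨⟨s', hs', Y', hc'⟩, -⟩ := id hb
  obtain ⟨ϱ, hϱ, hϱ1, hsum⟩ := ha.exists_le_one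
  obtain ⟨ϱ', hϱ', hϱ1', hsum'⟩ := hb.exists_le_one
  refine ⟨⟨min s s', by positivity, max Y Y', fun γ hγ => ?_⟩, min ϱ ϱ', by positivity, ?_⟩
  · have hn := norm_nonneg (P.μ γ)
    by_cases h0 : a γ = 0
    · have h1 : b γ ≠ 0 := fun h => hγ (by simp [h0, h])
      have := hc' γ h1
      have h2 : min s s' * ‖P.μ γ‖ ≤ s' * ‖P.μ γ‖ := by gcongr; exact min_le_right _ _
      linarith [le_max_right Y Y']
    · have := hc γ h0
      have h2 : min s s' * ‖P.μ γ‖ ≤ s * ‖P.μ γ‖ := by gcongr; exact min_le_left _ _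
      linarith [le_max_left Y Y']
  · refine (hsum.add hsum').of_nonneg_of_le (fun γ => by positivity) fun γ => ?_
    have hl := P.len_nonneg γ
    calc ‖a γ + b γ‖ * min ϱ ϱ' ^ P.len γ ≤ (‖a γ‖ + ‖b γ‖) * min ϱ ϱ' ^ P.len γ := by
          gcongr; exact norm_add_le _ _
      _ = ‖a γ‖ * min ϱ ϱ' ^ P.len γ + ‖b γ‖ * min ϱ ϱ' ^ P.len γ := add_mul _ _ _
      _ ≤ _ := by
          gcongr
          · exact min_le_left _ _
          · exact min_le_right _ _

theorem serO_add (ha : CoeffAt P w a) (hb : CoeffAt P w b) :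
    serO P (fun γ => a γ + b γ) w = serO P a w + serO P b w := by
  refine Hol.germ_injective ?_
  rw [map_add, (ha.add hb).germ, ha.germ, hb.germ]
  refine Germ.coe_eq.2 ?_
  filter_upwards [ha.summable, hb.summable] with z h1 h2
  rw [serFn, serFn, serFn, ← h1.tsum_add h2]
  exact tsum_congr fun γ => add_mul _ _ _

theorem serO_smul (ha : CoeffAt P w a) (c : ℂ) :
    serO P (fun γ => c * a γ) w = Hol.const c * serO P a w := by
  refine Hol.germ_injective ?_
  rw [map_mul, (ha.smul c).germ, ha.germ]
  refine Germ.coe_eq.2 (Eventually.of_forall fun z => ?_)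
  change serFn P _ z = c * serFn P a z
  rw [serFn, serFn, ← tsum_mul_left]
  exact tsum_congr fun γ => mul_assoc _ _ _

theorem shift (h : CoeffAt P w a) (δ : L) : CoeffAt P w (fun γ => a (γ - δ)) := by
  obtain ⟨⟨s, hs, Y, hc⟩, -⟩ := id h
  obtain ⟨ϱ, hϱ, hϱ1, hsum⟩ := h.exists_le_one
  refine ⟨⟨s, hs, Y + lev w (P.μ δ) + s * ‖P.μ δ‖, fun γ hγ => ?_⟩, ϱ, hϱ, ?_⟩
  · have h1 := hc _ hγ
    rw [map_sub, lev_sub] at h1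
    have h2 : ‖P.μ γ‖ ≤ ‖P.μ γ - P.μ δ‖ + ‖P.μ δ‖ := by
      simpa using norm_add_le (P.μ γ - P.μ δ) (P.μ δ)
    have h3 := mul_le_mul_of_nonneg_left h2 hs.le
    linarith
  · have h1 : Summable fun γ => ‖a (γ - δ)‖ * ϱ ^ P.len (γ - δ) :=
      (Equiv.subRight δ).summable_iff.2 hsum
    refine (h1.mul_right (ϱ ^ (-P.len δ))).of_nonneg_of_le (fun γ => by positivity) fun γ => ?_
    rw [mul_assoc, ← Real.rpow_add hϱ]
    refine mul_le_mul_of_nonneg_left ?_ (norm_nonneg _)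
    refine Real.rpow_le_rpow_of_exponent_ge hϱ hϱ1 ?_
    have := P.len_add_le γ (-δ)
    rw [P.len_neg, ← sub_eq_add_neg] at this
    linarith

theorem serO_shift (h : CoeffAt P w a) (δ : L) :
    serO P (fun γ => a (γ - δ)) w = expO (P.μ δ) w * serO P a w := by
  refine Hol.germ_injective ?_
  rw [map_mul, (h.shift δ).germ, h.germ]
  refine Germ.coe_eq.2 (Eventually.of_forall fun z => ?_)
  change serFn P _ z = Complex.exp (P.μ δ / z) * serFn P a z
  rw [serFn, serFn, ← tsum_mul_left, ← (Equiv.subRight δ).tsum_eq (fun γ => Complex.exp (P.μ δ / z) *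
    (a γ * Complex.exp (P.μ γ / z)))]
  refine tsum_congr fun γ => ?_
  simp only [Equiv.subRight_apply, map_sub]
  rw [mul_left_comm, ← Complex.exp_add]
  congr 2
  ring

theorem zero : CoeffAt P w (fun _ => 0) :=
  ⟨⟨1, one_pos, 0, fun γ h => (h rfl).elim⟩, 1, one_pos, by simp⟩

theorem serO_zero : serO P (fun _ => 0) w = 0 := by
  refine (eq_toO ?_).symm
  rw [map_zero]
  refine Germ.coe_eq.2 (Eventually.of_forall fun z => ?_)
  simp [serFn]

theorem of_finite {a : L → ℂ} (T : Finset L) (ha : ∀ γ, γ ∉ T → a γ = 0) : CoeffAt P w a := by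
  refine ⟨⟨1, one_pos, ∑ γ ∈ T, (‖P.μ γ‖ + ‖P.μ γ‖), fun γ hγ => ?_⟩, 1, one_pos,
    summable_of_ne_finset_zero (s := T) fun γ hγ => by simp [ha γ hγ]⟩
  have hγT : γ ∈ T := by by_contra h; exact hγ (ha γ h)
  have h1 := Finset.single_le_sum (f := fun γ => ‖P.μ γ‖ + ‖P.μ γ‖) (fun i _ => by positivity) hγT
  have h2 := (abs_le.1 (abs_lev_le w (P.μ γ))).2
  beta_reduce at h1
  linarith

theorem serO_finite {a : L → ℂ} (T : Finset L) (ha : ∀ γ, γ ∉ T → a γ = 0) :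
    serO P a w = ∑ γ ∈ T, Hol.const (a γ) * expO (P.μ γ) w := by
  have e : (∑ γ ∈ T, Hol.const (a γ) * expO (P.μ γ) w).germ = (serFn P a : Germ (dirNhds w) ℂ) := by
    have h1 : ∀ S : Finset L, (∑ γ ∈ S, Hol.const (a γ) * expO (P.μ γ) w).germ =
        ((fun z => ∑ γ ∈ S, a γ * Complex.exp (P.μ γ / z) : ℂ → ℂ) : Germ (dirNhds w) ℂ) := by
      classical
      intro S
      induction S using Finset.induction_on with
      | empty => simp; rfl
      | insert i S hi ih =>
        rw [Finset.sum_insert hi, map_add, ih]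
        simp only [Finset.sum_insert hi]
        rfl
    rw [h1]
    refine Germ.coe_eq.2 (Eventually.of_forall fun z => ?_)
    simp only [serFn]
    rw [tsum_eq_sum fun γ hγ => by rw [ha γ hγ, zero_mul]]
  exact (eq_toO e).symm

theorem single [DecidableEq L] (γ : L) (b : ℂ) : CoeffAt P w (Pi.single γ b) :=
  of_finite {γ} fun δ hδ => Pi.single_eq_of_ne (by simpa using hδ) _

theorem serO_single [DecidableEq L] (γ : L) (b : ℂ) :
    serO P (Pi.single γ b) w = Hol.const b * expO (P.μ γ) w := by
  rw [serO_finite {γ} fun δ hδ => Pi.single_eq_of_ne (by simpa using hδ) _]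
  simp

theorem mem_Amu (h : CoeffAt P w a) : serO P a w ∈ Amu P w := by
  classical
  obtain ⟨⟨s, hs, Y, hc⟩, hsum⟩ := id h
  set T : Finset L := (P.finite_norm_le (2 * |Y| / s)).toFinset with hT
  set a₁ : L → ℂ := fun γ => if γ ∈ T then a γ else 0 with ha₁
  set a₂ : L → ℂ := fun γ => if γ ∈ T then 0 else a γ with ha₂
  have h₁ : CoeffAt P w a₁ := h.of_support fun γ => by simp only [ha₁]; split_ifs <;> simp
  have h₂ : CoeffAt P w a₂ := h.of_support fun γ => by simp only [ha₂]; split_ifs <;> simp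
  have e : a = fun γ => a₁ γ + a₂ γ := by
    funext γ; simp only [ha₁, ha₂]; split_ifs <;> simp
  rw [e, h₁.serO_add h₂]
  refine add_mem ?_ ?_
  · rw [serO_finite T fun γ hγ => by simp [ha₁, hγ]]
    refine sum_mem fun γ _ => ?_
    exact (Amu P w).smul_mem (uExp P γ w).2 _
  · refine Submodule.subset_span ⟨0, serO P a₂ w, ⟨a₂, ?_, h₂.2, _, h₂.germ, h₂.hasSum⟩, ?_⟩
    · filter_upwards [eventually_inv_sub_lt w (half_pos hs)] with v hv γ hγ
      left
      rw [ltAt_zero_iff]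
      have hγT : γ ∉ T := fun hmem => hγ (by simp [ha₂, hmem])
      have hγa : a γ ≠ 0 := by simpa [ha₂, hγT] using hγ
      have hbig : 2 * |Y| / s < ‖P.μ γ‖ := by simpa [hT] using hγT
      have hpos : 0 < ‖P.μ γ‖ := lt_of_le_of_lt (by positivity) hbig
      rw [div_lt_iff₀ hs] at hbig
      have h1 := hc γ hγa
      have h2 := (abs_le.1 (lev_sub_lev_le v w (P.μ γ))).2
      have h3 := mul_lt_mul_of_pos_right hv hpos
      linarith [le_abs_self Y]
    · rw [map_zero, expO_zero, one_mul]

/-- Uniform strict negativity. -/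
theorem exists_gap (h : CoeffAt P w a) {y : ℝ} (hy : ∀ γ, a γ ≠ 0 → lev w (P.μ γ) < y) :
    ∃ s > 0, ∀ γ, a γ ≠ 0 → s * (‖P.μ γ‖ + 1) ≤ y - lev w (P.μ γ) := by
  obtain ⟨⟨s, hs, Y, hc⟩, -⟩ := h
  have hfin := P.finite_norm_le (2 * (|Y| + |y| + 1) / s)
  have h1 : ∀ᶠ t : ℝ in 𝓝[>] 0, ∀ γ ∈ {γ : L | ‖P.μ γ‖ ≤ 2 * (|Y| + |y| + 1) / s}, a γ ≠ 0 →
      t * (‖P.μ γ‖ + 1) ≤ y - lev w (P.μ γ) := by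
    rw [Filter.eventually_all_finite hfin]
    intro γ _
    by_cases ha : a γ = 0
    · exact Eventually.of_forall fun t h => (h ha).elim
    · have hpos : 0 < y - lev w (P.μ γ) := by linarith [hy γ ha]
      have ht : Tendsto (fun t : ℝ => t * (‖P.μ γ‖ + 1)) (𝓝[>] 0) (𝓝 0) := by
        have hcont : Continuous fun t : ℝ => t * (‖P.μ γ‖ + 1) := by fun_prop
        have := (hcont.tendsto 0).mono_left (nhdsWithin_le_nhds (s := Set.Ioi 0))
        simpa using this
      filter_upwards [ht.eventually (gt_mem_nhds hpos)] with t ht _ using le_of_lt ht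
  obtain ⟨t, ht, ht0⟩ := (h1.and self_mem_nhdsWithin).exists
  have ht0' : 0 < t := ht0
  refine ⟨min t (min (s / 2) 1), by positivity, fun γ hγ => ?_⟩
  have hn := norm_nonneg (P.μ γ)
  by_cases hsm : ‖P.μ γ‖ ≤ 2 * (|Y| + |y| + 1) / s
  · refine le_trans ?_ (ht γ hsm hγ)
    gcongr
    exact min_le_left _ _
  · push Not at hsm
    rw [div_lt_iff₀ hs] at hsm
    have h2 := hc γ hγ
    have h3 : min t (min (s / 2) 1) * (‖P.μ γ‖ + 1) ≤ s / 2 * ‖P.μ γ‖ + 1 := by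
      have h4 : min t (min (s / 2) 1) ≤ s / 2 := (min_le_right _ _).trans (min_le_left _ _)
      have h5 : min t (min (s / 2) 1) ≤ 1 := (min_le_right _ _).trans (min_le_right _ _)
      nlinarith
    have := le_abs_self Y
    have := neg_abs_le y
    linarith

theorem mem_Amod_of_lt (h : CoeffAt P w a) {b : ℂ} (hb : ∀ γ, a γ ≠ 0 → ltAt w (P.μ γ) b) :
    ∃ c, ltAt w c b ∧ serO P a w ∈ Amod c w := by
  obtain ⟨s, hs, hgap⟩ := h.exists_gap (y := lev w b) fun γ hγ => ltAt_iff.1 (hb γ hγ)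
  obtain ⟨ϱ, hϱ, hsum⟩ := h.2
  set y := lev w b - s / 2 with hy
  have hlev : lev w ((y : ℂ) * (w : ℂ)) = y := by
    rw [lev, mul_left_comm, Circle.coe_inv, inv_mul_cancel₀ (Circle.coe_ne_zero w), mul_one,
      Complex.ofReal_re]
  refine ⟨y * w, by rw [ltAt_iff, hlev]; linarith, ?_⟩
  rw [mem_Amod_iff, mem_Amod0_iff (f := fun z => Complex.exp (-(y * w) / z) * serFn P a z)
    (by rw [map_mul, h.germ]; rfl)]
  have hcone : ∀ γ ∈ {γ | a γ ≠ 0}, s * ‖P.μ γ‖ ≤ (lev w b - s) - lev w (P.μ γ) := by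
    intro γ hγ
    have := hgap γ hγ
    linarith
  have h1 : lev w (-(y * w)) < -(lev w b - s) := by rw [lev_neg, hlev]; linarith
  have hts : (0 : ℝ) ≤ ∑' γ, ‖a γ‖ * ϱ ^ P.len γ := tsum_nonneg fun γ => by positivity
  refine ⟨(∑' γ, ‖a γ‖ * ϱ ^ P.len γ) + 1, by positivity, 0, ?_⟩
  filter_upwards [exp_bound hs hϱ hcone, eventually_norm_exp_le h1] with z hz hz'
  have h2 : ‖serFn P a z‖ ≤ Real.exp ((lev w b - s) / ‖z‖) * ∑' γ, ‖a γ‖ * ϱ ^ P.len γ := by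
    refine tsum_of_norm_bounded (hsum.hasSum.mul_left _) fun γ => ?_
    by_cases ha : a γ = 0
    · simp [ha]
    · rw [norm_mul, mul_left_comm]
      exact mul_le_mul_of_nonneg_left (hz γ ha) (norm_nonneg _)
  rw [norm_mul, pow_zero, mul_one]
  calc _ ≤ Real.exp (-(lev w b - s) / ‖z‖) * (Real.exp ((lev w b - s) / ‖z‖) *
        ∑' γ, ‖a γ‖ * ϱ ^ P.len γ) := by gcongr
    _ = ∑' γ, ‖a γ‖ * ϱ ^ P.len γ := by
        rw [← mul_assoc, ← Real.exp_add, neg_div, neg_add_cancel, Real.exp_zero, one_mul]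
    _ ≤ _ := by linarith

theorem mem_Amod_of_le (h : CoeffAt P w a) {b : ℂ} (hb : ∀ γ, a γ ≠ 0 → leAt w (P.μ γ) b) :
    serO P a w ∈ Amod b w := by
  classical
  by_cases hex : ∃ γ₀, P.μ γ₀ = b
  · obtain ⟨γ₀, rfl⟩ := hex
    set a₂ : L → ℂ := fun γ => if γ = γ₀ then 0 else a γ with ha₂
    have h₂ : CoeffAt P w a₂ := h.of_support fun γ => by simp only [ha₂]; split_ifs <;> simp
    have e : a = fun γ => Pi.single (M := fun _ => ℂ) γ₀ (a γ₀) γ + a₂ γ := by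
      funext γ
      simp only [ha₂]
      split_ifs with hγ
      · subst hγ; simp
      · simp [hγ]
    rw [e, (CoeffAt.single γ₀ (a γ₀)).serO_add h₂, serO_single]
    refine Amod_add ?_ ?_
    · have := Amod_mul (const_mem_Amod0 w (a γ₀) |> (Amod_zero w).ge) (expO_mem_Amod (w := w) (P.μ γ₀))
      rwa [zero_add] at this
    · obtain ⟨c, hc, hmem⟩ := h₂.mem_Amod_of_lt (b := P.μ γ₀) fun γ hγ => by
        have hne : γ ≠ γ₀ := fun h0 => hγ (by simp [ha₂, h0])
        have hγa : a γ ≠ 0 := by simpa [ha₂, hne] using hγ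
        rcases hb γ hγa with h1 | h1
        · exact h1
        · exact (hne (P.μ_injective h1)).elim
      exact Amod_mono (Or.inl hc) hmem
  · push Not at hex
    obtain ⟨c, hc, hmem⟩ := h.mem_Amod_of_lt (b := b) fun γ hγ => (hb γ hγ).resolve_right (hex γ)
    exact Amod_mono (Or.inl hc) hmem

/-- The growth of a series is that of its terms. -/
theorem le_of_mem_Amod (h : CoeffAt P w a) {b : ℂ} (hb : serO P a w ∈ Amod b w) (γ : L)
    (hγ : a γ ≠ 0) : leAt w (P.μ γ) b := by
  have key : ∀ v : Circle, CoeffAt P v a → serO P a v ∈ Amod b v → ∀ γ, a γ ≠ 0 →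
      lev v (P.μ γ) ≤ lev v b := by
    intro v hv hbv γ₁ hγ₁
    by_contra hcon
    push Not at hcon
    obtain ⟨⟨s, hs, Y, hc⟩, ϱ, hϱ, hsum⟩ := id hv
    have hfin : {γ | a γ ≠ 0 ∧ lev v (P.μ γ₁) ≤ lev v (P.μ γ)}.Finite := by
      refine (P.finite_norm_le ((Y - lev v (P.μ γ₁)) / s)).subset fun γ hγ => ?_
      rw [Set.mem_ofPred, le_div_iff₀ hs, mul_comm]
      have := hc γ hγ.1
      have := hγ.2
      linarith
    obtain ⟨γ₀, ⟨h0, h01⟩, hmax⟩ := Set.exists_max_image _ (fun γ => lev v (P.μ γ)) hfin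
      ⟨γ₁, hγ₁, le_rfl⟩
    have hmax' : ∀ γ, a γ ≠ 0 → lev v (P.μ γ) ≤ lev v (P.μ γ₀) := by
      intro γ hγ
      rcases le_total (lev v (P.μ γ₁)) (lev v (P.μ γ)) with h1 | h1
      · exact hmax γ ⟨hγ, h1⟩
      · exact h1.trans h01
    have hsm : expO (-P.μ γ₀) v * serO P a v ∈ Small v := by
      refine Amod_subset_Small (c := -P.μ γ₀ + b) ?_ (Amod_mul (expO_mem_Amod _) hbv)
      rw [ltAt_zero_iff, lev_add, lev_neg]
      linarith
    rw [mem_Small_iff (f := fun z => Complex.exp (-P.μ γ₀ / z) * serFn P a z)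
      (by rw [map_mul, hv.germ]; rfl)] at hsm
    obtain ⟨C, hC, κ, hκ, hsm⟩ := hsm
    obtain ⟨θ, rfl⟩ := exists_circle_exp v
    obtain ⟨ρ, hρ, H⟩ := eventually_polar_of_isCompact (K := {θ}) isCompact_singleton
      (p := fun z => ‖Complex.exp (-P.μ γ₀ / z) * serFn P a z‖ ≤ C * Real.exp (-κ / ‖z‖) ∧
        Summable fun γ => a γ * Complex.exp (P.μ γ / z)) (fun θ' hθ' => by
          rw [Set.mem_singleton_iff.1 hθ']
          exact hsm.and hv.summable)
    set u : ℂ := (((Circle.exp θ)⁻¹ : Circle) : ℂ) with hu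
    have hexp : ∀ (c : ℂ) (t : ℝ), c / polar (t⁻¹, θ) = u * c * t := by
      intro c t
      rw [polar_eq, hu, Circle.coe_inv]
      push_cast
      field_simp
    have hT : 0 < ρ⁻¹ + 1 := by positivity
    have hsmall : ∀ t, ρ⁻¹ + 1 ≤ t → 0 < t⁻¹ ∧ t⁻¹ < ρ := by
      intro t ht
      have ht0 : 0 < t := hT.trans_le ht
      refine ⟨inv_pos.2 ht0, inv_lt_of_inv_lt₀ hρ (by linarith)⟩
    have hzero := laplace_coeff_eq_zero a (fun γ => -(u * P.μ γ)) (ρ⁻¹ + 1) γ₀ ?_ ?_ ?_ hκ (C := C) ?_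
    · exact h0 hzero
    · obtain ⟨h1, h2⟩ := hsmall _ le_rfl
      refine (H _ _ h1 h2 rfl).2.norm.congr fun γ => ?_
      rw [norm_mul, hexp, Complex.norm_exp, Complex.re_mul_ofReal, Complex.neg_re, neg_neg]
    · intro γ hγ
      rw [Complex.neg_re, Complex.neg_re, neg_le_neg_iff]
      exact hmax' γ hγ
    · intro γ _ hne h1
      refine hne (P.μ_injective ?_)
      exact mul_left_cancel₀ (Circle.coe_ne_zero _) (neg_injective h1)
    · intro t ht
      obtain ⟨h1, h2⟩ := hsmall t ht.le
      have h3 := (H _ _ h1 h2 rfl).1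
      rw [norm_polar, abs_of_pos h1, norm_mul, hexp, Complex.norm_exp, Complex.re_mul_ofReal] at h3
      have e1 : serFn P a (polar (t⁻¹, θ)) = ∑' γ, a γ * Complex.exp (- -(u * P.μ γ) * t) := by
        refine tsum_congr fun γ => ?_
        rw [hexp, neg_neg]
      rw [← e1]
      have e2 : (u * -P.μ γ₀).re = (-(u * P.μ γ₀)).re := by rw [mul_neg]
      rw [e2, div_inv_eq_mul] at h3
      have h4 := mul_le_mul_of_nonneg_left h3 (Real.exp_pos (-((-(u * P.μ γ₀)).re * t))).le
      rw [← mul_assoc, ← Real.exp_add, neg_add_cancel, Real.exp_zero, one_mul, mul_left_comm,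
        ← Real.exp_add] at h4
      have e3 : -((-(u * P.μ γ₀)).re * t) + -κ * t = -((-(u * P.μ γ₀)).re + κ) * t := by ring
      rw [e3] at h4
      exact h4
  have h1 : ∀ᶠ v in 𝓝 w, lev v (P.μ γ - b) ≤ 0 := by
    filter_upwards [h.nearby, h.isSec.mem_Amod hb] with v h1 h2
    rw [lev_sub]
    linarith [key v h1 h2 γ hγ]
  have h2 := (leAt_zero_of_eventually h1).add_right b
  simpa using h2

theorem eq_of_serO_eq (ha : CoeffAt P w a) (hb : CoeffAt P w b) (h : serO P a w = serO P b w) :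
    a = b := by
  funext γ
  by_contra hne
  have hc := ha.add (hb.smul (-1))
  have h0 : serO P (fun γ => a γ + -1 * b γ) w = 0 := by
    rw [ha.serO_add (hb.smul (-1)), hb.serO_smul, h, map_neg, map_one]
    ring
  have hmem : serO P (fun γ => a γ + -1 * b γ) w ∈ Amod (P.μ γ - w) w := by
    rw [h0]
    exact ⟨0, (modR w).zero_mem, by rw [mul_zero]⟩
  have h1 := hc.le_of_mem_Amod hmem γ (by
    intro h2
    exact hne (by linear_combination h2))
  have h2 := h1.lev_le
  have h3 : lev w (w : ℂ) = 1 := by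
    rw [lev, Circle.coe_inv, inv_mul_cancel₀ (Circle.coe_ne_zero w), Complex.one_re]
  rw [lev_sub, h3] at h2
  linarith

end CoeffAt

theorem exists_coeffAt {w : Circle} {f : O w} (hf : f ∈ Amu P w) :
    ∃ a, CoeffAt P w a ∧ f = serO P a w := by
  have hf' : f ∈ Submodule.span ℂ {g : O w | ∃ γ : L, ∃ h ∈ AmuNonpos P w,
    g = expO (P.μ γ) w * h} := hf
  clear hf
  induction hf' using Submodule.span_induction with
  | mem g hg =>
    obtain ⟨γ, h, ⟨b, hb, hϱ, f, hf, hfb⟩, rfl⟩ := hg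
    obtain ⟨s, hs, hcone⟩ := exists_cone w hb
    have hc : CoeffAt P w b := by
      refine ⟨⟨s, hs, 0, fun γ hγ => ?_⟩, hϱ⟩
      have := hcone (P.μ γ) fun v hv => hv γ hγ
      rw [mul_comm, zero_sub]
      exact this
    refine ⟨_, hc.shift γ, ?_⟩
    rw [hc.serO_shift]
    congr 1
    refine Hol.germ_injective ?_
    rw [hf, hc.germ]
    refine Germ.coe_eq.2 ?_
    filter_upwards [hfb] with z hz using hz.tsum_eq.symm
  | zero => exact ⟨_, CoeffAt.zero, CoeffAt.serO_zero.symm⟩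
  | add x y _ _ hx hy =>
    obtain ⟨a, ha, rfl⟩ := hx
    obtain ⟨b, hb, rfl⟩ := hy
    exact ⟨_, ha.add hb, (ha.serO_add hb).symm⟩
  | smul c x _ hx =>
    obtain ⟨a, ha, rfl⟩ := hx
    exact ⟨_, ha.smul c, (ha.serO_smul c).symm⟩

end PeriodRH

namespace PeriodRH

set_option linter.unusedSectionVars false

/-! ### Linear equations in `ℓ¹` -/

section L1

variable {X : Type*} {K : X → X → ℂ} {κ : ℝ}

theorem l1_apply (hK : ∀ h, Summable fun g => ‖K g h‖) (hκ : ∀ h, ∑' g, ‖K g h‖ ≤ κ) {y : X → ℂ}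
    (hy : Summable fun h => ‖y h‖) :
    (∀ g, Summable fun h => K g h * y h) ∧ (Summable fun g => ‖∑' h, K g h * y h‖) ∧
      ∑' g, ‖∑' h, K g h * y h‖ ≤ κ * ∑' h, ‖y h‖ := by
  have h1 : Summable fun x : X × X => ‖K x.2 x.1 * y x.1‖ := by
    rw [summable_prod_of_nonneg fun _ => norm_nonneg _]
    refine ⟨fun h => ?_, ?_⟩
    · simp only [norm_mul]
      exact (hK h).mul_right _
    · simp only [norm_mul, tsum_mul_right]
      refine (hy.mul_left κ).of_nonneg_of_le (fun h => ?_) fun h => ?_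
      · exact mul_nonneg (tsum_nonneg fun _ => norm_nonneg _) (norm_nonneg _)
      · exact mul_le_mul_of_nonneg_right (hκ h) (norm_nonneg _)
  have h2 : Summable fun x : X × X => ‖K x.1 x.2 * y x.2‖ := (Equiv.prodComm X X).summable_iff.2 h1
  have h3 : ∀ g, Summable fun h => ‖K g h * y h‖ := fun g => h2.prod_factor g
  have h4 : Summable fun g => ∑' h, ‖K g h * y h‖ := h2.prod
  have h5 : ∀ g, ‖∑' h, K g h * y h‖ ≤ ∑' h, ‖K g h * y h‖ := fun g => norm_tsum_le_tsum_norm (h3 g)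
  have h6 : Summable fun g => ‖∑' h, K g h * y h‖ := h4.of_nonneg_of_le (fun _ => norm_nonneg _) h5
  refine ⟨fun g => (h3 g).of_norm, h6, (h6.tsum_le_tsum h5 h4).trans ?_⟩
  rw [Summable.tsum_comm (f := fun h g => ‖K g h * y h‖) h1, ← tsum_mul_left]
  have h7 : Summable fun h => ∑' g, ‖K g h * y h‖ := h1.prod
  refine h7.tsum_le_tsum (fun h => ?_) (hy.mul_left κ)
  simp only [norm_mul, tsum_mul_right]
  exact mul_le_mul_of_nonneg_right (hκ h) (norm_nonneg _)

theorem l1_solve (hK : ∀ h, Summable fun g => ‖K g h‖) (hκ : ∀ h, ∑' g, ‖K g h‖ ≤ κ) (hκ0 : 0 ≤ κ)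
    (hκ1 : κ < 1) {m : X → ℂ} (hm : Summable fun h => ‖m h‖) :
    ∃ y : X → ℂ, (Summable fun h => ‖y h‖) ∧ ∀ g, y g = m g - ∑' h, K g h * y h := by
  have mem : ∀ y : X → ℂ, Memℓp y 1 ↔ Summable fun h => ‖y h‖ := by
    intro y
    rw [memℓp_gen_iff (by simp)]
    simp
  have nrm : ∀ y : lp (fun _ : X => ℂ) 1, ‖y‖ = ∑' h, ‖y h‖ := by
    intro y
    rw [lp.norm_eq_tsum_rpow (by simp)]
    simp
  have key : ∀ y : lp (fun _ : X => ℂ) 1, Memℓp (fun g => m g - ∑' h, K g h * y h) 1 := by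
    intro y
    exact ((mem _).2 hm).sub ((mem _).2 (l1_apply hK hκ ((mem _).1 y.2)).2.1)
  let F : lp (fun _ : X => ℂ) 1 → lp (fun _ : X => ℂ) 1 := fun y => ⟨_, key y⟩
  have hF : ContractingWith ⟨κ, hκ0⟩ F := by
    refine ⟨hκ1, LipschitzWith.of_dist_le_mul fun y y' => ?_⟩
    rw [dist_eq_norm, dist_eq_norm, nrm, nrm]
    have hy := l1_apply hK hκ ((mem _).1 y.2)
    have hy' := l1_apply hK hκ ((mem _).1 y'.2)
    have h1 := (l1_apply hK hκ ((mem _).1 (y' - y).2)).2.2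
    have e : ∀ g, (F y - F y') g = ∑' h, K g h * (y' - y) h := by
      intro g
      change (m g - ∑' h, K g h * y h) - (m g - ∑' h, K g h * y' h) = _
      rw [sub_sub_sub_cancel_left, ← (hy'.1 g).tsum_sub (hy.1 g)]
      exact tsum_congr fun h => (mul_sub _ _ _).symm
    simp only [e]
    refine h1.trans (le_of_eq ?_)
    congr 1
    refine tsum_congr fun h => ?_
    exact norm_sub_rev _ _
  obtain ⟨y, hy⟩ : ∃ y : lp (fun _ : X => ℂ) 1, F y = y := ⟨_, hF.fixedPoint_isFixedPt⟩
  refine ⟨y, (mem _).1 y.2, fun g => ?_⟩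
  have := congrArg (fun y : lp (fun _ : X => ℂ) 1 => y g) hy
  exact this.symm

end L1

/-! ### Matrices of coefficients -/

variable {L : Type*} [AddCommGroup L]

/-- Convolution. -/
def cv (a b : L → ℂ) (δ : L) : ℂ := ∑' γ, a (δ - γ) * b γ

theorem cv_hasSum {a b : L → ℂ} (ha : Summable fun γ => ‖a γ‖) (hb : Summable fun γ => ‖b γ‖) :
    (∀ δ, Summable fun γ => a (δ - γ) * b γ) ∧ (Summable fun δ => ‖cv a b δ‖) ∧
      HasSum (cv a b) ((∑' γ, a γ) * ∑' γ, b γ) := by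
  let e : L × L ≃ L × L :=
    { toFun := fun x => (x.1 - x.2, x.2)
      invFun := fun x => (x.1 + x.2, x.2)
      left_inv := fun x => by ext <;> simp
      right_inv := fun x => by ext <;> simp }
  have h1 : Summable fun x : L × L => ‖a (x.1 - x.2) * b x.2‖ := by
    have := e.summable_iff.2 (ha.mul_of_nonneg hb (fun _ => norm_nonneg _) fun _ => norm_nonneg _)
    refine this.congr fun x => ?_
    rw [norm_mul]
    rfl
  have h2 : HasSum (fun x : L × L => a (x.1 - x.2) * b x.2) ((∑' γ, a γ) * ∑' γ, b γ) :=
    e.hasSum_iff.2 (ha.of_norm.hasSum.mul hb.of_norm.hasSum (summable_mul_of_summable_norm ha hb))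
  have h3 : ∀ δ, Summable fun γ => a (δ - γ) * b γ := fun δ => (h1.prod_factor δ).of_norm
  refine ⟨h3, ?_, h2.prod_fiberwise fun δ => (h3 δ).hasSum⟩
  exact h1.prod.of_nonneg_of_le (fun _ => norm_nonneg _)
    fun δ => norm_tsum_le_tsum_norm (h1.prod_factor δ)

theorem exists_of_cv_ne_zero {a b : L → ℂ} {δ : L} (h : cv a b δ ≠ 0) :
    ∃ γ, a (δ - γ) ≠ 0 ∧ b γ ≠ 0 := by
  by_contra hcon
  push Not at hcon
  refine h ?_
  unfold cv
  rw [tsum_congr fun γ => ?_, tsum_zero]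
  by_cases h1 : a (δ - γ) = 0
  · rw [h1, zero_mul]
  · rw [hcon γ h1, mul_zero]

theorem cv_twist (χ : L → ℂ) (hχ : ∀ γ δ, χ (γ + δ) = χ γ * χ δ) (a b : L → ℂ) (δ : L) :
    cv (fun γ => a γ * χ γ) (fun γ => b γ * χ γ) δ = cv a b δ * χ δ := by
  unfold cv
  rw [← tsum_mul_right]
  refine tsum_congr fun γ => ?_
  rw [show χ δ = χ (δ - γ) * χ γ by rw [← hχ, sub_add_cancel]]
  ring

variable [Module.Free ℤ L] [Module.Finite ℤ L] (P : PeriodDatum L)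

theorem exp_twist (z : ℂ) (γ δ : L) : Complex.exp (P.μ (γ + δ) / z) =
    Complex.exp (P.μ γ / z) * Complex.exp (P.μ δ / z) := by
  rw [map_add, add_div, Complex.exp_add]

variable {ι : Type*} (c : ι → ℂ)

/-- The exponents `μ(γ) + c_j - c_i`. -/
def qexp (i j : ι) (γ : L) : ℂ := P.μ γ + c j - c i

variable [Fintype ι]

/-- Product of matrices of coefficients. -/
def mconv (M N : ι → ι → L → ℂ) : ι → ι → L → ℂ := fun i k δ => ∑ j, cv (M i j) (N j k) δ

/-- The matrix of series `∑_γ M_{ijγ} exp ((μ(γ) + c_j - c_i) / z)`. -/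
def serM (M : ι → ι → L → ℂ) (w : Circle) : Matrix ι ι (O w) :=
  Matrix.of fun i j => expO (c j - c i) w * serO P (M i j) w

/-- Coefficients all of whose exponents are negative on `U`. -/
structure NegOn (U : Set Circle) (M : ι → ι → L → ℂ) : Prop where
  neg : ∀ i j γ, M i j γ ≠ 0 → ∀ v ∈ U, ltAt v (qexp P c i j γ) 0
  summable : ∃ ϱ : ℝ, 0 < ϱ ∧ ∀ i j, Summable fun γ => ‖M i j γ‖ * ϱ ^ P.len γ

variable {P c}

theorem qexp_add (i j k : ι) (γ γ' : L) :
    qexp P c i k (γ + γ') = qexp P c i j γ + qexp P c j k γ' := by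
  simp only [qexp, map_add]; ring

theorem ltAt_zero_add {w : Circle} {a b : ℂ} (ha : ltAt w a 0) (hb : ltAt w b 0) :
    ltAt w (a + b) 0 := by
  rw [ltAt_zero_iff] at *
  rw [lev_add]
  linarith

theorem summable_len_of_summable_exp {a : L → ℂ} {z : ℂ}
    (h : Summable fun γ => ‖a γ * Complex.exp (P.μ γ / z)‖) :
    ∃ ϱ₀ : ℝ, 0 < ϱ₀ ∧ ∀ ϱ, 0 < ϱ → ϱ ≤ ϱ₀ → Summable fun γ => ‖a γ‖ * ϱ ^ P.len γ := by
  obtain ⟨M, hM, hMb⟩ := P.exists_bound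
  refine ⟨Real.exp (-(M / ‖z‖)), Real.exp_pos _, fun ϱ h0 hϱ =>
    h.of_nonneg_of_le (fun γ => by positivity) fun γ => ?_⟩
  rw [norm_mul]
  refine mul_le_mul_of_nonneg_left ?_ (norm_nonneg _)
  refine (Real.rpow_le_rpow h0.le hϱ (P.len_nonneg γ)).trans ?_
  rw [← Real.exp_mul, Complex.norm_exp, Real.exp_le_exp]
  have h1 := (abs_le.1 (Complex.abs_re_le_norm (P.μ γ / z))).1
  rw [norm_div] at h1
  have h2 : ‖P.μ γ‖ / ‖z‖ ≤ M * P.len γ / ‖z‖ := by gcongr; exact hMb γ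
  have h3 : -(M / ‖z‖) * P.len γ = -(M * P.len γ / ‖z‖) := by ring
  linarith

namespace NegOn

variable {U : Set Circle} {M N : ι → ι → L → ℂ}

theorem mono {U' : Set Circle} (h : NegOn P c U M) (hU : U' ⊆ U) : NegOn P c U' M :=
  ⟨fun i j γ h0 v hv => h.neg i j γ h0 v (hU hv), h.summable⟩

theorem of_norm_le (h : NegOn P c U M) (hN : ∀ i j γ, ‖N i j γ‖ ≤ ‖M i j γ‖) : NegOn P c U N := by
  obtain ⟨ϱ, hϱ, hs⟩ := h.summable
  refine ⟨fun i j γ h0 => h.neg i j γ fun h1 => h0 ?_, ϱ, hϱ, fun i j =>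
    (hs i j).of_nonneg_of_le (fun γ => by positivity) fun γ => by gcongr; exact hN i j γ⟩
  have := hN i j γ
  rw [h1, norm_zero] at this
  exact norm_le_zero_iff.1 this

theorem zero : NegOn P c U (fun _ _ _ => 0) :=
  ⟨fun _ _ _ h => (h rfl).elim, 1, one_pos, fun _ _ => by simp⟩

theorem coeffAt (h : NegOn P c U M) {w : Circle} (hU : U ∈ 𝓝 w) (i j : ι) : CoeffAt P w (M i j) := by
  obtain ⟨s, hs, hcone⟩ := exists_cone w hU
  obtain ⟨ϱ, hϱ, hsum⟩ := h.summable
  refine ⟨⟨s, hs, lev w (c i - c j) + s * ‖c i - c j‖, fun γ hγ => ?_⟩, ϱ, hϱ, hsum i j⟩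
  have h1 := hcone (qexp P c i j γ) fun v hv => Or.inl (h.neg i j γ hγ v hv)
  change ‖qexp P c i j γ‖ * s ≤ -lev w (qexp P c i j γ) at h1
  have e : P.μ γ = qexp P c i j γ + (c i - c j) := by simp only [qexp]; ring
  rw [e, lev_add]
  have h2 := mul_le_mul_of_nonneg_left (norm_add_le (qexp P c i j γ) (c i - c j)) hs.le
  linarith

theorem of_summable_exp (hneg : ∀ i j γ, M i j γ ≠ 0 → ∀ v ∈ U, ltAt v (qexp P c i j γ) 0) {z : ℂ}
    (h : ∀ i j, Summable fun γ => ‖M i j γ * Complex.exp (P.μ γ / z)‖) : NegOn P c U M := by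
  refine ⟨hneg, ?_⟩
  choose ϱ h0 h1 using fun i j => summable_len_of_summable_exp (h i j)
  have h2 : ∀ᶠ t : ℝ in 𝓝[>] 0, ∀ i j, t ≤ ϱ i j :=
    eventually_all.2 fun i => eventually_all.2 fun j =>
      mem_of_superset (Ioo_mem_nhdsGT (h0 i j)) fun t ht => ht.2.le
  obtain ⟨t, ht, ht0⟩ := (h2.and self_mem_nhdsWithin).exists
  exact ⟨t, ht0, fun i j => h1 i j t ht0 (ht i j)⟩

theorem exists_summable_exp (h : NegOn P c U M) {w : Circle} (hU : U ∈ 𝓝 w) :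
    ∀ᶠ z in dirNhds w, ∀ i j, Summable fun γ => ‖M i j γ * Complex.exp (P.μ γ / z)‖ :=
  eventually_all.2 fun i => eventually_all.2 fun j =>
    (h.coeffAt hU i j).summable.mono fun _ hz => hz.norm

theorem add (hM : NegOn P c U M) (hN : NegOn P c U N) {w : Circle} (hU : U ∈ 𝓝 w) :
    NegOn P c U (fun i j γ => M i j γ + N i j γ) := by
  obtain ⟨z, h1, h2⟩ := ((hM.exists_summable_exp hU).and (hN.exists_summable_exp hU)).exists
  refine of_summable_exp (fun i j γ h0 v hv => ?_) (z := z) fun i j => ?_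
  · by_cases h3 : M i j γ = 0
    · exact hN.neg i j γ (fun h4 => h0 (by rw [h3, h4, add_zero])) v hv
    · exact hM.neg i j γ h3 v hv
  · refine ((h1 i j).add (h2 i j)).of_nonneg_of_le (fun _ => norm_nonneg _) fun γ => ?_
    rw [add_mul]
    exact norm_add_le _ _

theorem mconv_neg (hM : NegOn P c U M) (hN : NegOn P c U N) (i k : ι) (δ : L)
    (h0 : mconv M N i k δ ≠ 0) : ∀ v ∈ U, ltAt v (qexp P c i k δ) 0 := by
  intro v hv
  obtain ⟨j, -, hj⟩ := Finset.exists_ne_zero_of_sum_ne_zero h0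
  obtain ⟨γ, h3, h4⟩ := exists_of_cv_ne_zero hj
  rw [← sub_add_cancel δ γ, qexp_add i j k]
  exact ltAt_zero_add (hM.neg _ _ _ h3 v hv) (hN.neg _ _ _ h4 v hv)

theorem _root_.PeriodRH.cv_exp {a b : L → ℂ} {z : ℂ}
    (ha : Summable fun γ => ‖a γ * Complex.exp (P.μ γ / z)‖)
    (hb : Summable fun γ => ‖b γ * Complex.exp (P.μ γ / z)‖) :
    (Summable fun δ => ‖cv a b δ * Complex.exp (P.μ δ / z)‖) ∧
      HasSum (fun δ => cv a b δ * Complex.exp (P.μ δ / z)) (serFn P a z * serFn P b z) := by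
  have h := cv_hasSum ha hb
  have e : cv (fun γ => a γ * Complex.exp (P.μ γ / z)) (fun γ => b γ * Complex.exp (P.μ γ / z)) =
      fun δ => cv a b δ * Complex.exp (P.μ δ / z) :=
    funext fun δ => cv_twist (fun γ => Complex.exp (P.μ γ / z)) (exp_twist P z) a b δ
  rw [e] at h
  exact h.2

theorem mconv (hM : NegOn P c U M) (hN : NegOn P c U N) {w : Circle} (hU : U ∈ 𝓝 w) :
    NegOn P c U (mconv M N) := by
  obtain ⟨z, h1, h2⟩ := ((hM.exists_summable_exp hU).and (hN.exists_summable_exp hU)).exists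
  refine of_summable_exp (hM.mconv_neg hN) (z := z) fun i k => ?_
  have := summable_sum (s := Finset.univ) fun j (_ : j ∈ Finset.univ) => (cv_exp (h1 i j) (h2 j k)).1
  refine this.of_nonneg_of_le (fun _ => norm_nonneg _) fun δ => ?_
  rw [PeriodRH.mconv, Finset.sum_mul]
  exact norm_sum_le _ _

theorem serM_add (hM : NegOn P c U M) (hN : NegOn P c U N) {w : Circle} (hU : U ∈ 𝓝 w) :
    serM P c (fun i j γ => M i j γ + N i j γ) w = serM P c M w + serM P c N w := by
  ext i j
  simp only [serM, Matrix.of_apply, Matrix.add_apply]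
  rw [(hM.coeffAt hU i j).serO_add (hN.coeffAt hU i j), mul_add]

theorem serM_mconv (hM : NegOn P c U M) (hN : NegOn P c U N) {w : Circle} (hU : U ∈ 𝓝 w) :
    serM P c (PeriodRH.mconv M N) w = serM P c M w * serM P c N w := by
  ext i k
  simp only [serM, Matrix.of_apply, Matrix.mul_apply]
  have e : serO P (PeriodRH.mconv M N i k) w = ∑ j, serO P (M i j) w * serO P (N j k) w := by
    refine Hol.germ_injective ?_
    rw [((hM.mconv hN hU).coeffAt hU i k).germ, map_sum]
    have h1 : ∀ S : Finset ι, ∑ j ∈ S, (serO P (M i j) w * serO P (N j k) w).germ =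
        ((fun z => ∑ j ∈ S, serFn P (M i j) z * serFn P (N j k) z : ℂ → ℂ) : Germ (dirNhds w) ℂ) := by
      classical
      intro S
      induction S using Finset.induction_on with
      | empty => simp; rfl
      | insert j S hj ih =>
        rw [Finset.sum_insert hj, ih, map_mul, (hM.coeffAt hU i j).germ, (hN.coeffAt hU j k).germ]
        simp only [Finset.sum_insert hj]
        rfl
    rw [h1]
    refine Germ.coe_eq.2 ?_
    filter_upwards [hM.exists_summable_exp hU, hN.exists_summable_exp hU] with z h2 h3
    have h4 := hasSum_sum (s := Finset.univ) fun j (_ : j ∈ Finset.univ) =>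
      (cv_exp (h2 i j) (h3 j k)).2
    rw [← h4.tsum_eq]
    refine tsum_congr fun δ => ?_
    rw [PeriodRH.mconv, Finset.sum_mul]
  rw [e, Finset.mul_sum]
  refine Finset.sum_congr rfl fun j _ => ?_
  rw [show c k - c i = (c j - c i) + (c k - c j) by ring, expO_add]
  ring

theorem serM_zero {w : Circle} : serM P c (fun _ _ _ => 0) w = 0 := by
  ext i j
  simp [serM, CoeffAt.serO_zero]

theorem serM_injective (hM : NegOn P c U M) (hN : NegOn P c U N) {w : Circle} (hU : U ∈ 𝓝 w)
    (h : serM P c M w = serM P c N w) : M = N := by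
  funext i j
  refine (hM.coeffAt hU i j).eq_of_serO_eq (hN.coeffAt hU i j) ?_
  have h1 := congrFun (congrFun h i) j
  simp only [serM, Matrix.of_apply] at h1
  have h2 := congrArg (expO (-(c j - c i)) w * ·) h1
  simp only [← mul_assoc, ← expO_add, neg_add_cancel, expO_zero, one_mul] at h2
  exact h2

/-- The norm of the coefficients, weighted by the exponentials at `z`, tends to zero. -/
theorem exists_small (h : NegOn P c U M) {w : Circle} (hU : U ∈ 𝓝 w) : ∃ z : ℂ,
    (∀ i j, Summable fun γ => ‖M i j γ * Complex.exp (qexp P c i j γ / z)‖) ∧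
      ∑ i, ∑ j, ∑' γ, ‖M i j γ * Complex.exp (qexp P c i j γ / z)‖ < 1 := by
  obtain ⟨d, rfl⟩ := exists_circle_exp w
  have h1 := h.exists_summable_exp hU
  rw [eventually_dirNhds_iff] at h1
  obtain ⟨r₀, hr, hr₀⟩ := (h1.curry.mono fun r hr => hr.self_of_nhds).and
    (self_mem_nhdsWithin (a := (0 : ℝ)) (s := Set.Ioi 0)) |>.exists
  have hr₀' : 0 < r₀ := hr₀
  have hpol : ∀ r : ℝ, ∀ i j γ, ‖M i j γ * Complex.exp (qexp P c i j γ / polar (r, d))‖ =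
      ‖M i j γ‖ * Real.exp (lev (Circle.exp d) (qexp P c i j γ) / r) := by
    intro r i j γ
    rw [norm_mul, norm_exp_div_polar]
  have hs0 : ∀ i j, Summable fun γ => ‖M i j γ * Complex.exp (qexp P c i j γ / polar (r₀, d))‖ := by
    intro i j
    refine ((hr i j).mul_right ‖Complex.exp ((c j - c i) / polar (r₀, d))‖).congr fun γ => ?_
    rw [← norm_mul, mul_assoc, ← Complex.exp_add, ← add_div, qexp, add_sub_assoc]
  have hle : ∀ r : ℝ, 0 < r → r ≤ r₀ → ∀ i j γ,
      ‖M i j γ * Complex.exp (qexp P c i j γ / polar (r, d))‖ ≤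
      ‖M i j γ * Complex.exp (qexp P c i j γ / polar (r₀, d))‖ := by
    intro r h0 hrr i j γ
    rw [hpol, hpol]
    by_cases hM : M i j γ = 0
    · simp [hM]
    · have hneg := ltAt_zero_iff.1 (h.neg i j γ hM _ (mem_of_mem_nhds hU))
      gcongr ‖M i j γ‖ * Real.exp ?_
      rw [div_le_div_iff₀ h0 hr₀']
      nlinarith
  have hev : ∀ᶠ r : ℝ in 𝓝[>] 0, 0 < r ∧ r ≤ r₀ := by
    filter_upwards [Ioo_mem_nhdsGT hr₀'] with r hr using ⟨hr.1, hr.2.le⟩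
  have hlim : Tendsto (fun r : ℝ => ∑ i, ∑ j, ∑' γ,
      ‖M i j γ * Complex.exp (qexp P c i j γ / polar (r, d))‖) (𝓝[>] 0) (𝓝 (∑ i : ι, ∑ j : ι, 0)) := by
    refine tendsto_finsetSum _ fun i _ => tendsto_finsetSum _ fun j _ => ?_
    suffices H : Tendsto (fun r : ℝ => ∑' γ, ‖M i j γ * Complex.exp (qexp P c i j γ / polar (r, d))‖)
        (𝓝[>] 0) (𝓝 (∑' _ : L, (0 : ℝ))) by simpa only [tsum_zero] using H
    refine tendsto_tsum_of_dominated_convergence (hs0 i j) (fun γ => ?_) ?_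
    · refine Tendsto.congr (fun r => (hpol r i j γ).symm) ?_
      by_cases hM : M i j γ = 0
      · simp [hM]
      · have hneg := ltAt_zero_iff.1 (h.neg i j γ hM _ (mem_of_mem_nhds hU))
        suffices H : Tendsto (fun r => ‖M i j γ‖ * Real.exp (lev (Circle.exp d) (qexp P c i j γ) / r))
            (𝓝[>] 0) (𝓝 (‖M i j γ‖ * 0)) by simpa only [mul_zero] using H
        refine Tendsto.const_mul _ (Real.tendsto_exp_atBot.comp ?_)
        refine Tendsto.congr (fun r => (div_eq_mul_inv _ _).symm) ?_
        exact tendsto_inv_nhdsGT_zero.const_mul_atTop_of_neg hneg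
    · filter_upwards [hev] with r hr γ
      rw [norm_norm]
      exact hle r hr.1 hr.2 i j γ
  simp only [Finset.sum_const_zero] at hlim
  obtain ⟨r, h2, h3⟩ := ((hlim.eventually (gt_mem_nhds one_pos)).and hev).exists
  exact ⟨polar (r, d), fun i j => (hs0 i j).of_nonneg_of_le (fun _ => norm_nonneg _)
    (hle r h3.1 h3.2 i j), h2⟩

end NegOn

end PeriodRH

namespace PeriodRH

set_option linter.unusedSectionVars false

variable {L : Type*} [AddCommGroup L] [Module.Free ℤ L] [Module.Finite ℤ L] {P : PeriodDatum L}
  {ι : Type*} [Fintype ι] [DecidableEq ι] {c : ι → ℂ} {U : Set Circle} {M N : ι → ι → L → ℂ}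

open Classical in
/-- Restriction of coefficients to a set of indices. -/
def restr (S : Set (ι × ι × L)) (y : ι → ι → L → ℂ) : ι → ι → L → ℂ :=
  fun i j γ => if (i, j, γ) ∈ S then y i j γ else 0

namespace NegOn

open Classical in
/-- Solution of `y = M - M P_S(y)` with `P_S` the restriction of coefficients to `S`. -/
theorem exists_solution (hM : NegOn P c U M) {w : Circle} (hU : U ∈ 𝓝 w) (S : Set (ι × ι × L))
    (hS : ∀ i j γ, (i, j, γ) ∈ S → ∀ v ∈ U, ltAt v (qexp P c i j γ) 0) :
    ∃ y, NegOn P c U y ∧ ∀ i k δ, y i k δ = M i k δ -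
      PeriodRH.mconv M (restr S y) i k δ := by
  obtain ⟨z, hz, hz1⟩ := hM.exists_small hU
  let χ : ι → ι → L → ℂ := fun i j γ => Complex.exp (qexp P c i j γ / z)
  have hχ0 : ∀ i j γ, χ i j γ ≠ 0 := fun i j γ => Complex.exp_ne_zero _
  have hχ : ∀ i j k γ δ, χ i k (γ + δ) = χ i j γ * χ j k δ := by
    intro i j k γ δ
    simp only [χ]
    rw [← Complex.exp_add, ← add_div, qexp_add i j k]
  let K : ι → (ι × L) → (ι × L) → ℂ := fun k g h =>
    if (h.1, k, h.2) ∈ S then M g.1 h.1 (g.2 - h.2) * χ g.1 h.1 (g.2 - h.2) else 0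
  set κ := ∑ i, ∑ j, ∑' γ, ‖M i j γ * χ i j γ‖ with hκ
  have hs1 : ∀ j γ', Summable fun g : ι × L => ‖M g.1 j (g.2 - γ') * χ g.1 j (g.2 - γ')‖ := by
    intro j γ'
    rw [summable_prod_of_nonneg fun _ => norm_nonneg _]
    exact ⟨fun i => (Equiv.subRight γ').summable_iff.2 (hz i j), summable_of_hasFiniteSupport (Set.toFinite _)⟩
  have hsK : ∀ k h, Summable fun g => ‖K k g h‖ := by
    intro k h
    by_cases hh : (h.1, k, h.2) ∈ S
    · simpa only [K, hh, if_true] using hs1 h.1 h.2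
    · simp only [K, hh, if_false, norm_zero]
      exact summable_zero
  have hκK : ∀ k h, ∑' g, ‖K k g h‖ ≤ κ := by
    intro k h
    have hnn : ∀ i j, 0 ≤ ∑' γ, ‖M i j γ * χ i j γ‖ := fun i j => tsum_nonneg fun _ => norm_nonneg _
    by_cases hh : (h.1, k, h.2) ∈ S
    · simp only [K, hh, if_true]
      rw [(hs1 h.1 h.2).tsum_prod, tsum_fintype]
      refine Finset.sum_le_sum fun i _ => ?_
      have h1 : ∑' γ, ‖M i h.1 (γ - h.2) * χ i h.1 (γ - h.2)‖ = ∑' γ, ‖M i h.1 γ * χ i h.1 γ‖ :=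
        (Equiv.subRight h.2).tsum_eq fun γ => ‖M i h.1 γ * χ i h.1 γ‖
      refine h1.le.trans ?_
      exact Finset.single_le_sum (f := fun j => ∑' γ, ‖M i j γ * χ i j γ‖) (fun j _ => hnn i j)
        (Finset.mem_univ h.1)
    · simp only [K, hh, if_false, norm_zero, tsum_zero]
      exact Finset.sum_nonneg fun i _ => Finset.sum_nonneg fun j _ => hnn i j
  have hκ0 : 0 ≤ κ := Finset.sum_nonneg fun i _ => Finset.sum_nonneg fun j _ =>
    tsum_nonneg fun _ => norm_nonneg _
  have hm : ∀ k, Summable fun g : ι × L => ‖M g.1 k g.2 * χ g.1 k g.2‖ := by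
    intro k
    simpa using hs1 k 0
  choose y hy hyK using fun k => l1_solve (hsK k) (hκK k) hκ0 hz1 (hm k)
  have hval : ∀ i k δ, y k (i, δ) = M i k δ * χ i k δ -
      PeriodRH.mconv M (restr S fun j k γ => y k (j, γ) / χ j k γ) i k δ * χ i k δ := by
    intro i k δ
    rw [hyK k (i, δ), ((l1_apply (hsK k) (hκK k) (hy k)).1 (i, δ)).tsum_prod, tsum_fintype,
      PeriodRH.mconv, Finset.sum_mul]
    congr 1
    refine Finset.sum_congr rfl fun j _ => ?_
    unfold cv
    rw [← tsum_mul_right]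
    refine tsum_congr fun γ => ?_
    by_cases hh : (j, k, γ) ∈ S
    · simp only [K, restr, hh, if_true]
      have h1 := hχ i j k (δ - γ) γ
      rw [sub_add_cancel] at h1
      rw [h1]
      have := hχ0 j k γ
      field_simp
    · simp only [K, restr, hh, if_false]
      ring
  refine ⟨fun i k δ => y k (i, δ) / χ i k δ, ?_, fun i k δ => ?_⟩
  · refine of_summable_exp (z := z) (fun i k δ h0 v hv => ?_) fun i k => ?_
    · have h1 : y k (i, δ) ≠ 0 := fun h => h0 (by rw [h, zero_div])
      rw [hval, ← sub_mul] at h1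
      by_cases h2 : M i k δ = 0
      · have h3 := left_ne_zero_of_mul h1
        rw [h2, zero_sub, neg_ne_zero] at h3
        obtain ⟨j, -, hj⟩ := Finset.exists_ne_zero_of_sum_ne_zero h3
        obtain ⟨γ, h4, h5⟩ := exists_of_cv_ne_zero hj
        rw [← sub_add_cancel δ γ, qexp_add i j k]
        refine ltAt_zero_add (hM.neg _ _ _ h4 v hv) (hS _ _ _ (by_contra fun h6 => h5 ?_) v hv)
        simp only [restr, h6, if_false]
      · exact hM.neg _ _ _ h2 v hv
    · have h1 : Summable fun γ => ‖y k (i, γ)‖ := (hy k).prod_factor i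
      refine (h1.mul_right ‖Complex.exp (-(c k - c i) / z)‖).congr fun γ => ?_
      rw [← norm_mul]
      congr 1
      have h2 := hχ0 i k γ
      rw [div_mul_eq_mul_div, eq_div_iff h2, mul_assoc, ← Complex.exp_add]
      congr 3
      simp only [qexp]
      ring
  · have h2 := hχ0 i k δ
    rw [div_eq_iff h2, sub_mul]
    exact hval i k δ

theorem restr (h : NegOn P c U M) (S : Set (ι × ι × L)) : NegOn P c U (PeriodRH.restr S M) :=
  h.of_norm_le fun i j γ => by unfold PeriodRH.restr; split_ifs <;> simp

theorem const_mul (h : NegOn P c U M) (b : ℂ) {w : Circle} (hU : U ∈ 𝓝 w) :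
    NegOn P c U (fun i j γ => b * M i j γ) ∧
      serM P c (fun i j γ => b * M i j γ) w = (Hol.const b : O w) • serM P c M w := by
  obtain ⟨ϱ, hϱ, hs⟩ := h.summable
  refine ⟨⟨fun i j γ h0 => h.neg i j γ (right_ne_zero_of_mul h0), ϱ, hϱ, fun i j => ?_⟩, ?_⟩
  · simp only [norm_mul, mul_assoc]
    exact (hs i j).mul_left _
  · ext i j
    simp only [serM, Matrix.of_apply, Matrix.smul_apply, smul_eq_mul]
    rw [(h.coeffAt hU i j).serO_smul]
    ring

/-- Right multiplication of `1 + M` by `1 + M₂`, with `M₂` supported in `S`, removes the terms with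
index in `S`. -/
theorem exists_factor (hM : NegOn P c U M) {w : Circle} (hw : U ∈ 𝓝 w) (S : Set (ι × ι × L)) :
    ∃ M₁ M₂, NegOn P c U M₁ ∧ NegOn P c U M₂ ∧ (∀ i j γ, M₁ i j γ ≠ 0 → (i, j, γ) ∉ S) ∧
      (∀ i j γ, M₂ i j γ ≠ 0 → (i, j, γ) ∈ S) ∧
      ∀ v, U ∈ 𝓝 v → (1 + serM P c M v) * (1 + serM P c M₂ v) = 1 + serM P c M₁ v := by
  classical
  set S' : Set (ι × ι × L) := {x | x ∈ S ∧ ∀ v ∈ U, ltAt v (qexp P c x.1 x.2.1 x.2.2) 0} with hS'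
  obtain ⟨y, hy, hyM⟩ := hM.exists_solution hw S' fun i j γ h => h.2
  set y' : ι → ι → L → ℂ := PeriodRH.restr S' y with hy'
  have hyn : NegOn P c U y' := hy.restr S'
  have hy2 : NegOn P c U (fun i j γ => -1 * y' i j γ) := (hyn.const_mul _ hw).1
  refine ⟨fun i j γ => y i j γ + -1 * y' i j γ, fun i j γ => -1 * y' i j γ,
    hy.add hy2 hw, hy2, fun i j γ h0 hmem => ?_, fun i j γ h0 => ?_, fun v hv' => ?_⟩
  · by_cases h1 : (i, j, γ) ∈ S'
    · simp [hy', PeriodRH.restr, h1] at h0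
    · simp only [hy', PeriodRH.restr, h1, if_false, mul_zero, add_zero] at h0
      exact h1 ⟨hmem, hy.neg i j γ h0⟩
  · by_contra h1
    have h2 : (i, j, γ) ∉ S' := fun h => h1 h.1
    simp [hy', PeriodRH.restr, h2] at h0
  · have e : y = fun i j γ => M i j γ + -1 * PeriodRH.mconv M y' i j γ := by
      funext i j γ
      rw [hyM i j γ]
      ring
    have hmc := (hM.mconv hyn hv').const_mul (-1) hv'
    rw [hy.serM_add hy2 hv', (hyn.const_mul (-1) hv').2]
    rw [show serM P c y v = serM P c M v + serM P c (fun i j γ => -1 * PeriodRH.mconv M y' i j γ) v by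
      conv_lhs => rw [e]
      exact hM.serM_add hmc.1 hv']
    rw [hmc.2, hM.serM_mconv hyn hv', map_neg, map_one]
    simp only [neg_smul, one_smul]
    noncomm_ring

theorem exists_inv (hM : NegOn P c U M) {w : Circle} (hw : U ∈ 𝓝 w) : ∃ N, NegOn P c U N ∧ ∀ v, U ∈ 𝓝 v →
    (1 + serM P c M v) * (1 + serM P c N v) = 1 ∧ (1 + serM P c N v) * (1 + serM P c M v) = 1 := by
  obtain ⟨M₁, N, h1, h2, h3, -, h5⟩ := hM.exists_factor hw Set.univ
  refine ⟨N, h2, fun v hv => ?_⟩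
  have h6 : M₁ = fun _ _ _ => 0 := by
    funext i j γ
    by_contra h
    exact h3 i j γ h trivial
  have h7 := h5 v hv
  rw [h6, serM_zero, add_zero] at h7
  exact ⟨h7, mul_eq_one_comm.1 h7⟩

theorem exists_mul (hM : NegOn P c U M) (hN : NegOn P c U N) {w : Circle} (hw' : U ∈ 𝓝 w) :
    ∃ M', NegOn P c U M' ∧ ∀ v, U ∈ 𝓝 v →
      (1 + serM P c M v) * (1 + serM P c N v) = 1 + serM P c M' v := by
  have h1 := hM.mconv hN hw'
  have h2 := hM.add hN hw'
  refine ⟨_, h2.add h1 hw', fun v hv' => ?_⟩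
  rw [h2.serM_add h1 hv', hM.serM_add hN hv', hM.serM_mconv hN hv']
  noncomm_ring

end NegOn

end PeriodRH

namespace PeriodRH

set_option linter.unusedSectionVars false

/-! ### Arcs and signs -/

theorem lev_exp (θ : ℝ) (q : ℂ) :
    lev (Circle.exp θ) q = Real.cos θ * q.re + Real.sin θ * q.im := by
  rw [lev, Circle.coe_inv, ← Circle.coe_inv, ← Circle.exp_neg, Circle.coe_exp, Complex.mul_re,
    Complex.exp_ofReal_mul_I_re, Complex.exp_ofReal_mul_I_im, Real.cos_neg, Real.sin_neg]
  ring

/-- A sinusoid that is nonnegative at two points of distance less than `π` is nonnegative between. -/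
theorem lev_nonneg_of_between {θ₀ θ₁ θ₂ : ℝ} {q : ℂ} (h01 : θ₀ < θ₁) (h12 : θ₁ < θ₂)
    (h02 : θ₂ - θ₀ < Real.pi) (h0 : 0 ≤ lev (Circle.exp θ₀) q) (h2 : 0 ≤ lev (Circle.exp θ₂) q) :
    0 ≤ lev (Circle.exp θ₁) q := by
  have e : Real.sin (θ₂ - θ₀) * lev (Circle.exp θ₁) q =
      Real.sin (θ₂ - θ₁) * lev (Circle.exp θ₀) q + Real.sin (θ₁ - θ₀) * lev (Circle.exp θ₂) q := by
    simp only [lev_exp, Real.sin_sub]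
    ring
  have h3 : 0 < Real.sin (θ₂ - θ₀) := Real.sin_pos_of_pos_of_lt_pi (by linarith) h02
  have h4 : 0 < Real.sin (θ₂ - θ₁) := Real.sin_pos_of_pos_of_lt_pi (by linarith) (by linarith)
  have h5 : 0 < Real.sin (θ₁ - θ₀) := Real.sin_pos_of_pos_of_lt_pi (by linarith) (by linarith)
  have h6 : 0 ≤ Real.sin (θ₂ - θ₀) * lev (Circle.exp θ₁) q := by rw [e]; positivity
  exact nonneg_of_mul_nonneg_right h6 h3

/-- Negativity of an exponent over a set of angles. -/
def NegAng (s : Set ℝ) (q : ℂ) : Prop := ∀ θ ∈ s, ltAt (Circle.exp θ) q 0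

theorem negAng_right {a a' b : ℝ} (hab : a' < b) {q : ℂ}
    (h1 : NegAng (Set.Ioo a' b) q) (h2 : ¬ NegAng (Set.Ioo a b) q) :
    NegAng (Set.Ioc a' (a + Real.pi)) q := by
  unfold NegAng at h2
  push Not at h2
  obtain ⟨θ₀, h0, h0'⟩ := h2
  rw [ltAt_zero_iff, not_lt] at h0'
  intro θ hθ
  rw [ltAt_zero_iff]
  by_contra hcon
  push Not at hcon
  have h3 : b ≤ θ := by
    by_contra h
    push Not at h
    exact hcon.not_gt (ltAt_zero_iff.1 (h1 θ ⟨hθ.1, h⟩))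
  have h4 : θ₀ ≤ a' := by
    by_contra h
    push Not at h
    exact h0'.not_gt (ltAt_zero_iff.1 (h1 θ₀ ⟨h, h0.2⟩))
  have h5 := lev_nonneg_of_between (θ₁ := (a' + b) / 2) (by linarith) (by linarith)
    (by linarith [hθ.2, h0.1]) h0' hcon
  exact h5.not_gt (ltAt_zero_iff.1 (h1 _ ⟨by linarith, by linarith⟩))

theorem negAng_left {a' b' s : ℝ} (hab : a' < s) {q : ℂ}
    (h1 : NegAng (Set.Ioc a' s) q) (h2 : ¬ NegAng (Set.Ioo a' b') q) :
    NegAng (Set.Icc (b' - Real.pi) s) q := by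
  unfold NegAng at h2
  push Not at h2
  obtain ⟨θ₀, h0, h0'⟩ := h2
  rw [ltAt_zero_iff, not_lt] at h0'
  intro θ hθ
  rw [ltAt_zero_iff]
  by_contra hcon
  push Not at hcon
  have h3 : θ ≤ a' := by
    by_contra h
    push Not at h
    exact hcon.not_gt (ltAt_zero_iff.1 (h1 θ ⟨h, hθ.2⟩))
  have h4 : s < θ₀ := by
    by_contra h
    push Not at h
    exact h0'.not_gt (ltAt_zero_iff.1 (h1 θ₀ ⟨h0.1, h⟩))
  have h5 := lev_nonneg_of_between (θ₁ := s) (by linarith) h4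
    (by linarith [hθ.1, h0.2]) hcon h0'
  exact h5.not_gt (ltAt_zero_iff.1 (h1 _ ⟨hab, le_rfl⟩))

theorem image_exp_mem_nhds {s : Set ℝ} {θ : ℝ} (h : s ∈ 𝓝 θ) : Circle.exp '' s ∈ 𝓝 (Circle.exp θ) :=
  isLocalHomeomorph_circleExp.isOpenMap.image_mem_nhds h

theorem eventually_exp_iff {p : Circle → Prop} {θ : ℝ} :
    (∀ᶠ v in 𝓝 (Circle.exp θ), p v) ↔ ∀ᶠ t in 𝓝 θ, p (Circle.exp t) := by
  rw [← isLocalHomeomorph_circleExp.map_nhds_eq θ, eventually_map]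

variable {L : Type*} [AddCommGroup L] [Module.Free ℤ L] [Module.Finite ℤ L] {P : PeriodDatum L}
  {ι : Type*} [Fintype ι] [DecidableEq ι] {c : ι → ℂ}

theorem NegOn.of_negAng {s s' : Set ℝ} {M : ι → ι → L → ℂ} (h : NegOn P c (Circle.exp '' s) M)
    (hs : ∀ i j γ, M i j γ ≠ 0 → NegAng s' (qexp P c i j γ)) : NegOn P c (Circle.exp '' s') M :=
  ⟨fun i j γ h0 => by rintro _ ⟨θ, hθ, rfl⟩; exact hs i j γ h0 θ hθ, h.summable⟩

theorem NegOn.negAng {s : Set ℝ} {M : ι → ι → L → ℂ} (h : NegOn P c (Circle.exp '' s) M) {i j : ι}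
    {γ : L} (h0 : M i j γ ≠ 0) : NegAng s (qexp P c i j γ) :=
  fun θ hθ => h.neg i j γ h0 _ ⟨θ, hθ, rfl⟩

/-! ### Gluing local trivialisations -/

variable (P c) in
/-- A sheaf of invertible matrices whose sections differ locally by right factors `1 + ∑ M e^{q/z}`
with negative exponents. -/
structure TrivSheaf where
  /-- being a section near a point -/
  T : Circle → (∀ v, Matrix ι ι (O v)) → Prop
  nearby : ∀ {w Ψ}, T w Ψ → ∀ᶠ v in 𝓝 w, T v Ψ
  compare : ∀ {w Ψ Ψ'}, T w Ψ → T w Ψ' → ∃ U ∈ 𝓝 w, ∃ M, NegOn P c U M ∧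
    ∀ᶠ v in 𝓝 w, Ψ' v = Ψ v * (1 + serM P c M v)
  mul : ∀ {w Ψ Ψ' U M}, T w Ψ → U ∈ 𝓝 w → NegOn P c U M →
    (∀ᶠ v in 𝓝 w, Ψ' v = Ψ v * (1 + serM P c M v)) → T w Ψ'
  isUnit : ∀ {w Ψ}, T w Ψ → IsUnit (Ψ w)

namespace TrivSheaf

variable (F : TrivSheaf P c)

/-- Sections over the arc of angles between `a` and `b`. -/
def On (a b : ℝ) (Ψ : ∀ v, Matrix ι ι (O v)) : Prop := ∀ θ ∈ Set.Ioo a b, F.T (Circle.exp θ) Ψ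

variable {F} {a a' b b' : ℝ} {Ψ Ψ' : ∀ v, Matrix ι ι (O v)}

theorem congr {w : Circle} (h : F.T w Ψ) (he : ∀ᶠ v in 𝓝 w, Ψ' v = Ψ v) : F.T w Ψ' :=
  F.mul h univ_mem (NegOn.zero) (by
    filter_upwards [he] with v hv
    rw [NegOn.serM_zero, add_zero, mul_one, hv])

theorem On.mono (h : F.On a b Ψ) (ha : a ≤ a') (hb : b' ≤ b) : F.On a' b' Ψ :=
  fun θ hθ => h θ ⟨ha.trans_lt hθ.1, hθ.2.trans_le hb⟩

theorem On.mul {M : ι → ι → L → ℂ} (h : F.On a b Ψ) (hM : NegOn P c (Circle.exp '' Set.Ioo a b) M) :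
    F.On a b fun v => Ψ v * (1 + serM P c M v) :=
  fun θ hθ => F.mul (h θ hθ) (image_exp_mem_nhds (Ioo_mem_nhds hθ.1 hθ.2)) hM
    (Eventually.of_forall fun _ => rfl)

theorem On.compare (h : F.On a b Ψ) (h' : F.On a b Ψ') :
    ∃ M, NegOn P c (Circle.exp '' Set.Ioo a b) M ∧
      ∀ θ ∈ Set.Ioo a b, Ψ' (Circle.exp θ) = Ψ (Circle.exp θ) * (1 + serM P c M (Circle.exp θ)) := by
  by_cases hab : a < b
  swap
  · exact ⟨_, NegOn.zero, fun θ hθ => (hab (hθ.1.trans hθ.2)).elim⟩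
  have key : ∀ θ : ℝ, ∃ M : ι → ι → L → ℂ, θ ∈ Set.Ioo a b → (∃ U ∈ 𝓝 (Circle.exp θ), NegOn P c U M) ∧
      ∀ᶠ v in 𝓝 (Circle.exp θ), Ψ' v = Ψ v * (1 + serM P c M v) := by
    intro θ
    by_cases hθ : θ ∈ Set.Ioo a b
    · obtain ⟨U, hU, M, h1, h2⟩ := F.compare (h θ hθ) (h' θ hθ)
      exact ⟨M, fun _ => ⟨⟨U, hU, h1⟩, h2⟩⟩
    · exact ⟨0, fun h => (hθ h).elim⟩
  choose m hm using key
  have hloc : ∀ θ ∈ Set.Ioo a b, ∀ᶠ t in 𝓝 θ, m t = m θ := by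
    intro θ hθ
    obtain ⟨⟨U, hU, hUM⟩, hev⟩ := hm θ hθ
    have h1 := eventually_exp_iff.1 (eventually_eventually_nhds.2 hev)
    have h2 := eventually_exp_iff.1 (eventually_mem_nhds_iff.2 hU)
    filter_upwards [h1, h2, Ioo_mem_nhds hθ.1 hθ.2] with t h3 h4 h5
    obtain ⟨⟨V, hV, hVM⟩, hev'⟩ := hm t h5
    have h6 : Ψ (Circle.exp t) * (1 + serM P c (m t) (Circle.exp t)) =
        Ψ (Circle.exp t) * (1 + serM P c (m θ) (Circle.exp t)) := by
      rw [← h3.self_of_nhds, ← hev'.self_of_nhds]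
    have h7 := add_left_cancel ((F.isUnit (h t h5)).mul_left_cancel h6)
    exact (hVM.mono Set.inter_subset_right).serM_injective (hUM.mono Set.inter_subset_left)
      (inter_mem h4 hV) h7
  have hconst : ∀ t ∈ Set.Ioo a b, ∀ θ ∈ Set.Ioo a b, m t = m θ := by
    let _ : TopologicalSpace (ι → ι → L → ℂ) := ⊥
    have : DiscreteTopology (ι → ι → L → ℂ) := ⟨rfl⟩
    intro t ht θ hθ
    refine isPreconnected_Ioo.constant_of_mapsTo (T := Set.univ) (f := m) (isDiscrete_iff_discreteTopology.2 inferInstance) ?_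
      (fun _ _ => trivial) ht hθ
    intro x hx
    refine ContinuousAt.continuousWithinAt ?_
    have : m =ᶠ[𝓝 x] fun _ => m x := hloc x hx
    exact continuousAt_const.congr this.symm
  have hmid : (a + b) / 2 ∈ Set.Ioo a b := ⟨by linarith, by linarith⟩
  refine ⟨m ((a + b) / 2), ⟨?_, ?_⟩, fun θ hθ => ?_⟩
  · rintro i j γ h0 _ ⟨θ, hθ, rfl⟩
    obtain ⟨⟨U, hU, hUM⟩, -⟩ := hm θ hθ
    exact hUM.neg i j γ (by rwa [hconst θ hθ _ hmid]) _ (mem_of_mem_nhds hU)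
  · obtain ⟨⟨U, hU, hUM⟩, -⟩ := hm _ hmid
    exact hUM.summable
  · rw [← hconst θ hθ _ hmid]
    exact (hm θ hθ).2.self_of_nhds

open Classical in
/-- Sections that agree on the intersection of two arcs have a common extension. -/
theorem On.union (hlen : b' - a ≤ 2 * Real.pi) (haa : a ≤ a') (hab : a' < b) (hbb : b ≤ b')
    (h : F.On a b Ψ) (h' : F.On a' b' Ψ')
    (he : ∀ θ ∈ Set.Ioo a' b, Ψ (Circle.exp θ) = Ψ' (Circle.exp θ)) :
    ∃ Ψ'', F.On a b' Ψ'' ∧ (∀ θ ∈ Set.Ioo a b, Ψ'' (Circle.exp θ) = Ψ (Circle.exp θ)) ∧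
      ∀ θ ∈ Set.Ioo a' b', Ψ'' (Circle.exp θ) = Ψ' (Circle.exp θ) := by
  set Ψ'' : ∀ v, Matrix ι ι (O v) := fun v => if v ∈ Circle.exp '' Set.Ioo a b then Ψ v else Ψ' v
  have h1 : ∀ θ ∈ Set.Ioo a b, Ψ'' (Circle.exp θ) = Ψ (Circle.exp θ) :=
    fun θ hθ => if_pos ⟨θ, hθ, rfl⟩
  have h2 : ∀ θ ∈ Set.Ioo a' b', Ψ'' (Circle.exp θ) = Ψ' (Circle.exp θ) := by
    intro θ hθ
    by_cases h3 : θ < b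
    · rw [← he θ ⟨hθ.1, h3⟩]
      exact h1 θ ⟨haa.trans_lt hθ.1, h3⟩
    · refine if_neg ?_
      rintro ⟨t, ht, hte⟩
      have : t = θ := Circle.exp_injOn_Ico (a := a) (b := b') hlen ⟨ht.1.le, ht.2.trans_le hbb⟩
        ⟨(haa.trans_lt hθ.1).le, hθ.2⟩ hte
      linarith [ht.2]
  refine ⟨Ψ'', fun θ hθ => ?_, h1, h2⟩
  by_cases h3 : θ < b
  · refine congr (h θ ⟨hθ.1, h3⟩) (eventually_exp_iff.2 ?_)
    filter_upwards [Ioo_mem_nhds hθ.1 h3] with t ht using h1 t ht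
  · refine congr (h' θ ⟨by linarith, hθ.2⟩) (eventually_exp_iff.2 ?_)
    filter_upwards [Ioo_mem_nhds (show a' < θ by linarith) hθ.2] with t ht using h2 t ht

theorem On.exists_right (h : F.On a b Ψ) (h' : F.On a' b' Ψ') (haa : a ≤ a') (hab : a' < b)
    (hbb : b ≤ b') :
    ∃ Ψm M, F.On a b Ψm ∧ NegOn P c (Circle.exp '' Set.Ioc a' (a + Real.pi)) M ∧
      ∀ θ ∈ Set.Ioo a' b, Ψm (Circle.exp θ) = Ψ' (Circle.exp θ) * (1 + serM P c M (Circle.exp θ)) := by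
  obtain ⟨M, hM, he⟩ := (h'.mono le_rfl hbb).compare (h.mono haa le_rfl)
  have hnh : ∀ θ ∈ Set.Ioo a' b, Circle.exp '' Set.Ioo a' b ∈ 𝓝 (Circle.exp θ) :=
    fun θ hθ => image_exp_mem_nhds (Ioo_mem_nhds hθ.1 hθ.2)
  obtain ⟨M₁, M₂, h1, h2, h3, h4, h5⟩ := hM.exists_factor
    (hnh ((a' + b) / 2) ⟨by linarith, by linarith⟩)
    {x | NegAng (Set.Ioo a b) (qexp P c x.1 x.2.1 x.2.2)}
  refine ⟨_, M₁, h.mul (h2.of_negAng h4), h1.of_negAng fun i j γ h0 =>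
    negAng_right hab (h1.negAng h0) (h3 i j γ h0), fun θ hθ => ?_⟩
  rw [he θ hθ, mul_assoc, h5 _ (hnh θ hθ)]

/-- Gluing over an arc of length at most `π`. -/
theorem On.glue (h : F.On a b Ψ) (h' : F.On a' b' Ψ') (haa : a ≤ a') (hab : a' < b)
    (hbb : b ≤ b') (hlen : b' - a ≤ Real.pi) : ∃ Ψ'', F.On a b' Ψ'' := by
  obtain ⟨Ψm, M, h1, h2, h3⟩ := h.exists_right h' haa hab hbb
  have h4 : NegOn P c (Circle.exp '' Set.Ioo a' b') M :=
    h2.mono (Set.image_mono fun θ hθ => ⟨hθ.1, by linarith [hθ.2]⟩)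
  obtain ⟨Ψ'', h5, -⟩ := h1.union (by linarith [Real.pi_pos]) haa hab hbb (h'.mul h4) h3
  exact ⟨Ψ'', h5⟩

/-- The obstruction to gluing over an arc of length larger than `π` can be concentrated in exponents
that are negative on a neighbourhood of the complementary arc. -/
theorem On.exists_cocycle (h : F.On a b Ψ) (h' : F.On a' b' Ψ') (haa : a ≤ a') (hab : a' < b)
    (hbb : b ≤ b') (hlen : b ≤ a + Real.pi) (hlen' : b' - Real.pi ≤ a') :
    ∃ Ψm Ψp N, F.On a b Ψm ∧ F.On a' b' Ψp ∧
      NegOn P c (Circle.exp '' Set.Icc (b' - Real.pi) (a + Real.pi)) N ∧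
      ∀ θ ∈ Set.Ioo a' b, Ψm (Circle.exp θ) = Ψp (Circle.exp θ) * (1 + serM P c N (Circle.exp θ)) := by
  obtain ⟨Ψm, M, h1, h2, h3⟩ := h.exists_right h' haa hab hbb
  have hn : ∀ θ ∈ Set.Ioo a' b, Circle.exp '' Set.Ioc a' (a + Real.pi) ∈ 𝓝 (Circle.exp θ) :=
    fun θ hθ => image_exp_mem_nhds (Ioc_mem_nhds hθ.1 (hθ.2.trans_le hlen))
  have hn' : ∀ θ ∈ Set.Ioo a' b,
      Circle.exp '' Set.Icc (b' - Real.pi) (a + Real.pi) ∈ 𝓝 (Circle.exp θ) :=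
    fun θ hθ => image_exp_mem_nhds (Icc_mem_nhds (hlen'.trans_lt hθ.1) (hθ.2.trans_le hlen))
  have hmid : (a' + b) / 2 ∈ Set.Ioo a' b := ⟨by linarith, by linarith⟩
  obtain ⟨N₁, h4, h5⟩ := h2.exists_inv (hn _ hmid)
  obtain ⟨N₃, N₂, h6, h7, h8, h9, h10⟩ := h4.exists_factor (hn _ hmid)
    {x | NegAng (Set.Ioo a' b') (qexp P c x.1 x.2.1 x.2.2)}
  have h11 : NegOn P c (Circle.exp '' Set.Icc (b' - Real.pi) (a + Real.pi)) N₃ :=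
    h6.of_negAng fun i j γ h0 => negAng_left (by linarith) (h6.negAng h0) (h8 i j γ h0)
  obtain ⟨N, h12, h13⟩ := h11.exists_inv (hn' _ hmid)
  refine ⟨Ψm, _, N, h1, h'.mul (h7.of_negAng h9), h12, fun θ hθ => ?_⟩
  have e : Ψ' (Circle.exp θ) * (1 + serM P c N₂ (Circle.exp θ)) =
      Ψm (Circle.exp θ) * (1 + serM P c N₃ (Circle.exp θ)) := by
    rw [h3 θ hθ, ← h10 _ (hn θ hθ), mul_assoc, ← mul_assoc (1 + serM P c M _) (1 + serM P c N₁ _),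
      (h5 _ (hn θ hθ)).1, one_mul]
  rw [e, mul_assoc, (h13 _ (hn' θ hθ)).1, mul_one]

/-- Sections exist near compact arcs of length less than `π`. -/
theorem exists_on {x y : ℝ} (hxy : x ≤ y) (hlen : y - x < Real.pi)
    (hex : ∀ θ ∈ Set.Icc x y, ∃ Ψ, F.T (Circle.exp θ) Ψ) : ∃ δ > 0, ∃ Ψ, F.On (x - δ) (y + δ) Ψ := by
  have key : ∀ θ : Set.Icc x y, ∃ r > 0, ∃ Ψ, ∀ t ∈ Metric.ball (θ : ℝ) r, F.T (Circle.exp t) Ψ := by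
    rintro ⟨θ, hθ⟩
    obtain ⟨Ψ, hΨ⟩ := hex θ hθ
    obtain ⟨r, hr, hb⟩ := Metric.eventually_nhds_iff_ball.1 (eventually_exp_iff.1 (F.nearby hΨ))
    exact ⟨r, hr, Ψ, hb⟩
  choose r hr Ψ hΨ using key
  obtain ⟨δ₀, hδ₀, hball⟩ := lebesgue_number_lemma_of_metric (isCompact_Icc (a := x) (b := y))
    (c := fun θ : Set.Icc x y => Metric.ball (θ : ℝ) (r θ)) (fun _ => Metric.isOpen_ball)
    (fun θ hθ => Set.mem_iUnion.2 ⟨⟨θ, hθ⟩, Metric.mem_ball_self (hr _)⟩)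
  set δ := min δ₀ ((Real.pi - (y - x)) / 2) with hδ
  have hδpos : 0 < δ := lt_min hδ₀ (by linarith)
  have hδle : δ ≤ δ₀ := min_le_left _ _
  have hδle' : δ ≤ (Real.pi - (y - x)) / 2 := min_le_right _ _
  have hloc : ∀ t ∈ Set.Icc x y, ∃ Ψ, F.On (t - δ) (t + δ) Ψ := by
    intro t ht
    obtain ⟨i, hi⟩ := hball t ht
    refine ⟨Ψ i, fun θ hθ => hΨ i θ (hi ?_)⟩
    rw [Metric.mem_ball, Real.dist_eq, abs_lt]
    constructor <;> linarith [hθ.1, hθ.2]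
  have hind : ∀ n : ℕ, ∃ Ψ, F.On (x - δ) (min (x + n * (δ / 2)) y + δ) Ψ := by
    intro n
    induction n with
    | zero =>
      obtain ⟨Ψ, h⟩ := hloc x ⟨le_rfl, hxy⟩
      refine ⟨Ψ, h.mono le_rfl ?_⟩
      gcongr
      simp
    | succ n ih =>
      obtain ⟨Ψ, h⟩ := ih
      have h1 : min (x + (n + 1 : ℕ) * (δ / 2)) y ∈ Set.Icc x y :=
        ⟨le_min (by nlinarith [Nat.cast_nonneg (α := ℝ) (n + 1)]) hxy, min_le_right _ _⟩
      have h2 : min (x + (n + 1 : ℕ) * (δ / 2)) y ≤ min (x + n * (δ / 2)) y + δ / 2 := by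
        rw [← min_add_add_right]
        refine min_le_min (le_of_eq ?_) (by linarith)
        push_cast
        ring
      have h3 : min (x + n * (δ / 2)) y ≤ min (x + (n + 1 : ℕ) * (δ / 2)) y := by
        gcongr
        linarith
      obtain ⟨Ψ', h'⟩ := hloc _ h1
      exact h.glue h' (by linarith [h1.1]) (by linarith) (by linarith) (by linarith [h1.2])
  obtain ⟨n, hn⟩ := exists_nat_ge ((y - x) / (δ / 2))
  obtain ⟨Ψ, h⟩ := hind n
  rw [div_le_iff₀ (by positivity)] at hn
  rw [min_eq_right (by linarith)] at h
  exact ⟨δ, hδpos, Ψ, h⟩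

end TrivSheaf

end PeriodRH

namespace PeriodRH

/-! ### Laplace integrals along rays -/

theorem exp_ofReal_add_mul_I (x ψ : ℝ) : Complex.exp (x + ψ * Complex.I) = polar (Real.exp x, ψ) := by
  rw [polar, Complex.exp_add, Complex.ofReal_exp]

theorem diff_shift {g : ℂ → ℂ} {T w : ℂ} (h : DifferentiableAt ℂ g (T + w)) :
    DifferentiableAt ℂ (fun w => g (T + w)) w :=
  DifferentiableAt.comp w h (differentiableAt_id.const_add T)

theorem continuousOn_ray {k : ℂ → ℂ} {ψ : ℝ}
    (hd : ∀ r : ℝ, 0 < r → DifferentiableAt ℂ k (polar (r, ψ))) :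
    ContinuousOn (fun r : ℝ => k (polar (r, ψ))) (Set.Ioi 0) := by
  intro r hr
  have h1 : ContinuousAt (fun r : ℝ => polar (r, ψ)) r :=
    (continuous_polar.comp (by fun_prop : Continuous fun r : ℝ => (r, ψ))).continuousAt
  exact (ContinuousAt.comp (f := fun r : ℝ => polar (r, ψ)) (hd r hr).continuousAt h1).continuousWithinAt

theorem integrableOn_of_exp_bound {h : ℝ → ℂ} {C κ : ℝ} (hκ : 0 < κ)
    (hc : ContinuousOn h (Set.Ioi 0)) (hb : ∀ s, 0 < s → ‖h s‖ ≤ C * Real.exp (-κ * s)) :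
    MeasureTheory.IntegrableOn h (Set.Ioi 0) := by
  refine MeasureTheory.Integrable.mono' ((integrableOn_exp_mul_Ioi (neg_lt_zero.2 hκ) 0).const_mul C)
    (hc.aestronglyMeasurable measurableSet_Ioi) ?_
  filter_upwards [MeasureTheory.ae_restrict_mem measurableSet_Ioi] with s hs using hb s hs

theorem integrableOn_exp_iff (g : ℝ → ℂ) : MeasureTheory.Integrable (fun x => Real.exp x • g (Real.exp x)) ↔
    MeasureTheory.IntegrableOn g (Set.Ioi 0) := by
  rw [← MeasureTheory.integrableOn_univ, ← Real.range_exp, ← Set.image_univ]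
  symm
  simpa [abs_of_pos (Real.exp_pos _)] using
    MeasureTheory.integrableOn_image_iff_integrableOn_abs_deriv_smul MeasurableSet.univ
      (fun x _ => (Real.hasDerivAt_exp x).hasDerivWithinAt) (fun x _ y _ h => Real.exp_injective h) g

theorem integral_comp_exp (g : ℝ → ℂ) : ∫ x : ℝ, Real.exp x • g (Real.exp x) = ∫ r in Set.Ioi 0, g r := by
  rw [← MeasureTheory.setIntegral_univ, ← Real.range_exp, ← Set.image_univ]
  symm
  simpa [abs_of_pos (Real.exp_pos _)] using
    MeasureTheory.integral_image_eq_integral_abs_deriv_smul MeasurableSet.univ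
      (fun x _ => (Real.hasDerivAt_exp x).hasDerivWithinAt) (fun x _ y _ h => Real.exp_injective h) g

/-- Rotation of the path of integration. -/
theorem integral_ray_rotate {k : ℂ → ℂ} {ψ C δ : ℝ} (hδ : 0 < δ)
    (hd : ∀ r : ℝ, 0 < r → ∀ φ ∈ Set.uIcc 0 ψ, DifferentiableAt ℂ k (polar (r, φ)))
    (hb : ∀ r : ℝ, 0 < r → ∀ φ ∈ Set.uIcc 0 ψ, ‖k (polar (r, φ))‖ ≤ C * Real.exp (-δ * r)) :
    ∫ r in Set.Ioi (0 : ℝ), k r = ∫ r in Set.Ioi (0 : ℝ), k (polar (r, ψ)) * Complex.exp (ψ * Complex.I) := by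
  set F : ℂ → ℂ := fun u => k (Complex.exp u) * Complex.exp u with hF
  have hFd : ∀ u : ℂ, u.im ∈ Set.uIcc 0 ψ → DifferentiableAt ℂ F u := by
    intro u hu
    have h1 : Complex.exp u = polar (Real.exp u.re, u.im) := by
      rw [← exp_ofReal_add_mul_I, Complex.re_add_im]
    have h2 : DifferentiableAt ℂ k (Complex.exp u) := h1 ▸ hd _ (Real.exp_pos _) _ hu
    exact (h2.comp u Complex.differentiableAt_exp).mul Complex.differentiableAt_exp
  have hray : ∀ φ ∈ Set.uIcc 0 ψ, MeasureTheory.Integrable (fun x : ℝ => F (x + φ * Complex.I)) ∧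
      ∫ x : ℝ, F (x + φ * Complex.I) =
        ∫ r in Set.Ioi (0 : ℝ), k (polar (r, φ)) * Complex.exp (φ * Complex.I) := by
    intro φ hφ
    have e : (fun x : ℝ => F (x + φ * Complex.I)) = fun x : ℝ => Real.exp x •
        (fun r : ℝ => k (polar (r, φ)) * Complex.exp (φ * Complex.I)) (Real.exp x) := by
      funext x
      simp only [hF, exp_ofReal_add_mul_I]
      rw [polar, Complex.real_smul]
      ring
    rw [e]
    exact ⟨(integrableOn_exp_iff _).2 <| (integrableOn_of_exp_bound hδ (continuousOn_ray fun r hr => hd r hr φ hφ)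
      fun s hs => hb s hs φ hφ).mul_const _, 
      integral_comp_exp fun r : ℝ => k (polar (r, φ)) * Complex.exp (φ * Complex.I)⟩
  have h0 := hray 0 Set.left_mem_uIcc
  have h1 := hray ψ Set.right_mem_uIcc
  have e0 : ∫ r in Set.Ioi (0 : ℝ), k r = ∫ x : ℝ, F (x + (0 : ℝ) * Complex.I) := by
    rw [h0.2]
    simp [polar]
  rw [e0, ← h1.2]
  have hneg : Tendsto (fun X : ℝ => -X) atTop atBot := tendsto_neg_atTop_atBot
  have t0 := MeasureTheory.intervalIntegral_tendsto_integral h0.1 hneg tendsto_id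
  have t1 := MeasureTheory.intervalIntegral_tendsto_integral h1.1 hneg tendsto_id
  have hC : 0 ≤ C := by
    have := (norm_nonneg _).trans (hb 1 one_pos 0 Set.left_mem_uIcc)
    exact nonneg_of_mul_nonneg_left this (Real.exp_pos _)
  have hFb : ∀ x : ℝ, ∀ y ∈ Set.uIoc 0 ψ,
      ‖F (x + y * Complex.I)‖ ≤ C * (Real.exp (-δ * Real.exp x) * Real.exp x) := by
    intro x y hy
    simp only [hF]
    rw [exp_ofReal_add_mul_I, norm_mul, norm_polar, abs_of_pos (Real.exp_pos x), ← mul_assoc]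
    exact mul_le_mul_of_nonneg_right (hb _ (Real.exp_pos x) y (Set.uIoc_subset_uIcc hy)) (Real.exp_pos x).le
  have hvert : ∀ (l : ℝ → ℝ), Tendsto (fun X => Real.exp (-δ * Real.exp (l X)) * Real.exp (l X)) atTop (𝓝 0) →
      Tendsto (fun X => ∫ y in (0 : ℝ)..ψ, F (l X + y * Complex.I)) atTop (𝓝 0) := by
    intro l hl
    have h2 : Tendsto (fun X => C * (Real.exp (-δ * Real.exp (l X)) * Real.exp (l X)) * |ψ - 0|)
        atTop (𝓝 0) := by simpa using (hl.const_mul C).mul_const |ψ - 0|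
    exact squeeze_zero_norm (fun X => intervalIntegral.norm_integral_le_of_norm_le_const (hFb (l X))) h2
  have v1 := hvert (fun X => X) (by
    have h2 : Tendsto (fun y : ℝ => Real.exp (-δ * y) * y) atTop (𝓝 0) := by
      have h3 : Tendsto (fun y : ℝ => δ * y) atTop atTop := tendsto_id.const_mul_atTop hδ
      have := ((Real.tendsto_pow_mul_exp_neg_atTop_nhds_zero 1).comp h3).const_mul δ⁻¹
      rw [mul_zero] at this
      refine this.congr fun y => ?_
      simp only [Function.comp, pow_one, neg_mul]
      field_simp
    exact h2.comp Real.tendsto_exp_atTop)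
  have v2 := hvert (fun X => -X) (by
    have h2 : Tendsto (fun y : ℝ => Real.exp (-δ * y) * y) (𝓝 0) (𝓝 0) := by
      have : Continuous fun y : ℝ => Real.exp (-δ * y) * y := by fun_prop
      simpa using this.tendsto 0
    exact h2.comp (Real.tendsto_exp_atBot.comp hneg))
  have key : ∀ X : ℝ, (∫ x in (-X)..X, F (x + (0 : ℝ) * Complex.I)) =
      (∫ x in (-X)..X, F (x + ψ * Complex.I)) - Complex.I * (∫ y in (0 : ℝ)..ψ, F (X + y * Complex.I)) +
        Complex.I * (∫ y in (0 : ℝ)..ψ, F ((-X : ℝ) + y * Complex.I)) := by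
    intro X
    have := Complex.integral_boundary_rect_eq_zero_of_differentiableOn F ((-X : ℝ) : ℂ) (X + ψ * Complex.I)
      (fun u hu => (hFd u (by
        have h3 := hu.2
        simpa using h3)).differentiableWithinAt)
    simp only [Complex.ofReal_re, Complex.ofReal_im, Complex.add_re, Complex.add_im, Complex.mul_re,
      Complex.mul_im, Complex.I_re, Complex.I_im, mul_zero, mul_one, sub_zero, add_zero, zero_add,
      smul_eq_mul] at this
    linear_combination this
  have t2 : Tendsto (fun X : ℝ => ∫ x in (-X)..X, F (x + (0 : ℝ) * Complex.I)) atTop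
      (𝓝 ((∫ x : ℝ, F (x + ψ * Complex.I)) - Complex.I * 0 + Complex.I * 0)) := by
    simp only [key]
    exact (t1.sub (v1.const_mul _)).add (v2.const_mul _)
  rw [mul_zero, sub_zero, add_zero] at t2
  exact tendsto_nhds_unique t0 t2

theorem differentiableAt_laplace {h : ℝ → ℂ} {C κ : ℝ} (hc : ContinuousOn h (Set.Ioi 0))
    (hb : ∀ s, 0 < s → ‖h s‖ ≤ C * Real.exp (-κ * s)) (u : ℂ) {ζ₀ : ℂ} (hζ : (ζ₀ * u).re < κ) :
    DifferentiableAt ℂ (fun ζ : ℂ => ∫ s in Set.Ioi (0 : ℝ), Complex.exp (ζ * u * s) * h s) ζ₀ := by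
  set η := κ - (ζ₀ * u).re with hη
  have hη0 : 0 < η := by linarith
  have hC : 0 ≤ C := by
    have := (norm_nonneg _).trans (hb 1 one_pos)
    exact nonneg_of_mul_nonneg_left this (Real.exp_pos _)
  have hS : {ζ : ℂ | (ζ * u).re < (ζ₀ * u).re + η / 2} ∈ 𝓝 ζ₀ := by
    refine IsOpen.mem_nhds (isOpen_lt (by fun_prop) continuous_const) ?_
    change (ζ₀ * u).re < (ζ₀ * u).re + η / 2
    linarith
  have hmeas : ∀ k : ℝ → ℂ, ContinuousOn k (Set.Ioi 0) → MeasureTheory.AEStronglyMeasurable k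
      (MeasureTheory.volume.restrict (Set.Ioi 0)) := fun k hk => hk.aestronglyMeasurable measurableSet_Ioi
  have hbd : ∀ ζ : ℂ, (ζ * u).re < (ζ₀ * u).re + η / 2 → ∀ s : ℝ, 0 < s →
      ‖Complex.exp (ζ * u * s) * h s‖ ≤ C * Real.exp (-(η / 2) * s) := by
    intro ζ h1 s hs
    rw [norm_mul, Complex.norm_exp, Complex.re_mul_ofReal]
    calc Real.exp ((ζ * u).re * s) * ‖h s‖
        ≤ Real.exp (((ζ₀ * u).re + η / 2) * s) * (C * Real.exp (-κ * s)) := by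
          gcongr
          exact hb s hs
      _ = C * Real.exp (-(η / 2) * s) := by
          rw [mul_left_comm, ← Real.exp_add]
          congr 2
          rw [hη]; ring
  refine (hasDerivAt_integral_of_dominated_loc_of_deriv_le (𝕜 := ℂ) (s := _)
    (F' := fun ζ s => u * s * (Complex.exp (ζ * u * s) * h s))
    (bound := fun s => ‖u‖ * (4 / η) * (C * Real.exp (-(η / 4) * s))) hS ?_ ?_ ?_ ?_ ?_ ?_).2.differentiableAt
  · exact Eventually.of_forall fun ζ => hmeas _ (ContinuousOn.mul (by fun_prop) hc)
  · exact integrableOn_of_exp_bound (half_pos hη0) (ContinuousOn.mul (by fun_prop) hc)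
      (hbd ζ₀ (by linarith))
  · exact hmeas _ (ContinuousOn.mul (by fun_prop) (ContinuousOn.mul (by fun_prop) hc))
  · filter_upwards [MeasureTheory.ae_restrict_mem measurableSet_Ioi] with s hs ζ hζ
    have hs0 : 0 < s := hs
    have h2 : s ≤ 4 / η * Real.exp (η / 4 * s) := by
      have := Real.add_one_le_exp (η / 4 * s)
      have h3 : 4 / η * (η / 4 * s) = s := by field_simp
      calc s = 4 / η * (η / 4 * s) := h3.symm
        _ ≤ _ := by gcongr; linarith
    rw [norm_mul, norm_mul, Complex.norm_real, Real.norm_of_nonneg hs0.le]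
    calc ‖u‖ * s * ‖Complex.exp (ζ * u * s) * h s‖
        ≤ ‖u‖ * (4 / η * Real.exp (η / 4 * s)) * (C * Real.exp (-(η / 2) * s)) := by
          gcongr
          exact hbd ζ hζ s hs0
      _ = ‖u‖ * (4 / η) * (C * (Real.exp (η / 4 * s) * Real.exp (-(η / 2) * s))) := by ring
      _ = _ := by
          rw [← Real.exp_add]
          congr 4
          linarith
  · exact ((integrableOn_exp_mul_Ioi (by linarith : -(η / 4) < 0) 0).const_mul C).const_mul _
  · refine Eventually.of_forall fun s ζ _ => ?_
    have h3 : HasDerivAt (fun ζ : ℂ => ζ * u * s) (u * s) ζ := by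
      simpa using ((hasDerivAt_id ζ).mul_const u).mul_const (s : ℂ)
    refine (h3.cexp.mul_const (h s)).congr_deriv ?_
    ring

/-- A function on a half-line that decays like `exp (-Re(p) t)` and is a difference of two
exponentially small functions which extend to sectors of opening larger than `π / 2` on either side has
a Laplace transform without a pole at `p`. -/
theorem tendsto_laplace_of_sectors {gm gp : ℂ → ℂ} {T ψ κ C : ℝ} {p : ℂ} (hκ : 0 < κ)
    (hm : ∀ s : ℝ, 0 < s → ∀ φ ∈ Set.uIcc 0 ψ, DifferentiableAt ℂ gm (T + polar (s, φ)) ∧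
      ‖gm (T + polar (s, φ))‖ ≤ C * Real.exp (-κ * s))
    (hp : ∀ s : ℝ, 0 < s → ∀ φ ∈ Set.uIcc 0 (-ψ), DifferentiableAt ℂ gp (T + polar (s, φ)) ∧
      ‖gp (T + polar (s, φ))‖ ≤ C * Real.exp (-κ * s))
    (hh : ∀ s : ℝ, 0 < s → ‖gm (T + s) - gp (T + s)‖ ≤ C * Real.exp (-p.re * s)) (hp0 : 0 < p.re)
    (h1 : (p * Complex.exp (ψ * Complex.I)).re < 0)
    (h2 : (p * Complex.exp ((-ψ : ℝ) * Complex.I)).re < 0) :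
    Tendsto (fun σ : ℝ => σ * ∫ s in Set.Ioi (0 : ℝ), Complex.exp ((p - σ) * s) *
      (gm (T + s) - gp (T + s))) (𝓝[>] 0) (𝓝 0) := by
  have key : ∀ (g : ℂ → ℂ) (ψ : ℝ), (∀ s : ℝ, 0 < s → ∀ φ ∈ Set.uIcc 0 ψ,
      DifferentiableAt ℂ g (T + polar (s, φ)) ∧ ‖g (T + polar (s, φ))‖ ≤ C * Real.exp (-κ * s)) →
      ∃ B : ℂ → ℂ, (∀ ζ, (ζ * Complex.exp (ψ * Complex.I)).re < κ → DifferentiableAt ℂ B ζ) ∧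
        ∀ ζ, ‖ζ‖ < κ / 2 → MeasureTheory.IntegrableOn (fun s : ℝ => Complex.exp (ζ * s) * g (T + s))
          (Set.Ioi 0) ∧ B ζ = ∫ s in Set.Ioi (0 : ℝ), Complex.exp (ζ * s) * g (T + s) := by
    intro g ψ hg
    have hC : 0 ≤ C := by
      have := (norm_nonneg _).trans (hg 1 one_pos 0 Set.left_mem_uIcc).2
      exact nonneg_of_mul_nonneg_left this (Real.exp_pos _)
    have hgd : ∀ s : ℝ, 0 < s → ∀ φ ∈ Set.uIcc 0 ψ, DifferentiableAt ℂ (fun w => g (T + w)) (polar (s, φ)) :=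
      fun s hs φ hφ => diff_shift (hg s hs φ hφ).1
    refine ⟨fun ζ => ∫ s in Set.Ioi (0 : ℝ), Complex.exp (ζ * Complex.exp (ψ * Complex.I) * s) *
      (g (T + polar (s, ψ)) * Complex.exp (ψ * Complex.I)), fun ζ hζ => ?_, fun ζ hζ => ?_⟩
    · refine differentiableAt_laplace (C := C) (κ := κ) ?_ (fun s hs => ?_) _ hζ
      · exact (continuousOn_ray (k := fun w => g (T + w)) fun r hr => hgd r hr ψ Set.right_mem_uIcc).mul
          continuousOn_const
      · rw [norm_mul, Complex.norm_exp_ofReal_mul_I, mul_one]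
        exact (hg s hs ψ Set.right_mem_uIcc).2
    · have hd' : ∀ s : ℝ, 0 < s → ∀ φ ∈ Set.uIcc 0 ψ,
          DifferentiableAt ℂ (fun w => Complex.exp (ζ * w) * g (T + w)) (polar (s, φ)) := by
        intro s hs φ hφ
        exact DifferentiableAt.mul (by fun_prop) (hgd s hs φ hφ)
      have hb' : ∀ s : ℝ, 0 < s → ∀ φ ∈ Set.uIcc 0 ψ,
          ‖Complex.exp (ζ * polar (s, φ)) * g (T + polar (s, φ))‖ ≤ C * Real.exp (-(κ / 2) * s) := by
        intro s hs φ hφ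
        rw [norm_mul]
        calc _ ≤ Real.exp (κ / 2 * s) * (C * Real.exp (-κ * s)) := by
              refine mul_le_mul ?_ (hg s hs φ hφ).2 (norm_nonneg _) (Real.exp_pos _).le
              refine (Complex.norm_exp_le_exp_norm _).trans (Real.exp_le_exp.2 ?_)
              rw [norm_mul, norm_polar, abs_of_pos hs]
              gcongr
          _ = _ := by
              rw [mul_left_comm, ← Real.exp_add]
              congr 2
              ring
      have hp0 : ∀ s : ℝ, polar (s, 0) = s := fun s => by simp [polar]
      constructor
      · have h3 := integrableOn_of_exp_bound (half_pos hκ)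
          (continuousOn_ray (k := fun w => Complex.exp (ζ * w) * g (T + w)) (ψ := 0)
            fun r hr => hd' r hr 0 Set.left_mem_uIcc) fun s hs => hb' s hs 0 Set.left_mem_uIcc
        simpa only [hp0] using h3
      · rw [integral_ray_rotate (k := fun w => Complex.exp (ζ * w) * g (T + w)) (half_pos hκ) hd' hb']
        refine MeasureTheory.integral_congr_ae (Eventually.of_forall fun s => ?_)
        simp only [polar]
        rw [show ζ * Complex.exp (ψ * Complex.I) * s = ζ * (s * Complex.exp (ψ * Complex.I)) by ring]
        ring
  obtain ⟨Bm, hBm, hBm'⟩ := key gm ψ hm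
  obtain ⟨Bp, hBp, hBp'⟩ := key gp (-ψ) hp
  set H : ℂ → ℂ := fun ζ => ∫ s in Set.Ioi (0 : ℝ), Complex.exp (ζ * s) * (gm (T + s) - gp (T + s))
    with hH
  have hpol0 : ∀ s : ℝ, polar (s, 0) = s := fun s => by simp [polar]
  have hcont : ContinuousOn (fun s : ℝ => gm (T + s) - gp (T + s)) (Set.Ioi 0) := by
    have c1 := continuousOn_ray (k := fun w => gm (T + w)) (ψ := 0)
      fun r hr => diff_shift (hm r hr 0 Set.left_mem_uIcc).1
    have c2 := continuousOn_ray (k := fun w => gp (T + w)) (ψ := 0)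
      fun r hr => diff_shift (hp r hr 0 Set.left_mem_uIcc).1
    simp only [hpol0] at c1 c2
    exact c1.sub c2
  have hHd : ∀ ζ : ℂ, ζ.re < p.re → DifferentiableAt ℂ H ζ := by
    intro ζ hζ
    have := differentiableAt_laplace hcont hh 1 (ζ₀ := ζ) (by rwa [mul_one])
    simpa only [mul_one] using this
  set V : Set ℂ := {ζ | (ζ * Complex.exp (ψ * Complex.I)).re < κ} ∩
    ({ζ | (ζ * Complex.exp ((-ψ : ℝ) * Complex.I)).re < κ} ∩ {ζ | ζ.re < p.re}) with hV
  have hhalf : ∀ (u : ℂ) (r : ℝ), IsOpen {ζ : ℂ | (ζ * u).re < r} ∧ Convex ℝ {ζ : ℂ | (ζ * u).re < r} := by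
    intro u r
    refine ⟨isOpen_lt (by fun_prop) continuous_const, ?_⟩
    have : {ζ : ℂ | (ζ * u).re < r} = (Complex.reLm.comp (LinearMap.mulRight ℝ u)) ⁻¹' Set.Iio r := rfl
    rw [this]
    exact (convex_Iio r).linear_preimage _
  have hone := hhalf 1 p.re
  simp only [mul_one] at hone
  have hVo : IsOpen V := (hhalf _ _).1.inter ((hhalf _ _).1.inter hone.1)
  have hVc : Convex ℝ V := (hhalf _ _).2.inter ((hhalf _ _).2.inter hone.2)
  have hV0 : (0 : ℂ) ∈ V := by
    refine ⟨?_, ?_, ?_⟩ <;> simp [hκ, hp0]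
  have heq : Set.EqOn H (fun ζ => Bm ζ - Bp ζ) V := by
    refine AnalyticOnNhd.eqOn_of_preconnected_of_eventuallyEq (𝕜 := ℂ) (z₀ := 0) ?_ ?_ hVc.isPreconnected hV0 ?_
    · exact DifferentiableOn.analyticOnNhd (fun ζ hζ => (hHd ζ hζ.2.2).differentiableWithinAt) hVo
    · exact DifferentiableOn.analyticOnNhd
        (fun ζ hζ => ((hBm ζ hζ.1).sub (hBp ζ hζ.2.1)).differentiableWithinAt) hVo
    · filter_upwards [Metric.ball_mem_nhds (0 : ℂ) (half_pos hκ)] with ζ hζ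
      rw [mem_ball_zero_iff] at hζ
      obtain ⟨i1, e1⟩ := hBm' ζ hζ
      obtain ⟨i2, e2⟩ := hBp' ζ hζ
      rw [e1, e2, ← MeasureTheory.integral_sub i1 i2]
      simp only [hH, mul_sub]
  have hcB : ContinuousAt (fun ζ => Bm ζ - Bp ζ) p :=
    (hBm p (h1.trans hκ)).continuousAt.sub (hBp p (h2.trans hκ)).continuousAt
  have hlim : Tendsto (fun σ : ℝ => p - (σ : ℂ)) (𝓝[>] 0) (𝓝 p) := by
    have : Continuous fun σ : ℝ => p - (σ : ℂ) := by fun_prop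
    have h3 := (this.tendsto 0).mono_left (nhdsWithin_le_nhds (s := Set.Ioi 0))
    simpa using h3
  have hid : Tendsto (fun σ : ℝ => (σ : ℂ)) (𝓝[>] 0) (𝓝 0) := by
    have h3 := (Complex.continuous_ofReal.tendsto 0).mono_left (nhdsWithin_le_nhds (s := Set.Ioi 0))
    simpa using h3
  have hfin := hid.mul (hcB.tendsto.comp hlim)
  rw [zero_mul] at hfin
  refine hfin.congr' ?_
  have o1 : ∀ᶠ σ : ℝ in 𝓝[>] 0, ((p - σ) * Complex.exp (ψ * Complex.I)).re < κ :=
    hlim.eventually ((hhalf _ _).1.mem_nhds (h1.trans hκ))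
  have o2 : ∀ᶠ σ : ℝ in 𝓝[>] 0, ((p - σ) * Complex.exp ((-ψ : ℝ) * Complex.I)).re < κ :=
    hlim.eventually ((hhalf _ _).1.mem_nhds (h2.trans hκ))
  filter_upwards [o1, o2, self_mem_nhdsWithin] with σ h3 h4 h5
  have h6 : p - (σ : ℂ) ∈ V := ⟨h3, h4, by
    have : 0 < σ := h5
    simpa using this⟩
  have h7 := heq h6
  simp only [Function.comp, ← h7, hH]

end PeriodRH

namespace PeriodRH

set_option linter.unusedSectionVars false

/-! ### Vanishing of the obstruction -/

theorem exists_small_uniform {K : Set ℝ} (hK : IsCompact K) {f : ℂ → ℂ}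
    (h : ∀ θ ∈ K, SmallFn (Circle.exp θ) f) : ∃ C > 0, ∃ κ > 0, ∀ θ ∈ K,
      ∀ᶠ z in dirNhds (Circle.exp θ), ‖f z‖ ≤ C * Real.exp (-κ / ‖z‖) := by
  refine hK.induction_on (p := fun K => ∃ C > 0, ∃ κ > 0, ∀ θ ∈ K,
      ∀ᶠ z in dirNhds (Circle.exp θ), ‖f z‖ ≤ C * Real.exp (-κ / ‖z‖)) ?_ ?_ ?_ ?_
  · exact ⟨1, one_pos, 1, one_pos, fun θ hθ => hθ.elim⟩
  · rintro s t hst ⟨C, hC, κ, hκ, hb⟩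
    exact ⟨C, hC, κ, hκ, fun θ hθ => hb θ (hst hθ)⟩
  · rintro s t ⟨C, hC, κ, hκ, hb⟩ ⟨C', hC', κ', hκ', hb'⟩
    refine ⟨max C C', lt_max_of_lt_left hC, min κ κ', lt_min hκ hκ', fun θ hθ => ?_⟩
    rcases hθ with hθ | hθ
    · filter_upwards [hb θ hθ] with z hz
      refine hz.trans ?_
      gcongr
      · exact le_max_left _ _
      · exact min_le_left _ _
    · filter_upwards [hb' θ hθ] with z hz
      refine hz.trans ?_
      gcongr
      · exact le_max_right _ _
      · exact min_le_right _ _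
  · intro θ hθ
    obtain ⟨C, hC, κ, hκ, hb⟩ := h θ hθ
    refine ⟨_, mem_nhdsWithin_of_mem_nhds (eventually_exp_iff.1 (eventually_dirNhds hb)), C, hC, κ, hκ,
      fun t ht => ht⟩

theorem conj_polar (r φ : ℝ) : (starRingEnd ℂ) (polar (r, φ)) = polar (r, -φ) := by
  rw [polar, polar, map_mul, Complex.conj_ofReal, ← Complex.exp_conj, map_mul, Complex.conj_ofReal,
    Complex.conj_I]
  push_cast
  ring_nf

theorem shift_polar {T s φ ψ : ℝ} (hT : 0 < T) (hs : 0 < s) (hψ : ψ < Real.pi) (hφ : |φ| ≤ ψ) :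
    ∃ r χ : ℝ, 0 < r ∧ (T : ℂ) + polar (s, φ) = polar (r, χ) ∧ T * Real.sin ψ ≤ r ∧ s - T ≤ r ∧
      χ ∈ Set.uIcc 0 φ := by
  wlog h0 : 0 ≤ φ generalizing φ with H
  · obtain ⟨r, χ, h1, h2, h3, h4, h5⟩ := H (φ := -φ) (by rwa [abs_neg]) (by linarith)
    refine ⟨r, -χ, h1, ?_, h3, h4, ?_⟩
    · have := congrArg (starRingEnd ℂ) h2
      rw [map_add, conj_polar, conj_polar, Complex.conj_ofReal, neg_neg] at this
      exact this
    · rw [Set.uIcc_of_le (by linarith)] at h5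
      rw [Set.uIcc_of_ge (by linarith)]
      exact ⟨by linarith [h5.2], by linarith [h5.1]⟩
  rw [abs_of_nonneg h0] at hφ
  have hψ0 : 0 ≤ ψ := h0.trans hφ
  set t : ℂ := (T : ℂ) + polar (s, φ) with ht
  have hpre : (polar (s, φ)).re = s * Real.cos φ := by
    rw [polar, Complex.re_ofReal_mul, Complex.exp_ofReal_mul_I_re]
  have hpim : (polar (s, φ)).im = s * Real.sin φ := by
    rw [polar, Complex.im_ofReal_mul, Complex.exp_ofReal_mul_I_im]
  have hre : t.re = T + s * Real.cos φ := by rw [ht, Complex.add_re, hpre, Complex.ofReal_re]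
  have him : t.im = s * Real.sin φ := by rw [ht, Complex.add_im, hpim, Complex.ofReal_im, zero_add]
  have hsinφ : 0 ≤ Real.sin φ := Real.sin_nonneg_of_nonneg_of_le_pi h0 (by linarith)
  have hsinψ : 0 ≤ Real.sin ψ := Real.sin_nonneg_of_nonneg_of_le_pi hψ0 hψ.le
  have hsq : ‖t‖ ^ 2 = T ^ 2 + s ^ 2 + 2 * T * s * Real.cos φ := by
    rw [← Complex.normSq_eq_norm_sq, Complex.normSq_apply, hre, him]
    linear_combination s ^ 2 * Real.sin_sq_add_cos_sq φ
  have hcos : Real.cos ψ ≤ Real.cos φ := Real.cos_le_cos_of_nonneg_of_le_pi h0 hψ.le hφ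
  have hlow : T * Real.sin ψ ≤ ‖t‖ := by
    refine abs_le_of_sq_le_sq' ?_ (norm_nonneg _) |>.2
    rw [hsq]
    have h1 : 0 < T * s := by positivity
    nlinarith [Real.sin_sq_add_cos_sq ψ, sq_nonneg (s + T * Real.cos ψ)]
  have hne : t ≠ 0 := by
    intro h
    have h1 : s * Real.sin φ = 0 := by rw [← him, h, Complex.zero_im]
    have h2 : T + s * Real.cos φ = 0 := by rw [← hre, h, Complex.zero_re]
    have h3 : Real.sin φ = 0 := (mul_eq_zero.1 h1).resolve_left hs.ne'
    have h4 : φ = 0 := by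
      by_contra hφ0
      exact (Real.sin_pos_of_pos_of_lt_pi (lt_of_le_of_ne h0 (Ne.symm hφ0)) (by linarith)).ne' h3
    rw [h4, Real.cos_zero] at h2
    linarith
  have hrpos : 0 < ‖t‖ := norm_pos_iff.2 hne
  have hpol : t = polar (‖t‖, t.arg) := (Complex.norm_mul_exp_arg_mul_I t).symm
  have harg0 : 0 ≤ t.arg := Complex.arg_nonneg_iff.2 (by rw [him]; positivity)
  refine ⟨‖t‖, t.arg, hrpos, hpol, hlow, ?_, ?_⟩
  · have h1 : s = ‖polar (s, φ)‖ := by rw [norm_polar, abs_of_pos hs]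
    have h2 : polar (s, φ) = t - T := by rw [ht]; ring
    have h3 := norm_sub_le t T
    rw [← h2, ← h1, Complex.norm_real, Real.norm_of_nonneg hT.le] at h3
    linarith
  · rw [Set.uIcc_of_le h0]
    refine ⟨harg0, ?_⟩
    by_contra hcon
    push Not at hcon
    have h1 : Real.cos t.arg * ‖t‖ = t.re := by
      rw [mul_comm]; exact Complex.norm_mul_cos_arg t
    have h2 : Real.sin t.arg * ‖t‖ = t.im := by
      rw [mul_comm]; exact Complex.norm_mul_sin_arg t
    have h3 : ‖t‖ * Real.sin (t.arg - φ) = -(T * Real.sin φ) := by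
      rw [Real.sin_sub]
      rw [hre] at h1
      rw [him] at h2
      linear_combination h2 * Real.cos φ - h1 * Real.sin φ
    rcases eq_or_lt_of_le h0 with h4 | h4
    · rw [← h4] at hre him hcon
      have h5 : t.arg = 0 := Complex.arg_eq_zero_iff.2 ⟨by rw [hre, Real.cos_zero]; linarith, by
        rw [him, Real.sin_zero, mul_zero]⟩
      linarith
    · have h5 : 0 < Real.sin (t.arg - φ) :=
        Real.sin_pos_of_pos_of_lt_pi (by linarith) (by linarith [Complex.arg_le_pi t])
      have h6 := mul_pos hrpos h5
      have h7 : 0 ≤ T * Real.sin φ := by positivity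
      linarith

theorem exp_mul_I_div_polar (d r χ : ℝ) :
    Complex.exp (d * Complex.I) / polar (r, χ) = polar (r⁻¹, d - χ) := by
  rw [polar, polar, div_mul_eq_div_div_swap, ← Complex.exp_sub]
  push_cast
  rw [← sub_mul, div_eq_mul_inv, mul_comm]

/-- A germ that is exponentially small on a compact arc, in the coordinate `t = exp (i d) / z`. -/
theorem exists_shifted_bound {d ψ : ℝ} (hψ : |ψ| < Real.pi) (hψ0 : ψ ≠ 0) {f : ℂ → ℂ}
    (hf : ∀ θ ∈ Set.uIcc d (d - ψ), SmallFn (Circle.exp θ) f ∧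
      ∀ᶠ z in dirNhds (Circle.exp θ), DifferentiableAt ℂ f z) :
    ∃ κ > 0, ∀ᶠ T : ℝ in atTop, ∃ C, ∀ s : ℝ, 0 < s → ∀ φ ∈ Set.uIcc 0 ψ,
      DifferentiableAt ℂ (fun t => f (Complex.exp (d * Complex.I) / t)) (T + polar (s, φ)) ∧
      ‖f (Complex.exp (d * Complex.I) / (T + polar (s, φ)))‖ ≤ C * Real.exp (-κ * s) := by
  obtain ⟨C, hC, κ, hκ, hb⟩ := exists_small_uniform isCompact_uIcc fun θ hθ => (hf θ hθ).1
  obtain ⟨ρ, hρ, hu⟩ := eventually_polar_of_isCompact isCompact_uIcc fun θ hθ =>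
    (hb θ hθ).and (hf θ hθ).2
  have hsin : 0 < Real.sin |ψ| := Real.sin_pos_of_pos_of_lt_pi (abs_pos.2 hψ0) hψ
  refine ⟨κ, hκ, ?_⟩
  filter_upwards [eventually_gt_atTop (ρ⁻¹ / Real.sin |ψ|)] with T hT
  have hT0 : 0 < T := lt_trans (by positivity) hT
  rw [div_lt_iff₀ hsin] at hT
  refine ⟨C * Real.exp (κ * T), fun s hs φ hφ => ?_⟩
  have hφψ : |φ| ≤ |ψ| := by
    have := Set.abs_sub_left_of_mem_uIcc hφ
    simpa using this
  obtain ⟨r, χ, hr, he, h1, h2, h3⟩ := shift_polar hT0 hs hψ hφψ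
  have hχ : d - χ ∈ Set.uIcc d (d - ψ) := by
    have h4 : χ ∈ Set.uIcc 0 ψ := Set.uIcc_subset_uIcc_left hφ h3
    have := Set.mem_image_of_mem (fun x => d - x) h4
    rwa [Set.image_const_sub_uIcc, sub_zero] at this
  have hrρ : r⁻¹ < ρ := inv_lt_of_inv_lt₀ hρ (by linarith)
  obtain ⟨h5, h6⟩ := hu r⁻¹ (d - χ) (inv_pos.2 hr) hrρ hχ
  have hne : polar (r, χ) ≠ 0 := by
    rw [← norm_pos_iff, norm_polar]
    positivity
  rw [he]
  refine ⟨?_, ?_⟩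
  · rw [← exp_mul_I_div_polar] at h6
    exact DifferentiableAt.comp (polar (r, χ)) h6 ((differentiableAt_const _).div differentiableAt_id hne)
  · rw [exp_mul_I_div_polar]
    refine h5.trans ?_
    rw [norm_polar, abs_of_pos (inv_pos.2 hr), div_inv_eq_mul, mul_assoc, ← Real.exp_add]
    gcongr
    nlinarith

end PeriodRH

namespace PeriodRH

set_option linter.unusedSectionVars false

variable {L : Type*} [AddCommGroup L] [Module.Free ℤ L] [Module.Finite ℤ L] {P : PeriodDatum L}
  {ι : Type*} [Fintype ι] [DecidableEq ι] {c : ι → ℂ}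

theorem NegOn.exists_max {U : Set Circle} {N : ι → ι → L → ℂ} (h : NegOn P c U N) {w : Circle}
    (hU : U ∈ 𝓝 w) {i j : ι} {γ : L} (h0 : N i j γ ≠ 0) :
    ∃ i₀ j₀ γ₀, N i₀ j₀ γ₀ ≠ 0 ∧ ∀ i j γ, N i j γ ≠ 0 →
      lev w (qexp P c i j γ) ≤ lev w (qexp P c i₀ j₀ γ₀) := by
  set y := lev w (qexp P c i j γ) with hy
  have hfin : {x : ι × ι × L | N x.1 x.2.1 x.2.2 ≠ 0 ∧ y ≤ lev w (qexp P c x.1 x.2.1 x.2.2)}.Finite := by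
    have h1 : ∀ i j, {γ | N i j γ ≠ 0 ∧ y ≤ lev w (qexp P c i j γ)}.Finite := by
      intro i j
      obtain ⟨⟨s, hs, Y, hc⟩, -⟩ := h.coeffAt hU i j
      refine (P.finite_norm_le ((Y - y + lev w (c j - c i)) / s)).subset fun γ hγ => ?_
      rw [Set.mem_ofPred, le_div_iff₀ hs, mul_comm]
      have h2 := hc γ hγ.1
      have h3 := hγ.2
      rw [qexp, add_sub_assoc, lev_add] at h3
      linarith
    have h2 : {x : ι × ι × L | N x.1 x.2.1 x.2.2 ≠ 0 ∧ y ≤ lev w (qexp P c x.1 x.2.1 x.2.2)} ⊆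
        ⋃ i, ⋃ j, (fun γ => (i, j, γ)) '' {γ | N i j γ ≠ 0 ∧ y ≤ lev w (qexp P c i j γ)} := by
      rintro ⟨i, j, γ⟩ hx
      exact Set.mem_iUnion.2 ⟨i, Set.mem_iUnion.2 ⟨j, γ, hx, rfl⟩⟩
    exact (Set.finite_iUnion fun i => Set.finite_iUnion fun j => (h1 i j).image _).subset h2
  obtain ⟨⟨i₀, j₀, γ₀⟩, h1, h2⟩ := Set.exists_max_image _
    (fun x : ι × ι × L => lev w (qexp P c x.1 x.2.1 x.2.2)) hfin ⟨(i, j, γ), h0, le_rfl⟩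
  refine ⟨i₀, j₀, γ₀, h1.1, fun i' j' γ' h' => ?_⟩
  rcases le_total y (lev w (qexp P c i' j' γ')) with h3 | h3
  · exact h2 (i', j', γ') ⟨h', h3⟩
  · exact h3.trans h1.2

theorem exp_div_polar_inv (d : ℝ) (q : ℂ) (t : ℝ) :
    q / polar (t⁻¹, d) = (((Circle.exp d)⁻¹ : Circle) : ℂ) * q * t := by
  rw [polar_eq, Circle.coe_inv]
  push_cast
  field_simp

theorem mul_exp_re (d ψ : ℝ) (q : ℂ) :
    (-((((Circle.exp d)⁻¹ : Circle) : ℂ) * q) * Complex.exp (ψ * Complex.I)).re =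
      lev (Circle.exp (d - ψ + Real.pi)) q := by
  rw [lev, Circle.coe_inv, Circle.coe_exp, Circle.coe_inv, Circle.coe_exp, ← Complex.exp_neg,
    ← Complex.exp_neg]
  congr 1
  push_cast
  have : -(((d : ℂ) - ψ + Real.pi) * Complex.I) = -(d * Complex.I) + ψ * Complex.I + -(Real.pi * Complex.I) := by
    ring
  rw [this, Complex.exp_add, Complex.exp_add, Complex.exp_neg (Real.pi * Complex.I), Complex.exp_pi_mul_I]
  ring

/-- Two exponentially small sections over arcs which together are longer than a half circle plus
`2 α` differ by a cocycle with exponents that are negative on the complementary arc only if the cocycle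
is trivial. -/
theorem NegOn.eq_zero_of_small {d α : ℝ} (hα : 0 < α) (hα' : α < Real.pi / 2) {N : ι → ι → L → ℂ}
    (hN : NegOn P c (Circle.exp '' Set.Icc (d - Real.pi / 2 + α) (d + Real.pi / 2 - α)) N)
    {Rm Rp : ∀ v, Matrix ι ι (O v)}
    (hm : ∀ θ ∈ Set.Ioc (d - Real.pi / 2 - α) d, ∀ i j, IsSec (fun v => Rm v i j) (Circle.exp θ) ∧
      (Rm (Circle.exp θ) - 1) i j ∈ Small (Circle.exp θ))
    (hp : ∀ θ ∈ Set.Ico d (d + Real.pi / 2 + α), ∀ i j, IsSec (fun v => Rp v i j) (Circle.exp θ) ∧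
      (Rp (Circle.exp θ) - 1) i j ∈ Small (Circle.exp θ))
    (he : Rm (Circle.exp d) = Rp (Circle.exp d) * (1 + serM P c N (Circle.exp d))) (i j : ι) (γ : L) :
    N i j γ = 0 := by
  by_contra h0
  have hπ := Real.pi_pos
  have hU : Circle.exp '' Set.Icc (d - Real.pi / 2 + α) (d + Real.pi / 2 - α) ∈ 𝓝 (Circle.exp d) :=
    image_exp_mem_nhds (Icc_mem_nhds (by linarith) (by linarith))
  obtain ⟨i₀, j₀, γ₀, h1, hmax⟩ := hN.exists_max hU h0
  clear h0 i j γ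
  set q₀ := qexp P c i₀ j₀ γ₀ with hq₀
  set u : ℂ := (((Circle.exp d)⁻¹ : Circle) : ℂ) with hu
  set p : ι → ι → L → ℂ := fun i j γ => -(u * qexp P c i j γ) with hpdef
  have hpre : ∀ i j γ, (p i j γ).re = -lev (Circle.exp d) (qexp P c i j γ) := fun i j γ => by
    simp only [hpdef, Complex.neg_re]; rfl
  set p₀ := p i₀ j₀ γ₀ with hp₀
  have hp₀re : 0 < p₀.re := by
    rw [hp₀, hpre]
    have := ltAt_zero_iff.1 (hN.neg i₀ j₀ γ₀ h1 _ (mem_of_mem_nhds hU))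
    linarith
  -- choice of the rays
  obtain ⟨ψ, hψ1, hψ2, hψ3, hψ4⟩ : ∃ ψ, Real.pi / 2 < ψ ∧ ψ < Real.pi / 2 + α ∧
      lev (Circle.exp (d - ψ + Real.pi)) q₀ < 0 ∧ lev (Circle.exp (d - -ψ + Real.pi)) q₀ < 0 := by
    have c1 : Continuous fun ψ : ℝ => lev (Circle.exp (d - ψ + Real.pi)) q₀ :=
      (continuous_lev q₀).comp (by fun_prop)
    have c2 : Continuous fun ψ : ℝ => lev (Circle.exp (d - -ψ + Real.pi)) q₀ :=
      (continuous_lev q₀).comp (by fun_prop)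
    have n1 : lev (Circle.exp (d - (Real.pi / 2 + α) + Real.pi)) q₀ < 0 := by
      refine ltAt_zero_iff.1 (hN.neg i₀ j₀ γ₀ h1 _ ⟨_, ⟨?_, ?_⟩, rfl⟩) <;> linarith
    have n2 : lev (Circle.exp (d - -(Real.pi / 2 + α) + Real.pi)) q₀ < 0 := by
      have e : d - -(Real.pi / 2 + α) + Real.pi = (d - Real.pi / 2 + α) + 2 * Real.pi := by ring
      rw [e, Circle.exp_add_two_pi]
      refine ltAt_zero_iff.1 (hN.neg i₀ j₀ γ₀ h1 _ ⟨_, ⟨?_, ?_⟩, rfl⟩) <;> linarith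
    have h2 : ∀ᶠ ψ in 𝓝[<] (Real.pi / 2 + α), lev (Circle.exp (d - ψ + Real.pi)) q₀ < 0 ∧
        lev (Circle.exp (d - -ψ + Real.pi)) q₀ < 0 :=
      nhdsWithin_le_nhds ((c1.continuousAt.eventually (gt_mem_nhds n1)).and
        (c2.continuousAt.eventually (gt_mem_nhds n2)))
    obtain ⟨ψ, h3, h4⟩ := (h2.and (Ioo_mem_nhdsLT (show Real.pi / 2 < Real.pi / 2 + α by linarith))).exists
    exact ⟨ψ, h4.1, h4.2, h3.1, h3.2⟩
  -- functions
  have hsub : ∀ {R : ∀ v, Matrix ι ι (O v)} {θ : ℝ} (i j : ι), IsSec (fun v => R v i j) (Circle.exp θ) →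
      IsSec (fun v => (R v - 1) i j) (Circle.exp θ) := by
    intro R θ i j h
    refine IsSec.congr (Eventually.of_forall fun v => ?_) (h.add (isSec_const (-(1 : Matrix ι ι ℂ) i j)))
    rw [Matrix.sub_apply, sub_eq_add_neg, map_neg, Matrix.one_apply, Matrix.one_apply]
    split_ifs <;> simp
  obtain ⟨fm, hfm⟩ := exists_function_of_isSec (a := d - ψ) (b := d) (by linarith)
    (s := fun v => (Rm v - 1) i₀ j₀) fun θ hθ => hsub _ _ (hm θ ⟨by linarith [hθ.1], hθ.2⟩ i₀ j₀).1
  obtain ⟨fp, hfp⟩ := exists_function_of_isSec (a := d) (b := d + ψ) (by linarith)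
    (s := fun v => (Rp v - 1) i₀ j₀) fun θ hθ => hsub _ _ (hp θ ⟨hθ.1, by linarith [hθ.2]⟩ i₀ j₀).1
  obtain ⟨κm, hκm, hbm⟩ := exists_shifted_bound (d := d) (ψ := ψ) (f := fm)
    (by rw [abs_of_pos (by linarith)]; linarith) (by linarith) (by
      rw [Set.uIcc_of_ge (by linarith)]
      intro θ hθ
      exact ⟨(mem_Small_iff (hfm θ hθ)).1 (hm θ ⟨by linarith [hθ.1], hθ.2⟩ i₀ j₀).2,
        germ_eventually_diff (hfm θ hθ)⟩)
  obtain ⟨κp, hκp, hbp⟩ := exists_shifted_bound (d := d) (ψ := -ψ) (f := fp)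
    (by rw [abs_neg, abs_of_pos (by linarith)]; linarith) (by linarith) (by
      rw [sub_neg_eq_add, Set.uIcc_of_le (by linarith)]
      intro θ hθ
      exact ⟨(mem_Small_iff (hfp θ hθ)).1 (hp θ ⟨hθ.1, by linarith [hθ.2]⟩ i₀ j₀).2,
        germ_eventually_diff (hfp θ hθ)⟩)
  choose τ hτd hτ using fun k => ((Rp (Circle.exp d) - 1) i₀ k).exists_rep
  have hτs : ∀ k, SmallFn (Circle.exp d) (τ k) := fun k =>
    (mem_Small_iff (hτ k)).1 (hp d ⟨le_rfl, by linarith⟩ i₀ k).2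
  choose Cτ hCτ κτ hκτ hbτ using hτs
  set ν : ι → ι → ℂ → ℂ := fun i j z => Complex.exp ((c j - c i) / z) * serFn P (N i j) z with hν
  have hνg : ∀ i j, (serM P c N (Circle.exp d) i j).germ = (ν i j : Germ (dirNhds (Circle.exp d)) ℂ) := by
    intro i j
    simp only [serM, Matrix.of_apply]
    rw [map_mul, (hN.coeffAt hU i j).germ]
    rfl
  have hrel : ∀ᶠ z in dirNhds (Circle.exp d), fm z - fp z = ν i₀ j₀ z + ∑ k, τ k z * ν k j₀ z := by
    have e1 : (Rm (Circle.exp d) - 1) i₀ j₀ - (Rp (Circle.exp d) - 1) i₀ j₀ =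
        serM P c N (Circle.exp d) i₀ j₀ +
          ∑ k, (Rp (Circle.exp d) - 1) i₀ k * serM P c N (Circle.exp d) k j₀ := by
      rw [← Matrix.mul_apply, ← Matrix.sub_apply, ← Matrix.add_apply, he]
      refine congrFun (congrFun (?_ : (_ : Matrix ι ι _) = _) i₀) j₀
      noncomm_ring
    have e2 := congrArg Hol.germ e1
    have hsum : ∀ S : Finset ι, (∑ k ∈ S, (Rp (Circle.exp d) - 1) i₀ k * serM P c N (Circle.exp d) k j₀).germ =
        ((fun z => ∑ k ∈ S, τ k z * ν k j₀ z : ℂ → ℂ) : Germ (dirNhds (Circle.exp d)) ℂ) := by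
      intro S
      induction S using Finset.induction_on with
      | empty => simp; rfl
      | insert k S hk ih =>
        rw [Finset.sum_insert hk, map_add, ih, map_mul, hτ, hνg]
        simp only [Finset.sum_insert hk]
        rfl
    rw [map_sub, map_add, hsum, hνg, hfm d ⟨by linarith, le_rfl⟩, hfp d ⟨le_rfl, by linarith⟩] at e2
    exact Germ.coe_eq.1 e2
  -- radius
  obtain ⟨ρ, hρ, hev⟩ := eventually_polar_of_isCompact (K := {d}) isCompact_singleton
    (p := fun z => (fm z - fp z = ν i₀ j₀ z + ∑ k, τ k z * ν k j₀ z) ∧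
      (∀ i j, Summable fun γ => ‖N i j γ * Complex.exp (P.μ γ / z)‖) ∧
      (∀ k, ‖τ k z‖ ≤ Cτ k * Real.exp (-κτ k / ‖z‖)) ∧ DifferentiableAt ℂ (ν i₀ j₀) z)
    (fun θ hθ => by
      rw [Set.mem_singleton_iff.1 hθ]
      exact hrel.and ((hN.exists_summable_exp hU).and ((eventually_all.2 hbτ).and
        (germ_eventually_diff (hνg i₀ j₀)))))
  obtain ⟨T, ⟨⟨Cm, hTm⟩, Cp, hTp⟩, hTρ, hT0⟩ := ((hbm.and hbp).and
    ((eventually_gt_atTop ρ⁻¹).and (eventually_gt_atTop (0 : ℝ)))).exists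
  have hz : ∀ s : ℝ, 0 ≤ s → 0 < (T + s)⁻¹ ∧ (T + s)⁻¹ < ρ := fun s hs =>
    ⟨inv_pos.2 (by linarith), inv_lt_of_inv_lt₀ hρ (by linarith)⟩
  have hpt : ∀ s : ℝ, 0 ≤ s → Complex.exp (d * Complex.I) / ((T : ℂ) + s) = polar ((T + s)⁻¹, d) := by
    intro s hs
    have := exp_mul_I_div_polar d (T + s) 0
    rw [sub_zero] at this
    rw [← this]
    simp [polar]
  -- the series along the ray
  have hνs : ∀ i j (s : ℝ), ν i j (polar ((T + s)⁻¹, d)) =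
      ∑' γ, (N i j γ * Complex.exp (-p i j γ * T)) * Complex.exp (-p i j γ * s) := by
    intro i j s
    simp only [hν, serFn]
    rw [← tsum_mul_left]
    refine tsum_congr fun γ => ?_
    rw [mul_left_comm, ← Complex.exp_add, ← add_div, exp_div_polar_inv, mul_assoc (N i j γ),
      ← Complex.exp_add]
    congr 2
    simp only [hpdef, qexp, hu]
    push_cast
    ring
  have hsumT : ∀ i j, Summable fun γ => ‖N i j γ * Complex.exp (-p i j γ * T)‖ := by
    intro i j
    obtain ⟨r1, r2⟩ := hz 0 le_rfl
    have h2 := (hev _ d r1 r2 rfl).2.1 i j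
    rw [add_zero] at h2
    refine (h2.mul_right ‖Complex.exp ((c j - c i) / polar (T⁻¹, d))‖).congr fun γ => ?_
    rw [← norm_mul, mul_assoc, ← Complex.exp_add, ← add_div, exp_div_polar_inv]
    congr 3
    simp only [hpdef, qexp]
    ring
  set Kn : ι → ι → ℝ := fun i j => ∑' γ, ‖N i j γ * Complex.exp (-p i j γ * T)‖ with hKn
  have hνb : ∀ i j (s : ℝ), 0 < s → ‖ν i j (polar ((T + s)⁻¹, d))‖ ≤ Kn i j * Real.exp (-p₀.re * s) := by
    intro i j s hs
    rw [hνs]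
    refine tsum_of_norm_bounded ((hsumT i j).hasSum.mul_right _) fun γ => ?_
    rw [norm_mul]
    by_cases h3 : N i j γ = 0
    · simp [h3]
    · refine mul_le_mul_of_nonneg_left ?_ (norm_nonneg _)
      rw [Complex.norm_exp, Complex.re_mul_ofReal, Complex.neg_re, Real.exp_le_exp]
      have h4 := hmax i j γ h3
      refine mul_le_mul_of_nonneg_right ?_ hs.le
      rw [hp₀, hpre, hpre]
      linarith
  have hKn0 : ∀ i j, 0 ≤ Kn i j := fun i j => tsum_nonneg fun _ => norm_nonneg _
  -- the functions in the coordinate `t`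
  set gm : ℂ → ℂ := fun t => fm (Complex.exp (d * Complex.I) / t) with hgm
  set gp : ℂ → ℂ := fun t => fp (Complex.exp (d * Complex.I) / t) with hgp
  set ν₀ : ℝ → ℂ := fun s => ν i₀ j₀ (polar ((T + s)⁻¹, d)) with hν₀
  set E : ℝ → ℂ := fun s => ∑ k, τ k (polar ((T + s)⁻¹, d)) * ν k j₀ (polar ((T + s)⁻¹, d)) with hE
  have hh : ∀ s : ℝ, 0 < s → gm (T + s) - gp (T + s) = ν₀ s + E s := by
    intro s hs
    simp only [hgm, hgp, hpt s hs.le]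
    obtain ⟨r1, r2⟩ := hz s hs.le
    exact (hev _ d r1 r2 rfl).1
  -- the error term
  obtain ⟨κ, hκ, hκle⟩ : ∃ κ > 0, κ ≤ κm ∧ κ ≤ κp ∧ ∀ k, κ ≤ κτ k := by
    have h2 : ∀ᶠ t : ℝ in 𝓝[>] 0, ∀ k, t ≤ κτ k := eventually_all.2 fun k =>
      mem_of_superset (Ioo_mem_nhdsGT (hκτ k)) fun t ht => ht.2.le
    obtain ⟨t, ⟨ht, ht1, ht2⟩, ht0⟩ := ((h2.and (inter_mem (Ioo_mem_nhdsGT hκm)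
      (Ioo_mem_nhdsGT hκp))).and self_mem_nhdsWithin).exists
    exact ⟨t, ht0, ht1.2.le, ht2.2.le, ht⟩
  set CE : ℝ := ∑ k, Cτ k * Kn k j₀ with hCE
  have hEb : ∀ s : ℝ, 0 < s → ‖E s‖ ≤ CE * Real.exp (-(p₀.re + κ) * s) := by
    intro s hs
    obtain ⟨r1, r2⟩ := hz s hs.le
    rw [hCE, Finset.sum_mul]
    refine (norm_sum_le _ _).trans (Finset.sum_le_sum fun k _ => ?_)
    have h3 := (hev _ d r1 r2 rfl).2.2.1 k
    rw [norm_polar, abs_of_pos r1, div_inv_eq_mul] at h3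
    have h4 : Real.exp (-κτ k * (T + s)) ≤ Real.exp (-κ * s) := by
      rw [Real.exp_le_exp]
      have := hκle.2.2 k
      nlinarith [hκτ k]
    rw [norm_mul]
    calc _ ≤ (Cτ k * Real.exp (-κ * s)) * (Kn k j₀ * Real.exp (-p₀.re * s)) := by
          refine mul_le_mul (h3.trans ?_) (hνb k j₀ s hs) (norm_nonneg _) ?_
          · exact mul_le_mul_of_nonneg_left h4 (hCτ k).le
          · have := hCτ k
            positivity
      _ = Cτ k * Kn k j₀ * (Real.exp (-κ * s) * Real.exp (-p₀.re * s)) := by ring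
      _ = _ := by
          rw [← Real.exp_add]
          congr 2
          ring
  have hCE0 : 0 ≤ CE := Finset.sum_nonneg fun k _ => mul_nonneg (hCτ k).le (hKn0 k j₀)
  -- bounds
  set C : ℝ := |Cm| + |Cp| + Kn i₀ j₀ + CE with hC
  have hb1 : ∀ {Cx κx : ℝ} {s x : ℝ}, 0 < s → |Cx| ≤ C → κ ≤ κx → x ≤ Cx * Real.exp (-κx * s) →
      x ≤ C * Real.exp (-κ * s) := by
    intro Cx κx s x hs h2 h3 h4
    refine h4.trans ?_
    calc Cx * Real.exp (-κx * s) ≤ |Cx| * Real.exp (-κx * s) := by gcongr; exact le_abs_self _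
      _ ≤ C * Real.exp (-κ * s) := by gcongr
  have hKp := hKn0 i₀ j₀
  have hCm : |Cm| ≤ C := by linarith [abs_nonneg Cp]
  have hCp : |Cp| ≤ C := by linarith [abs_nonneg Cm]
  have hhb : ∀ s : ℝ, 0 < s → ‖gm (T + s) - gp (T + s)‖ ≤ C * Real.exp (-p₀.re * s) := by
    intro s hs
    rw [hh s hs]
    refine (norm_add_le _ _).trans ((add_le_add (hνb i₀ j₀ s hs) (hEb s hs)).trans ?_)
    have h3 : Real.exp (-(p₀.re + κ) * s) ≤ Real.exp (-p₀.re * s) := by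
      rw [Real.exp_le_exp]; nlinarith
    calc _ ≤ Kn i₀ j₀ * Real.exp (-p₀.re * s) + CE * Real.exp (-p₀.re * s) := by gcongr
      _ = (Kn i₀ j₀ + CE) * Real.exp (-p₀.re * s) := by ring
      _ ≤ _ := by gcongr; linarith [abs_nonneg Cm, abs_nonneg Cp]
  have hlim1 := tendsto_laplace_of_sectors (gm := gm) (gp := gp) (T := T) (ψ := ψ) (C := C) (p := p₀) hκ
    (fun s hs φ hφ => ⟨(hTm s hs φ hφ).1, hb1 hs hCm hκle.1 (hTm s hs φ hφ).2⟩)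
    (fun s hs φ hφ => ⟨(hTp s hs φ hφ).1, hb1 hs hCp hκle.2.1 (hTp s hs φ hφ).2⟩) hhb hp₀re
    (by rw [hp₀, hpdef, hu, mul_exp_re]; exact hψ3) (by rw [hp₀, hpdef, hu, mul_exp_re]; exact hψ4)
  -- the leading term
  have hlim2 := tendsto_laplace_coeff (fun γ => N i₀ j₀ γ * Complex.exp (-p i₀ j₀ γ * T)) (p i₀ j₀) 0 γ₀
    (by simpa using hsumT i₀ j₀) (fun γ h3 => by
      have := hmax i₀ j₀ γ (left_ne_zero_of_mul h3)
      rw [hpre, hpre]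
      linarith) (fun γ _ hne h3 => hne (P.μ_injective (by
        have h4 := mul_left_cancel₀ (Circle.coe_ne_zero _) (neg_injective h3)
        simpa [qexp] using h4)))
  -- comparison
  have hνc : ContinuousOn ν₀ (Set.Ioi 0) := by
    intro s hs
    have hs0 : 0 < s := hs
    obtain ⟨r1, r2⟩ := hz s hs0.le
    refine ContinuousAt.continuousWithinAt ?_
    refine ContinuousAt.comp (f := fun s : ℝ => polar ((T + s)⁻¹, d)) (hev _ d r1 r2 rfl).2.2.2.continuousAt ?_
    have h3 : ContinuousAt (fun s : ℝ => ((T + s)⁻¹, d)) s :=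
      (ContinuousAt.inv₀ (by fun_prop) (by linarith)).prodMk continuousAt_const
    exact ContinuousAt.comp (g := polar) continuous_polar.continuousAt h3
  have hgc : ContinuousOn (fun s : ℝ => gm (T + s) - gp (T + s)) (Set.Ioi 0) := by
    have c1 := continuousOn_ray (k := fun w => gm (T + w)) (ψ := 0)
      fun r hr => diff_shift (hTm r hr 0 Set.left_mem_uIcc).1
    have c2 := continuousOn_ray (k := fun w => gp (T + w)) (ψ := 0)
      fun r hr => diff_shift (hTp r hr 0 Set.left_mem_uIcc).1
    have hpol0 : ∀ s : ℝ, polar (s, 0) = s := fun s => by simp [polar]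
    simp only [hpol0] at c1 c2
    exact c1.sub c2
  have hEc : ContinuousOn E (Set.Ioi 0) := by
    refine (hgc.sub hνc).congr fun s hs => ?_
    change E s = gm (T + s) - gp (T + s) - ν₀ s
    rw [hh s hs, add_sub_cancel_left]
  have hexpn : ∀ (σ s : ℝ), ‖Complex.exp ((p₀ - σ) * s)‖ = Real.exp ((p₀.re - σ) * s) := by
    intro σ s
    rw [Complex.norm_exp, Complex.re_mul_ofReal, Complex.sub_re, Complex.ofReal_re]
  have hlim3 : Tendsto (fun σ : ℝ => (σ : ℂ) * ∫ s in Set.Ioi (0 : ℝ), Complex.exp ((p₀ - σ) * s) * E s)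
      (𝓝[>] 0) (𝓝 0) := by
    have hbd : ∀ σ : ℝ, 0 < σ → ‖(σ : ℂ) * ∫ s in Set.Ioi (0 : ℝ), Complex.exp ((p₀ - σ) * s) * E s‖ ≤
        σ * ∫ s in Set.Ioi (0 : ℝ), CE * Real.exp (-κ * s) := by
      intro σ hσ
      rw [norm_mul, Complex.norm_real, Real.norm_of_nonneg hσ.le]
      refine mul_le_mul_of_nonneg_left ?_ hσ.le
      refine MeasureTheory.norm_integral_le_of_norm_le
        ((integrableOn_exp_mul_Ioi (neg_lt_zero.2 hκ) 0).const_mul _) ?_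
      filter_upwards [MeasureTheory.ae_restrict_mem measurableSet_Ioi] with s hs
      have hs0 : 0 < s := hs
      rw [norm_mul, hexpn]
      refine (mul_le_mul_of_nonneg_left (hEb s hs0) (Real.exp_pos _).le).trans ?_
      rw [mul_left_comm, ← Real.exp_add]
      refine mul_le_mul_of_nonneg_left (Real.exp_le_exp.2 ?_) hCE0
      nlinarith
    have hz0 : Tendsto (fun σ : ℝ => σ * ∫ s in Set.Ioi (0 : ℝ), CE * Real.exp (-κ * s)) (𝓝[>] 0) (𝓝 0) := by
      have h3 : Continuous fun σ : ℝ => σ * ∫ s in Set.Ioi (0 : ℝ), CE * Real.exp (-κ * s) := by fun_prop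
      have h4 := (h3.tendsto 0).mono_left (nhdsWithin_le_nhds (s := Set.Ioi 0))
      simpa using h4
    refine squeeze_zero_norm' ?_ hz0
    filter_upwards [self_mem_nhdsWithin] with σ hσ using hbd σ hσ
  have hsplit : ∀ᶠ σ : ℝ in 𝓝[>] 0,
      (σ : ℂ) * ∫ s in Set.Ioi (0 : ℝ), Complex.exp ((p₀ - σ) * s) * (gm (T + s) - gp (T + s)) =
      σ * (∫ s in Set.Ioi (0 : ℝ), Complex.exp ((p₀ - σ) * s) *
        ∑' γ, N i₀ j₀ γ * Complex.exp (-p i₀ j₀ γ * T) * Complex.exp (-p i₀ j₀ γ * s)) +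
      σ * ∫ s in Set.Ioi (0 : ℝ), Complex.exp ((p₀ - σ) * s) * E s := by
    filter_upwards [self_mem_nhdsWithin] with σ hσ
    have hσ0 : 0 < σ := hσ
    have ce : ContinuousOn (fun s : ℝ => Complex.exp ((p₀ - σ) * s)) (Set.Ioi 0) := by fun_prop
    have hint : ∀ {g : ℝ → ℂ} {K : ℝ}, ContinuousOn g (Set.Ioi 0) →
        (∀ s, 0 < s → ‖g s‖ ≤ K * Real.exp (-p₀.re * s)) →
        MeasureTheory.IntegrableOn (fun s : ℝ => Complex.exp ((p₀ - σ) * s) * g s) (Set.Ioi 0) := by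
      intro g K hg hK
      refine integrableOn_of_exp_bound (C := K) hσ0 (ce.mul hg) fun s hs => ?_
      rw [norm_mul, hexpn]
      refine (mul_le_mul_of_nonneg_left (hK s hs) (Real.exp_pos _).le).trans (le_of_eq ?_)
      rw [mul_left_comm, ← Real.exp_add]
      congr 2
      ring
    have i1 := hint hνc (hνb i₀ j₀)
    have i2 := hint (K := CE) hEc fun s hs => (hEb s hs).trans (by
      refine mul_le_mul_of_nonneg_left (Real.exp_le_exp.2 ?_) hCE0
      nlinarith)
    rw [← mul_add]
    congr 1
    have e3 : ∫ s in Set.Ioi (0 : ℝ), Complex.exp ((p₀ - σ) * s) *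
        ∑' γ, N i₀ j₀ γ * Complex.exp (-p i₀ j₀ γ * T) * Complex.exp (-p i₀ j₀ γ * s) =
        ∫ s in Set.Ioi (0 : ℝ), Complex.exp ((p₀ - σ) * s) * ν₀ s := by
      simp only [hν₀, hνs]
    rw [e3, ← MeasureTheory.integral_add i1 i2]
    refine MeasureTheory.setIntegral_congr_fun measurableSet_Ioi fun s hs => ?_
    rw [hh s hs, mul_add]
  have hfin := tendsto_nhds_unique (hlim1.congr' hsplit) (hlim2.add hlim3)
  rw [add_zero] at hfin
  exact mul_ne_zero h1 (Complex.exp_ne_zero _) hfin.symm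

end PeriodRH

namespace PeriodRH

section MatrixPower

open scoped Matrix.Norms.Operator

variable {ι : Type*} [Fintype ι] [DecidableEq ι]

/-- The matrix function `(z exp (-i d)) ^ (s 𝔸)`. -/
def matPow (d : ℝ) (𝔸 : Matrix ι ι ℂ) (s : ℂ) (z : ℂ) : Matrix ι ι ℂ :=
  NormedSpace.exp ((s * Complex.log (z * Complex.exp (-(d * Complex.I)))) • 𝔸)

theorem eventually_mem_slitPlane {d θ : ℝ} (h : |θ - d| < Real.pi) :
    ∀ᶠ z in dirNhds (Circle.exp θ), z * Complex.exp (-(d * Complex.I)) ∈ Complex.slitPlane := by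
  rw [eventually_dirNhds_iff]
  have h1 : ∀ᶠ t in 𝓝 θ, |t - d| < Real.pi :=
    (show Continuous fun t : ℝ => |t - d| by fun_prop).continuousAt.eventually_lt continuousAt_const h
  have h0 : ∀ᶠ r in 𝓝[>] (0 : ℝ), 0 < r := self_mem_nhdsWithin
  filter_upwards [(h0.prod_inl (𝓝 θ)).and (h1.prod_inr (𝓝[>] (0 : ℝ)))] with x hx
  obtain ⟨hr, ht⟩ := hx
  have hr0 : 0 < x.1 := hr
  have e : polar x * Complex.exp (-(d * Complex.I)) =
      (x.1 : ℂ) * (Complex.cos ((x.2 - d : ℝ) : ℂ) + Complex.sin ((x.2 - d : ℝ) : ℂ) * Complex.I) := by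
    rw [← Complex.exp_mul_I]
    simp only [polar]
    rw [mul_assoc, ← Complex.exp_add]
    congr 2
    push_cast
    ring
  obtain ⟨l1, l2⟩ := abs_lt.1 ht
  have harg := Complex.arg_mul_cos_add_sin_mul_I hr0 (θ := x.2 - d) ⟨l1, l2.le⟩
  rw [Complex.mem_slitPlane_iff_arg]
  rw [e]
  refine ⟨by rw [harg]; exact l2.ne, ?_⟩
  rw [← Complex.exp_mul_I]
  exact mul_ne_zero (by exact_mod_cast hr0.ne') (Complex.exp_ne_zero _)

theorem hasDerivAt_matPow (d : ℝ) (𝔸 : Matrix ι ι ℂ) (s : ℂ) {z : ℂ}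
    (h : z * Complex.exp (-(d * Complex.I)) ∈ Complex.slitPlane) (i j : ι) :
    HasDerivAt (fun z => matPow d 𝔸 s z i j) (s / z * (𝔸 * matPow d 𝔸 s z) i j) z := by
  have hz : z ≠ 0 := by
    rintro rfl
    simp at h
  have h1 : HasDerivAt (fun u : ℂ => NormedSpace.exp (u • 𝔸))
      (𝔸 * NormedSpace.exp ((s * Complex.log (z * Complex.exp (-(d * Complex.I)))) • 𝔸))
      (s * Complex.log (z * Complex.exp (-(d * Complex.I)))) := hasDerivAt_exp_smul_const' 𝔸 _
  have h2 : HasDerivAt (fun z => s * Complex.log (z * Complex.exp (-(d * Complex.I)))) (s / z) z := by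
    have h3 := (((hasDerivAt_id z).mul_const (Complex.exp (-(d * Complex.I)))).clog h).const_mul s
    have e : s / z = s * (1 * Complex.exp (-(d * Complex.I)) / (z * Complex.exp (-(d * Complex.I)))) := by
      rw [mul_div_mul_right _ _ (Complex.exp_ne_zero _), mul_one_div]
    rw [e]
    exact h3
  have h4 := h1.scomp z h2
  have h5 : HasDerivAt (fun z => matPow d 𝔸 s z) ((s / z) • (𝔸 * matPow d 𝔸 s z)) z := h4
  exact hasDerivAt_pi.1 (hasDerivAt_pi.1 h5 i) j

theorem matPow_mul_neg (d : ℝ) (𝔸 : Matrix ι ι ℂ) (s : ℂ) (z : ℂ) :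
    matPow d 𝔸 s z * matPow d 𝔸 (-s) z = 1 := by
  unfold matPow
  rw [← Matrix.exp_add_of_commute _ _ (((Commute.refl 𝔸).smul_left _).smul_right _), ← add_smul]
  simp

theorem norm_exp_le_mul_exp {A : Type*} [NormedRing A] [NormedAlgebra ℂ A] [CompleteSpace A] (x : A) :
    ‖NormedSpace.exp x‖ ≤ (1 + ‖(1 : A)‖) * Real.exp ‖x‖ := by
  rw [NormedSpace.exp_eq_tsum ℂ]
  have hs : HasSum (fun n : ℕ => ‖x‖ ^ n / n.factorial) (Real.exp ‖x‖) := by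
    rw [Real.exp_eq_exp_ℝ]
    exact NormedSpace.expSeries_div_hasSum_exp ‖x‖
  refine tsum_of_norm_bounded (hs.mul_left (1 + ‖(1 : A)‖)) fun n => ?_
  have hpow : ‖x ^ n‖ ≤ (1 + ‖(1 : A)‖) * ‖x‖ ^ n := by
    rcases Nat.eq_zero_or_pos n with rfl | hn
    · simp
    · have := norm_pow_le' x hn
      have : 0 ≤ ‖(1 : A)‖ * ‖x‖ ^ n := by positivity
      nlinarith
  rw [norm_smul, norm_inv, Complex.norm_natCast, mul_div_assoc', div_eq_inv_mul]
  gcongr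

theorem norm_entry_le_linfty_opNorm (M : Matrix ι ι ℂ) (i j : ι) : ‖M i j‖ ≤ ‖M‖ := by
  have h := (norm_le_pi_norm (M.mulVec (Pi.single j 1)) i).trans
    (Matrix.linfty_opNorm_mulVec M (Pi.single j 1))
  simpa [Pi.norm_single] using h

theorem matPow_bound (d : ℝ) (𝔸 : Matrix ι ι ℂ) (s : ℂ) (w : Circle) (i j : ι) :
    ∃ B > 0, ∃ N : ℕ, ∀ᶠ z in dirNhds w, ‖matPow d 𝔸 s z i j‖ ≤ B * (‖z‖⁻¹) ^ N := by
  obtain ⟨N, hN⟩ := exists_nat_ge (‖s‖ * ‖𝔸‖)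
  refine ⟨(1 + ‖(1 : Matrix ι ι ℂ)‖) * Real.exp (Real.pi * N), by positivity, N, ?_⟩
  filter_upwards [eventually_norm_lt w one_pos, eventually_ne_dirNhds w] with z hz hz0
  have hz1 : 0 < ‖z‖ := norm_pos_iff.2 hz0
  refine (norm_entry_le_linfty_opNorm _ i j).trans ?_
  have hl : ‖Complex.log (z * Complex.exp (-(d * Complex.I)))‖ ≤ Real.log ‖z‖⁻¹ + Real.pi := by
    refine (Complex.norm_le_abs_re_add_abs_im _).trans (add_le_add ?_ ?_)
    · rw [Complex.log_re, norm_mul, ← neg_mul, ← Complex.ofReal_neg, Complex.norm_exp_ofReal_mul_I, mul_one,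
        Real.log_inv, abs_of_nonpos (Real.log_nonpos hz1.le hz.le)]
    · rw [Complex.log_im]
      exact Complex.abs_arg_le_pi _
  have hl0 : 0 ≤ Real.log ‖z‖⁻¹ := Real.log_nonneg ((one_le_inv₀ hz1).2 hz.le)
  refine (norm_exp_le_mul_exp _).trans ?_
  rw [mul_assoc]
  gcongr
  have h3 : Real.exp (Real.pi * N) * (‖z‖⁻¹) ^ N = Real.exp ((Real.log ‖z‖⁻¹ + Real.pi) * N) := by
    rw [add_mul, Real.exp_add, mul_comm, mul_comm (Real.log _), Real.exp_nat_mul,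
      Real.exp_log (inv_pos.2 hz1)]
  rw [h3]
  refine Real.exp_le_exp.2 ?_
  rw [norm_smul, norm_mul]
  calc _ = ‖Complex.log (z * Complex.exp (-(d * Complex.I)))‖ * (‖s‖ * ‖𝔸‖) := by ring
    _ ≤ _ := by gcongr

theorem matPow_commute {𝔸 B : Matrix ι ι ℂ} (h : Commute 𝔸 B) (d : ℝ) (s z : ℂ) :
    matPow d 𝔸 s z * B = B * matPow d 𝔸 s z :=
  ((h.symm.smul_right _).exp_right).symm.eq

end MatrixPower

end PeriodRH

namespace PeriodRH

theorem germ_sum_mul {w : Circle} {κ : Type*} (S : Finset κ) {x y : κ → O w} {f g : κ → ℂ → ℂ}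
    (hx : ∀ k, (x k).germ = (f k : Germ (dirNhds w) ℂ)) (hy : ∀ k, (y k).germ = (g k : Germ (dirNhds w) ℂ)) :
    (∑ k ∈ S, x k * y k).germ = ((fun z => ∑ k ∈ S, f k z * g k z : ℂ → ℂ) : Germ (dirNhds w) ℂ) := by
  classical
  induction S using Finset.induction_on with
  | empty => simp; rfl
  | insert k S hk ih =>
    rw [Finset.sum_insert hk, map_add, ih, map_mul, hx, hy]
    simp only [Finset.sum_insert hk]
    rfl

theorem Mero.D_const (b : ℂ) : Mero.D (Mero.const b) = 0 := by
  apply Subtype.ext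
  change derivGerm _ ((fun _ => b : ℂ → ℂ) : Germ (𝓝[≠] (0 : ℂ)) ℂ) =
    ((fun _ => 0 : ℂ → ℂ) : Germ (𝓝[≠] (0 : ℂ)) ℂ)
  rw [derivGerm_coe]
  simp

theorem algebraMap_mero_const (w : Circle) (b : ℂ) :
    algebraMap Mero (O w) (Mero.const b) = Hol.const b := rfl

theorem germ_mero_X (w : Circle) : (algebraMap Mero (O w) Mero.X).germ = ((fun z => z : ℂ → ℂ) : Germ (dirNhds w) ℂ) := rfl

theorem Mero.X_ne_zero : Mero.X ≠ 0 := by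
  intro h
  have h1 : ((fun z => z : ℂ → ℂ) : Germ (𝓝[≠] (0 : ℂ)) ℂ) = ((fun _ => 0 : ℂ → ℂ) : Germ (𝓝[≠] (0 : ℂ)) ℂ) :=
    congrArg Subtype.val h
  have h2 : ∀ᶠ z in 𝓝[≠] (0 : ℂ), z = 0 := Germ.coe_eq.1 h1
  obtain ⟨z, hz, hz0⟩ := (h2.and self_mem_nhdsWithin).exists
  exact hz0 hz

section Frame

variable {E : Type*} [AddCommGroup E] [Module Mero E] {ι : Type*} [Fintype ι]

/-- The coordinates on `O w ⊗ E` given by a basis of `E`. -/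
def coordB (b : Module.Basis ι Mero E) (w : Circle) : (O w ⊗[Mero] E) ≃ₗ[O w] (ι → O w) :=
  (b.baseChange (O w)).equivFun

theorem coordB_symm (b : Module.Basis ι Mero E) (w : Circle) (x : ι → O w) :
    (coordB b w).symm x = ∑ i, x i ⊗ₜ b i := by
  rw [coordB, Module.Basis.equivFun_symm_apply]
  refine Finset.sum_congr rfl fun i _ => ?_
  rw [Module.Basis.baseChange_apply, TensorProduct.smul_tmul', smul_eq_mul, mul_one]

theorem coordB_tmul (b : Module.Basis ι Mero E) (w : Circle) (f : O w) (e : E) (i : ι) :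
    coordB b w (f ⊗ₜ e) i = f * algebraMap Mero (O w) (b.repr e i) := by
  rw [coordB, Module.Basis.equivFun_apply, Module.Basis.baseChange_repr_tmul, Algebra.smul_def, mul_comm]

theorem ext_coordB_symm (N : Connection E) (b : Module.Basis ι Mero E) (w : Circle) (x : ι → O w) :
    N.ext w ((coordB b w).symm x) = (coordB b w).symm fun i =>
      Hol.D (x i) + ∑ j, algebraMap Mero (O w) (b.repr (N.nabla (b j)) i) * x j := by
  apply (coordB b w).injective
  rw [LinearEquiv.apply_symm_apply, coordB_symm, map_sum, map_sum]
  ext i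
  rw [Finset.sum_apply]
  simp only [N.ext_tmul, map_add, Pi.add_apply, coordB_tmul, Finset.sum_add_distrib]
  congr 1
  · classical
    rw [Finset.sum_eq_single i]
    · simp
    · intro j _ hj
      simp [hj]
    · simp
  · refine Finset.sum_congr rfl fun j _ => mul_comm _ _

variable [DecidableEq ι]

/-- A frame in which the connection is the direct sum of the rank one connections
`d - c_i dz / z²`, over the complement of the direction opposite to `exp (i d)`. -/
structure FlatFrame (N : Connection E) (d : ℝ) (c : ι → ℂ) where
  /-- a basis of `E` -/
  b : Module.Basis ι Mero E
  /-- the change of frame -/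
  G : ∀ v, (Matrix ι ι (O v))ˣ
  isSec : ∀ θ : ℝ, |θ - d| < Real.pi → ∀ i j, IsSec (fun v => (G v).1 i j) (Circle.exp θ)
  isSec_inv : ∀ θ : ℝ, |θ - d| < Real.pi → ∀ i j, IsSec (fun v => (G v)⁻¹.1 i j) (Circle.exp θ)
  mod : ∀ θ : ℝ, |θ - d| < Real.pi → ∀ i j, (G (Circle.exp θ)).1 i j ∈ Amod0 (Circle.exp θ)
  mod_inv : ∀ θ : ℝ, |θ - d| < Real.pi → ∀ i j, (G (Circle.exp θ))⁻¹.1 i j ∈ Amod0 (Circle.exp θ)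
  ext_eq : ∀ θ : ℝ, |θ - d| < Real.pi → ∀ y : ι → O (Circle.exp θ),
    N.ext (Circle.exp θ) ((coordB b _).symm ((G (Circle.exp θ)).1.mulVec y)) =
      (coordB b _).symm ((G (Circle.exp θ)).1.mulVec fun i =>
        Hol.D (y i) - Hol.const (c i) * algebraMap Mero (O (Circle.exp θ)) Mero.X⁻¹ ^ 2 * y i)

theorem germ_toO_matPow {d θ : ℝ} (h : |θ - d| < Real.pi) (𝔸 : Matrix ι ι ℂ) (s : ℂ) (i j : ι) :
    (∀ᶠ z in dirNhds (Circle.exp θ), DifferentiableAt ℂ (fun z => matPow d 𝔸 s z i j) z) ∧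
    (toO (fun z => matPow d 𝔸 s z i j) (Circle.exp θ)).germ =
      ((fun z => matPow d 𝔸 s z i j : ℂ → ℂ) : Germ (dirNhds (Circle.exp θ)) ℂ) := by
  have h1 : ∀ᶠ z in dirNhds (Circle.exp θ), DifferentiableAt ℂ (fun z => matPow d 𝔸 s z i j) z := by
    filter_upwards [eventually_mem_slitPlane h] with z hz
    exact (hasDerivAt_matPow d 𝔸 s hz i j).differentiableAt
  exact ⟨h1, germ_toO h1⟩

theorem exists_matPow_units (d : ℝ) (𝔸 : Matrix ι ι ℂ) : ∃ G : ∀ v, (Matrix ι ι (O v))ˣ,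
    ∀ θ : ℝ, |θ - d| < Real.pi → ∀ i j,
      (G (Circle.exp θ)).1 i j = toO (fun z => matPow d 𝔸 (-1) z i j) (Circle.exp θ) ∧
      (G (Circle.exp θ))⁻¹.1 i j = toO (fun z => matPow d 𝔸 1 z i j) (Circle.exp θ) := by
  have key : ∀ v : Circle, ∃ U : (Matrix ι ι (O v))ˣ, ∀ θ : ℝ, |θ - d| < Real.pi → Circle.exp θ = v →
      ∀ i j, U.1 i j = toO (fun z => matPow d 𝔸 (-1) z i j) v ∧
        U⁻¹.1 i j = toO (fun z => matPow d 𝔸 1 z i j) v := by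
    intro v
    by_cases hv : ∃ θ : ℝ, |θ - d| < Real.pi ∧ Circle.exp θ = v
    · obtain ⟨θ, hθ, rfl⟩ := hv
      have hmul : ∀ s : ℂ, (Matrix.of fun i j => toO (fun z => matPow d 𝔸 s z i j) (Circle.exp θ)) *
          (Matrix.of fun i j => toO (fun z => matPow d 𝔸 (-s) z i j) (Circle.exp θ)) = 1 := by
        intro s
        ext i j
        apply Hol.germ_injective
        rw [Matrix.mul_apply]
        simp only [Matrix.of_apply]
        rw [germ_sum_mul _ (fun k => (germ_toO_matPow hθ 𝔸 s i k).2)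
          fun k => (germ_toO_matPow hθ 𝔸 (-s) k j).2]
        have e : ∀ z, ∑ k, matPow d 𝔸 s z i k * matPow d 𝔸 (-s) z k j = (1 : Matrix ι ι ℂ) i j := fun z => by
          rw [← Matrix.mul_apply, matPow_mul_neg]
        simp only [e, Matrix.one_apply]
        split_ifs <;> rfl
      refine ⟨⟨_, _, hmul (-1), ?_⟩, fun _ _ _ i j => ⟨rfl, by simp⟩⟩
      have := hmul 1
      rwa [← neg_neg (1 : ℂ), neg_neg (-1 : ℂ)] at this
    · exact ⟨1, fun θ hθ h => (hv ⟨θ, hθ, h⟩).elim⟩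
  choose G hG using key
  exact ⟨G, fun θ hθ => hG _ θ hθ rfl⟩

theorem Connection.IsElementaryExponential.exists_basis {N : Connection E} {C : Finset ℂ}
    (h : N.IsElementaryExponential C) : ∃ (r : C → ℕ) (b : Module.Basis (Σ c : C, Fin (r c)) Mero E)
      (𝔸 : Matrix (Σ c : C, Fin (r c)) (Σ c : C, Fin (r c)) ℂ),
      (∀ i j, 𝔸 i j ≠ 0 → i.1 = j.1) ∧ ∀ i j, b.repr (N.nabla (b j)) i =
        -(Mero.const ((i.1 : ℂ)) * (if i = j then 1 else 0) - Mero.X * Mero.const (𝔸 i j)) / Mero.X ^ 2 := by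
  obtain ⟨r, A, φ, hφ⟩ := h
  let b0 : Module.Basis (Σ c : C, Fin (r c)) Mero (∀ c, Fin (r c) → Mero) :=
    Pi.basis fun c => Pi.basisFun Mero (Fin (r c))
  have hrepr : ∀ e i, (b0.map φ.symm).repr e i = φ e i.1 i.2 := by
    intro e i
    simp [b0, Pi.basis_repr]
  refine ⟨r, b0.map φ.symm, Matrix.blockDiagonal' A, ?_, ?_⟩
  · rintro ⟨c, i⟩ ⟨c', j⟩ h0
    by_contra hne
    exact h0 (Matrix.blockDiagonal'_apply_ne A _ _ hne)
  · rintro ⟨c, i⟩ j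
    have hδ : ∀ k : Σ c : C, Fin (r c), φ ((b0.map φ.symm) j) k.1 k.2 = if k = j then 1 else 0 := by
      intro k
      rw [← hrepr, Module.Basis.repr_self, Finsupp.single_apply]
      simp only [eq_comm]
    rw [hrepr, hφ]
    have h1 := hδ ⟨c, i⟩
    simp only at h1
    have h2 : Mero.D (if (⟨c, i⟩ : Σ c : C, Fin (r c)) = j then 1 else 0) = 0 := by
      split_ifs
      · exact Mero.D_const 1
      · exact Mero.D_const 0
    have h3 : ∑ k, Mero.const (A c i k) * φ ((b0.map φ.symm) j) c k =
        Mero.const (Matrix.blockDiagonal' A ⟨c, i⟩ j) := by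
      have h4 : ∀ k, φ ((b0.map φ.symm) j) c k = if (⟨c, k⟩ : Σ c : C, Fin (r c)) = j then 1 else 0 :=
        fun k => hδ ⟨c, k⟩
      simp only [h4]
      obtain ⟨c', j⟩ := j
      by_cases hc : c = c'
      · subst hc
        rw [Finset.sum_eq_single j]
        · simp [Matrix.blockDiagonal'_apply]
        · intro k _ hk
          simp [hk]
        · simp
      · rw [Matrix.blockDiagonal'_apply_ne A _ _ hc]
        refine (Finset.sum_eq_zero fun k _ => ?_).trans rfl
        simp [hc]
    rw [h1, h2, h3]
    ring

theorem Connection.IsElementaryExponential.exists_flatFrame {N : Connection E} {C : Finset ℂ}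
    (h : N.IsElementaryExponential C) (d : ℝ) :
    ∃ (r : C → ℕ), Nonempty (FlatFrame N d fun i : Σ c : C, Fin (r c) => (i.1 : ℂ)) := by
  obtain ⟨r, b, 𝔸, h𝔸, hb⟩ := h.exists_basis
  obtain ⟨G, hG⟩ := exists_matPow_units d 𝔸
  have hnear : ∀ {θ : ℝ}, |θ - d| < Real.pi → ∀ᶠ v in 𝓝 (Circle.exp θ), ∀ i j,
      (G v).1 i j = toO (fun z => matPow d 𝔸 (-1) z i j) v ∧
      (G v)⁻¹.1 i j = toO (fun z => matPow d 𝔸 1 z i j) v := by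
    intro θ hθ
    rw [eventually_exp_iff]
    filter_upwards [(show Continuous fun t : ℝ => |t - d| by fun_prop).continuousAt.eventually_lt
      continuousAt_const hθ] with t ht using hG t ht
  have hmod : ∀ {θ : ℝ}, |θ - d| < Real.pi → ∀ s i j,
      toO (fun z => matPow d 𝔸 s z i j) (Circle.exp θ) ∈ Amod0 (Circle.exp θ) := fun hθ s i j =>
    (mem_Amod0_iff (germ_toO_matPow hθ 𝔸 s i j).2).2 (matPow_bound d 𝔸 s _ i j)
  refine ⟨r, ⟨⟨b, G, fun θ hθ i j => ?_, fun θ hθ i j => ?_, fun θ hθ i j => ?_, fun θ hθ i j => ?_,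
    fun θ hθ y => ?_⟩⟩⟩
  · refine IsSec.congr ?_ (isSec_toO (germ_toO_matPow hθ 𝔸 (-1) i j).1)
    filter_upwards [hnear hθ] with v hv using (hv i j).1.symm
  · refine IsSec.congr ?_ (isSec_toO (germ_toO_matPow hθ 𝔸 1 i j).1)
    filter_upwards [hnear hθ] with v hv using (hv i j).2.symm
  · rw [(hG θ hθ i j).1]
    exact hmod hθ _ i j
  · rw [(hG θ hθ i j).2]
    exact hmod hθ _ i j
  · rw [ext_coordB_symm]
    congr 1
    have hg : ∀ i j, ((G (Circle.exp θ)).1 i j).germ =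
        ((fun z => matPow d 𝔸 (-1) z i j : ℂ → ℂ) : Germ (dirNhds (Circle.exp θ)) ℂ) := fun i j => by
      rw [(hG θ hθ i j).1, (germ_toO_matPow hθ 𝔸 (-1) i j).2]
    have hsl := eventually_mem_slitPlane hθ
    clear hnear hmod hG
    generalize Circle.exp θ = w at hg hsl y ⊢
    generalize (G w).1 = Γ at hg ⊢
    obtain ⟨x, hx⟩ : ∃ x : O w, x = algebraMap Mero (O w) Mero.X⁻¹ := ⟨_, rfl⟩
    have hxg : x.germ = ((fun z => z⁻¹ : ℂ → ℂ) : Germ (dirNhds w) ℂ) := by rw [hx]; rfl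
    rw [← hx]
    have hD : ∀ i j, Hol.D (Γ i j) = -x * ∑ k, Hol.const (𝔸 i k) * Γ k j := by
      intro i j
      apply Hol.germ_injective
      rw [Hol.germ_D, hg, derivGerm_coe, map_mul, map_neg, hxg,
        germ_sum_mul (f := fun k _ => 𝔸 i k) (g := fun k z => matPow d 𝔸 (-1) z k j) _ (fun k => rfl)
          fun k => hg k j]
      refine Germ.coe_eq.2 ?_
      filter_upwards [hsl] with z hz
      rw [(hasDerivAt_matPow d 𝔸 (-1) hz i j).deriv, Matrix.mul_apply]
      simp [neg_div]
    have hcomm : ∀ i j, Hol.const ((i.1 : ℂ)) * Γ i j = Γ i j * Hol.const ((j.1 : ℂ)) := by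
      intro i j
      apply Hol.germ_injective
      rw [map_mul, map_mul, hg]
      refine Germ.coe_eq.2 (Eventually.of_forall fun z => ?_)
      have hc : Commute 𝔸 (Matrix.diagonal fun i : Σ c : C, Fin (r c) => (i.1 : ℂ)) := by
        ext i j
        rw [Matrix.mul_diagonal, Matrix.diagonal_mul, mul_comm]
        by_cases h0 : 𝔸 i j = 0
        · simp [h0]
        · rw [h𝔸 i j h0]
      have h1 := congrFun (congrFun (matPow_commute hc d (-1) z) i) j
      rw [Matrix.mul_diagonal, Matrix.diagonal_mul] at h1
      exact h1.symm
    have hcoef : ∀ i j, algebraMap Mero (O w) (b.repr (N.nabla (b j)) i) =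
        -(Hol.const ((i.1 : ℂ)) * x ^ 2 * (if i = j then 1 else 0)) + x * Hol.const (𝔸 i j) := by
      intro i j
      rw [hb, ← algebraMap_mero_const, ← algebraMap_mero_const]
      have : (if i = j then (1 : O w) else 0) = algebraMap Mero (O w) (if i = j then 1 else 0) := by
        split_ifs <;> simp
      rw [this, hx]
      simp only [← map_mul, ← map_pow, ← map_neg, ← map_add]
      congr 1
      field_simp [Mero.X_ne_zero]
      ring
    ext i
    simp only [hcoef, Matrix.mulVec, dotProduct]
    have e1 : Hol.D (∑ j, Γ i j * y j) =
        -x * (∑ j, ∑ k, Hol.const (𝔸 i k) * Γ k j * y j) + ∑ j, Γ i j * Hol.D (y j) := by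
      rw [map_sum]
      simp only [Hol.D_mul, hD, Finset.sum_add_distrib]
      rw [Finset.mul_sum]
      congr 1
      refine Finset.sum_congr rfl fun j _ => ?_
      rw [mul_assoc, Finset.sum_mul]
    have e2 : ∑ k, (-(Hol.const ((i.1 : ℂ)) * x ^ 2 * (if i = k then 1 else 0)) + x * Hol.const (𝔸 i k)) *
        (∑ j, Γ k j * y j) = -(∑ j, Γ i j * (Hol.const ((j.1 : ℂ)) * x ^ 2 * y j)) +
          x * (∑ j, ∑ k, Hol.const (𝔸 i k) * Γ k j * y j) := by
      simp only [add_mul, Finset.sum_add_distrib]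
      congr 1
      · rw [Finset.sum_eq_single i]
        · rw [if_pos rfl, mul_one, Finset.mul_sum, ← Finset.sum_neg_distrib]
          refine Finset.sum_congr rfl fun j _ => ?_
          linear_combination (-x ^ 2 * y j) * hcomm i j
        · intro k _ hk
          simp [Ne.symm hk]
        · simp
      · rw [Finset.sum_comm, Finset.mul_sum]
        refine Finset.sum_congr rfl fun k _ => ?_
        simp only [Finset.mul_sum]
        refine Finset.sum_congr rfl fun j _ => ?_
        ring
    rw [e1, e2]
    simp only [mul_sub, Finset.sum_sub_distrib]
    ring

end Frame

end PeriodRH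

namespace PeriodRH

theorem Hol.D_const {w : Circle} (a : ℂ) : Hol.D (Hol.const a : O w) = 0 := by
  apply Hol.germ_injective
  change derivGerm _ ((fun _ => a : ℂ → ℂ) : Germ (dirNhds w) ℂ) = ((fun _ => 0 : ℂ → ℂ) : Germ (dirNhds w) ℂ)
  rw [derivGerm_coe]
  simp

theorem D_expO (c : ℂ) (w : Circle) : Hol.D (expO c w) =
    -(Hol.const c * algebraMap Mero (O w) Mero.X⁻¹ ^ 2 * expO c w) := by
  apply Hol.germ_injective
  rw [Hol.germ_D]
  change derivGerm _ ((fun z => Complex.exp (c / z) : ℂ → ℂ) : Germ (dirNhds w) ℂ) =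
    ((fun z => -(c * z⁻¹ ^ 2 * Complex.exp (c / z)) : ℂ → ℂ) : Germ (dirNhds w) ℂ)
  rw [derivGerm_coe]
  refine Germ.coe_eq.2 ?_
  filter_upwards [eventually_ne_dirNhds w] with z hz
  have h := ((hasDerivAt_inv hz).const_mul c).cexp
  simp only [div_eq_mul_inv]
  rw [h.deriv]
  field_simp

theorem expO_mul_neg (c : ℂ) (w : Circle) : expO c w * expO (-c) w = 1 := by
  rw [← expO_add, add_neg_cancel, expO_zero]

theorem mero_mem_Amod0 (k : Mero) (w : Circle) : algebraMap Mero (O w) k ∈ Amod0 w := by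
  obtain ⟨f, hf, hk⟩ := k.2
  have hg : (algebraMap Mero (O w) k).germ = (f : Germ (dirNhds w) ℂ) := by
    change Germ.compTendsto k.1 id (lc := dirNhds w) (dirNhds_le w) = _
    rw [← hk]
    rfl
  rw [mem_Amod0_iff hg]
  obtain ⟨n, hn⟩ := hf
  simp only [sub_zero] at hn
  have hc := hn.continuousAt.norm.eventually_lt continuousAt_const
    (show ‖(0 : ℂ) ^ n • f 0‖ < ‖(0 : ℂ) ^ n • f 0‖ + 1 by linarith)
  refine ⟨‖(0 : ℂ) ^ n • f 0‖ + 1, by positivity, n, ?_⟩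
  filter_upwards [(dirNhds_le w).trans nhdsWithin_le_nhds hc, eventually_ne_dirNhds w] with z hz hz0
  have hz1 : 0 < ‖z‖ ^ n := by positivity
  rw [inv_pow, ← div_eq_mul_inv, le_div_iff₀ hz1, mul_comm]
  rw [norm_smul, norm_pow] at hz
  exact hz.le

theorem Amod_mul_Amod0 {w : Circle} {c : ℂ} {g h : O w} (hg : g ∈ Amod c w) (hh : h ∈ Amod0 w) :
    g * h ∈ Amod c w := by
  rw [← Amod_zero] at hh
  simpa using Amod_mul hg hh

theorem zero_mem_Amod (c : ℂ) (w : Circle) : (0 : O w) ∈ Amod c w :=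
  ⟨0, (modR w).zero_mem, by rw [mul_zero]⟩

theorem neg_mem_Amod {w : Circle} {c : ℂ} {g : O w} (hg : g ∈ Amod c w) : -g ∈ Amod c w := by
  obtain ⟨h, hh, rfl⟩ := hg
  exact ⟨-h, (modR w).neg_mem hh, by rw [mul_neg]⟩

theorem sum_mem_Amod {w : Circle} {c : ℂ} {κ : Type*} (S : Finset κ) {g : κ → O w}
    (hg : ∀ i ∈ S, g i ∈ Amod c w) : ∑ i ∈ S, g i ∈ Amod c w := by
  classical
  induction S using Finset.induction_on with
  | empty => simpa using zero_mem_Amod c w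
  | insert i S hi ih =>
    rw [Finset.sum_insert hi]
    exact Amod_add (hg i (Finset.mem_insert_self i S)) (ih fun j hj => hg j (Finset.mem_insert_of_mem hj))

section Endo

variable {E : Type*} [AddCommGroup E] [Module Mero E] {w : Circle}

theorem endSpan_apply {e e' : ℂ} {ψ : Module.End (O w) (O w ⊗[Mero] E)} (hψ : ψ ∈ endSpan E e w)
    {x : O w ⊗[Mero] E} (hx : x ∈ tensorSpan E (Amod e' w)) : ψ x ∈ tensorSpan E (Amod (e + e') w) := by
  induction hψ using AddSubgroup.closure_induction with
  | mem ψ h =>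
    obtain ⟨f, hf, u, rfl⟩ := h
    rw [LinearMap.smul_apply]
    refine smul_mem_tensorSpan hf ?_
    induction hx using AddSubgroup.closure_induction with
    | mem x hx =>
      obtain ⟨g, hg, y, rfl⟩ := hx
      exact AddSubgroup.subset_closure ⟨g, hg, u y, rfl⟩
    | zero => simp
    | add x y _ _ hx hy => rw [map_add]; exact add_mem hx hy
    | neg x _ hx => rw [map_neg]; exact neg_mem hx
  | zero => simp
  | add ψ ψ' _ _ h h' => rw [LinearMap.add_apply]; exact add_mem h h'
  | neg ψ _ h => rw [LinearMap.neg_apply]; exact neg_mem h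

variable {ι : Type*} [Fintype ι]

theorem mem_tensorSpan_iff_coordB (b : Module.Basis ι Mero E) {e : ℂ} {x : O w ⊗[Mero] E} :
    x ∈ tensorSpan E (Amod e w) ↔ ∀ i, coordB b w x i ∈ Amod e w := by
  constructor
  · intro hx
    induction hx using AddSubgroup.closure_induction with
    | mem x hx =>
      obtain ⟨f, hf, y, rfl⟩ := hx
      intro i
      rw [coordB_tmul]
      exact Amod_mul_Amod0 hf (mero_mem_Amod0 _ _)
    | zero => intro i; rw [map_zero]; exact zero_mem_Amod e w
    | add x y _ _ hx hy => intro i; rw [map_add]; exact Amod_add (hx i) (hy i)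
    | neg x _ hx => intro i; rw [map_neg]; exact neg_mem_Amod (hx i)
  · intro h
    rw [← (coordB b w).symm_apply_apply x, coordB_symm]
    exact sum_mem fun i _ => AddSubgroup.subset_closure ⟨_, h i, _, rfl⟩

theorem isSec_coordB (b : Module.Basis ι Mero E) {t : ∀ v, O v ⊗[Mero] E} (ht : IsSecT t w) (i : ι) :
    IsSec (fun v => coordB b v (t v) i) w := by
  obtain ⟨n, s, e, hs, h⟩ := ht
  refine IsSec.congr ?_ (IsSec.sum Finset.univ fun k => (hs k).mul (isSec_mero (b.repr (e k) i)))
  filter_upwards [h] with v hv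
  rw [hv, map_sum, Finset.sum_apply]
  exact Finset.sum_congr rfl fun k _ => (coordB_tmul b v _ _ i).symm

theorem isSecT_coordB_symm (b : Module.Basis ι Mero E) {y : ∀ v, ι → O v}
    (hy : ∀ i, IsSec (fun v => y v i) w) : IsSecT (fun v => (coordB b v).symm (y v)) w := by
  refine IsSecT.congr (Eventually.of_forall fun v => (coordB_symm b v (y v)).symm)
    (IsSecT.sum Finset.univ fun i => isSecT_tmul (hy i) (b i))

end Endo

theorem IsSec.mulVec {ι κ : Type*} [Fintype κ] {w : Circle} {A : ∀ v, Matrix ι κ (O v)}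
    {y : ∀ v, κ → O v}
    (hA : ∀ i j, IsSec (fun v => A v i j) w) (hy : ∀ j, IsSec (fun v => y v j) w) (i : ι) :
    IsSec (fun v => (A v).mulVec (y v) i) w :=
  IsSec.sum Finset.univ fun j => (hA i j).mul (hy j)

theorem IsSec.matMul {ι κ σ : Type*} [Fintype κ] {w : Circle} {A : ∀ v, Matrix ι κ (O v)}
    {B : ∀ v, Matrix κ σ (O v)} (hA : ∀ i j, IsSec (fun v => A v i j) w)
    (hB : ∀ i j, IsSec (fun v => B v i j) w) (i : ι) (j : σ) :
    IsSec (fun v => (A v * B v) i j) w :=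
  IsSec.congr (Eventually.of_forall fun _ => (Matrix.mul_apply).symm)
    (IsSec.sum Finset.univ fun k => (hA i k).mul (hB k j))

namespace FlatFrame

variable {E : Type*} [AddCommGroup E] [Module Mero E] {ι : Type*} [Fintype ι] [DecidableEq ι]
  {N : Connection E} {d : ℝ} {c : ι → ℂ} (F : FlatFrame N d c)

/-- The coordinates in the frame. -/
def coord (w : Circle) : (O w ⊗[Mero] E) ≃ₗ[O w] (ι → O w) :=
  (coordB F.b w).trans (Matrix.toLin'OfInv (F.G w).mul_inv (F.G w).inv_mul)

theorem coord_apply (w : Circle) (x : O w ⊗[Mero] E) :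
    F.coord w x = (F.G w)⁻¹.1.mulVec (coordB F.b w x) := rfl

theorem coord_symm (w : Circle) (y : ι → O w) :
    (F.coord w).symm y = (coordB F.b w).symm ((F.G w).1.mulVec y) := rfl

variable {θ : ℝ}

theorem coord_ext (hθ : |θ - d| < Real.pi) (x : O (Circle.exp θ) ⊗[Mero] E) (i : ι) :
    F.coord _ (N.ext (Circle.exp θ) x) i = Hol.D (F.coord _ x i) -
      Hol.const (c i) * algebraMap Mero (O (Circle.exp θ)) Mero.X⁻¹ ^ 2 * F.coord _ x i := by
  obtain ⟨y, rfl⟩ := (F.coord _).symm.surjective x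
  rw [coord_symm, F.ext_eq θ hθ, ← coord_symm, ← coord_symm, LinearEquiv.apply_symm_apply,
    LinearEquiv.apply_symm_apply]

theorem flat_iff (hθ : |θ - d| < Real.pi) {x : O (Circle.exp θ) ⊗[Mero] E} : N.ext (Circle.exp θ) x = 0 ↔
    ∀ i, ∃ a : ℂ, F.coord _ x i = Hol.const a * expO (-c i) (Circle.exp θ) := by
  rw [← (F.coord (Circle.exp θ)).map_eq_zero_iff, funext_iff]
  refine forall_congr' fun i => ?_
  rw [F.coord_ext hθ, Pi.zero_apply, sub_eq_zero]
  constructor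
  · intro h
    have h1 : Hol.D (F.coord _ x i * expO (c i) (Circle.exp θ)) = 0 := by
      rw [Hol.D_mul, h, D_expO]
      ring
    obtain ⟨a, ha⟩ := Hol.const_of_D_eq_zero h1
    exact ⟨a, by rw [← ha, mul_assoc, expO_mul_neg, mul_one]⟩
  · rintro ⟨a, ha⟩
    rw [ha, Hol.D_mul, Hol.D_const, D_expO, map_neg]
    ring

theorem mem_tensorSpan_iff (hθ : |θ - d| < Real.pi) {e : ℂ} {x : O (Circle.exp θ) ⊗[Mero] E} :
    x ∈ tensorSpan E (Amod e (Circle.exp θ)) ↔ ∀ i, F.coord _ x i ∈ Amod e (Circle.exp θ) := by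
  rw [mem_tensorSpan_iff_coordB F.b]
  constructor
  · intro h i
    rw [coord_apply]
    refine sum_mem_Amod _ fun j _ => ?_
    rw [mul_comm]
    exact Amod_mul_Amod0 (h j) (F.mod_inv θ hθ i j)
  · intro h i
    rw [← (F.coord _).symm_apply_apply x, coord_symm, LinearEquiv.apply_symm_apply]
    refine sum_mem_Amod _ fun j _ => ?_
    rw [mul_comm]
    exact Amod_mul_Amod0 (h j) (F.mod θ hθ i j)

theorem isSec_coord (hθ : |θ - d| < Real.pi) {t : ∀ v, O v ⊗[Mero] E} (ht : IsSecT t (Circle.exp θ)) (i : ι) :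
    IsSec (fun v => F.coord v (t v) i) (Circle.exp θ) :=
  IsSec.mulVec (F.isSec_inv θ hθ) (isSec_coordB F.b ht) i

/-- The matrix of an endomorphism in the frame. -/
def mat (w : Circle) (ψ : Module.End (O w) (O w ⊗[Mero] E)) : Matrix ι ι (O w) :=
  Matrix.of fun i j => F.coord w (ψ ((F.coord w).symm (Pi.single j 1))) i

theorem coord_end (w : Circle) (ψ : Module.End (O w) (O w ⊗[Mero] E)) (x : O w ⊗[Mero] E) :
    F.coord w (ψ x) = (F.mat w ψ).mulVec (F.coord w x) := by
  obtain ⟨y, rfl⟩ := (F.coord w).symm.surjective x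
  rw [LinearEquiv.apply_symm_apply]
  have h : y = ∑ j, y j • (Pi.single j 1 : ι → O w) := by
    ext i
    simp [Finset.sum_apply, Pi.single_apply]
  conv_lhs => rw [h]
  simp only [map_sum, map_smul]
  ext i
  rw [Finset.sum_apply]
  refine Finset.sum_congr rfl fun j _ => ?_
  rw [Pi.smul_apply, smul_eq_mul, mul_comm]
  rfl

theorem mat_mem_Amod (hθ : |θ - d| < Real.pi) {e : ℂ} {ψ : Module.End (O (Circle.exp θ)) (O (Circle.exp θ) ⊗[Mero] E)}
    (hψ : ψ ∈ endSpan E e (Circle.exp θ)) (i j : ι) : F.mat _ ψ i j ∈ Amod e (Circle.exp θ) := by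
  have h : (F.coord _).symm (Pi.single j 1) ∈ tensorSpan E (Amod 0 (Circle.exp θ)) := by
    rw [F.mem_tensorSpan_iff hθ]
    intro i
    rw [LinearEquiv.apply_symm_apply, Pi.single_apply]
    split_ifs
    · rw [Amod_zero]
      exact (modR _).one_mem
    · exact zero_mem_Amod _ _
  have h1 := (F.mem_tensorSpan_iff hθ).1 (endSpan_apply hψ h) i
  rwa [add_zero] at h1

theorem mat_flat (hθ : |θ - d| < Real.pi) {ψ : Module.End (O (Circle.exp θ)) (O (Circle.exp θ) ⊗[Mero] E)}
    (hψ : ∀ x, N.ext _ (ψ x) = ψ (N.ext _ x)) (i j : ι) :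
    ∃ m : ℂ, F.mat _ ψ i j = Hol.const m * expO (c j - c i) (Circle.exp θ) := by
  have hx : N.ext (Circle.exp θ) ((F.coord (Circle.exp θ)).symm (Pi.single j (expO (-c j) (Circle.exp θ)))) = 0 := by
    rw [F.flat_iff hθ]
    intro k
    rw [LinearEquiv.apply_symm_apply, Pi.single_apply]
    split_ifs with h
    · exact ⟨1, by rw [h, map_one, one_mul]⟩
    · exact ⟨0, by rw [map_zero, zero_mul]⟩
  have h1 := hψ ((F.coord _).symm (Pi.single j (expO (-c j) (Circle.exp θ))))
  rw [hx, map_zero, F.flat_iff hθ] at h1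
  obtain ⟨a, ha⟩ := h1 i
  rw [F.coord_end, LinearEquiv.apply_symm_apply, Matrix.mulVec_single] at ha
  refine ⟨a, ?_⟩
  have ha' : F.mat (Circle.exp θ) ψ i j * expO (-c j) (Circle.exp θ) =
    Hol.const a * expO (-c i) (Circle.exp θ) := ha
  have e : expO (c j - c i) (Circle.exp θ) = expO (-c i) (Circle.exp θ) * expO (c j) (Circle.exp θ) := by rw [← expO_add]; congr 1; ring
  rw [e, ← mul_assoc, ← ha', mul_assoc, mul_comm (expO (-c j) (Circle.exp θ)), expO_mul_neg, mul_one]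

end FlatFrame

section EndNeg

variable {L : Type*} [AddCommGroup L] [Module.Free ℤ L] [Module.Finite ℤ L] {P : PeriodDatum L}
  {ι : Type*} [Fintype ι] {c : ι → ℂ}

theorem lev_neg_nearby {w : Circle} {a : L → ℂ} (h : CoeffAt P w a) {q : ℂ}
    (hq : ∀ γ, a γ ≠ 0 → ltAt w (P.μ γ + q) 0) :
    ∀ᶠ v in 𝓝 w, ∀ γ, a γ ≠ 0 → ltAt v (P.μ γ + q) 0 := by
  obtain ⟨s, hs, hgap⟩ := h.exists_gap (y := -lev w q) fun γ hγ => by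
    have := ltAt_zero_iff.1 (hq γ hγ)
    rw [lev_add] at this
    linarith
  filter_upwards [eventually_inv_sub_lt w (s := s / (1 + ‖q‖)) (by positivity)] with v hv γ hγ
  have h1 := hgap γ hγ
  have h2 := (abs_le.1 (lev_sub_lev_le v w (P.μ γ + q))).2
  have h3 := norm_add_le (P.μ γ) q
  have h4 : ‖P.μ γ + q‖ ≤ (1 + ‖q‖) * (‖P.μ γ‖ + 1) := by
    nlinarith [norm_nonneg (P.μ γ), norm_nonneg q]
  rw [ltAt_zero_iff]
  rw [lev_add w] at h2
  have h5 : ‖((v⁻¹ : Circle) : ℂ) - ((w⁻¹ : Circle) : ℂ)‖ * ‖P.μ γ + q‖ <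
      s / (1 + ‖q‖) * ((1 + ‖q‖) * (‖P.μ γ‖ + 1)) :=
    mul_lt_mul_of_lt_of_le_of_nonneg_of_pos hv h4 (norm_nonneg _) (by positivity)
  have h6 : s / (1 + ‖q‖) * ((1 + ‖q‖) * (‖P.μ γ‖ + 1)) = s * (‖P.μ γ‖ + 1) := by
    field_simp
  linarith

theorem NegOn.of_coeffAt {w : Circle} {M : ι → ι → L → ℂ} (hM : ∀ i j, CoeffAt P w (M i j))
    (hneg : ∀ i j γ, M i j γ ≠ 0 → ltAt w (qexp P c i j γ) 0) : ∃ U ∈ 𝓝 w, NegOn P c U M := by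
  have e : ∀ i j γ, qexp P c i j γ = P.μ γ + (c j - c i) := fun i j γ => add_sub_assoc _ _ _
  have h : ∀ᶠ v in 𝓝 w, ∀ i j γ, M i j γ ≠ 0 → ltAt v (qexp P c i j γ) 0 := by
    simp only [e] at hneg ⊢
    exact eventually_all.2 fun i => eventually_all.2 fun j => lev_neg_nearby (hM i j) (hneg i j)
  refine ⟨_, h, fun i j γ h0 v hv => hv i j γ h0, ?_⟩
  choose ϱ hϱ hϱ1 hsum using fun p : ι × ι => (hM p.1 p.2).exists_le_one
  obtain ⟨t, ht, ht0⟩ : ∃ t : ℝ, (∀ p, t ≤ ϱ p) ∧ 0 < t := by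
    have h2 : ∀ᶠ t : ℝ in 𝓝[>] 0, ∀ p, t ≤ ϱ p := eventually_all.2 fun p =>
      mem_of_superset (Ioo_mem_nhdsGT (hϱ p)) fun t ht => ht.2.le
    exact (h2.and self_mem_nhdsWithin).exists
  refine ⟨t, ht0, fun i j => (hsum (i, j)).of_nonneg_of_le (fun γ => by positivity) fun γ => ?_⟩
  have := P.len_nonneg γ
  have := ht (i, j)
  gcongr

variable [DecidableEq ι] {E : Type*} [AddCommGroup E] [Module Mero E] {N : Connection E} {d : ℝ}

theorem leAt_of_const_mul_mem_Amod {w : Circle} {m q e : ℂ} (hm : m ≠ 0)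
    (h : (Hol.const m : O w) * expO q w ∈ Amod e w) : leAt w q e := by
  have h1 := zero_le_of_const_mem_Amod hm (by
    have h2 := Amod_mul h (expO_mem_Amod (w := w) (-q))
    rw [mul_assoc, expO_mul_neg, mul_one] at h2
    exact h2)
  have h2 := h1.add_right q
  simpa using h2

theorem FlatFrame.mat_endNeg (F : FlatFrame N d c) {θ : ℝ} (hθ : |θ - d| < Real.pi)
    {φ : Module.End (O (Circle.exp θ)) (O (Circle.exp θ) ⊗[Mero] E)}
    (hφ : φ ∈ endNeg P N (Circle.exp θ)) :
    ∃ U ∈ 𝓝 (Circle.exp θ), ∃ M, NegOn P c U M ∧ F.mat _ φ = serM P c M (Circle.exp θ) := by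
  suffices h : ∃ M : ι → ι → L → ℂ, (∀ i j, CoeffAt P (Circle.exp θ) (M i j)) ∧
      (∀ i j γ, M i j γ ≠ 0 → ltAt (Circle.exp θ) (qexp P c i j γ) 0) ∧
      F.mat _ φ = serM P c M (Circle.exp θ) by
    obtain ⟨M, h1, h2, h3⟩ := h
    obtain ⟨U, hU, h4⟩ := NegOn.of_coeffAt h1 h2
    exact ⟨U, hU, M, h4, h3⟩
  induction hφ using AddSubgroup.closure_induction with
  | mem φ h =>
    obtain ⟨e, e', he, a, ha, ψ, hψ, hψN, rfl⟩ := h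
    choose m hm using F.mat_flat hθ hψN
    obtain ⟨α, hα, hαa⟩ := exists_coeffAt a.2
    refine ⟨fun i j γ => m i j * α γ, fun i j => hα.smul (m i j), fun i j γ h0 => ?_, ?_⟩
    · have h1 : leAt (Circle.exp θ) (c j - c i) e' := leAt_of_const_mul_mem_Amod (left_ne_zero_of_mul h0)
        (by rw [← hm]; exact F.mat_mem_Amod hθ hψ i j)
      have h2 : leAt (Circle.exp θ) (P.μ γ) e := hα.le_of_mem_Amod (by rw [← hαa]; exact ha) γ
        (right_ne_zero_of_mul h0)
      have h3 := h1.lev_le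
      have h4 := h2.lev_le
      rw [ltAt_zero_iff] at he ⊢
      rw [lev_add] at he
      simp only [qexp, lev_add, lev_sub] at h3 ⊢
      linarith
    · ext i j
      have e1 : F.mat _ ((a : O (Circle.exp θ)) • ψ) i j = (a : O (Circle.exp θ)) * F.mat _ ψ i j := by
        simp [FlatFrame.mat]
      rw [e1, hm, hαa]
      simp only [serM, Matrix.of_apply]
      rw [hα.serO_smul]
      ring
  | zero =>
    refine ⟨fun _ _ _ => 0, fun _ _ => CoeffAt.zero, fun i j γ h => (h rfl).elim, ?_⟩
    rw [NegOn.serM_zero]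
    ext i j
    simp [FlatFrame.mat]
  | add φ φ' _ _ h h' =>
    obtain ⟨M, h1, h2, h3⟩ := h
    obtain ⟨M', h1', h2', h3'⟩ := h'
    refine ⟨fun i j γ => M i j γ + M' i j γ, fun i j => (h1 i j).add (h1' i j), fun i j γ h0 => ?_, ?_⟩
    · by_cases hz : M i j γ = 0
      · exact h2' i j γ fun hz' => h0 (by simp [hz, hz'])
      · exact h2 i j γ hz
    · ext i j
      have e1 : F.mat _ (φ + φ') i j = F.mat _ φ i j + F.mat _ φ' i j := by simp [FlatFrame.mat]
      rw [e1, h3, h3']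
      simp only [serM, Matrix.of_apply]
      rw [(h1 i j).serO_add (h1' i j)]
      ring
  | neg φ _ h =>
    obtain ⟨M, h1, h2, h3⟩ := h
    refine ⟨fun i j γ => -1 * M i j γ, fun i j => (h1 i j).smul (-1), fun i j γ h0 =>
      h2 i j γ (right_ne_zero_of_mul h0), ?_⟩
    ext i j
    have e1 : F.mat _ (-φ) i j = -F.mat _ φ i j := by simp [FlatFrame.mat]
    rw [e1, h3]
    simp only [serM, Matrix.of_apply]
    rw [(h1 i j).serO_smul, map_neg, map_one]
    ring

end EndNeg

end PeriodRH

namespace PeriodRH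

instance (w : Circle) : Nontrivial (O w) :=
  ⟨⟨0, 1, fun h => zero_ne_one (α := Germ (dirNhds w) ℂ) (by
    rw [← map_zero (Hol.germ (l := dirNhds w)), h, map_one])⟩⟩

theorem isSec_one_apply {ι : Type*} [DecidableEq ι] {w : Circle} (i j : ι) :
    IsSec (fun v => (1 : Matrix ι ι (O v)) i j) w := by
  simp only [Matrix.one_apply]
  split_ifs
  · simpa using isSec_const (w := w) 1
  · exact isSec_zero

theorem IsSec.matrix_inv {ι : Type*} [Fintype ι] [DecidableEq ι] {w : Circle}
    {A B : ∀ v, Matrix ι ι (O v)} (hA : ∀ i j, IsSec (fun v => A v i j) w)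
    (h : ∀ᶠ v in 𝓝 w, B v * A v = 1) (h' : A w * B w = 1) (i j : ι) :
    IsSec (fun v => B v i j) w := by
  choose B' hB' hBw using fun i j => exists_isSec (B w i j)
  have h1 := IsSec.matMul hA (B := fun v => Matrix.of fun i j => B' i j v) hB'
  have h2 : ∀ᶠ v in 𝓝 w, ∀ i j, (A v * Matrix.of fun i j => B' i j v) i j = (1 : Matrix ι ι (O v)) i j := by
    refine eventually_all.2 fun i => eventually_all.2 fun j => (h1 i j).unique (isSec_one_apply i j) ?_
    have : (Matrix.of fun i j => B' i j w) = B w := by ext i j; exact hBw i j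
    rw [this, h']
  refine IsSec.congr ?_ (hB' i j)
  filter_upwards [h, h2] with v h3 h4
  have h5 : A v * Matrix.of (fun i j => B' i j v) = 1 := by ext i j; exact h4 i j
  have h6 : B v = Matrix.of (fun i j => B' i j v) := by
    rw [← mul_one (B v), ← h5, ← mul_assoc, h3, one_mul]
  rw [h6]
  rfl

section SerM

variable {L : Type*} [AddCommGroup L] [Module.Free ℤ L] [Module.Finite ℤ L] {P : PeriodDatum L}
  {ι : Type*} [Fintype ι] {c : ι → ℂ}

theorem NegOn.isSec_serM {U : Set Circle} {M : ι → ι → L → ℂ} (h : NegOn P c U M) {w : Circle}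
    (hU : U ∈ 𝓝 w) (i j : ι) : IsSec (fun v => serM P c M v i j) w :=
  (isSec_expO _).mul (h.coeffAt hU i j).isSec

end SerM

namespace DRObject

variable {L : Type*} [AddCommGroup L] [Module.Free ℤ L] [Module.Finite ℤ L] {P : PeriodDatum L}
  {C : Finset ℂ} (X : DRObject P C)

theorem finrank_eq : Module.finrank Mero X.E = Module.finrank Mero X.E0 := by
  obtain ⟨k, hk⟩ := X.cov.covers 1
  have h := (X.Xi k 1 hk).finrank_eq
  rwa [Module.finrank_baseChange, Module.finrank_baseChange] at h

variable {ι : Type*} [Fintype ι] [DecidableEq ι] {d : ℝ} {c : ι → ℂ} (F : FlatFrame X.conn d c)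
  (b : Module.Basis ι Mero X.E)

/-- The isomorphism `Ξ_k` in coordinates. -/
def xiEquiv (k : ZMod X.cov.K) (w : Circle) (hw : w ∈ X.cov.arc k) : (ι → O w) ≃ₗ[O w] (ι → O w) :=
  (coordB b w).symm.trans ((X.Xi k w hw).trans (F.coord w))

open Classical in
/-- The matrix of `Ξ_k⁻¹`. -/
def fund (k : ZMod X.cov.K) (w : Circle) : Matrix ι ι (O w) :=
  if hw : w ∈ X.cov.arc k then LinearMap.toMatrix' (X.xiEquiv F b k w hw).symm.toLinearMap else 1

open Classical in
/-- The matrix of `Ξ_k`. -/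
def fundInv (k : ZMod X.cov.K) (w : Circle) : Matrix ι ι (O w) :=
  if hw : w ∈ X.cov.arc k then LinearMap.toMatrix' (X.xiEquiv F b k w hw).toLinearMap else 1

theorem fund_mul_fundInv (k : ZMod X.cov.K) (w : Circle) : X.fund F b k w * X.fundInv F b k w = 1 := by
  unfold fund fundInv
  split_ifs with hw
  · rw [← LinearMap.toMatrix'_comp, LinearEquiv.symm_comp, LinearMap.toMatrix'_id]
  · rw [mul_one]

theorem fundInv_mul_fund (k : ZMod X.cov.K) (w : Circle) : X.fundInv F b k w * X.fund F b k w = 1 := by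
  unfold fund fundInv
  split_ifs with hw
  · rw [← LinearMap.toMatrix'_comp, LinearEquiv.comp_symm, LinearMap.toMatrix'_id]
  · rw [mul_one]

theorem fundInv_mulVec {k : ZMod X.cov.K} {w : Circle} (hw : w ∈ X.cov.arc k) (x : O w ⊗[Mero] X.E) :
    (X.fundInv F b k w).mulVec (coordB b w x) = F.coord w (X.Xi k w hw x) := by
  unfold fundInv
  rw [dif_pos hw, LinearMap.toMatrix'_mulVec]
  simp [xiEquiv]

theorem fund_mulVec {k : ZMod X.cov.K} {w : Circle} (hw : w ∈ X.cov.arc k) (x : O w ⊗[Mero] X.E) :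
    (X.fund F b k w).mulVec (F.coord w (X.Xi k w hw x)) = coordB b w x := by
  rw [← X.fundInv_mulVec F b hw, Matrix.mulVec_mulVec, fund_mul_fundInv, Matrix.one_mulVec]

theorem isSec_fundInv {θ : ℝ} (hθ : |θ - d| < Real.pi) {k : ZMod X.cov.K}
    (hw : Circle.exp θ ∈ X.cov.arc k) (i j : ι) :
    IsSec (fun v => X.fundInv F b k v i j) (Circle.exp θ) := by
  obtain ⟨t, ht, htv⟩ := X.Xi_section k _ hw (b j)
  refine IsSec.congr ?_ (F.isSec_coord hθ ht i)
  filter_upwards [htv, (X.cov.isOpen_arc k).mem_nhds hw] with v h1 h2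
  rw [← h1 h2, ← X.fundInv_mulVec F b h2]
  have : coordB b v (1 ⊗ₜ b j) = Pi.single j 1 := by
    ext l
    rw [coordB_tmul, one_mul, Module.Basis.repr_self, Finsupp.single_apply, Pi.single_apply]
    simp only [eq_comm]
    split_ifs <;> simp
  rw [this, Matrix.mulVec_single_one]
  rfl

theorem isSec_fund {θ : ℝ} (hθ : |θ - d| < Real.pi) {k : ZMod X.cov.K}
    (hw : Circle.exp θ ∈ X.cov.arc k) (i j : ι) :
    IsSec (fun v => X.fund F b k v i j) (Circle.exp θ) :=
  IsSec.matrix_inv (X.isSec_fundInv F b hθ hw)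
    (Eventually.of_forall fun v => X.fund_mul_fundInv F b k v) (X.fundInv_mul_fund F b k _) i j

theorem fund_succ {θ : ℝ} (hθ : |θ - d| < Real.pi) {k : ZMod X.cov.K}
    (hw : Circle.exp θ ∈ X.cov.arc k) (hw' : Circle.exp θ ∈ X.cov.arc (k + 1)) :
    ∃ U ∈ 𝓝 (Circle.exp θ), ∃ M, NegOn P c U M ∧ ∀ᶠ v in 𝓝 (Circle.exp θ),
      X.fund F b (k + 1) v = X.fund F b k v * (1 + serM P c M v) := by
  obtain ⟨U, hU, M, hM, he⟩ := F.mat_endNeg hθ (X.Xi_aut k _ hw hw')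
  refine ⟨U, hU, M, hM, ?_⟩
  have hpt : X.fundInv F b k (Circle.exp θ) * X.fund F b (k + 1) (Circle.exp θ) =
      1 + serM P c M (Circle.exp θ) := by
    rw [← he]
    refine Matrix.ext_of_mulVec_single fun j => ?_
    obtain ⟨x, hx⟩ := ((X.Xi (k + 1) _ hw').trans (F.coord _)).surjective (Pi.single j 1)
    have hx' : F.coord _ (X.Xi (k + 1) _ hw' x) = Pi.single j 1 := hx
    rw [← hx', ← Matrix.mulVec_mulVec, X.fund_mulVec F b hw', X.fundInv_mulVec F b hw, Matrix.add_mulVec,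
      Matrix.one_mulVec, ← F.coord_end, ← map_add]
    congr 1
    simp
  have hl := IsSec.matMul (X.isSec_fundInv F b hθ hw) (X.isSec_fund F b hθ hw')
  have hr : ∀ i j, IsSec (fun v => (1 + serM P c M v) i j) (Circle.exp θ) := fun i j =>
    (isSec_one_apply i j).add (hM.isSec_serM hU i j)
  have hev : ∀ᶠ v in 𝓝 (Circle.exp θ), ∀ i j,
      (X.fundInv F b k v * X.fund F b (k + 1) v) i j = (1 + serM P c M v) i j :=
    eventually_all.2 fun i => eventually_all.2 fun j => (hl i j).unique (hr i j) (by rw [hpt])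
  filter_upwards [hev] with v hv
  have h1 : X.fundInv F b k v * X.fund F b (k + 1) v = 1 + serM P c M v := by ext i j; exact hv i j
  rw [← h1, ← mul_assoc, fund_mul_fundInv, one_mul]

theorem fund_compare {θ : ℝ} (hθ : |θ - d| < Real.pi) {k l : ZMod X.cov.K}
    (hw : Circle.exp θ ∈ X.cov.arc k) (hw' : Circle.exp θ ∈ X.cov.arc l) :
    ∃ U ∈ 𝓝 (Circle.exp θ), ∃ M, NegOn P c U M ∧ ∀ᶠ v in 𝓝 (Circle.exp θ),
      X.fund F b l v = X.fund F b k v * (1 + serM P c M v) := by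
  rcases (X.cov.meets_iff k l).1 ⟨_, hw, hw'⟩ with h | rfl | rfl
  · obtain rfl : k = l + 1 := by rw [h, sub_add_cancel]
    obtain ⟨U, hU, M, hM, he⟩ := X.fund_succ F b hθ hw' hw
    obtain ⟨N, hN, hNe⟩ := hM.exists_inv hU
    refine ⟨U, hU, N, hN, ?_⟩
    filter_upwards [he, eventually_mem_nhds_iff.2 hU] with v h1 h2
    rw [h1, mul_assoc, (hNe v h2).1, mul_one]
  · exact ⟨Set.univ, univ_mem, _, NegOn.zero, Eventually.of_forall fun v => by
      rw [NegOn.serM_zero, add_zero, mul_one]⟩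
  · exact X.fund_succ F b hθ hw hw'

/-- The sheaf of trivializations of the de Rham sheaf by bases that induce the standard basis of the
graded module. -/
def triv : TrivSheaf P c where
  T w Ψ := (∃ θ : ℝ, |θ - d| < Real.pi ∧ w = Circle.exp θ) ∧ ∃ k, w ∈ X.cov.arc k ∧ ∃ U ∈ 𝓝 w, ∃ M,
    NegOn P c U M ∧ ∀ᶠ v in 𝓝 w, Ψ v = X.fund F b k v * (1 + serM P c M v)
  nearby := by
    rintro w Ψ ⟨⟨θ, hθ, rfl⟩, k, hk, U, hU, M, hM, he⟩
    have h1 : ∀ᶠ v in 𝓝 (Circle.exp θ), ∃ θ : ℝ, |θ - d| < Real.pi ∧ v = Circle.exp θ := by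
      rw [eventually_exp_iff]
      filter_upwards [(show Continuous fun t : ℝ => |t - d| by fun_prop).continuousAt.eventually_lt
        continuousAt_const hθ] with t ht using ⟨t, ht, rfl⟩
    filter_upwards [h1, (X.cov.isOpen_arc k).mem_nhds hk, eventually_mem_nhds_iff.2 hU,
      eventually_eventually_nhds.2 he] with v h2 h3 h4 h5
    exact ⟨h2, k, h3, U, h4, M, hM, h5⟩
  compare := by
    rintro w Ψ Ψ' ⟨⟨θ, hθ, rfl⟩, k, hk, U, hU, M, hM, he⟩ ⟨-, l, hl, U', hU', M', hM', he'⟩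
    obtain ⟨V, hV, N, hN, hNe⟩ := X.fund_compare F b hθ hk hl
    have hW : U ∩ U' ∩ V ∈ 𝓝 (Circle.exp θ) := inter_mem (inter_mem hU hU') hV
    obtain ⟨M₁, hM₁, h1⟩ := (hM.mono (U' := U ∩ U' ∩ V) fun v hv => hv.1.1).exists_inv hW
    obtain ⟨M₂, hM₂, h2⟩ := hM₁.exists_mul (hN.mono fun v hv => hv.2) hW
    obtain ⟨M₃, hM₃, h3⟩ := hM₂.exists_mul (hM'.mono fun v hv => hv.1.2) hW
    refine ⟨_, hW, M₃, hM₃, ?_⟩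
    filter_upwards [he, he', hNe, eventually_mem_nhds_iff.2 hW] with v e1 e2 e3 e4
    rw [e1, e2, e3, ← h3 v e4, ← h2 v e4, mul_assoc, mul_assoc, mul_assoc, ← mul_assoc _ (1 + serM P c M₁ v),
      (h1 v e4).1, one_mul]
  mul := by
    rintro w Ψ Ψ' V N ⟨hw, k, hk, U, hU, M, hM, he⟩ hV hN hNe
    have hW : U ∩ V ∈ 𝓝 w := inter_mem hU hV
    obtain ⟨M₁, hM₁, h1⟩ := (hM.mono fun v hv => hv.1).exists_mul (hN.mono fun v (hv : v ∈ U ∩ V) => hv.2) hW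
    refine ⟨hw, k, hk, _, hW, M₁, hM₁, ?_⟩
    filter_upwards [he, hNe, eventually_mem_nhds_iff.2 hW] with v e1 e2 e4
    rw [e2, e1, mul_assoc, h1 v e4]
  isUnit := by
    rintro w Ψ ⟨-, k, hk, U, hU, M, hM, he⟩
    obtain ⟨N, -, hN⟩ := hM.exists_inv hU
    rw [he.self_of_nhds]
    exact (IsUnit.of_mul_eq_one _ (X.fund_mul_fundInv F b k w)).mul (IsUnit.of_mul_eq_one _ (hN w hU).1)

theorem triv_fund {θ : ℝ} (hθ : |θ - d| < Real.pi) {k : ZMod X.cov.K} (hw : Circle.exp θ ∈ X.cov.arc k) :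
    (X.triv F b).T (Circle.exp θ) (X.fund F b k) :=
  ⟨⟨θ, hθ, rfl⟩, k, hw, Set.univ, univ_mem, _, NegOn.zero, Eventually.of_forall fun v => by
      rw [NegOn.serM_zero, add_zero, mul_one]⟩

theorem exists_triv {θ : ℝ} (hθ : |θ - d| < Real.pi) : ∃ Ψ, (X.triv F b).T (Circle.exp θ) Ψ := by
  obtain ⟨k, hk⟩ := X.cov.covers (Circle.exp θ)
  exact ⟨_, X.triv_fund F b hθ hk⟩

theorem triv_isSec {w : Circle} {Ψ : ∀ v, Matrix ι ι (O v)} (h : (X.triv F b).T w Ψ) (i j : ι) :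
    IsSec (fun v => Ψ v i j) w := by
  obtain ⟨⟨θ, hθ, rfl⟩, k, hk, U, hU, M, hM, he⟩ := h
  refine IsSec.congr ?_ (IsSec.matMul (X.isSec_fund F b hθ hk) (B := fun v => 1 + serM P c M v)
    (fun i j => (isSec_one_apply i j).add (hM.isSec_serM hU i j)) i j)
  filter_upwards [he] with v hv
  rw [hv]

end DRObject

end PeriodRH

namespace PeriodRH

theorem AGev_subset_Amod0 (w : Circle) : AGev w ⊆ Amod0 w := by
  rintro g ⟨F, hF⟩
  obtain ⟨f, -, hf⟩ := g.exists_rep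
  rw [mem_Amod0_iff hf]
  obtain ⟨B, hB, h⟩ := ((hasAsyAt_iff hf).1 hF).bounded
  exact ⟨B, hB, 0, by simpa using h⟩

theorem one_mem_AGev (w : Circle) : (1 : O w) ∈ AGev w := by
  obtain ⟨F, hF⟩ := AsyFn.of_analyticAt (f := fun _ => (1 : ℂ)) analyticAt_const
  exact ⟨F, (hasAsyAt_iff (f := fun _ => 1) (by rw [map_one]; rfl)).2 (hF w)⟩

theorem tensorSpan_mono {E : Type*} [AddCommGroup E] [Module Mero E] {w : Circle} {S S' : Set (O w)}
    (h : S ⊆ S') : tensorSpan E S ≤ tensorSpan E S' :=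
  AddSubgroup.closure_mono fun _ ⟨f, hf, e, he⟩ => ⟨f, h hf, e, he⟩

/-- Semilinear maps that preserve the span of the bounded elements preserve all the growth filtrations. -/
theorem map_mem_tensorSpan {E E' : Type*} [AddCommGroup E] [Module Mero E] [AddCommGroup E'] [Module Mero E']
    {w : Circle} (f : O w ⊗[Mero] E →ₗ[O w] O w ⊗[Mero] E')
    (hf : ∀ x ∈ tensorSpan E (AGev w), f x ∈ tensorSpan E' (AGev w)) {e : ℂ} {x : O w ⊗[Mero] E}
    (hx : x ∈ tensorSpan E (Amod e w)) : f x ∈ tensorSpan E' (Amod e w) := by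
  induction hx using AddSubgroup.closure_induction with
  | mem x hx =>
    obtain ⟨g, hg, y, rfl⟩ := hx
    have e1 : g ⊗ₜ[Mero] y = g • ((1 : O w) ⊗ₜ[Mero] y) := by
      rw [TensorProduct.smul_tmul', smul_eq_mul, mul_one]
    rw [e1, map_smul]
    have h1 := hf (1 ⊗ₜ y) (AddSubgroup.subset_closure ⟨1, one_mem_AGev w, y, rfl⟩)
    have h2 := tensorSpan_mono (AGev_subset_Amod0 w) h1
    rw [← Amod_zero] at h2
    simpa using smul_mem_tensorSpan hg h2
  | zero => simp
  | add x y _ _ hx hy => rw [map_add]; exact add_mem hx hy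
  | neg x _ hx => rw [map_neg]; exact neg_mem hx

theorem matMul_mem_Small {ι : Type*} [Fintype ι] {w : Circle} {A B : Matrix ι ι (O w)}
    (hA : ∀ i j, A i j ∈ Amod0 w) (hB : ∀ i j, B i j ∈ Small w) (i j : ι) : (A * B) i j ∈ Small w := by
  rw [Matrix.mul_apply]
  exact sum_mem_Small _ fun k _ => mul_mem_Small (hA i k) (hB k j)

theorem matMul_mem_Small' {ι : Type*} [Fintype ι] {w : Circle} {A B : Matrix ι ι (O w)}
    (hA : ∀ i j, A i j ∈ Small w) (hB : ∀ i j, B i j ∈ Amod0 w) (i j : ι) : (A * B) i j ∈ Small w := by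
  rw [Matrix.mul_apply]
  refine sum_mem_Small _ fun k _ => ?_
  rw [mul_comm]
  exact mul_mem_Small (hB k j) (hA i k)

theorem one_apply_mem_Amod0 {ι : Type*} [DecidableEq ι] {w : Circle} (i j : ι) :
    (1 : Matrix ι ι (O w)) i j ∈ Amod0 w := by
  rw [Matrix.one_apply]
  split_ifs
  · exact (modR w).one_mem
  · exact (modR w).zero_mem

theorem NegOn.serM_mem_Small {L : Type*} [AddCommGroup L] [Module.Free ℤ L] [Module.Finite ℤ L]
    {P : PeriodDatum L} {ι : Type*} [Fintype ι] {c : ι → ℂ} {U : Set Circle} {M : ι → ι → L → ℂ}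
    (h : NegOn P c U M) {w : Circle} (hU : U ∈ 𝓝 w) (i j : ι) : serM P c M w i j ∈ Small w := by
  obtain ⟨e, he, hs⟩ := (h.coeffAt hU i j).mem_Amod_of_lt (b := c i - c j) fun γ hγ => by
    have := ltAt_zero_iff.1 (h.neg i j γ hγ w (mem_of_mem_nhds hU))
    simp only [qexp, lev_add, lev_sub] at this
    rw [ltAt_iff, lev_sub]
    linarith
  refine Amod_subset_Small (c := c j - c i + e) ?_ (Amod_mul (expO_mem_Amod _) hs)
  rw [ltAt_iff, lev_sub] at he
  rw [ltAt_zero_iff, lev_add, lev_sub]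
  linarith

theorem rid_baseChange_coord {E : Type*} [AddCommGroup E] [Module Mero E] {ι : Type*} [Fintype ι]
    (b : Module.Basis ι Mero E) (w : Circle) (x : O w ⊗[Mero] E) (i : ι) :
    TensorProduct.AlgebraTensorModule.rid Mero (O w) (O w) ((b.coord i).baseChange (O w) x) =
      coordB b w x i := by
  induction x using TensorProduct.induction_on with
  | zero => simp
  | tmul f e => rw [coordB_tmul]; simp [Algebra.smul_def, mul_comm]
  | add x y hx hy => rw [map_add, map_add, hx, hy, map_add]; rfl

namespace DRObject

variable {L : Type*} [AddCommGroup L] [Module.Free ℤ L] [Module.Finite ℤ L] {P : PeriodDatum L}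
  {C : Finset ℂ} (X : DRObject P C)

theorem Xi_mem_Amod {k : ZMod X.cov.K} {w : Circle} (hw : w ∈ X.cov.arc k) {e : ℂ} {x : O w ⊗[Mero] X.E} :
    X.Xi k w hw x ∈ tensorSpan X.E0 (Amod e w) ↔ x ∈ tensorSpan X.E (Amod e w) := by
  constructor
  · intro h
    have := map_mem_tensorSpan (X.Xi k w hw).symm.toLinearMap (fun y hy => by
      rw [← X.Xi_mem k w hw]
      simpa using hy) h
    simpa using this
  · exact map_mem_tensorSpan (X.Xi k w hw).toLinearMap fun y hy => (X.Xi_mem k w hw y).2 hy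

variable {ι : Type*} [Fintype ι] [DecidableEq ι] {d : ℝ} {c : ι → ℂ} (F : FlatFrame X.conn d c)
  (b : Module.Basis ι Mero X.E)

theorem fund_mem_Amod0 {θ : ℝ} (hθ : |θ - d| < Real.pi) {k : ZMod X.cov.K}
    (hw : Circle.exp θ ∈ X.cov.arc k) (i j : ι) : X.fund F b k (Circle.exp θ) i j ∈ Amod0 (Circle.exp θ) := by
  obtain ⟨x, hx⟩ := ((X.Xi k _ hw).trans (F.coord _)).surjective (Pi.single j 1)
  have hx' : F.coord _ (X.Xi k _ hw x) = Pi.single j 1 := hx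
  have h1 : x ∈ tensorSpan X.E (Amod 0 (Circle.exp θ)) := by
    rw [← X.Xi_mem_Amod hw, F.mem_tensorSpan_iff hθ, hx', Amod_zero]
    intro l
    rw [Pi.single_apply]
    split_ifs
    · exact (modR _).one_mem
    · exact (modR _).zero_mem
  rw [mem_tensorSpan_iff_coordB b, Amod_zero] at h1
  have h2 := h1 i
  rw [← X.fund_mulVec F b hw, hx', Matrix.mulVec_single_one] at h2
  exact h2

theorem fundInv_apply {k : ZMod X.cov.K} {w : Circle} (hw : w ∈ X.cov.arc k) (i j : ι) :
    X.fundInv F b k w i j = ((F.G w)⁻¹.1 * Matrix.of fun i j => X.coeff k w hw (b j) (F.b.coord i)) i j := by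
  have h := congrFun (X.fundInv_mulVec F b hw (1 ⊗ₜ b j)) i
  have hs : coordB b w (1 ⊗ₜ b j) = Pi.single j 1 := by
    ext l
    rw [coordB_tmul, one_mul, Module.Basis.repr_self, Finsupp.single_apply, Pi.single_apply]
    simp only [eq_comm]
    split_ifs <;> simp
  rw [hs, Matrix.mulVec_single_one] at h
  refine h.trans ?_
  rw [F.coord_apply, Matrix.mul_apply]
  refine Finset.sum_congr rfl fun l _ => ?_
  rw [Matrix.of_apply, coeff, rid_baseChange_coord]

theorem exists_sum_matrix (h : X.SummableAlong d) : ∃ A, Real.pi / 2 < A ∧ ∃ Q : ∀ v, Matrix ι ι (O v),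
    ∀ θ : ℝ, |θ - d| < A → |θ - d| < Real.pi → (∀ i j, IsSec (fun v => Q v i j) (Circle.exp θ)) ∧
      ∀ k, Circle.exp θ ∈ X.cov.arc k → ∀ i j,
        (Q (Circle.exp θ) * X.fund F b k (Circle.exp θ) - 1) i j ∈ Small (Circle.exp θ) := by
  choose n S hS hsum using fun i j => h (b j) (F.b.coord i)
  choose A f hA hf using fun i j => (hsum i j).exists_asyFn
  obtain ⟨A₀, hA₀, hAle⟩ : ∃ A₀, Real.pi / 2 < A₀ ∧ ∀ p : ι × ι, A₀ ≤ A p.1 p.2 := by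
    have h2 : ∀ᶠ t : ℝ in 𝓝[>] (Real.pi / 2), ∀ p : ι × ι, t ≤ A p.1 p.2 := eventually_all.2 fun p =>
      mem_of_superset (Ioo_mem_nhdsGT (hA p.1 p.2)) fun t ht => ht.2.le
    obtain ⟨t, ht, ht0⟩ := (h2.and self_mem_nhdsWithin).exists
    exact ⟨t, ht0, ht⟩
  let S' : ∀ v, Matrix ι ι (O v) := fun v =>
    Matrix.of fun i j => algebraMap Mero (O v) (Mero.X⁻¹ ^ n i j) * toO (f i j) v
  refine ⟨A₀, hA₀, fun v => (F.G v)⁻¹.1 * S' v, fun θ hθA hθ => ⟨?_, fun k hk => ?_⟩⟩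
  · refine IsSec.matMul (F.isSec_inv θ hθ) (B := S') fun i j => (isSec_mero _).mul
      (isSec_toO (hf i j θ (hθA.trans_le (hAle (i, j)))).2)
  · have hdiff : ∀ i j, (S' (Circle.exp θ) -
        Matrix.of fun i j => X.coeff k _ hk (b j) (F.b.coord i)) i j ∈ Small (Circle.exp θ) := by
      intro i j
      set x : O (Circle.exp θ) := algebraMap Mero (O (Circle.exp θ)) Mero.X with hx
      set y : O (Circle.exp θ) := algebraMap Mero (O (Circle.exp θ)) (Mero.X⁻¹ ^ n i j) with hy
      have hxy : y * x ^ n i j = 1 := by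
        rw [hx, hy, ← map_pow, ← map_mul, ← mul_pow, inv_mul_cancel₀ Mero.X_ne_zero, one_pow, map_one]
      have h1 := hf i j θ (hθA.trans_le (hAle (i, j)))
      obtain ⟨g, -, hg⟩ := (x ^ n i j * X.coeff k _ hk (b j) (F.b.coord i)).exists_rep
      have h2 := (hasAsyAt_iff hg).1 (hS i j k _ hk)
      have h3 := (h1.1.add h2.neg)
      rw [add_neg_cancel] at h3
      have h4 : toO (f i j) (Circle.exp θ) - x ^ n i j * X.coeff k _ hk (b j) (F.b.coord i) ∈
          Small (Circle.exp θ) := by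
        refine (mem_Small_iff (f := fun z => f i j z + -g z) ?_).2 h3.small
        rw [map_sub, germ_toO h1.2, hg, sub_eq_add_neg]
        rfl
      have h5 := mul_mem_Small (mero_mem_Amod0 (Mero.X⁻¹ ^ n i j) _) h4
      rw [mul_sub, ← mul_assoc, ← hy, hxy, one_mul] at h5
      exact h5
    intro i j
    have e : (F.G (Circle.exp θ))⁻¹.1 * S' (Circle.exp θ) * X.fund F b k (Circle.exp θ) - 1 =
        (F.G (Circle.exp θ))⁻¹.1 * (S' (Circle.exp θ) -
        Matrix.of fun i j => X.coeff k _ hk (b j) (F.b.coord i)) * X.fund F b k (Circle.exp θ) := by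
      rw [mul_sub, sub_mul]
      congr 1
      rw [← X.fundInv_mul_fund F b k]
      congr 1
      ext i j
      exact X.fundInv_apply F b hk i j
    change ((F.G (Circle.exp θ))⁻¹.1 * S' (Circle.exp θ) * X.fund F b k (Circle.exp θ) - 1) i j ∈ _
    rw [e]
    exact matMul_mem_Small' (matMul_mem_Small (F.mod_inv θ hθ) hdiff) (X.fund_mem_Amod0 F b hθ hk) i j

theorem exists_triv_of_summable (h : X.SummableAlong d) : ∃ α > 0, α < Real.pi / 2 ∧ ∃ Ψ : ∀ v, Matrix ι ι (O v),
    (X.triv F b).On (d - Real.pi / 2 - α) (d + Real.pi / 2 + α) Ψ := by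
  obtain ⟨A, hA, Q, hQ⟩ := X.exists_sum_matrix F b h
  have hπ := Real.pi_pos
  obtain ⟨α, hα, hαA, hαπ⟩ : ∃ α > 0, α < A - Real.pi / 2 ∧ α < Real.pi / 8 :=
    ⟨min (A - Real.pi / 2) (Real.pi / 8) / 2, by
      have : 0 < min (A - Real.pi / 2) (Real.pi / 8) := lt_min (by linarith) (by linarith)
      refine ⟨by linarith, ?_, ?_⟩
      · linarith [min_le_left (A - Real.pi / 2) (Real.pi / 8)]
      · linarith [min_le_right (A - Real.pi / 2) (Real.pi / 8)]⟩
  have key : ∀ {Ψ : ∀ v, Matrix ι ι (O v)} {θ : ℝ}, |θ - d| < A → |θ - d| < Real.pi →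
      (X.triv F b).T (Circle.exp θ) Ψ → ∀ i j, IsSec (fun v => (Q v * Ψ v) i j) (Circle.exp θ) ∧
        (Q (Circle.exp θ) * Ψ (Circle.exp θ) - 1) i j ∈ Small (Circle.exp θ) := by
    intro Ψ θ hθA hθ hT i j
    refine ⟨IsSec.matMul (hQ θ hθA hθ).1 (X.triv_isSec F b hT) i j, ?_⟩
    obtain ⟨-, k, hk, U, hU, M, hM, he⟩ := hT
    have h1 := (hQ θ hθA hθ).2 k hk
    have e : Q (Circle.exp θ) * Ψ (Circle.exp θ) - 1 =
        (Q (Circle.exp θ) * X.fund F b k (Circle.exp θ) - 1) * (1 + serM P c M (Circle.exp θ)) +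
          serM P c M (Circle.exp θ) := by
      rw [he.self_of_nhds]
      noncomm_ring
    rw [e, Matrix.add_apply]
    refine Small_add (matMul_mem_Small' h1 (fun i j => ?_) i j) (hM.serM_mem_Small hU i j)
    exact Amod0_add (one_apply_mem_Amod0 i j) (Small_subset_Amod0 (hM.serM_mem_Small hU i j))
  have hab : ∀ {θ : ℝ}, d - Real.pi / 2 - α ≤ θ → θ ≤ d + Real.pi / 2 + α → |θ - d| < A ∧ |θ - d| < Real.pi := by
    intro θ h1 h2
    exact ⟨abs_lt.2 ⟨by linarith, by linarith⟩, abs_lt.2 ⟨by linarith, by linarith⟩⟩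
  obtain ⟨δ, hδ, Ψm, hm⟩ := (X.triv F b).exists_on (x := d - Real.pi / 2 - α) (y := d + Real.pi / 2 - 2 * α)
    (by linarith) (by linarith) fun θ hθ => X.exists_triv F b (hab hθ.1 (by linarith [hθ.2])).2
  obtain ⟨δ', hδ', Ψp, hp⟩ := (X.triv F b).exists_on (x := d - Real.pi / 2 + 2 * α) (y := d + Real.pi / 2 + α)
    (by linarith) (by linarith) fun θ hθ => X.exists_triv F b (hab (by linarith [hθ.1]) hθ.2).2
  obtain ⟨Ψm, Ψp, N, hm, hp, hN, he⟩ := (hm.mono (a' := d - Real.pi / 2 - α) (b' := d + Real.pi / 2 - 2 * α)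
    (by linarith) (by linarith)).exists_cocycle (hp.mono (a' := d - Real.pi / 2 + 2 * α)
      (b' := d + Real.pi / 2 + α) (by linarith) (by linarith)) (by linarith) (by linarith) (by linarith)
      (by linarith) (by linarith)
  have hN0 : ∀ i j γ, N i j γ = 0 := by
    have e1 : d + Real.pi / 2 + α - Real.pi = d - Real.pi / 2 + α := by ring
    have e2 : d - Real.pi / 2 - α + Real.pi = d + Real.pi / 2 - α := by ring
    rw [e1, e2] at hN
    refine NegOn.eq_zero_of_small hα (by linarith) hN (Rm := fun v => Q v * Ψm v) (Rp := fun v => Q v * Ψp v)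
      (fun θ hθ => ?_) (fun θ hθ => ?_) ?_
    · obtain ⟨h1, h2⟩ := hab (θ := θ) hθ.1.le (by linarith [hθ.2])
      exact key h1 h2 (hm θ ⟨hθ.1, by linarith [hθ.2]⟩)
    · obtain ⟨h1, h2⟩ := hab (θ := θ) (by linarith [hθ.1]) hθ.2.le
      exact key h1 h2 (hp θ ⟨by linarith [hθ.1], hθ.2⟩)
    · rw [he d ⟨by linarith, by linarith⟩, mul_assoc]
  obtain ⟨Ψ, hΨ, -, -⟩ := TrivSheaf.On.union (by linarith) (by linarith) (by linarith) (by linarith) hm hp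
    fun θ hθ => by
      rw [he θ hθ]
      have : N = fun _ _ _ => 0 := by funext i j γ; exact hN0 i j γ
      rw [this, NegOn.serM_zero, add_zero, mul_one]
  exact ⟨α, hα, by linarith, Ψ, hΨ⟩

end DRObject

end PeriodRH

namespace PeriodRH

section AmuLe

variable {L : Type*} [AddCommGroup L] [Module.Free ℤ L] [Module.Finite ℤ L] {P : PeriodDatum L}
  {w : Circle} {e e' : ℂ} {a a' : Amu P w}

theorem AmuLe_add (h : a ∈ AmuLe P e w) (h' : a' ∈ AmuLe P e w) : a + a' ∈ AmuLe P e w := Amod_add h h'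

theorem AmuLe_mul (h : a ∈ AmuLe P e w) (h' : a' ∈ AmuLe P e' w) : a * a' ∈ AmuLe P (e + e') w :=
  Amod_mul h h'

theorem AmuLe_mono (he : leAt w e e') (h : a ∈ AmuLe P e w) : a ∈ AmuLe P e' w := Amod_mono he h

theorem zero_mem_AmuLe (e : ℂ) : (0 : Amu P w) ∈ AmuLe P e w := zero_mem_Amod e w

theorem sum_mem_AmuLe {κ : Type*} (S : Finset κ) {g : κ → Amu P w} (h : ∀ k ∈ S, g k ∈ AmuLe P e w) :
    ∑ k ∈ S, g k ∈ AmuLe P e w := by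
  change ((∑ k ∈ S, g k : Amu P w) : O w) ∈ Amod e w
  rw [AddSubmonoidClass.coe_finsetSum]
  exact sum_mem_Amod S h

theorem algebraMap_mem_AmuLe (r : ℂ) : algebraMap ℂ (Amu P w) r ∈ AmuLe P 0 w := by
  change Hol.const r ∈ Amod 0 w
  rw [Amod_zero]
  exact const_mem_Amod0 w r

theorem smul_mem_AmuLe (r : ℂ) (h : a ∈ AmuLe P e w) : r • a ∈ AmuLe P e w := by
  have := AmuLe_mul (algebraMap_mem_AmuLe r) h
  rw [zero_add, ← Algebra.smul_def] at this
  exact this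

variable {ι : Type*} (c : ι → ℂ)

/-- The vector `(a_i exp (-c_i / z))`. -/
def twist (a : ι → Amu P w) : ι → O w := fun i => (a i : O w) * expO (-c i) w

theorem twist_add (a a' : ι → Amu P w) : twist c (a + a') = twist c a + twist c a' := by
  ext i
  simp [twist, add_mul]

theorem twist_smul (r : Amu P w) (a : ι → Amu P w) : twist c (r • a) = (r : O w) • twist c a := by
  ext i
  simp [twist, mul_assoc]

theorem twist_injective : Function.Injective (twist c : (ι → Amu P w) → ι → O w) := by
  intro a a' h
  ext i
  have h1 := congrFun h i
  simp only [twist] at h1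
  have h2 := congrArg (· * expO (c i) w) h1
  simpa [mul_assoc, mul_comm (expO (-c i) w), expO_mul_neg] using h2

variable {c} [Fintype ι]

theorem NegOn.exists_twist [DecidableEq ι] {U : Set Circle} {N : ι → ι → L → ℂ} (hN : NegOn P c U N) (hU : U ∈ 𝓝 w) :
    ∃ H : Matrix ι ι (Amu P w), (∀ i j, H i j ∈ AmuLe P (c i - c j) w) ∧
      (∀ i j, ((H - 1) i j : O w) = serO P (N i j) w) ∧
      ∀ a : ι → Amu P w, (1 + serM P c N w).mulVec (twist c a) = twist c (H.mulVec a) := by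
  refine ⟨1 + Matrix.of fun i j => ⟨serO P (N i j) w, (hN.coeffAt hU i j).mem_Amu⟩, fun i j => ?_,
    fun i j => by rw [add_sub_cancel_left]; rfl, fun a => ?_⟩
  · rw [Matrix.add_apply]
    refine AmuLe_add ?_ ?_
    · rw [Matrix.one_apply]
      split_ifs with h
      · rw [h, sub_self]
        simpa using algebraMap_mem_AmuLe (P := P) (w := w) 1
      · exact zero_mem_AmuLe _
    · refine (hN.coeffAt hU i j).mem_Amod_of_le fun γ hγ => Or.inl ?_
      have := ltAt_zero_iff.1 (hN.neg i j γ hγ w (mem_of_mem_nhds hU))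
      simp only [qexp, lev_add, lev_sub] at this
      rw [ltAt_iff, lev_sub]
      linarith
  · rw [Matrix.add_mulVec, Matrix.add_mulVec, Matrix.one_mulVec, Matrix.one_mulVec, twist_add]
    congr 1
    ext i
    simp only [Matrix.mulVec, dotProduct, serM, Matrix.of_apply, twist]
    rw [AddSubmonoidClass.coe_finsetSum, Finset.sum_mul]
    refine Finset.sum_congr rfl fun j _ => ?_
    have e1 : expO (c j - c i) w = expO (c j) w * expO (-c i) w := by rw [← expO_add]; congr 1
    have e2 := expO_mul_neg (c j) w
    rw [MulMemClass.coe_mul, e1]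
    linear_combination (serO P (N i j) w * (a j : O w) * expO (-c i) w) * e2

theorem mulVec_mem_AmuLe {H : Matrix ι ι (Amu P w)} (hH : ∀ i j, H i j ∈ AmuLe P (c i - c j) w)
    {a : ι → Amu P w} (ha : ∀ j, a j ∈ AmuLe P (e + c j) w) (i : ι) : H.mulVec a i ∈ AmuLe P (e + c i) w := by
  refine sum_mem_AmuLe _ fun j _ => ?_
  have := AmuLe_mul (hH i j) (ha j)
  rwa [show c i - c j + (e + c j) = e + c i by ring] at this

end AmuLe

namespace FilteredModule

variable {L : Type*} [AddCommGroup L] [Module.Free ℤ L] [Module.Finite ℤ L] {P : PeriodDatum L}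

/-- A basis of a filtered module over an open set whose `i`-th element is homogeneous of degree `-c_i`. -/
structure SplitBasis (M : FilteredModule P) {ι : Type*} [Fintype ι] (c : ι → ℂ) (I : Set Circle) where
  /-- the elements -/
  ψ : ι → ∀ w, M.stalk w
  isSection : ∀ w ∈ I, ∀ i, M.IsSection (ψ i) w
  injective : ∀ w ∈ I, ∀ a a' : ι → Amu P w, ∑ i, a i • ψ i w = ∑ i, a' i • ψ i w → a = a'
  surjective : ∀ w ∈ I, ∀ x : M.stalk w, ∃ a : ι → Amu P w, x = ∑ i, a i • ψ i w
  mem_le : ∀ w ∈ I, ∀ (e : ℂ) (a : ι → Amu P w), ∑ i, a i • ψ i w ∈ M.le e w ↔ ∀ i, a i ∈ AmuLe P (e + c i) w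

end FilteredModule

namespace DRObject

variable {L : Type*} [AddCommGroup L] [Module.Free ℤ L] [Module.Finite ℤ L] {P : PeriodDatum L}
  {C : Finset ℂ} (X : DRObject P C)
variable {ι : Type*} [Fintype ι] [DecidableEq ι] {d : ℝ} {c : ι → ℂ} (F : FlatFrame X.conn d c)
  (b : Module.Basis ι Mero X.E) {Ψ : ∀ v, Matrix ι ι (O v)}

/-- The linear combinations of the columns of `Ψ diag (exp (-c_i / z))` with coefficients in `𝒜_μ`. -/
def comb (c : ι → ℂ) (Ψ : ∀ v, Matrix ι ι (O v)) (w : Circle) : (ι → Amu P w) →ₗ[Amu P w] O w ⊗[Mero] X.E where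
  toFun a := (coordB b w).symm ((Ψ w).mulVec (twist c a))
  map_add' a a' := by rw [twist_add, Matrix.mulVec_add, map_add]
  map_smul' r a := by
    rw [twist_smul, Matrix.mulVec_smul, map_smul]
    rfl

theorem comb_injective {w : Circle} (h : IsUnit (Ψ w)) :
    Function.Injective (X.comb b c Ψ w : (ι → Amu P w) → _) := by
  intro a a' haa
  refine twist_injective c ?_
  have h1 : (Ψ w).mulVec (twist c a) = (Ψ w).mulVec (twist c a') := (coordB b w).symm.injective haa
  obtain ⟨u, hu⟩ := h
  have h2 := congrArg (u⁻¹.1.mulVec) h1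
  rwa [Matrix.mulVec_mulVec, Matrix.mulVec_mulVec, ← hu, Units.inv_mul, Matrix.one_mulVec,
    Matrix.one_mulVec] at h2

theorem isFlat_iff {θ : ℝ} (hθ : |θ - d| < Real.pi) {k : ZMod X.cov.K} (hk : Circle.exp θ ∈ X.cov.arc k)
    {h : O (Circle.exp θ) ⊗[Mero] X.E} : X.IsFlat k _ hk h ↔ ∃ a : ι → ℂ,
      h = X.comb b c (X.fund F b k) _ (fun i => algebraMap ℂ (Amu P (Circle.exp θ)) (a i)) := by
  unfold IsFlat
  rw [LinearEquiv.map_eq_zero_iff, F.flat_iff hθ]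
  constructor
  · intro h1
    choose a ha using h1
    refine ⟨a, (coordB b _).injective ?_⟩
    change _ = coordB b _ ((coordB b _).symm _)
    rw [LinearEquiv.apply_symm_apply, ← X.fund_mulVec F b hk h]
    congr 1
    ext i
    rw [ha]
    rfl
  · rintro ⟨a, rfl⟩ i
    refine ⟨a i, ?_⟩
    rw [← X.fundInv_mulVec F b hk]
    change (X.fundInv F b k _).mulVec (coordB b _ ((coordB b _).symm _)) i = _
    rw [LinearEquiv.apply_symm_apply, Matrix.mulVec_mulVec, fundInv_mul_fund, Matrix.one_mulVec]
    rfl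

theorem comb_fund_mem_tensorSpan {θ : ℝ} (hθ : |θ - d| < Real.pi) {k : ZMod X.cov.K}
    (hk : Circle.exp θ ∈ X.cov.arc k) {e : ℂ} {a : ι → Amu P (Circle.exp θ)} :
    X.comb b c (X.fund F b k) _ a ∈ tensorSpan X.E (Amod e (Circle.exp θ)) ↔
      ∀ i, twist c a i ∈ Amod e (Circle.exp θ) := by
  rw [← X.Xi_mem_Amod hk, F.mem_tensorSpan_iff hθ, ← X.fundInv_mulVec F b hk]
  change (∀ i, (X.fundInv F b k _).mulVec (coordB b _ ((coordB b _).symm _)) i ∈ _) ↔ _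
  rw [LinearEquiv.apply_symm_apply, Matrix.mulVec_mulVec, fundInv_mul_fund, Matrix.one_mulVec]

theorem exists_transition {w : Circle} {Ψ' : ∀ v, Matrix ι ι (O v)} (h : (X.triv F b).T w Ψ)
    (h' : (X.triv F b).T w Ψ') : ∃ H : Matrix ι ι (Amu P w), (∀ i j, H i j ∈ AmuLe P (c i - c j) w) ∧
      (∀ i j, ∃ e, ltAt w e (c i - c j) ∧ (H - 1) i j ∈ AmuLe P e w) ∧
      ∀ a : ι → Amu P w, X.comb b c Ψ' w a = X.comb b c Ψ w (H.mulVec a) := by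
  obtain ⟨U, hU, N, hN, he⟩ := (X.triv F b).compare h h'
  obtain ⟨H, hH, hH1, hHa⟩ := hN.exists_twist hU
  refine ⟨H, hH, fun i j => ?_, fun a => ?_⟩
  · obtain ⟨e, he, hs⟩ := (hN.coeffAt hU i j).mem_Amod_of_lt (b := c i - c j) fun γ hγ => by
      have := ltAt_zero_iff.1 (hN.neg i j γ hγ w (mem_of_mem_nhds hU))
      simp only [qexp, lev_add, lev_sub] at this
      rw [ltAt_iff, lev_sub]
      linarith
    refine ⟨e, he, ?_⟩
    change ((H - 1) i j : O w) ∈ Amod e w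
    rwa [hH1]
  change (coordB b w).symm _ = (coordB b w).symm _
  rw [he.self_of_nhds, ← Matrix.mulVec_mulVec, hHa]

theorem range_comb {w : Circle} (h : (X.triv F b).T w Ψ) :
    LinearMap.range (X.comb b c Ψ w) = X.drStalk w := by
  obtain ⟨θ, hθ, rfl⟩ := h.1
  apply le_antisymm
  · rintro _ ⟨a, rfl⟩
    obtain ⟨k, hk⟩ := X.cov.covers (Circle.exp θ)
    obtain ⟨H, hH, -, hHa⟩ := X.exists_transition F b (X.triv_fund F b hθ hk) h
    rw [hHa, pi_eq_sum_univ (H.mulVec a), map_sum]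
    refine sum_mem fun i _ => ?_
    rw [map_smul]
    refine Submodule.smul_mem _ _ (Submodule.subset_span ⟨k, hk, ?_⟩)
    rw [X.isFlat_iff F b hθ hk]
    refine ⟨fun j => if i = j then 1 else 0, ?_⟩
    congr 1
    funext j
    split_ifs <;> simp_all
  · refine Submodule.span_le.2 ?_
    rintro x ⟨k, hk, hx⟩
    obtain ⟨a, rfl⟩ := (X.isFlat_iff F b hθ hk).1 hx
    obtain ⟨H, hH, -, hHa⟩ := X.exists_transition F b h (X.triv_fund F b hθ hk)
    exact ⟨_, (hHa _).symm⟩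

theorem comb_mem_drLe {w : Circle} (h : (X.triv F b).T w Ψ) {e : ℂ} {a : ι → Amu P w} :
    X.comb b c Ψ w a ∈ X.drLe e w ↔ ∀ i, a i ∈ AmuLe P (e + c i) w := by
  obtain ⟨θ, hθ, rfl⟩ := h.1
  constructor
  · intro ha
    have key : ∀ x ∈ X.drLe e (Circle.exp θ), ∃ a : ι → Amu P (Circle.exp θ), x = X.comb b c Ψ _ a ∧
        ∀ i, a i ∈ AmuLe P (e + c i) (Circle.exp θ) := by
      intro x hx
      induction hx using Submodule.span_induction with
      | mem x hx =>
        obtain ⟨c', c'', hc, r, hr, y, hy, ⟨k, hk, hflat⟩, rfl⟩ := hx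
        obtain ⟨a, rfl⟩ := (X.isFlat_iff F b hθ hk).1 hflat
        obtain ⟨H, hH, -, hHa⟩ := X.exists_transition F b h (X.triv_fund F b hθ hk)
        refine ⟨r • H.mulVec fun i => algebraMap ℂ _ (a i), by rw [map_smul, ← hHa], fun i => ?_⟩
        have h1 : ∀ i, algebraMap ℂ (Amu P (Circle.exp θ)) (a i) ∈ AmuLe P (c'' + c i) (Circle.exp θ) := by
          intro i
          have h2 := (X.comb_fund_mem_tensorSpan F b hθ hk).1 hy i
          have h3 := Amod_mul h2 (expO_mem_Amod (w := Circle.exp θ) (c i))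
          simp only [twist] at h3
          rwa [mul_assoc, mul_comm (expO _ _), expO_mul_neg, mul_one] at h3
        have h2 := AmuLe_mul hr (mulVec_mem_AmuLe hH h1 i)
        rw [← add_assoc] at h2
        exact AmuLe_mono (hc.add_right (c i)) h2
      | zero => exact ⟨0, by rw [map_zero], fun i => zero_mem_AmuLe _⟩
      | add x y _ _ hx hy =>
        obtain ⟨a, rfl, ha⟩ := hx
        obtain ⟨a', rfl, ha'⟩ := hy
        exact ⟨a + a', by rw [map_add], fun i => AmuLe_add (ha i) (ha' i)⟩
      | smul r x _ hx =>
        obtain ⟨a, rfl, ha⟩ := hx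
        refine ⟨r • a, ?_, fun i => smul_mem_AmuLe r (ha i)⟩
        rw [← algebraMap_smul (Amu P (Circle.exp θ)) r a, map_smul]
        rfl
    obtain ⟨a', h1, h2⟩ := key _ ha
    rwa [X.comb_injective b ((X.triv F b).isUnit h) h1]
  · intro ha
    obtain ⟨k, hk⟩ := X.cov.covers (Circle.exp θ)
    obtain ⟨H, hH, -, hHa⟩ := X.exists_transition F b (X.triv_fund F b hθ hk) h
    rw [hHa, pi_eq_sum_univ (H.mulVec a), map_sum]
    refine sum_mem fun i _ => ?_
    rw [map_smul]
    have e1 : (fun j => if i = j then (1 : Amu P (Circle.exp θ)) else 0) =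
        fun j => algebraMap ℂ (Amu P (Circle.exp θ)) (if i = j then 1 else 0) := by
      funext j
      split_ifs <;> simp
    refine Submodule.subset_span ⟨e + c i, -c i, Or.inr (by ring), _, mulVec_mem_AmuLe hH ha i, _, ?_,
      ⟨k, hk, (X.isFlat_iff F b hθ hk).2 ⟨fun j => if i = j then 1 else 0, by rw [e1]⟩⟩, rfl⟩
    rw [X.comb_fund_mem_tensorSpan F b hθ hk]
    intro j
    simp only [twist]
    split_ifs with hij
    · rw [← hij]
      simpa using expO_mem_Amod (w := Circle.exp θ) (-c i)
    · simpa using zero_mem_Amod (-c i) (Circle.exp θ)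

theorem comb_single_mem {w : Circle} (h : (X.triv F b).T w Ψ) (i : ι) :
    X.comb b c Ψ w (Pi.single i 1) ∈ X.drStalk w := by
  rw [← X.range_comb F b h]
  exact ⟨_, rfl⟩

theorem isSecT_comb {w : Circle} (h : (X.triv F b).T w Ψ) (i : ι) :
    IsSecT (fun v => X.comb b c Ψ v (Pi.single i 1)) w := by
  refine isSecT_coordB_symm b (y := fun v => (Ψ v).mulVec (twist c (Pi.single i (1 : Amu P v))))
    (IsSec.mulVec (X.triv_isSec F b h) fun j => ?_)
  have e : ∀ v, twist c (Pi.single i (1 : Amu P v)) j = Hol.const (if j = i then 1 else 0) * expO (-c j) v := by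
    intro v
    simp only [twist, Pi.single_apply]
    split_ifs <;> simp
  simp only [e]
  exact (isSec_const _).mul (isSec_expO _)

/-- The inclusion of the stalks of the de Rham sheaf in those of `E ⊗ Õ`. -/
def drVal (w : Circle) : X.DR.stalk w →ₗ[Amu P w] O w ⊗[Mero] X.E := (X.drStalk w).subtype

theorem drVal_injective (w : Circle) : Function.Injective (X.drVal w) := Subtype.val_injective

theorem range_drVal (w : Circle) : LinearMap.range (X.drVal w) = X.drStalk w := Submodule.range_subtype _

theorem isSection_DR {s : ∀ v, X.DR.stalk v} {w : Circle} :
    X.DR.IsSection s w ↔ IsSecT (fun v => X.drVal v (s v)) w := Iff.rfl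

theorem mem_DR_le {e : ℂ} {w : Circle} {x : X.DR.stalk w} :
    x ∈ X.DR.le e w ↔ X.drVal w x ∈ X.drLe e w := Iff.rfl

theorem exists_col : ∃ ψ : ι → ∀ w, X.DR.stalk w, ∀ w, (X.triv F b).T w Ψ →
    ∀ i, X.drVal w (ψ i w) = X.comb b c Ψ w (Pi.single i 1) := by
  have key : ∀ i w, ∃ x : X.DR.stalk w, (X.triv F b).T w Ψ →
      X.drVal w x = X.comb b c Ψ w (Pi.single i 1) := by
    intro i w
    by_cases h : (X.triv F b).T w Ψ
    · have h1 := X.comb_single_mem F b h i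
      rw [← range_drVal] at h1
      obtain ⟨x, hx⟩ := h1
      exact ⟨x, fun _ => hx⟩
    · exact ⟨0, fun h' => (h h').elim⟩
  choose ψ hψ using key
  exact ⟨ψ, fun w h i => hψ i w h⟩

theorem exists_splitBasis {I : Set Circle} (h : ∀ w ∈ I, (X.triv F b).T w Ψ) :
    ∃ S : X.DR.SplitBasis c I, ∀ w ∈ I, ∀ i, X.drVal w (S.ψ i w) = X.comb b c Ψ w (Pi.single i 1) := by
  obtain ⟨ψ, hψ⟩ := X.exists_col F b (Ψ := Ψ)
  have hsum : ∀ w ∈ I, ∀ a : ι → Amu P w, X.drVal w (∑ i, a i • ψ i w) = X.comb b c Ψ w a := by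
    intro w hw a
    have e : a = ∑ i, a i • (Pi.single i 1 : ι → Amu P w) := by
      ext i
      simp [Finset.sum_apply, Pi.single_apply]
    conv_rhs => rw [e, map_sum]
    rw [map_sum]
    refine Finset.sum_congr rfl fun i _ => ?_
    rw [map_smul, map_smul, hψ w (h w hw)]
  refine ⟨⟨ψ, fun w hw i => ?_, fun w hw a a' haa => ?_, fun w hw x => ?_, fun w hw e a => ?_⟩,
    fun w hw i => hψ w (h w hw) i⟩
  · rw [isSection_DR]
    refine IsSecT.congr ?_ (X.isSecT_comb F b (h w hw) i)
    filter_upwards [(X.triv F b).nearby (h w hw)] with v hv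
    rw [hψ v hv]
  · refine X.comb_injective (c := c) b ((X.triv F b).isUnit (h w hw)) ?_
    rw [← hsum w hw, ← hsum w hw, haa]
  · have hx : X.drVal w x ∈ LinearMap.range (X.comb b c Ψ w) := by
      rw [X.range_comb F b (h w hw), ← range_drVal]
      exact ⟨x, rfl⟩
    obtain ⟨a, ha⟩ := hx
    exact ⟨a, X.drVal_injective w (by rw [hsum w hw, ha])⟩
  · rw [mem_DR_le, hsum w hw, X.comb_mem_drLe F b (h w hw)]

end DRObject

end PeriodRH

namespace PeriodRH

variable {L : Type*} [AddCommGroup L] [Module.Free ℤ L] [Module.Finite ℤ L] {P : PeriodDatum L}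
  {w : Circle}

section Coefficients

/-- The coefficients of an element of `𝒜_μ`. -/
def cf : Amu P w →ₗ[ℂ] (L → ℂ) where
  toFun a := (exists_coeffAt a.2).choose
  map_add' a b := by
    obtain ⟨h1, h2⟩ := (exists_coeffAt a.2).choose_spec
    obtain ⟨h3, h4⟩ := (exists_coeffAt b.2).choose_spec
    obtain ⟨h5, h6⟩ := (exists_coeffAt (a + b).2).choose_spec
    refine h5.eq_of_serO_eq (h1.add h3) ?_
    refine h6.symm.trans (Eq.trans ?_ (h1.serO_add h3).symm)
    rw [← h2, ← h4]
    rfl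
  map_smul' r a := by
    obtain ⟨h1, h2⟩ := (exists_coeffAt a.2).choose_spec
    obtain ⟨h5, h6⟩ := (exists_coeffAt (r • a).2).choose_spec
    refine h5.eq_of_serO_eq (h1.smul r) ?_
    refine h6.symm.trans (Eq.trans ?_ (h1.serO_smul r).symm)
    rw [← h2]
    rfl

theorem coeffAt_cf (a : Amu P w) : CoeffAt P w (cf a) := (exists_coeffAt a.2).choose_spec.1

theorem serO_cf (a : Amu P w) : (a : O w) = serO P (cf a) w := (exists_coeffAt a.2).choose_spec.2

theorem cf_eq {a : Amu P w} {α : L → ℂ} (h : CoeffAt P w α) (ha : (a : O w) = serO P α w) : cf a = α :=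
  (coeffAt_cf a).eq_of_serO_eq h (by rw [← serO_cf, ha])

theorem mem_AmuLe_iff {a : Amu P w} {e : ℂ} : a ∈ AmuLe P e w ↔ ∀ γ, cf a γ ≠ 0 → leAt w (P.μ γ) e := by
  constructor
  · intro h
    refine (coeffAt_cf a).le_of_mem_Amod ?_
    rw [← serO_cf]
    exact h
  · intro h
    have := (coeffAt_cf a).mem_Amod_of_le h
    rwa [← serO_cf] at this

theorem exists_lt_iff {a : Amu P w} {e : ℂ} :
    (∃ e', ltAt w e' e ∧ a ∈ AmuLe P e' w) ↔ ∀ γ, cf a γ ≠ 0 → ltAt w (P.μ γ) e := by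
  constructor
  · rintro ⟨e', he', ha⟩ γ hγ
    have := (mem_AmuLe_iff.1 ha γ hγ).lev_le
    rw [ltAt_iff] at he' ⊢
    linarith
  · intro h
    obtain ⟨e', he', ha⟩ := (coeffAt_cf a).mem_Amod_of_lt h
    rw [← serO_cf] at ha
    exact ⟨e', he', ha⟩

theorem cf_uExp_mul (δ : L) (a : Amu P w) (γ : L) : cf (uExp P δ w * a) γ = cf a (γ - δ) := by
  refine congrFun (cf_eq ((coeffAt_cf a).shift δ) ?_) γ
  rw [(coeffAt_cf a).serO_shift, ← serO_cf]
  rfl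

open Classical in
theorem cf_one : cf (1 : Amu P w) = Pi.single 0 1 := by
  refine cf_eq (CoeffAt.single 0 1) ?_
  rw [CoeffAt.serO_single, map_zero, expO_zero, map_one, mul_one]
  rfl

open Classical in
/-- The homogeneous component of degree `e` of an element of `𝒜_μ`. -/
def homog (e : ℂ) : Amu P w →ₗ[ℂ] AddMonoidAlgebra ℂ L :=
  if h : ∃ γ, P.μ γ = e then (AddMonoidAlgebra.lsingle h.choose).comp ((LinearMap.proj h.choose).comp cf)
  else 0

theorem homog_mu (γ : L) (a : Amu P w) : homog (P.μ γ) a = AddMonoidAlgebra.single γ (cf a γ) := by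
  have h : ∃ γ', P.μ γ' = P.μ γ := ⟨γ, rfl⟩
  have h1 : h.choose = γ := P.μ_injective h.choose_spec
  rw [homog, dif_pos h]
  simp [h1]

theorem homog_of_forall_ne {e : ℂ} (h : ∀ γ, P.μ γ ≠ e) (a : Amu P w) : homog e a = 0 := by
  rw [homog, dif_neg (by push Not; exact h)]
  rfl

theorem algebraMap_single (γ : L) (s : ℂ) :
    algebraMap (AddMonoidAlgebra ℂ L) (Amu P w) (AddMonoidAlgebra.single γ s) = s • uExp P γ w :=
  AddMonoidAlgebra.lift_single (R := ℂ) (uHom P w) γ s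

open Classical in
theorem cf_uExp (γ γ' : L) : cf (uExp P γ w) γ' = if γ' = γ then 1 else 0 := by
  have h := cf_uExp_mul γ (1 : Amu P w) γ'
  rw [mul_one, cf_one] at h
  rw [h, Pi.single_apply]
  simp only [sub_eq_zero]

theorem cf_homog (e : ℂ) (a : Amu P w) (γ : L) : P.μ γ = e →
    cf (algebraMap (AddMonoidAlgebra ℂ L) (Amu P w) (homog e a)) γ = cf a γ := by
  rintro rfl
  rw [homog_mu, algebraMap_single, map_smul, Pi.smul_apply, cf_uExp, if_pos rfl, smul_eq_mul, mul_one]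

theorem cf_homog_ne {e : ℂ} (a : Amu P w) {γ : L} (h : P.μ γ ≠ e) :
    cf (algebraMap (AddMonoidAlgebra ℂ L) (Amu P w) (homog e a)) γ = 0 := by
  by_cases he : ∃ γ', P.μ γ' = e
  · obtain ⟨γ', rfl⟩ := he
    rw [homog_mu, algebraMap_single, map_smul, Pi.smul_apply, cf_uExp, if_neg, smul_zero]
    rintro rfl
    exact h rfl
  · push Not at he
    rw [homog_of_forall_ne he, map_zero, map_zero]
    rfl

theorem homog_mem_AmuLe (e : ℂ) (a : Amu P w) :
    algebraMap (AddMonoidAlgebra ℂ L) (Amu P w) (homog e a) ∈ AmuLe P e w := by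
  rw [mem_AmuLe_iff]
  intro γ hγ
  by_contra h
  exact hγ (cf_homog_ne a fun he => h (Or.inr he))

end Coefficients

namespace FilteredModule

variable (M : FilteredModule P)

theorem single_smul_gr (γ : L) (s : ℂ) (x : M.Gr w) :
    (AddMonoidAlgebra.single γ s : AddMonoidAlgebra ℂ L) • x = s • M.grShift γ w x := by
  change (AddMonoidAlgebra.lift ℂ _ L (M.grAction w) (AddMonoidAlgebra.single γ s)) x = _
  rw [AddMonoidAlgebra.lift_single]
  rfl

instance : IsScalarTower ℂ (AddMonoidAlgebra ℂ L) (M.Gr w) where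
  smul_assoc s r x := by
    change (AddMonoidAlgebra.lift ℂ _ L (M.grAction w) (s • r)) x =
      s • (AddMonoidAlgebra.lift ℂ _ L (M.grAction w) r) x
    rw [map_smul]
    rfl

variable {M} {ι : Type*} [Fintype ι] {c : ι → ℂ} {I : Set Circle}

theorem toGr_eq_zero {e : ℂ} {x : M.le e w} (hx : (x : M.stalk w) ∈ M.lt e w) : M.toGr e w x = 0 := by
  change DirectSum.lof ℂ ℂ (M.grPiece w) e (((M.lt e w).submoduleOf (M.le e w)).mkQ x) = 0
  have h : ((M.lt e w).submoduleOf (M.le e w)).mkQ x = 0 := by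
    rw [Submodule.mkQ_apply, Submodule.Quotient.mk_eq_zero]
    exact hx
  rw [h, map_zero]

namespace SplitBasis

variable (S : M.SplitBasis c I) (hw : w ∈ I)

/-- The coordinates in a split basis. -/
def equiv : (ι → Amu P w) ≃ₗ[Amu P w] M.stalk w :=
  LinearEquiv.ofBijective (Fintype.linearCombination (Amu P w) fun i => S.ψ i w)
    ⟨fun a a' h => S.injective w hw a a' h, fun x => by
      obtain ⟨a, ha⟩ := S.surjective w hw x
      exact ⟨a, ha.symm⟩⟩

theorem equiv_apply (a : ι → Amu P w) : S.equiv hw a = ∑ i, a i • S.ψ i w := rfl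

theorem equiv_single [DecidableEq ι] (i : ι) (a : Amu P w) : S.equiv hw (Pi.single i a) = a • S.ψ i w := by
  rw [equiv_apply, Finset.sum_eq_single i]
  · simp
  · intro j _ hj
    simp [hj]
  · simp

theorem mem_le_iff {e : ℂ} {x : M.stalk w} :
    x ∈ M.le e w ↔ ∀ i, (S.equiv hw).symm x i ∈ AmuLe P (e + c i) w := by
  obtain ⟨a, rfl⟩ := (S.equiv hw).surjective x
  rw [LinearEquiv.symm_apply_apply]
  exact S.mem_le w hw e a

theorem mem_lt_iff {e : ℂ} {x : M.stalk w} :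
    x ∈ M.lt e w ↔ ∀ i γ, cf ((S.equiv hw).symm x i) γ ≠ 0 → ltAt w (P.μ γ) (e + c i) := by
  classical
  constructor
  · intro hx
    refine Submodule.iSup_induction _ (motive := fun x => ∀ i γ, cf ((S.equiv hw).symm x i) γ ≠ 0 →
      ltAt w (P.μ γ) (e + c i)) hx (fun e' y hy i => ?_) (fun i γ h => ?_) fun y z hy hz i γ h => ?_
    · refine exists_lt_iff.1 ⟨e'.1 + c i, ?_, (S.mem_le_iff hw).1 hy i⟩
      have := e'.2
      unfold ltAt at *
      rwa [add_sub_add_right_eq_sub]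
    · simp at h
    · rw [map_add, Pi.add_apply, map_add, Pi.add_apply] at h
      by_cases h0 : cf ((S.equiv hw).symm y i) γ = 0
      · exact hz i γ (by rwa [h0, zero_add] at h)
      · exact hy i γ h0
  · intro h
    rw [← (S.equiv hw).apply_symm_apply x, equiv_apply]
    refine sum_mem fun i _ => ?_
    obtain ⟨e', he', ha⟩ := exists_lt_iff.2 (h i)
    refine Submodule.mem_iSup_of_mem (⟨e' - c i, ?_⟩ : {e' : ℂ // ltAt w e' e}) ?_
    · unfold ltAt at *
      rwa [sub_sub, add_comm (c i)]
    · rw [← S.equiv_single hw, S.mem_le_iff hw]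
      intro j
      rw [LinearEquiv.symm_apply_apply, Pi.single_apply]
      split_ifs with hij
      · rw [hij, sub_add_cancel]
        exact ha
      · exact zero_mem_AmuLe _

open Classical in
/-- The coordinates on the graded module. -/
def grCoord : M.Gr w →ₗ[ℂ] (ι → AddMonoidAlgebra ℂ L) :=
  DirectSum.toModule ℂ ℂ (ι → AddMonoidAlgebra ℂ L) fun e => Submodule.liftQ _
    (LinearMap.pi fun i => (homog (e + c i)).comp ((LinearMap.proj i).comp
      (((S.equiv hw).symm.toLinearMap.restrictScalars ℂ).comp (M.le e w).subtype))) (by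
    intro x hx
    rw [LinearMap.mem_ker]
    funext i
    change homog (e + c i) ((S.equiv hw).symm (x : M.stalk w) i) = 0
    have h1 := (S.mem_lt_iff hw).1 hx i
    by_cases he : ∃ γ, P.μ γ = e + c i
    · obtain ⟨γ, hγ⟩ := he
      rw [← hγ, homog_mu]
      have h0 : cf ((S.equiv hw).symm (x : M.stalk w) i) γ = 0 := by
        by_contra h0
        have := h1 γ h0
        rw [hγ, ltAt_iff] at this
        exact lt_irrefl _ this
      rw [h0, AddMonoidAlgebra.single_zero]
    · push Not at he
      exact homog_of_forall_ne he _)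

theorem grCoord_toGr (e : ℂ) (x : M.le e w) (i : ι) :
    S.grCoord hw (M.toGr e w x) i = homog (e + c i) ((S.equiv hw).symm x i) :=
  congrFun (DirectSum.toModule_lof (R := ℂ) (M := M.grPiece w) e
    (((M.lt e w).submoduleOf (M.le e w)).mkQ x)) i

theorem ψ_mem_le (hw : w ∈ I) (i : ι) : S.ψ i w ∈ M.le (-c i) w := by
  classical
  have h := S.equiv_single hw i 1
  rw [one_smul] at h
  rw [← h, S.mem_le_iff hw]
  intro j
  rw [LinearEquiv.symm_apply_apply, Pi.single_apply]
  split_ifs with hij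
  · rw [hij, neg_add_cancel]
    simpa using algebraMap_mem_AmuLe (P := P) (w := w) 1
  · exact zero_mem_AmuLe _

/-- The basis elements of the graded module. -/
def β (i : ι) : M.Gr w := M.toGr (-c i) w ⟨S.ψ i w, S.ψ_mem_le hw i⟩

theorem toGr_eq (e : ℂ) (x : M.le e w) :
    M.toGr e w x = ∑ i, homog (e + c i) ((S.equiv hw).symm x i) • S.β hw i := by
  classical
  set a := (S.equiv hw).symm (x : M.stalk w) with ha
  have hmem : ∀ i, algebraMap (AddMonoidAlgebra ℂ L) (Amu P w) (homog (e + c i) (a i)) • S.ψ i w ∈ M.le e w := by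
    intro i
    rw [← S.equiv_single hw, S.mem_le_iff hw]
    intro j
    rw [LinearEquiv.symm_apply_apply, Pi.single_apply]
    split_ifs with hij
    · rw [hij]
      exact homog_mem_AmuLe _ _
    · exact zero_mem_AmuLe _
  have hβ : ∀ i, homog (e + c i) (a i) • S.β hw i = M.toGr e w ⟨_, hmem i⟩ := by
    intro i
    by_cases he : ∃ γ, P.μ γ = e + c i
    · obtain ⟨γ, hγ⟩ := he
      have aux : ∀ r (hm : algebraMap (AddMonoidAlgebra ℂ L) (Amu P w) r • S.ψ i w ∈ M.le e w),
          r = AddMonoidAlgebra.single γ (cf (a i) γ) → r • S.β hw i = M.toGr e w ⟨_, hm⟩ := by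
        rintro _ hm rfl
        rw [single_smul_gr, β, grShift_toGr, ← map_smul]
        refine M.toGr_congr (by rw [hγ]; ring) ?_
        simp only [algebraMap_single]
        change (cf (a i) γ : ℂ) • (uExp P γ w • S.ψ i w) = _
        rw [smul_assoc]
      exact aux _ (hmem i) (by rw [← hγ, homog_mu])
    · push Not at he
      have aux : ∀ r (hm : algebraMap (AddMonoidAlgebra ℂ L) (Amu P w) r • S.ψ i w ∈ M.le e w),
          r = 0 → r • S.β hw i = M.toGr e w ⟨_, hm⟩ := by
        rintro _ hm rfl
        rw [zero_smul, toGr_eq_zero]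
        simp only [map_zero, zero_smul]
        exact zero_mem _
      exact aux _ (hmem i) (homog_of_forall_ne he _)
  rw [Finset.sum_congr rfl fun i _ => hβ i, ← map_sum, ← sub_eq_zero, ← map_sub]
  refine toGr_eq_zero ((S.mem_lt_iff hw).2 fun i γ h => ?_)
  have e1 : (S.equiv hw).symm ((x - ∑ i, (⟨_, hmem i⟩ : M.le e w) : M.le e w) : M.stalk w) i =
      a i - algebraMap (AddMonoidAlgebra ℂ L) (Amu P w) (homog (e + c i) (a i)) := by
    rw [AddSubgroupClass.coe_sub, AddSubmonoidClass.coe_finsetSum, map_sub, ← ha, ← S.equiv_apply hw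
      fun i => algebraMap (AddMonoidAlgebra ℂ L) (Amu P w) (homog (e + c i) (a i)),
      LinearEquiv.symm_apply_apply]
    rfl
  rw [e1, map_sub, Pi.sub_apply] at h
  have h2 : P.μ γ ≠ e + c i := fun he => h (by rw [cf_homog _ _ _ he, sub_self])
  rw [cf_homog_ne _ h2, sub_zero] at h
  exact ((mem_AmuLe_iff.1 ((S.mem_le_iff hw).1 x.2 i)) γ h).resolve_right h2

theorem grCoord_single_smul [DecidableEq ι] (γ : L) (s : ℂ) (i : ι) :
    S.grCoord hw ((AddMonoidAlgebra.single γ s : AddMonoidAlgebra ℂ L) • S.β hw i) =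
      Pi.single i (AddMonoidAlgebra.single γ s) := by
  funext j
  rw [single_smul_gr, β, grShift_toGr, map_smul, Pi.smul_apply, grCoord_toGr]
  have e1 : (S.equiv hw).symm (M.shiftLe γ (-c i) w ⟨S.ψ i w, S.ψ_mem_le hw i⟩ : M.stalk w) =
      Pi.single i (uExp P γ w) := by
    rw [LinearEquiv.symm_apply_eq, equiv_single]
    rfl
  rw [e1, Pi.single_apply, Pi.single_apply]
  split_ifs with h
  · have e2 : -c i + P.μ γ + c j = P.μ γ := by rw [h]; ring
    rw [e2, homog_mu, cf_uExp, if_pos rfl, AddMonoidAlgebra.smul_single, smul_eq_mul, mul_one]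
  · rw [map_zero, smul_zero]

/-- The graded module is free. -/
def grEquiv : M.Gr w ≃ₗ[AddMonoidAlgebra ℂ L] (ι → AddMonoidAlgebra ℂ L) := by
  classical
  refine LinearEquiv.symm { Fintype.linearCombination (AddMonoidAlgebra ℂ L) (S.β hw) with
    invFun := S.grCoord hw
    left_inv := fun y => ?_
    right_inv := fun x => ?_ }
  · change S.grCoord hw (∑ i, y i • S.β hw i) = y
    have key : ∀ (i : ι) (r : AddMonoidAlgebra ℂ L), S.grCoord hw (r • S.β hw i) = Pi.single i r := by
      intro i r
      induction r using AddMonoidAlgebra.induction_linear with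
      | zero => simp
      | add f g hf hg => rw [add_smul, map_add, hf, hg, Pi.single_add]
      | single γ s => exact S.grCoord_single_smul hw γ s i
    rw [map_sum]
    simp only [key]
    exact Finset.univ_sum_single y
  · have h : ((Fintype.linearCombination (AddMonoidAlgebra ℂ L) (S.β hw)).restrictScalars ℂ).comp
        (S.grCoord hw) = LinearMap.id := M.gr_hom_ext fun e x => by
      change ∑ i, S.grCoord hw (M.toGr e w x) i • S.β hw i = M.toGr e w x
      rw [S.toGr_eq hw e x]
      refine Finset.sum_congr rfl fun i _ => ?_
      rw [← S.toGr_eq hw e x, S.grCoord_toGr hw]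
    exact LinearMap.congr_fun h x

/-- The splitting. -/
def split : M.Graded w ≃ₗ[Amu P w] M.stalk w :=
  ((Module.Basis.ofEquivFun (S.grEquiv hw)).baseChange (Amu P w)).equivFun.trans (S.equiv hw)

theorem split_tmul_β (a : Amu P w) (i : ι) : S.split hw (a ⊗ₜ S.β hw i) = a • S.ψ i w := by
  classical
  have h : S.β hw i = Module.Basis.ofEquivFun (S.grEquiv hw) i := by
    rw [Module.Basis.coe_ofEquivFun]
    change _ = ∑ j, (Pi.single i 1 : ι → AddMonoidAlgebra ℂ L) j • S.β hw j
    rw [Finset.sum_eq_single i]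
    · simp
    · intro j _ hj
      simp [hj]
    · simp
  rw [h, ← S.equiv_single hw]
  change S.equiv hw _ = _
  congr 1
  funext j
  change (((Module.Basis.ofEquivFun (S.grEquiv hw)).baseChange (Amu P w)).repr _) j = _
  rw [Module.Basis.baseChange_repr_tmul, Module.Basis.repr_self,
    Finsupp.single_apply, Pi.single_apply]
  simp only [eq_comm]
  split_ifs <;> simp

theorem split_tmul_toGr (a : Amu P w) (e : ℂ) (x : M.le e w) : S.split hw (a ⊗ₜ M.toGr e w x) =
    ∑ i, (a * algebraMap (AddMonoidAlgebra ℂ L) (Amu P w) (homog (e + c i) ((S.equiv hw).symm x i))) •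
      S.ψ i w := by
  rw [S.toGr_eq hw, TensorProduct.tmul_sum, map_sum]
  refine Finset.sum_congr rfl fun i _ => ?_
  rw [← TensorProduct.smul_tmul, Algebra.smul_def, mul_comm, split_tmul_β]

end SplitBasis

end FilteredModule

end PeriodRH

namespace PeriodRH

variable {L : Type*} [AddCommGroup L] [Module.Free ℤ L] [Module.Finite ℤ L] {P : PeriodDatum L}
  {w : Circle}

theorem homog_congr {v w : Circle} {a : Amu P v} {a' : Amu P w} (h : cf a = cf a') (e : ℂ) :
    homog e a = homog e a' := by
  by_cases he : ∃ γ, P.μ γ = e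
  · obtain ⟨γ, rfl⟩ := he
    rw [homog_mu, homog_mu, h]
  · push Not at he
    rw [homog_of_forall_ne he, homog_of_forall_ne he]

theorem isSecAmu_algebraMap (r : AddMonoidAlgebra ℂ L) :
    IsSecAmu P (fun v => algebraMap (AddMonoidAlgebra ℂ L) (Amu P v) r) w := by
  induction r using AddMonoidAlgebra.induction_linear with
  | zero =>
    simp only [map_zero]
    exact isSec_zero
  | add f g hf hg =>
    simp only [map_add]
    exact IsSec.add hf hg
  | single γ s =>
    simp only [algebraMap_single]
    exact (isSec_const s).mul (isSec_expO (P.μ γ))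

theorem IsSecAmu.cf_eventually {s : ∀ v, Amu P v} (hs : IsSecAmu P s w) :
    ∀ᶠ v in 𝓝 w, cf (s v) = cf (s w) := by
  filter_upwards [(coeffAt_cf (s w)).nearby, IsSec.unique hs (coeffAt_cf (s w)).isSec (serO_cf (s w))]
    with v h1 h2 using cf_eq h1 h2

namespace FilteredModule

variable {M : FilteredModule P}

theorem isSection_zero : M.IsSection (fun _ => 0) w := by
  obtain ⟨s, hs, -⟩ := M.section_exists w 0
  refine M.section_congr (Eventually.of_forall fun v => ?_)
    (M.section_smul (a := fun v => (0 : Amu P v)) isSec_zero hs)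
  exact zero_smul _ _

theorem isSection_sum {κ : Type*} (T : Finset κ) {s : κ → ∀ v, M.stalk v} (h : ∀ i, M.IsSection (s i) w) :
    M.IsSection (fun v => ∑ i ∈ T, s i v) w := by
  classical
  induction T using Finset.induction_on with
  | empty => simpa using isSection_zero
  | insert i T hi ih =>
    simp only [Finset.sum_insert hi]
    exact M.section_add (h i) ih

theorem le_closed_gradedLe {e : ℂ} {N : AddSubgroup (M.Graded w)}
    (h : ∀ c' c'' : ℂ, leAt w (c' + c'') e → ∀ a ∈ AmuLe P c' w, ∀ x : M.le c'' w, a ⊗ₜ M.toGr c'' w x ∈ N) :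
    M.gradedLe e w ≤ N := by
  refine (AddSubgroup.closure_le N).2 ?_
  rintro _ ⟨c', c'', hc, a, ha, x, rfl⟩
  exact h c' c'' hc a ha x

namespace SplitBasis

variable {ι : Type*} [Fintype ι] {c : ι → ℂ} {I : Set Circle} (S : M.SplitBasis c I)

theorem split_mem_le (hw : w ∈ I) {e : ℂ} {t : M.Graded w} :
    S.split hw t ∈ M.le e w ↔ t ∈ M.gradedLe e w := by
  constructor
  · intro h
    obtain ⟨t, rfl⟩ := (S.split hw).symm.surjective t
    rw [LinearEquiv.apply_symm_apply] at h
    have h1 := (S.mem_le_iff hw).1 h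
    have h2 : (S.split hw).symm t = ∑ i, (S.equiv hw).symm t i ⊗ₜ S.β hw i := by
      rw [LinearEquiv.symm_apply_eq, map_sum]
      simp only [split_tmul_β]
      rw [← S.equiv_apply hw, LinearEquiv.apply_symm_apply]
    rw [h2]
    refine sum_mem fun i _ => AddSubgroup.subset_closure ⟨e + c i, -c i, Or.inr (by ring), _, h1 i, _, rfl⟩
  · intro h
    have h1 : M.gradedLe e w ≤ (M.le e w).toAddSubgroup.comap (S.split hw).toAddMonoidHom := by
      refine le_closed_gradedLe fun c' c'' hc a ha x => ?_
      change S.split hw (a ⊗ₜ M.toGr c'' w x) ∈ M.le e w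
      rw [split_tmul_toGr, S.mem_le w hw]
      intro i
      have h2 := AmuLe_mul ha (homog_mem_AmuLe (c'' + c i) ((S.equiv hw).symm (x : M.stalk w) i))
      rw [← add_assoc] at h2
      exact AmuLe_mono (hc.add_right _) h2
    exact h1 h

theorem split_sub_mem_lt (hw : w ∈ I) {e : ℂ} (x : M.le e w) :
    S.split hw (1 ⊗ₜ M.toGr e w x) - (x : M.stalk w) ∈ M.lt e w := by
  rw [split_tmul_toGr, ← S.equiv_apply hw fun i => 1 * algebraMap (AddMonoidAlgebra ℂ L) (Amu P w)
    (homog (e + c i) ((S.equiv hw).symm x i)), S.mem_lt_iff hw]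
  intro i γ h
  rw [map_sub, LinearEquiv.symm_apply_apply, Pi.sub_apply, one_mul, map_sub, Pi.sub_apply] at h
  have h2 : P.μ γ ≠ e + c i := fun he => h (by rw [cf_homog _ _ _ he, sub_self])
  rw [cf_homog_ne _ h2, zero_sub, neg_ne_zero] at h
  exact ((mem_AmuLe_iff.1 ((S.mem_le_iff hw).1 x.2 i)) γ h).resolve_right h2

theorem exists_coord_sections (hw : w ∈ I) {v : ∀ w, M.stalk w} (hv : M.IsSection v w) :
    ∃ s : ι → ∀ v, Amu P v, (∀ i, IsSecAmu P (s i) w) ∧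
      ∀ᶠ w' in 𝓝 w, ∀ hw' : w' ∈ I, (S.equiv hw').symm (v w') = fun i => s i w' := by
  choose s hs hsw using fun i => exists_isSecAmu ((S.equiv hw).symm (v w) i)
  refine ⟨s, hs, ?_⟩
  have h1 : M.IsSection (fun v => ∑ i, s i v • S.ψ i v) w :=
    isSection_sum _ fun i => M.section_smul (hs i) (S.isSection w hw i)
  have h2 := M.section_unique hv h1 (by
    simp only [hsw]
    rw [← S.equiv_apply hw, LinearEquiv.apply_symm_apply])
  filter_upwards [h2] with w' h3 hw'
  rw [LinearEquiv.symm_apply_eq, h3]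
  rfl

theorem split_section (hw : w ∈ I) {e : ℂ} {v : ∀ w, M.stalk w} (hv : M.IsSection v w) :
    ∃ s : ∀ w, M.stalk w, M.IsSection s w ∧ ∀ᶠ w' in 𝓝 w, ∀ (hw' : w' ∈ I) (hv : v w' ∈ M.le e w'),
      S.split hw' (1 ⊗ₜ M.toGr e w' ⟨v w', hv⟩) = s w' := by
  obtain ⟨s, hs, hsv⟩ := S.exists_coord_sections hw hv
  refine ⟨fun w' => ∑ i, algebraMap (AddMonoidAlgebra ℂ L) (Amu P w') (homog (e + c i) (s i w)) • S.ψ i w',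
    isSection_sum _ fun i => M.section_smul (isSecAmu_algebraMap _) (S.isSection w hw i), ?_⟩
  filter_upwards [hsv, eventually_all.2 fun i => (hs i).cf_eventually] with w' h1 h2 hw' hv'
  rw [split_tmul_toGr]
  refine Finset.sum_congr rfl fun i _ => ?_
  rw [one_mul, h1 hw', homog_congr (h2 i)]

theorem splitsOn (S : M.SplitBasis c I) : M.SplitsOn I :=
  ⟨fun _ hw => S.split hw, fun _ hw _ _ hv _ => S.split_section hw hv,
    fun _ hw _ _ => S.split_mem_le hw, fun _ hw _ x => S.split_sub_mem_lt hw x⟩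

end SplitBasis
end FilteredModule

theorem arcAround_eq (d ε : ℝ) : arcAround d ε =
    Circle.exp '' Set.Ioo (d - (Real.pi + ε) / 2) (d + (Real.pi + ε) / 2) := by
  ext w
  constructor
  · rintro ⟨θ, h, rfl⟩
    obtain ⟨h1, h2⟩ := abs_lt.1 h
    exact ⟨θ, ⟨by linarith, by linarith⟩, rfl⟩
  · rintro ⟨θ, ⟨h1, h2⟩, rfl⟩
    exact ⟨θ, abs_lt.2 ⟨by linarith, by linarith⟩, rfl⟩

theorem isOpen_arcAround (d ε : ℝ) : IsOpen (arcAround d ε) := by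
  rw [arcAround_eq]
  exact isLocalHomeomorph_circleExp.isOpenMap _ isOpen_Ioo

namespace DRObject

variable {C : Finset ℂ} (X : DRObject P C)

theorem exists_frame (d : ℝ) : ∃ (r : C → ℕ)
    (_ : FlatFrame X.conn d fun i : Σ c : C, Fin (r c) => (i.1 : ℂ)),
    Nonempty (Module.Basis (Σ c : C, Fin (r c)) Mero X.E) := by
  obtain ⟨r, ⟨F⟩⟩ := X.elementary.exists_flatFrame d
  refine ⟨r, F, ⟨(Module.finBasis Mero X.E).reindex (Fintype.equivOfCardEq ?_)⟩⟩
  rw [Fintype.card_fin, X.finrank_eq, Module.finrank_eq_card_basis F.b]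

theorem summableAlong_DR {d : ℝ} (h : X.SummableAlong d) : X.DR.SummableAlong d := by
  obtain ⟨r, F, ⟨b⟩⟩ := X.exists_frame d
  obtain ⟨α, hα, -, Ψ, hΨ⟩ := X.exists_triv_of_summable F b h
  refine ⟨2 * α, by linarith, ?_⟩
  obtain ⟨S, -⟩ := X.exists_splitBasis F b (I := arcAround d (2 * α)) (Ψ := Ψ) (by
    rintro w ⟨θ, hθ, rfl⟩
    obtain ⟨h1, h2⟩ := abs_lt.1 hθ
    exact hΨ θ ⟨by linarith, by linarith⟩)
  exact S.splitsOn

end DRObject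

end PeriodRH

namespace PeriodRH

theorem FilteredModule.SplitsOn.mono {L : Type*} [AddCommGroup L] [Module.Free ℤ L] [Module.Finite ℤ L]
    {P : PeriodDatum L} {M : FilteredModule P} {I J : Set Circle} (h : M.SplitsOn I) (hJ : J ⊆ I) :
    M.SplitsOn J := by
  obtain ⟨η, h1, h2, h3⟩ := h
  refine ⟨fun w hw => η w (hJ hw), fun w hw c v hv hc => ?_, fun w hw => h2 w (hJ hw), fun w hw => h3 w (hJ hw)⟩
  obtain ⟨s, hs, he⟩ := h1 w (hJ hw) c v hv hc
  exact ⟨s, hs, he.mono fun w' hw' h => hw' (hJ h)⟩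

namespace DRObject

variable {L : Type*} [AddCommGroup L] [Module.Free ℤ L] [Module.Finite ℤ L] {P : PeriodDatum L}
  {C : Finset ℂ} (X : DRObject P C)
variable {ι : Type*} [Fintype ι] [DecidableEq ι] {d : ℝ} {c : ι → ℂ} (F : FlatFrame X.conn d c)
  (b : Module.Basis ι Mero X.E) {Ψ Φ : ∀ v, Matrix ι ι (O v)} {w : Circle} {I J : Set Circle}

theorem drVal_equiv {S : X.DR.SplitBasis c I}
    (hS : ∀ w ∈ I, ∀ i, X.drVal w (S.ψ i w) = X.comb b c Ψ w (Pi.single i 1)) (hw : w ∈ I) (a : ι → Amu P w) :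
    X.drVal w (S.equiv hw a) = X.comb b c Ψ w a := by
  have e : a = ∑ i, a i • (Pi.single i 1 : ι → Amu P w) := by
    ext i
    simp [Finset.sum_apply, Pi.single_apply]
  conv_rhs => rw [e, map_sum]
  rw [S.equiv_apply, map_sum]
  refine Finset.sum_congr rfl fun i _ => ?_
  rw [map_smul, map_smul, hS w hw]

theorem β_eq {S : X.DR.SplitBasis c I} {S' : X.DR.SplitBasis c J}
    (hS : ∀ w ∈ I, ∀ i, X.drVal w (S.ψ i w) = X.comb b c Ψ w (Pi.single i 1))
    (hS' : ∀ w ∈ J, ∀ i, X.drVal w (S'.ψ i w) = X.comb b c Φ w (Pi.single i 1))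
    (h : (X.triv F b).T w Ψ) (h' : (X.triv F b).T w Φ) (hw : w ∈ I) (hw' : w ∈ J) (i : ι) :
    S.β hw i = S'.β hw' i := by
  obtain ⟨H, -, hH, hHa⟩ := X.exists_transition F b h h'
  symm
  rw [FilteredModule.SplitBasis.β, FilteredModule.SplitBasis.β, ← sub_eq_zero, ← map_sub]
  refine FilteredModule.toGr_eq_zero ((S.mem_lt_iff hw).2 fun j => exists_lt_iff.1 ?_)
  obtain ⟨e, he, hm⟩ := hH j i
  refine ⟨e, by rwa [neg_add_eq_sub], ?_⟩
  convert hm using 1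
  have e1 : S'.ψ i w - S.ψ i w = S.equiv hw ((H - 1).mulVec (Pi.single i 1)) := by
    refine X.drVal_injective w ?_
    rw [X.drVal_equiv b hS, map_sub, hS w hw, hS' w hw', hHa, Matrix.sub_mulVec, map_sub, Matrix.one_mulVec]
  change (S.equiv hw).symm (S'.ψ i w - S.ψ i w) j = _
  rw [e1, LinearEquiv.symm_apply_apply, Matrix.mulVec_single_one]
  rfl

theorem triv_of_sub_mem_lt {S : X.DR.SplitBasis c I}
    (hS : ∀ w ∈ I, ∀ i, X.drVal w (S.ψ i w) = X.comb b c Φ w (Pi.single i 1))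
    (h : (X.triv F b).T w Φ) (hw : w ∈ I) {y : ι → ∀ v, X.DR.stalk v} (hy : ∀ i, X.DR.IsSection (y i) w)
    (hlt : ∀ i, y i w - S.ψ i w ∈ X.DR.lt (-c i) w) :
    (X.triv F b).T w fun v => Matrix.of fun j i => coordB b v (X.drVal v (y i v)) j * expO (c i) v := by
  set Ψ : ∀ v, Matrix ι ι (O v) := fun v =>
    Matrix.of fun j i => coordB b v (X.drVal v (y i v)) j * expO (c i) v with hΨ
  set n : ι → ι → Amu P w := fun j i => (S.equiv hw).symm (y i w - S.ψ i w) j with hn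
  obtain ⟨U, hU, hN⟩ := NegOn.of_coeffAt (c := c) (M := fun j i => cf (n j i)) (fun j i => coeffAt_cf _)
    fun j i γ h0 => by
      have h1 := (S.mem_lt_iff hw).1 (hlt i) j γ h0
      rw [ltAt_iff] at h1
      rw [ltAt_zero_iff]
      simp only [qexp, lev_add, lev_sub, lev_neg] at h1 ⊢
      linarith
  obtain ⟨H, -, hH, hHa⟩ := hN.exists_twist hU
  have hpt : Ψ w = Φ w * (1 + serM P c (fun j i => cf (n j i)) w) := by
    ext j i
    have e1 : y i w = S.equiv hw (H.mulVec (Pi.single i 1)) := by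
      have e2 : (H - 1).mulVec (Pi.single i 1) = (S.equiv hw).symm (y i w - S.ψ i w) := by
        rw [Matrix.mulVec_single_one]
        funext j
        refine Subtype.ext ((hH j i).trans ?_)
        rw [← serO_cf]
      have e3 := S.equiv_single hw i 1
      rw [one_smul] at e3
      rw [Matrix.sub_mulVec, Matrix.one_mulVec, LinearEquiv.eq_symm_apply, map_sub, e3] at e2
      exact (sub_left_injective e2).symm
    have e4 : coordB b w (X.drVal w (y i w)) =
        (Φ w * (1 + serM P c (fun j i => cf (n j i)) w)).mulVec (twist c (Pi.single i (1 : Amu P w))) := by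
      rw [e1, X.drVal_equiv b hS, ← Matrix.mulVec_mulVec, hHa]
      exact LinearEquiv.apply_symm_apply _ _
    have e5 : twist (P := P) c (Pi.single i (1 : Amu P w)) = Pi.single i (expO (-c i) w) := by
      ext l
      simp only [twist, Pi.single_apply]
      split_ifs with hl
      · rw [hl]; simp
      · simp
    change coordB b w (X.drVal w (y i w)) j * expO (c i) w = _
    rw [e4, e5, Matrix.mulVec_single]
    change _ * expO (-c i) w * expO (c i) w = _
    rw [mul_assoc, mul_comm (expO (-c i) w), expO_mul_neg, mul_one]
    rfl
  refine (X.triv F b).mul h hU hN ?_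
  have hl : ∀ j i, IsSec (fun v => Ψ v j i) w := fun j i =>
    (isSec_coordB b (X.isSection_DR.1 (hy i)) j).mul (isSec_expO _)
  have hr := IsSec.matMul (X.triv_isSec F b h) (B := fun v => 1 + serM P c (fun j i => cf (n j i)) v)
    fun i j => (isSec_one_apply i j).add (hN.isSec_serM hU i j)
  have hev : ∀ᶠ v in 𝓝 w, ∀ j i, Ψ v j i = (Φ v * (1 + serM P c (fun j i => cf (n j i)) v)) j i :=
    eventually_all.2 fun j => eventually_all.2 fun i => (hl j i).unique (hr j i) (by rw [hpt])
  filter_upwards [hev] with v hv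
  ext j i
  exact hv j i

theorem exists_triv_of_splitsOn (h : X.DR.SplitsOn I) (hI : IsOpen I)
    (hIπ : ∀ w ∈ I, ∃ θ : ℝ, |θ - d| < Real.pi ∧ w = Circle.exp θ) :
    ∃ Ψ, ∀ w ∈ I, (X.triv F b).T w Ψ := by
  obtain ⟨η, hη, -, hlt⟩ := h
  choose S hS using fun k => X.exists_splitBasis F b (I := {v | (X.triv F b).T v (X.fund F b k)})
    (Ψ := X.fund F b k) fun w hw => hw
  have key : ∀ (i : ι) (w : Circle), ∃ x : X.DR.stalk w, ∀ (hw : w ∈ I) (k : ZMod X.cov.K)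
      (hk : (X.triv F b).T w (X.fund F b k)), x = η w hw (1 ⊗ₜ (S k).β hk i) := by
    intro i w
    by_cases hw : w ∈ I
    · obtain ⟨θ, hθ, rfl⟩ := hIπ w hw
      obtain ⟨l, hl⟩ := X.cov.covers (Circle.exp θ)
      have hl' := X.triv_fund F b hθ hl
      refine ⟨η (Circle.exp θ) hw (1 ⊗ₜ (S l).β hl' i), fun _ k hk => ?_⟩
      rw [X.β_eq F b (hS l) (hS k) hl' hk hl' hk]
    · exact ⟨0, fun h => (hw h).elim⟩
  choose y hy using key
  refine ⟨fun v => Matrix.of fun j i => coordB b v (X.drVal v (y i v)) j * expO (c i) v, fun w hw => ?_⟩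
  obtain ⟨θ, hθ, rfl⟩ := hIπ w hw
  obtain ⟨k, hk⟩ := X.cov.covers (Circle.exp θ)
  have hk' := X.triv_fund F b hθ hk
  refine X.triv_of_sub_mem_lt F b (hS k) hk' hk' (y := y) (fun i => ?_) fun i => ?_
  · obtain ⟨s, hs, hsv⟩ := hη _ hw (-c i) ((S k).ψ i) ((S k).isSection _ hk' i) ((S k).ψ_mem_le hk' i)
    refine X.DR.section_congr ?_ hs
    filter_upwards [hsv, (X.triv F b).nearby hk', hI.mem_nhds hw] with v h1 h2 h3
    rw [hy i v h3 k h2]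
    exact (h1 h3 ((S k).ψ_mem_le h2 i)).symm
  · rw [hy i _ hw k hk']
    exact hlt _ hw (-c i) _

end DRObject

end PeriodRH

namespace PeriodRH

section Expansion

variable {w : Circle} {n m : ℕ} {F F' : PowerSeries ℂ} {g h : O w}

/-- The germ `g` has the asymptotic expansion `z^{-n} F` of Gevrey order one. -/
def HasExp (w : Circle) (n : ℕ) (F : PowerSeries ℂ) (g : O w) : Prop :=
  HasAsyAt w (algebraMap Mero (O w) Mero.X ^ n * g) F

theorem germ_X_pow_mul {f : ℂ → ℂ} (hg : g.germ = (f : Germ (dirNhds w) ℂ)) :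
    (algebraMap Mero (O w) Mero.X ^ n * g).germ = ((fun z => z ^ n * f z : ℂ → ℂ) : Germ (dirNhds w) ℂ) := by
  rw [map_mul, map_pow, germ_mero_X, hg]
  rfl

theorem hasExp_iff {f : ℂ → ℂ} (hg : g.germ = (f : Germ (dirNhds w) ℂ)) :
    HasExp w n F g ↔ AsyFn w (fun z => z ^ n * f z) F :=
  hasAsyAt_iff (germ_X_pow_mul hg)

theorem hasExp_shift : HasExp w (m + n) (PowerSeries.X ^ m * F) g ↔ HasExp w n F g := by
  obtain ⟨f, -, hf⟩ := g.exists_rep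
  rw [hasExp_iff hf, hasExp_iff hf]
  have e : (fun z : ℂ => z ^ (m + n) * f z) = fun z => z ^ m * (z ^ n * f z) := by
    funext z
    ring
  rw [e]
  exact ⟨AsyFn.of_X_pow_mul, AsyFn.X_pow_mul m⟩

namespace HasExp

theorem unique (h1 : HasExp w n F g) (h2 : HasExp w n F' g) : F = F' := by
  obtain ⟨f, -, hf⟩ := g.exists_rep
  exact ((hasExp_iff hf).1 h1).unique ((hasExp_iff hf).1 h2)

theorem cross (h1 : HasExp w n F g) (h2 : HasExp w m F' g) : PowerSeries.X ^ m * F = PowerSeries.X ^ n * F' := by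
  refine (hasExp_shift.2 h1).unique (n := m + n) ?_
  rw [add_comm]
  exact hasExp_shift.2 h2

theorem of_cross (h1 : HasExp w n F g) (h2 : PowerSeries.X ^ m * F = PowerSeries.X ^ n * F') :
    HasExp w m F' g := by
  rw [← hasExp_shift (m := n), ← h2, add_comm]
  exact hasExp_shift.2 h1

theorem add (h1 : HasExp w n F g) (h2 : HasExp w n F' h) : HasExp w n (F + F') (g + h) := by
  obtain ⟨f, -, hf⟩ := g.exists_rep
  obtain ⟨f', -, hf'⟩ := h.exists_rep
  rw [hasExp_iff hf] at h1
  rw [hasExp_iff hf'] at h2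
  rw [hasExp_iff (f := fun z => f z + f' z) (by rw [map_add, hf, hf']; rfl)]
  refine (h1.add h2).congr (Eventually.of_forall fun z => ?_)
  ring

theorem neg (h1 : HasExp w n F g) : HasExp w n (-F) (-g) := by
  obtain ⟨f, -, hf⟩ := g.exists_rep
  rw [hasExp_iff hf] at h1
  rw [hasExp_iff (f := fun z => -f z) (by rw [map_neg, hf]; rfl)]
  refine h1.neg.congr (Eventually.of_forall fun z => ?_)
  ring

theorem mul (h1 : HasExp w n F g) (h2 : HasExp w m F' h) : HasExp w (n + m) (F * F') (g * h) := by
  obtain ⟨f, -, hf⟩ := g.exists_rep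
  obtain ⟨f', -, hf'⟩ := h.exists_rep
  rw [hasExp_iff hf] at h1
  rw [hasExp_iff hf'] at h2
  rw [hasExp_iff (f := fun z => f z * f' z) (by rw [map_mul, hf, hf']; rfl)]
  refine (h1.mul h2).congr (Eventually.of_forall fun z => ?_)
  ring

theorem of_small (hg : g ∈ Small w) : HasExp w n 0 g := by
  obtain ⟨f, hf, hs⟩ := hg
  rw [hasExp_iff hf]
  simpa using hs.asyFn.X_pow_mul n

theorem add_small (h1 : HasExp w n F g) (hh : h ∈ Small w) : HasExp w n F (g + h) := by
  simpa using h1.add (of_small hh)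

theorem nearby {s : ∀ v, O v} (hs : IsSec s w) (h1 : HasExp w n F (s w)) : ∀ᶠ v in 𝓝 w, HasExp v n F (s v) := by
  obtain ⟨f, hf⟩ := hs
  rw [hasExp_iff hf.self_of_nhds] at h1
  filter_upwards [h1.nearby, hf] with v h2 h3
  rwa [hasExp_iff h3]

end HasExp

theorem exists_hasExp_mero (k : Mero) (w : Circle) : ∃ n F, HasExp w n F (algebraMap Mero (O w) k) := by
  obtain ⟨f, hf, hfk, -⟩ := k.exists_rep (dirNhds_le w)
  obtain ⟨n, hn⟩ := hf
  obtain ⟨F, hF⟩ := AsyFn.of_analyticAt hn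
  refine ⟨n, F, (hasExp_iff hfk).2 ((hF w).congr (Eventually.of_forall fun z => ?_))⟩
  simp

theorem exists_hasExp_add (h1 : ∃ n F, HasExp w n F g) (h2 : ∃ n F, HasExp w n F h) :
    ∃ n F, HasExp w n F (g + h) := by
  obtain ⟨n, F, h1⟩ := h1
  obtain ⟨m, F', h2⟩ := h2
  refine ⟨m + n, _, (hasExp_shift.2 h1).add (F' := PowerSeries.X ^ n * F') ?_⟩
  rw [add_comm]
  exact hasExp_shift.2 h2

/-- The contraction with a linear form. -/
def contract {E : Type*} [AddCommGroup E] [Module Mero E] (φ : E →ₗ[Mero] Mero) (w : Circle) :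
    O w ⊗[Mero] E →ₗ[O w] O w :=
  (TensorProduct.AlgebraTensorModule.rid Mero (O w) (O w)).toLinearMap.comp (φ.baseChange (O w))

section

variable {E : Type*} [AddCommGroup E] [Module Mero E] (φ : E →ₗ[Mero] Mero)

theorem contract_tmul (f : O w) (e : E) : contract φ w (f ⊗ₜ e) = f * algebraMap Mero (O w) (φ e) := by
  simp [contract, Algebra.smul_def, mul_comm]

theorem contract_eq_sum {ι : Type*} [Fintype ι] (b : Module.Basis ι Mero E) (x : O w ⊗[Mero] E) :
    contract φ w x = ∑ i, algebraMap Mero (O w) (φ (b i)) * coordB b w x i := by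
  obtain ⟨y, rfl⟩ := (coordB b w).symm.surjective x
  rw [LinearEquiv.apply_symm_apply, coordB_symm, map_sum]
  refine Finset.sum_congr rfl fun i _ => ?_
  rw [contract_tmul, mul_comm]

theorem isSec_contract {t : ∀ v, O v ⊗[Mero] E} (ht : IsSecT t w) :
    IsSec (fun v => contract φ v (t v)) w := by
  obtain ⟨n, s, e, hs, h⟩ := ht
  refine IsSec.congr ?_ (IsSec.sum Finset.univ fun k => (hs k).mul (isSec_mero (φ (e k))))
  filter_upwards [h] with v hv
  rw [hv, map_sum]
  exact Finset.sum_congr rfl fun k _ => (contract_tmul φ _ _).symm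

theorem exists_hasExp_contract {x : O w ⊗[Mero] E} (hx : x ∈ tensorSpan E (AGev w)) :
    ∃ n F, HasExp w n F (contract φ w x) := by
  induction hx using AddSubgroup.closure_induction with
  | mem x hx =>
    obtain ⟨f, ⟨F, hF⟩, e, rfl⟩ := hx
    rw [contract_tmul]
    obtain ⟨m, F', h'⟩ := exists_hasExp_mero (φ e) w
    have h0 : HasExp w 0 F f := by
      unfold HasExp
      rwa [pow_zero, one_mul]
    exact ⟨_, _, h0.mul h'⟩
  | zero => exact ⟨0, 0, by rw [map_zero]; exact HasExp.of_small zero_mem_Small⟩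
  | add x y _ _ hx hy =>
    rw [map_add]
    exact exists_hasExp_add hx hy
  | neg x _ hx =>
    obtain ⟨n, F, h⟩ := hx
    rw [map_neg]
    exact ⟨n, _, h.neg⟩

theorem contract_mem_Small {e : ℂ} (he : ltAt w e 0) {x : O w ⊗[Mero] E}
    (hx : x ∈ tensorSpan E (Amod e w)) : contract φ w x ∈ Small w := by
  refine Amod_subset_Small he ?_
  induction hx using AddSubgroup.closure_induction with
  | mem x hx =>
    obtain ⟨f, hf, y, rfl⟩ := hx
    rw [contract_tmul]
    have := Amod_mul hf (by rw [Amod_zero]; exact mero_mem_Amod0 (φ y) w : _ ∈ Amod 0 w)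
    rwa [add_zero] at this
  | zero => rw [map_zero]; exact zero_mem_Amod _ _
  | add x y _ _ hx hy => rw [map_add]; exact Amod_add hx hy
  | neg x _ hx => rw [map_neg]; exact neg_mem_Amod hx

end

end Expansion

namespace DRObject

variable {L : Type*} [AddCommGroup L] [Module.Free ℤ L] [Module.Finite ℤ L] {P : PeriodDatum L}
  {C : Finset ℂ} (X : DRObject P C)

theorem coeff_eq {k : ZMod X.cov.K} {w : Circle} (hw : w ∈ X.cov.arc k) (e : X.E) (φ : X.E0 →ₗ[Mero] Mero) :
    X.coeff k w hw e φ = contract φ w (X.Xi k w hw (1 ⊗ₜ e)) := rfl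

theorem one_tmul_mem (w : Circle) (e : X.E) : (1 : O w) ⊗ₜ[Mero] e ∈ tensorSpan X.E (AGev w) :=
  AddSubgroup.subset_closure ⟨1, one_mem_AGev w, e, rfl⟩

theorem endNeg_contract {w : Circle} {E : Type*} [AddCommGroup E] [Module Mero E] {N : Connection E}
    {ψ : Module.End (O w) (O w ⊗[Mero] E)} (hψ : ψ ∈ endNeg P N w) (φ : E →ₗ[Mero] Mero)
    {x : O w ⊗[Mero] E} (hx : x ∈ tensorSpan E (AGev w)) : contract φ w (ψ x) ∈ Small w := by
  have hx0 : x ∈ tensorSpan E (Amod 0 w) := by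
    rw [Amod_zero]
    exact tensorSpan_mono (AGev_subset_Amod0 w) hx
  induction hψ using AddSubgroup.closure_induction with
  | mem ψ h =>
    obtain ⟨c, c', hc, a, ha, χ, hχ, -, rfl⟩ := h
    have h1 := smul_mem_tensorSpan ha (endSpan_apply hχ hx0)
    rw [add_zero] at h1
    exact contract_mem_Small φ hc h1
  | zero =>
    rw [LinearMap.zero_apply, map_zero]
    exact zero_mem_Small
  | add ψ χ _ _ h1 h2 =>
    rw [LinearMap.add_apply, map_add]
    exact Small_add h1 h2
  | neg ψ _ h1 =>
    rw [LinearMap.neg_apply, map_neg, ← neg_one_mul]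
    exact mul_mem_Small (neg_mem (one_mem (modR w))) h1

theorem coeff_sub_mem_Small {k : ZMod X.cov.K} {w : Circle} (hw : w ∈ X.cov.arc k)
    (hw' : w ∈ X.cov.arc (k + 1)) (e : X.E) (φ : X.E0 →ₗ[Mero] Mero) :
    X.coeff k w hw e φ - X.coeff (k + 1) w hw' e φ ∈ Small w := by
  have h := endNeg_contract (X.Xi_aut k w hw hw') φ ((X.Xi_mem (k + 1) w hw' _).2 (X.one_tmul_mem w e))
  rw [LinearMap.sub_apply, map_sub] at h
  simpa [coeff_eq] using h

theorem exists_coeff_section {k : ZMod X.cov.K} {w : Circle} (hw : w ∈ X.cov.arc k) (e : X.E)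
    (φ : X.E0 →ₗ[Mero] Mero) : ∃ s : ∀ v, O v, IsSec s w ∧ s w = X.coeff k w hw e φ ∧
      ∀ᶠ v in 𝓝 w, ∀ hv : v ∈ X.cov.arc k, s v = X.coeff k v hv e φ := by
  obtain ⟨t, ht, htv⟩ := X.Xi_section k w hw e
  refine ⟨_, isSec_contract φ ht, ?_, ?_⟩
  · rw [coeff_eq, htv.self_of_nhds hw]
  · filter_upwards [htv] with v h1 hv
    rw [coeff_eq, h1 hv]

theorem hasExp_coeff_arc {k : ZMod X.cov.K} {e : X.E} {φ : X.E0 →ₗ[Mero] Mero} {n : ℕ} {F : PowerSeries ℂ}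
    {v : Circle} {hv : v ∈ X.cov.arc k} (h : HasExp v n F (X.coeff k v hv e φ)) {w : Circle}
    (hw : w ∈ X.cov.arc k) : HasExp w n F (X.coeff k w hw e φ) := by
  set u : Set Circle := {w | ∃ hw : w ∈ X.cov.arc k, HasExp w n F (X.coeff k w hw e φ)} with hu
  have hopen : IsOpen u := by
    refine isOpen_iff_mem_nhds.2 ?_
    rintro w ⟨hw, h⟩
    obtain ⟨s, hs, hsw, hsv⟩ := X.exists_coeff_section hw e φ
    rw [← hsw] at h
    filter_upwards [h.nearby hs, hsv, (X.cov.isOpen_arc k).mem_nhds hw] with v h1 h2 h3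
    exact ⟨h3, by rwa [← h2 h3]⟩
  have hconn : IsPreconnected (X.cov.arc k) := by
    obtain ⟨α, β, -, h⟩ := X.cov.isArc k
    rw [h]
    exact isPreconnected_Ioo.image _ Circle.exp.continuous.continuousOn
  refine (hconn.subset_of_closure_inter_subset hopen ⟨v, hv, hv, h⟩ ?_ hw).2
  rintro w ⟨hwc, hw⟩
  refine ⟨hw, ?_⟩
  obtain ⟨m, F', h'⟩ := exists_hasExp_contract φ ((X.Xi_mem k w hw _).2 (X.one_tmul_mem w e))
  rw [← coeff_eq] at h'
  obtain ⟨s, hs, hsw, hsv⟩ := X.exists_coeff_section hw e φ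
  have h'' := h'
  rw [← hsw] at h'
  obtain ⟨x, ⟨hx1, hx2⟩, hx3, hx4⟩ := mem_closure_iff_nhds.1 hwc _ ((h'.nearby hs).and hsv)
  rw [hx2 hx3] at hx1
  exact h''.of_cross (hx1.cross hx4)

theorem exists_common_exp (e : X.E) (φ : X.E0 →ₗ[Mero] Mero) : ∃ n F, ∀ k w (hw : w ∈ X.cov.arc k),
    HasExp w n F (X.coeff k w hw e φ) := by
  have hne : ∀ k, (X.cov.arc k).Nonempty := fun k => by
    have := (X.cov.meets_iff k k).2 (Or.inr (Or.inl rfl))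
    rwa [Set.inter_self] at this
  obtain ⟨v, hv⟩ := hne 0
  obtain ⟨n, F, h⟩ := exists_hasExp_contract φ ((X.Xi_mem 0 v hv _).2 (X.one_tmul_mem v e))
  refine ⟨n, F, ?_⟩
  have key : ∀ m : ℕ, ∀ w (hw : w ∈ X.cov.arc (m : ZMod X.cov.K)), HasExp w n F (X.coeff m w hw e φ) := by
    intro m
    induction m with
    | zero =>
      rw [Nat.cast_zero]
      exact fun w hw => X.hasExp_coeff_arc h hw
    | succ m ih =>
      rw [Nat.cast_succ]
      intro w hw
      obtain ⟨x, hx, hx'⟩ := (X.cov.meets_iff m (m + 1)).2 (Or.inr (Or.inr rfl))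
      refine X.hasExp_coeff_arc (hv := hx') ?_ hw
      have h1 := mul_mem_Small (neg_mem (one_mem (modR x))) (X.coeff_sub_mem_Small hx hx' e φ)
      have h2 := (ih x hx).add_small h1
      rwa [neg_one_mul, neg_sub, add_sub_cancel] at h2
  intro k
  have : NeZero X.cov.K := ⟨X.cov.K_pos.ne'⟩
  obtain ⟨m, rfl⟩ := ZMod.natCast_zmod_surjective k
  exact key m

variable {ι : Type*} [Fintype ι] [DecidableEq ι] {d : ℝ} {c : ι → ℂ} (F : FlatFrame X.conn d c)
  (b : Module.Basis ι Mero X.E) {Ψ : ∀ v, Matrix ι ι (O v)}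

theorem fundInv_mem_Amod0 {θ : ℝ} (hθ : |θ - d| < Real.pi) {k : ZMod X.cov.K}
    (hw : Circle.exp θ ∈ X.cov.arc k) (i j : ι) : X.fundInv F b k (Circle.exp θ) i j ∈ Amod0 (Circle.exp θ) := by
  have h1 : (coordB b _).symm (Pi.single j 1) ∈ tensorSpan X.E (Amod 0 (Circle.exp θ)) := by
    rw [mem_tensorSpan_iff_coordB b, LinearEquiv.apply_symm_apply, Amod_zero]
    intro l
    rw [Pi.single_apply]
    split_ifs
    · exact (modR _).one_mem
    · exact (modR _).zero_mem
  rw [← X.Xi_mem_Amod hw, F.mem_tensorSpan_iff hθ, Amod_zero] at h1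
  have h2 := h1 i
  rw [← X.fundInv_mulVec F b hw, LinearEquiv.apply_symm_apply, Matrix.mulVec_single_one] at h2
  exact h2

theorem coeff_eq_sum {k : ZMod X.cov.K} {w : Circle} (hw : w ∈ X.cov.arc k) (e : X.E)
    (φ : X.E0 →ₗ[Mero] Mero) : X.coeff k w hw e φ = ∑ i, algebraMap Mero (O w) (φ (F.b i)) *
      ((F.G w).1 * X.fundInv F b k w).mulVec (fun j => algebraMap Mero (O w) (b.repr e j)) i := by
  have h1 : coordB b w (1 ⊗ₜ e) = fun j => algebraMap Mero (O w) (b.repr e j) := by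
    funext j
    rw [coordB_tmul, one_mul]
  rw [coeff_eq, contract_eq_sum φ F.b, ← Matrix.mulVec_mulVec, ← h1, X.fundInv_mulVec F b hw, F.coord_apply,
    Matrix.mulVec_mulVec, Units.mul_inv, Matrix.one_mulVec]

theorem exists_sum_section {a a' : ℝ} (h : (X.triv F b).On a a' Ψ) (e : X.E) (φ : X.E0 →ₗ[Mero] Mero) :
    ∃ g : ∀ v, O v, ∀ θ ∈ Set.Ioo a a', IsSec g (Circle.exp θ) ∧ ∀ k (hk : Circle.exp θ ∈ X.cov.arc k),
      g (Circle.exp θ) - X.coeff k _ hk e φ ∈ Small (Circle.exp θ) := by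
  refine ⟨fun v => ∑ i, algebraMap Mero (O v) (φ (F.b i)) *
    ((F.G v).1 * Ring.inverse (Ψ v)).mulVec (fun j => algebraMap Mero (O v) (b.repr e j)) i, fun θ hθ => ?_⟩
  have hT := h θ hθ
  have hT' := hT
  obtain ⟨⟨θ', hθ', hw⟩, -⟩ := hT
  have hinv : ∀ i j, IsSec (fun v => Ring.inverse (Ψ v) i j) (Circle.exp θ) :=
    IsSec.matrix_inv (X.triv_isSec F b hT') (by
      filter_upwards [(X.triv F b).nearby hT'] with v hv using
        Ring.inverse_mul_cancel _ ((X.triv F b).isUnit hv))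
      (Ring.mul_inverse_cancel _ ((X.triv F b).isUnit hT'))
  constructor
  · refine IsSec.sum Finset.univ fun i => (isSec_mero _).mul ?_
    have hG : ∀ i j, IsSec (fun v => (F.G v).1 i j) (Circle.exp θ) := by
      rw [hw]
      exact F.isSec θ' hθ'
    exact IsSec.mulVec (IsSec.matMul hG hinv) (fun j => isSec_mero _) i
  · intro k hk
    rw [X.coeff_eq_sum F b hk]
    generalize Circle.exp θ = w at *
    subst hw
    obtain ⟨U, hU, M, hM, he⟩ := (X.triv F b).compare hT' (X.triv_fund F b hθ' hk)
    have e1 : Ring.inverse (Ψ (Circle.exp θ')) - X.fundInv F b k (Circle.exp θ') =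
        serM P c M (Circle.exp θ') * X.fundInv F b k (Circle.exp θ') := by
      have h2 := X.fund_mul_fundInv F b k (Circle.exp θ')
      rw [he.self_of_nhds, mul_assoc] at h2
      have h3 := congrArg (Ring.inverse (Ψ (Circle.exp θ')) * ·) h2
      simp only [mul_one] at h3
      rw [← mul_assoc, Ring.inverse_mul_cancel _ ((X.triv F b).isUnit hT'), one_mul] at h3
      rw [← h3, add_mul, one_mul, add_sub_cancel_left]
    rw [← Finset.sum_sub_distrib]
    refine sum_mem_Small _ fun i _ => ?_
    rw [← mul_sub]
    refine mul_mem_Small (mero_mem_Amod0 _ _) ?_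
    rw [← Pi.sub_apply, ← Matrix.sub_mulVec, ← mul_sub, e1]
    refine sum_mem_Small _ fun j _ => ?_
    rw [mul_comm]
    refine mul_mem_Small (mero_mem_Amod0 _ _) (matMul_mem_Small (F.mod θ' hθ') (fun i j => ?_) i j)
    exact matMul_mem_Small' (hM.serM_mem_Small hU) (X.fundInv_mem_Amod0 F b hθ' hk) i j

theorem summableAlong_of_on {A : ℝ} (hA : Real.pi / 2 < A) (hA' : A ≤ Real.pi)
    (h : (X.triv F b).On (d - A) (d + A) Ψ) : X.SummableAlong d := by
  intro e φ
  obtain ⟨n, S, hS⟩ := X.exists_common_exp e φ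
  refine ⟨n, S, hS, ?_⟩
  obtain ⟨g, hg⟩ := X.exists_sum_section F b h e φ
  obtain ⟨A', hA1, hA2⟩ := exists_between hA
  have hmem : ∀ θ ∈ Set.Icc (d - A') (d + A'), θ ∈ Set.Ioo (d - A) (d + A) := fun θ hθ =>
    ⟨by linarith [hθ.1], by linarith [hθ.2]⟩
  obtain ⟨f, hf⟩ := exists_function_of_isSec (a := d - A') (b := d + A') (by linarith) fun θ hθ =>
    (hg θ (hmem θ hθ)).1
  refine isSummable_of_asyFn (f := fun z => z ^ n * f z) hA1 (fun θ hθ => ?_) fun θ hθ => ?_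
  · exact germ_eventually_diff (germ_X_pow_mul (n := n) (hf θ hθ))
  · rw [← hasExp_iff (hf θ hθ)]
    obtain ⟨k, hk⟩ := X.cov.covers (Circle.exp θ)
    have h1 : HasExp _ n S (X.coeff k _ hk e φ) := hS k _ hk
    have h2 := h1.add_small ((hg θ (hmem θ hθ)).2 k hk)
    rwa [add_sub_cancel] at h2

theorem summableAlong_of_DR (h : X.DR.SummableAlong d) : X.SummableAlong d := by
  obtain ⟨r, F, ⟨b⟩⟩ := X.exists_frame d
  obtain ⟨ε, hε, h⟩ := h
  have hπ := Real.pi_pos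
  obtain ⟨A, hA, hAm⟩ := exists_between (show Real.pi / 2 < min ((Real.pi + ε) / 2) Real.pi from
    lt_min (by linarith) (by linarith))
  obtain ⟨hA1, hA2⟩ := lt_min_iff.1 hAm
  have hsub : arcAround d (2 * A - Real.pi) ⊆ arcAround d ε := by
    rintro w ⟨θ, hθ, rfl⟩
    exact ⟨θ, by linarith, rfl⟩
  obtain ⟨Ψ, hΨ⟩ := X.exists_triv_of_splitsOn F b (h.mono hsub) (isOpen_arcAround d _) (by
    rintro w ⟨θ, hθ, rfl⟩
    exact ⟨θ, by linarith, rfl⟩)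
  refine X.summableAlong_of_on F b hA hA2.le (Ψ := Ψ) fun θ hθ => hΨ _ ⟨θ, abs_lt.2 ⟨?_, ?_⟩, rfl⟩
  · linarith [hθ.1]
  · linarith [hθ.2]

end DRObject

end PeriodRH

end

theorem corollary3p12 {L : Type*} [AddCommGroup L] [Module.Free ℤ L] [Module.Finite ℤ L]
    (P : PeriodRH.PeriodDatum L) (C : Finset ℂ)
    (hC : ∀ c ∈ C, ∀ c' ∈ C, c ≠ c' → ∀ γ : L, c ≠ c' + P.μ γ)
    (X : PeriodRH.DRObject P C) (d : ℝ) :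
    X.SummableAlong d ↔ X.DR.SummableAlong d :=
  ⟨X.summableAlong_DR, X.summableAlong_of_DR⟩
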